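/- Let $k$ be a field with $\operatorname{char} k\neq 2$. All tensor products are over $k$, and $\Delta(x)=x_{(1)}\otimes x_{(2)}$ denotes a comultiplication and $\varepsilon$ a counit. **The Hopf algebras.** Let $H=k[b,c]\#k\mathbb Z$ be generated by $b,c,h^{\pm1}$ with $hb=-bh$, $hc=-ch$, $bc=cb$, and let $U=k[a]\#k\mathbb Z$ be generated by $a,g^{\pm1}$ with $ga=-ag$. They are Hopf algebras with $h,g$ group-like and $$\Delta(a)=a\otimes 1+g^2\otimes a,\quad \Delta(b)=b\otimes1+h^2\otimes b,\quad \Delta(c)=c\otimes 1+h^2\otimes c .$$ The monomials $b^rc^sh^p$ and $a^ng^q$ ($r,s,n\ge0$; $p,q\in\mathbb Z$) are bases of $H$ and $U$. Let $U$ act on $H$ from the left by $\triangleright$: $a$ acts by $0$, and $g$ acts by the algebra automorphism $b\mapsto-c$, $c\mapsto-b$, $h\mapsto h$. Let $H$ act on $U$ from the right by $\triangleleft$: $b,c$ act by $0$, and $h$ acts by the algebra automorphism $a\mapsto-a$, $g\mapsto g$. For $\alpha,\beta\in k$, $\lambda\in k^\times$ let $E^\lambda_{\alpha,\beta}$ be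 the algebra generated by $a,b,c,h^{\pm1},g^{\pm1}$ with relations $gh=hg$, $$ah=-\lambda^2ha,\quad hb=-bh,\quad hc=-ch,\quad ga=-ag,\quad gb=-\lambda^2cg,\quad gc=-\lambda^2bg\qquad(*)$$ and $$ab-\lambda^4ba=\beta(1-g^2h^2)=ac-\lambda^4ca,\qquad bc-cb=\alpha(1-h^4);$$ it is a Hopf algebra with $g,h$ group-like and $\Delta(a),\Delta(b),\Delta(c)$ as above. Let $A^\lambda_{\alpha,\beta}$ be the algebra with the same generators and the relations $gh=\lambda hg$, $(*)$ and $$ab-\lambda^4ba=\beta=ac-\lambda^4ca,\qquad bc-cb=\alpha .$$ Put $E=E^1_{0,0}$. The same formulas as for $\Delta$ on the generators define algebra maps $A^\lambda_{\alpha,\beta}\to A^\lambda_{\alpha,\beta}\otimes E$ and $A^\lambda_{\alpha,\beta}\to E^\lambda_{\alpha,\beta}\otimes A^\lambda_{\alpha,\beta}$, the right and left coactions on $A^\lambda_{\alpha,\beta}$. Also let $H_\alpha$ and $L_\alpha$ be generated by $b,c,h^{\pm1}$ with $hb=-bh$, $hc=-ch$ and, respectively, $bc-cb=\alpha$ and $bc-cb=\alpha(1-h^4)$;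 $L_\alpha$ is a Hopf algebra with $\Delta$ as above. **Bicrossed and twisted products.** If the space $H$ carries a product $m$ and actions $x\triangleright' f\in H$, $x\triangleleft' f\in U$ are given ($x\in U$, $f\in H$), the bicrossed product on $H\otimes U$ is $(f\bowtie x)(f'\bowtie x')=m(f,x_{(1)}\triangleright' f'_{(1)})\bowtie(x_{(2)}\triangleleft' f'_{(2)})x'$. For a linear map $\theta:U\otimes H\to H\otimes U$, the twisted product $(H,m)\#_\theta U$ on $H\otimes U$ is $(f\#x)(f'\#x')=f\cdot\theta(x\otimes f')\cdot x'$, with $m$ on the left and the product of $U$ on the right. For linear $\psi:H\otimes U\to k$ put $\theta_\psi(x\otimes f)=\psi(f_{(1)},x_{(1)})\,x_{(2)}\triangleright f_{(2)}\otimes x_{(3)}\triangleleft f_{(3)}$ and, if $\psi$ is convolution invertible, $$x\triangleright_\psi f=\psi(f_{(1)},x_{(1)})\,(x_{(2)}\triangleright f_{(2)})\,\psi^{-1}(f_{(3)},x_{(3)}),\qquad x\triangleleft_\psi f=\psi(f_{(1)},x_{(1)})\,(x_{(2)}\triangleleft f_{(2)})\,\psi^{-1}(f_{(3)},x_{(3)}).$$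 Say that $(m_L,m_A,\psi)$, where $m_L,m_A$ are products on the space $H$ and $\psi$ is linear on $H\otimes U$, *realizes* $(\alpha,\beta,\lambda)$ if $\psi$ is convolution invertible and there are an isomorphism of coalgebras and unital algebras from $E^\lambda_{\alpha,\beta}$ to the tensor product coalgebra $H\otimes U$ with the bicrossed product for $m_L,\triangleright_\psi,\triangleleft_\psi$, and an isomorphism of unital algebras from $A^\lambda_{\alpha,\beta}$ to $(H,m_A)\#_{\theta_\psi}U$, such that under these isomorphisms and the identification $E\cong H\otimes U$ of (0), both coactions on $A^\lambda_{\alpha,\beta}$ become the comultiplication of $H\otimes U$. **Pairings and twisting data.** A *skew $H\bowtie U$-pairing* is a convolution invertible linear map $\tau:H\otimes U\to k$ with $\tau(f,1)=\varepsilon(f)$, $\tau(1,x)=\varepsilon(x)$ and $$\tau(f,xy)=\tau(f_{(1)},y_{(1)})\tau(y_{(2)}\triangleright f_{(2)},x),\qquad \tau(ff',x)=\tau(f_{(1)},x_{(1)})\tau(f',x_{(2)}\triangleleft f_{(2)}).$$ Let $\tau_\lambda$ ($\lambda\in k^\times$) and $\tau_\lambda^\beta$ ($\lambda\in k^\times$,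 $\beta\in k$) be the linear maps $H\otimes U\to k$ with $$\tau_\lambda(b^rc^sh^p,a^ng^q)=\begin{cases}\lambda^{pq}&r=s=n=0\\0&\text{otherwise,}\end{cases}\qquad \tau_\lambda^\beta(b^rc^sh^p,a^ng^q)=\delta_{r+s,n}(-1)^{qn}\lambda^{pq}\,n!\,\beta^n ,$$ and write $\tau_\pm^\beta=\tau_{\pm1}^\beta$; for $\zeta\in k$ with $\zeta^4=-1$ put $\psi_\zeta=\tau_\zeta$. Let $\sigma_\alpha:H\otimes H\to k$ be the linear map $$\sigma_\alpha(b^nc^mh^p,b^rc^sh^q)=\delta_{n,s}\delta_{m,r}(-1)^m(-1)^{p(n+m)}\,n!\,m!\,(\alpha/2)^{n+m}.$$ A *twisting datum* for $H_\alpha$ is a linear map $\psi:H\otimes U\to k$ with $\psi(f,1)=\varepsilon(f)$, $\psi(1,x)=\varepsilon(x)$ and, for $\sigma=\sigma_\alpha$ and $\tau=\varepsilon_U\otimes\varepsilon_U$, $$\tau(x_{(1)},y_{(1)})\psi(f,x_{(2)}y_{(2)})=\psi(f_{(1)},y_{(1)})\psi(y_{(2)}\triangleright f_{(2)},x_{(1)})\tau(x_{(2)}\triangleleft(y_{(3)}\triangleright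 f_{(3)}),y_{(4)}\triangleleft f_{(4)}),$$ $$\sigma(f_{(1)},t_{(1)})\psi(f_{(2)}t_{(2)},x)=\psi(f_{(1)},x_{(1)})\psi(t_{(1)},x_{(2)}\triangleleft f_{(2)})\sigma(x_{(3)}\triangleright f_{(3)},(x_{(4)}\triangleleft f_{(4)})\triangleright t_{(2)}).$$ **Theorem (Corollary 5.10, with Proposition 5.6 and Lemma 5.8).** (0) The map $f\otimes x\mapsto fx$ is an isomorphism of Hopf algebras from the bicrossed product $H\bowtie U$ for $\triangleright,\triangleleft$ onto $E$. For all $\alpha,\beta\in k$, $\lambda\in k^\times$ with $\alpha(1+\lambda^4)=0$ and $\beta(1-\lambda^2)=0$, the algebra $A^\lambda_{\alpha,\beta}$ with its two coactions is an $E^\lambda_{\alpha,\beta}$-$E$-bi-Galois object (a nonzero bicomodule algebra with trivial coinvariants on both sides and bijective left and right Galois maps). For every $\alpha$, $\sigma_\alpha$ is convolution invertible with inverse $\sigma_{-\alpha}$. There is a linear isomorphism $H_\alpha\cong H$ that fixes $1$ and the generators $b,c,h^{\pm1}$ and carries the product of $H_\alpha$ to the product $\sigma_\alpha(x_{(1)},y_{(1)})x_{(2)}y_{(2)}$;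 there is a coalgebra isomorphism $L_\alpha\cong H$ that fixes $1$ and the generators and carries the product of $L_\alpha$ to the product $\sigma_\alpha(x_{(1)},y_{(1)})x_{(2)}y_{(2)}\sigma_\alpha^{-1}(x_{(3)},y_{(3)})$. We write $H_\alpha$, $L_\alpha$ also for the space $H$ with these products. (1) A linear map $\tau:H\otimes U\to k$ is a skew $H\bowtie U$-pairing if and only if $\tau=\tau_\lambda$ for some $\lambda\in k^\times$, or $\tau=\tau^\beta_{+}$ or $\tau=\tau^\beta_-$ for some $\beta\in k$. Here $(H,H,\tau_\lambda)$ realizes $(0,0,\lambda)$: the left Hopf algebra is $E^\lambda_{0,0}$ and the Galois object $H\#_{\theta_{\tau_\lambda}}U$ is $A^\lambda_{0,0}$; and $(H,H,\tau^\beta_\pm)$ realizes $(0,\beta,\pm1)$: they are $E^{\pm}_{0,\beta}=E^{\pm1}_{0,\beta}$ and $A^{\pm}_{0,\beta}=A^{\pm1}_{0,\beta}$. (2a) Let $\alpha\ne0$. A linear map $\psi:H\otimes U\to k$ is a twisting datum for $H_\alpha$ if and only if $\psi=\psi_\zeta$ for some $\zeta\in k$ with $\zeta^4=-1$. For each such $\zeta$,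 $(L_\alpha,H_\alpha,\psi_\zeta)$ realizes $(\alpha,0,\zeta)$: the left Hopf algebra is $E^\zeta_{\alpha,0}$ and the Galois object $H_\alpha\#_{\theta_{\psi_\zeta}}U$ is $A^\zeta_{\alpha,0}$. Moreover, for every $\zeta$ with $\zeta^4=-1$, the map $\theta=\theta_{\psi_\zeta}$ satisfies $$\theta(g\otimes h)=\zeta\,h\otimes g,\quad \theta(g\otimes b)=-\zeta^2c\otimes g,\quad\theta(g\otimes c)=-\zeta^2b\otimes g,$$ $$\theta(a\otimes h)=-\zeta^2h\otimes a,\quad\theta(a\otimes b)=\zeta^4b\otimes a,\quad\theta(a\otimes c)=\zeta^4c\otimes a .$$ (2b) A linear map $\psi:H\otimes U\to k$ is a twisting datum for $H_0=H$ if and only if it is a skew $H\bowtie U$-pairing, if and only if $\psi=\tau^\beta_\lambda$ for some $\lambda\in k^\times$, $\beta\in k$ with $\beta(1-\lambda^2)=0$. For all such $\lambda,\beta$, $(L_0,H_0,\tau_\lambda^\beta)$ realizes $(0,\beta,\lambda)$: the left Hopf algebra is $E^\lambda_{0,\beta}$ and the Galois object is $A^\lambda_{0,\beta}$. -/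

import Mathlib

open scoped TensorProduct
open Coalgebra
set_option linter.unusedSimpArgs false
set_option linter.unusedVariables false

noncomputable section

namespace BicrossedExample

universe u

section General

variable {k : Type u} [Field k]

/-- The algebra presented by generators `X` and relations `r`. -/
def Pres {X : Type} (r : FreeAlgebra k X → FreeAlgebra k X → Prop) : Type u := RingQuot r

instance {X : Type} (r : FreeAlgebra k X → FreeAlgebra k X → Prop) : Ring (Pres r) :=
  inferInstanceAs (Ring (RingQuot r))

instance {X : Type} (r : FreeAlgebra k X → FreeAlgebra k X → Prop) : Algebra k (Pres r) :=
  inferInstanceAs (Algebra k (RingQuot r))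

/-- The projection of the free algebra onto a presented algebra. -/
def presMk {X : Type} (r : FreeAlgebra k X → FreeAlgebra k X → Prop) :
    FreeAlgebra k X →ₐ[k] Pres r :=
  RingQuot.mkAlgHom k r

/-- The class of the generator `x` in the algebra presented by generators `X` and relations `r`. -/
def gen {X : Type} (r : FreeAlgebra k X → FreeAlgebra k X → Prop) (x : X) : Pres r :=
  presMk r (FreeAlgebra.ι k x)

/-- The algebra map out of a presented algebra determined by images of the generators that
satisfy the relations. -/
def presLift {X : Type} (r : FreeAlgebra k X → FreeAlgebra k X → Prop) {B : Type*} [Semiring B]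
    [Algebra k B] (f : X → B)
    (hf : ∀ ⦃x y⦄, r x y → FreeAlgebra.lift k f x = FreeAlgebra.lift k f y) :
    Pres r →ₐ[k] B :=
  RingQuot.liftAlgHom k ⟨FreeAlgebra.lift k f, hf⟩

@[simp] theorem presLift_gen {X : Type} (r : FreeAlgebra k X → FreeAlgebra k X → Prop) {B : Type*}
    [Semiring B] [Algebra k B] (f : X → B)
    (hf : ∀ ⦃x y⦄, r x y → FreeAlgebra.lift k f x = FreeAlgebra.lift k f y) (x : X) :
    presLift r f hf (gen r x) = f x := by
  exact (RingQuot.liftAlgHom_mkAlgHom_apply k (FreeAlgebra.lift k f) hf _).trans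
    (FreeAlgebra.lift_ι_apply f x)

theorem pres_ext {X : Type} {r : FreeAlgebra k X → FreeAlgebra k X → Prop} {B : Type*}
    [Semiring B] [Algebra k B] {f g : Pres r →ₐ[k] B}
    (h : ∀ x, f (gen r x) = g (gen r x)) : f = g := by
  apply RingQuot.ringQuot_ext'
  apply FreeAlgebra.hom_ext
  funext x
  exact h x

theorem adjoin_gen {X : Type} (r : FreeAlgebra k X → FreeAlgebra k X → Prop) :
    Algebra.adjoin k (Set.range (gen r)) = ⊤ := by
  have h1 : Set.range (gen r) = (presMk r) '' (Set.range (FreeAlgebra.ι k)) := by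
    rw [← Set.range_comp]; rfl
  rw [h1, ← AlgHom.map_adjoin, FreeAlgebra.adjoin_range_ι, Algebra.map_top]
  exact (AlgHom.range_eq_top _).2 (RingQuot.mkAlgHom_surjective k r)

/-- A bialgebra generated by a set, with an algebra map `S : A → Aᵒᵖ` that satisfies the antipode
identities on the generators, is a Hopf algebra with antipode `S`. -/
@[reducible] def hopfOfGenerators {A : Type*} [Ring A] [Bialgebra k A] (S : A →ₐ[k] Aᵐᵒᵖ) (s : Set A)
    (hs : Algebra.adjoin k s = ⊤)
    (hl : ∀ x ∈ s, LinearMap.mul' k A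
      ((((MulOpposite.opLinearEquiv k).symm.toLinearMap ∘ₗ S.toLinearMap).rTensor A) (comul x)) =
        algebraMap k A (counit x))
    (hr : ∀ x ∈ s, LinearMap.mul' k A
      ((((MulOpposite.opLinearEquiv k).symm.toLinearMap ∘ₗ S.toLinearMap).lTensor A) (comul x)) =
        algebraMap k A (counit x)) : HopfAlgebra k A where
  antipode := (MulOpposite.opLinearEquiv k).symm.toLinearMap ∘ₗ S.toLinearMap
  mul_antipode_rTensor_comul := by
    ext x
    have hx : x ∈ Algebra.adjoin k s := by rw [hs]; trivial
    simp only [LinearMap.comp_apply, Algebra.linearMap_apply] at hl ⊢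
    induction hx using Algebra.adjoin_induction with
    | mem x hx => exact hl x hx
    | algebraMap r => simp [Algebra.algebraMap_eq_smul_one, Algebra.TensorProduct.one_def]
    | add x y _ _ hx hy => simp only [map_add, hx, hy]
    | mul x y _ _ hx hy =>
      rw [Bialgebra.comul_mul, Bialgebra.counit_mul, map_mul (algebraMap k A), ← hy]
      generalize comul (R := k) x = X at hx ⊢
      have key : ∀ Y : A ⊗[k] A, LinearMap.mul' k A
          ((((MulOpposite.opLinearEquiv k).symm.toLinearMap ∘ₗ S.toLinearMap).rTensor A) (X * Y)) =
          LinearMap.mul' k A ((((MulOpposite.opLinearEquiv k).symm.toLinearMap ∘ₗ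
            S.toLinearMap).rTensor A)
            ((1 ⊗ₜ LinearMap.mul' k A ((((MulOpposite.opLinearEquiv k).symm.toLinearMap ∘ₗ
            S.toLinearMap).rTensor A) X)) * Y)) := by
        intro Y
        clear hx hy
        induction X using TensorProduct.induction_on with
        | zero => simp
        | add X X' h h' => simp only [add_mul, map_add, h, h', TensorProduct.tmul_add]
        | tmul p q =>
          induction Y using TensorProduct.induction_on with
          | zero => simp
          | add Y Y' h h' => simp only [mul_add, map_add, h, h']
          | tmul p' q' => simp [mul_assoc]
      rw [key, hx]
      generalize comul (R := k) y = Y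
      induction Y using TensorProduct.induction_on with
      | zero => simp
      | add Y Y' h h' => simp only [mul_add, map_add, h, h']
      | tmul p' q' =>
        simp [Algebra.left_comm]
  mul_antipode_lTensor_comul := by
    ext x
    have hx : x ∈ Algebra.adjoin k s := by rw [hs]; trivial
    simp only [LinearMap.comp_apply, Algebra.linearMap_apply] at hr ⊢
    induction hx using Algebra.adjoin_induction with
    | mem x hx => exact hr x hx
    | algebraMap r => simp [Algebra.algebraMap_eq_smul_one, Algebra.TensorProduct.one_def]
    | add x y _ _ hx hy => simp only [map_add, hx, hy]
    | mul x y _ _ hx hy =>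
      rw [Bialgebra.comul_mul, Bialgebra.counit_mul, map_mul (algebraMap k A), ← hx]
      generalize comul (R := k) y = Y at hy ⊢
      have key : ∀ X : A ⊗[k] A, LinearMap.mul' k A
          ((((MulOpposite.opLinearEquiv k).symm.toLinearMap ∘ₗ S.toLinearMap).lTensor A) (X * Y)) =
          LinearMap.mul' k A ((((MulOpposite.opLinearEquiv k).symm.toLinearMap ∘ₗ
            S.toLinearMap).lTensor A)
            (X * ((LinearMap.mul' k A ((((MulOpposite.opLinearEquiv k).symm.toLinearMap ∘ₗ
            S.toLinearMap).lTensor A) Y)) ⊗ₜ 1))) := by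
        intro X
        clear hx hy
        induction Y using TensorProduct.induction_on with
        | zero => simp
        | add X X' h h' => simp only [mul_add, map_add, h, h', TensorProduct.add_tmul]
        | tmul p q =>
          induction X using TensorProduct.induction_on with
          | zero => simp
          | add Y Y' h h' => simp only [add_mul, map_add, h, h']
          | tmul p' q' => simp [mul_assoc]
      rw [key, hy]
      generalize comul (R := k) x = X
      induction X using TensorProduct.induction_on with
      | zero => simp
      | add Y Y' h h' => simp only [add_mul, map_add, h, h']
      | tmul p' q' =>
        simp [mul_assoc, Algebra.commutes]

end General

section Presentations

variable (k : Type u) [Field k]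

inductive UGen
  | a | g | gInv

inductive URel : FreeAlgebra k UGen → FreeAlgebra k UGen → Prop
  | g_gInv : URel (FreeAlgebra.ι k .g * FreeAlgebra.ι k .gInv) 1
  | gInv_g : URel (FreeAlgebra.ι k .gInv * FreeAlgebra.ι k .g) 1
  | g_a : URel (FreeAlgebra.ι k .g * FreeAlgebra.ι k .a)
      (-(FreeAlgebra.ι k .a * FreeAlgebra.ι k .g))

/-- `U = k[a] # kℤ`, with `ℤ = ⟨g⟩` and `ga = -ag`. -/
abbrev U : Type u := Pres (URel k)

/-- Generators of `H`, `H_α` and `L_α`. -/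
inductive LGen
  | b | c | h | hInv

inductive LRel (α : k) : FreeAlgebra k LGen → FreeAlgebra k LGen → Prop
  | h_hInv : LRel α (FreeAlgebra.ι k .h * FreeAlgebra.ι k .hInv) 1
  | hInv_h : LRel α (FreeAlgebra.ι k .hInv * FreeAlgebra.ι k .h) 1
  | h_b : LRel α (FreeAlgebra.ι k .h * FreeAlgebra.ι k .b)
      (-(FreeAlgebra.ι k .b * FreeAlgebra.ι k .h))
  | h_c : LRel α (FreeAlgebra.ι k .h * FreeAlgebra.ι k .c)
      (-(FreeAlgebra.ι k .c * FreeAlgebra.ι k .h))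
  | b_c : LRel α (FreeAlgebra.ι k .b * FreeAlgebra.ι k .c
        - FreeAlgebra.ι k .c * FreeAlgebra.ι k .b)
      (α • (1 - FreeAlgebra.ι k .h ^ 4))

/-- `L_α`: generators `b, c, h^{±1}`, relations `hb = -bh`, `hc = -ch`, `bc - cb = α(1 - h⁴)`. -/
abbrev L (α : k) : Type u := Pres (LRel k α)

/-- `H = L_0 = k[b,c] # kℤ`, with `ℤ = ⟨h⟩`, `hb = -bh`, `hc = -ch` and `bc = cb`. -/
abbrev H : Type u := L k 0

inductive HRel (α : k) : FreeAlgebra k LGen → FreeAlgebra k LGen → Prop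
  | h_hInv : HRel α (FreeAlgebra.ι k .h * FreeAlgebra.ι k .hInv) 1
  | hInv_h : HRel α (FreeAlgebra.ι k .hInv * FreeAlgebra.ι k .h) 1
  | h_b : HRel α (FreeAlgebra.ι k .h * FreeAlgebra.ι k .b)
      (-(FreeAlgebra.ι k .b * FreeAlgebra.ι k .h))
  | h_c : HRel α (FreeAlgebra.ι k .h * FreeAlgebra.ι k .c)
      (-(FreeAlgebra.ι k .c * FreeAlgebra.ι k .h))
  | b_c : HRel α (FreeAlgebra.ι k .b * FreeAlgebra.ι k .c
        - FreeAlgebra.ι k .c * FreeAlgebra.ι k .b)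
      (α • 1)

/-- `H_α`: generators `b, c, h^{±1}`, relations `hb = -bh`, `hc = -ch`, `bc - cb = α`. -/
abbrev HCleft (α : k) : Type u := Pres (HRel k α)

inductive EGen
  | a | b | c | h | hInv | g | gInv

/-- The relations that the algebras `E^λ_{α,β}` and `A^λ_{α,β}` have in common:
`h^{±1}`, `g^{±1}` are inverse pairs, and `ah = -λ²ha`, `hb = -bh`, `hc = -ch`,
`ga = -ag`, `gb = -λ²cg`, `gc = -λ²bg`. -/
inductive BasicRel (l : kˣ) : FreeAlgebra k EGen → FreeAlgebra k EGen → Prop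
  | h_hInv : BasicRel l (FreeAlgebra.ι k .h * FreeAlgebra.ι k .hInv) 1
  | hInv_h : BasicRel l (FreeAlgebra.ι k .hInv * FreeAlgebra.ι k .h) 1
  | g_gInv : BasicRel l (FreeAlgebra.ι k .g * FreeAlgebra.ι k .gInv) 1
  | gInv_g : BasicRel l (FreeAlgebra.ι k .gInv * FreeAlgebra.ι k .g) 1
  | a_h : BasicRel l (FreeAlgebra.ι k .a * FreeAlgebra.ι k .h)
      (-((l : k) ^ 2 • (FreeAlgebra.ι k .h * FreeAlgebra.ι k .a)))
  | h_b : BasicRel l (FreeAlgebra.ι k .h * FreeAlgebra.ι k .b)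
      (-(FreeAlgebra.ι k .b * FreeAlgebra.ι k .h))
  | h_c : BasicRel l (FreeAlgebra.ι k .h * FreeAlgebra.ι k .c)
      (-(FreeAlgebra.ι k .c * FreeAlgebra.ι k .h))
  | g_a : BasicRel l (FreeAlgebra.ι k .g * FreeAlgebra.ι k .a)
      (-(FreeAlgebra.ι k .a * FreeAlgebra.ι k .g))
  | g_b : BasicRel l (FreeAlgebra.ι k .g * FreeAlgebra.ι k .b)
      (-((l : k) ^ 2 • (FreeAlgebra.ι k .c * FreeAlgebra.ι k .g)))
  | g_c : BasicRel l (FreeAlgebra.ι k .g * FreeAlgebra.ι k .c)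
      (-((l : k) ^ 2 • (FreeAlgebra.ι k .b * FreeAlgebra.ι k .g)))

inductive ERel (α β : k) (l : kˣ) : FreeAlgebra k EGen → FreeAlgebra k EGen → Prop
  | basic {x y} : BasicRel k l x y → ERel α β l x y
  | g_h : ERel α β l (FreeAlgebra.ι k .g * FreeAlgebra.ι k .h)
      (FreeAlgebra.ι k .h * FreeAlgebra.ι k .g)
  | a_b : ERel α β l (FreeAlgebra.ι k .a * FreeAlgebra.ι k .b
        - (l : k) ^ 4 • (FreeAlgebra.ι k .b * FreeAlgebra.ι k .a))
      (β • (1 - FreeAlgebra.ι k .g ^ 2 * FreeAlgebra.ι k .h ^ 2))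
  | a_c : ERel α β l (FreeAlgebra.ι k .a * FreeAlgebra.ι k .c
        - (l : k) ^ 4 • (FreeAlgebra.ι k .c * FreeAlgebra.ι k .a))
      (β • (1 - FreeAlgebra.ι k .g ^ 2 * FreeAlgebra.ι k .h ^ 2))
  | b_c : ERel α β l (FreeAlgebra.ι k .b * FreeAlgebra.ι k .c
        - FreeAlgebra.ι k .c * FreeAlgebra.ι k .b)
      (α • (1 - FreeAlgebra.ι k .h ^ 4))

/-- `E^λ_{α,β}`: the relations of `BasicRel` together with `gh = hg`,
`ab - λ⁴ba = β(1 - g²h²) = ac - λ⁴ca` and `bc - cb = α(1 - h⁴)`. -/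
abbrev Edef (α β : k) (l : kˣ) : Type u := Pres (ERel k α β l)

/-- `E = E^1_{0,0}`. -/
abbrev E : Type u := Edef k 0 0 1

inductive ARel (α β : k) (l : kˣ) : FreeAlgebra k EGen → FreeAlgebra k EGen → Prop
  | basic {x y} : BasicRel k l x y → ARel α β l x y
  | g_h : ARel α β l (FreeAlgebra.ι k .g * FreeAlgebra.ι k .h)
      ((l : k) • (FreeAlgebra.ι k .h * FreeAlgebra.ι k .g))
  | a_b : ARel α β l (FreeAlgebra.ι k .a * FreeAlgebra.ι k .b
        - (l : k) ^ 4 • (FreeAlgebra.ι k .b * FreeAlgebra.ι k .a)) (β • 1)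
  | a_c : ARel α β l (FreeAlgebra.ι k .a * FreeAlgebra.ι k .c
        - (l : k) ^ 4 • (FreeAlgebra.ι k .c * FreeAlgebra.ι k .a)) (β • 1)
  | b_c : ARel α β l (FreeAlgebra.ι k .b * FreeAlgebra.ι k .c
        - FreeAlgebra.ι k .c * FreeAlgebra.ι k .b) (α • 1)

/-- `A^λ_{α,β}`: the relations of `BasicRel` together with `gh = λhg`,
`ab - λ⁴ba = β = ac - λ⁴ca` and `bc - cb = α`. -/
abbrev Adef (α β : k) (l : kˣ) : Type u := Pres (ARel k α β l)

end Presentations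

section Rels
variable {k : Type u} [Field k]

theorem rel_gen {X : Type} {r : FreeAlgebra k X → FreeAlgebra k X → Prop} {x y}
    (h : r x y) : FreeAlgebra.lift k (gen r) x = FreeAlgebra.lift k (gen r) y := by
  have : FreeAlgebra.lift k (gen r) = presMk r := by
    apply FreeAlgebra.hom_ext
    funext z
    simp [gen]
  rw [this]
  exact RingQuot.mkAlgHom_rel k h

end Rels

section HopfU
variable {k : Type u} [Field k]

theorem U_g_gInv : gen (URel k) .g * gen (URel k) .gInv = 1 := by
  simpa using rel_gen (URel.g_gInv (k := k))
theorem U_gInv_g : gen (URel k) .gInv * gen (URel k) .g = 1 := by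
  simpa using rel_gen (URel.gInv_g (k := k))
theorem U_g_a : gen (URel k) .g * gen (URel k) .a = -(gen (URel k) .a * gen (URel k) .g) := by
  simpa using rel_gen (URel.g_a (k := k))

theorem assoc_rule {B : Type*} [Semigroup B] {x y z : B} (h : x * y = z) (w : B) :
    x * (y * w) = z * w := by rw [← mul_assoc, h]

theorem neg_comm_inv {B : Type*} [Ring B] {y y' x : B} (e1 : y * y' = 1) (e2 : y' * y = 1)
    (h : y * x = -(x * y)) : y' * x = -(x * y') := by
  calc y' * x = y' * (x * y) * y' := by simp [mul_assoc, e1]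
    _ = -(y' * (y * x) * y') := by simp [h]
    _ = _ := by rw [← mul_assoc, e2, one_mul]

theorem U_gInv_a : gen (URel k) .gInv * gen (URel k) .a =
    -(gen (URel k) .a * gen (URel k) .gInv) :=
  neg_comm_inv U_g_gInv U_gInv_g U_g_a

/-- `Δ(g) = g ⊗ g`, `Δ(a) = a ⊗ 1 + g² ⊗ a`. -/
def comulU : U k →ₐ[k] U k ⊗[k] U k :=
  presLift (URel k)
    (fun
      | .a => gen (URel k) .a ⊗ₜ 1 + (gen (URel k) .g ^ 2) ⊗ₜ gen (URel k) .a
      | .g => gen (URel k) .g ⊗ₜ gen (URel k) .g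
      | .gInv => gen (URel k) .gInv ⊗ₜ gen (URel k) .gInv) (by
    rintro _ _ (_ | _ | _)
    · simp [U_g_gInv, Algebra.TensorProduct.one_def]
    · simp [U_gInv_g, Algebra.TensorProduct.one_def]
    · simp only [map_mul, map_neg, FreeAlgebra.lift_ι_apply, mul_add, add_mul,
        Algebra.TensorProduct.tmul_mul_tmul, mul_one, one_mul, U_g_a, TensorProduct.neg_tmul,
        TensorProduct.tmul_neg, pow_two, mul_assoc]
      abel)

def counitU : U k →ₐ[k] k :=
  presLift (URel k) (fun | .a => 0 | .g => 1 | .gInv => 1) (by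
    rintro _ _ (_ | _ | _) <;> simp)

instance : Bialgebra k (U k) :=
  Bialgebra.ofAlgHom comulU counitU
    (by
      apply pres_ext
      rintro (_ | _ | _)
      · simp [comulU, TensorProduct.tmul_add, TensorProduct.add_tmul,
          Algebra.TensorProduct.one_def, pow_two]
        abel
      · simp [comulU]
      · simp [comulU])
    (by
      apply pres_ext
      rintro (_ | _ | _) <;>
      simp [comulU, counitU])
    (by
      apply pres_ext
      rintro (_ | _ | _) <;>
      simp [comulU, counitU])

@[simp] theorem comul_U_a : comul (R := k) (gen (URel k) .a) =
    gen (URel k) .a ⊗ₜ 1 + (gen (URel k) .g ^ 2) ⊗ₜ gen (URel k) .a :=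
  presLift_gen _ _ _ _
@[simp] theorem comul_U_g : comul (R := k) (gen (URel k) .g) =
    gen (URel k) .g ⊗ₜ gen (URel k) .g :=
  presLift_gen _ _ _ _
@[simp] theorem comul_U_gInv : comul (R := k) (gen (URel k) .gInv) =
    gen (URel k) .gInv ⊗ₜ gen (URel k) .gInv :=
  presLift_gen _ _ _ _
@[simp] theorem counit_U_a : counit (R := k) (gen (URel k) .a) = 0 := presLift_gen _ _ _ _
@[simp] theorem counit_U_g : counit (R := k) (gen (URel k) .g) = 1 := presLift_gen _ _ _ _
@[simp] theorem counit_U_gInv : counit (R := k) (gen (URel k) .gInv) = 1 := presLift_gen _ _ _ _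

/-- `S(g) = g⁻¹`, `S(a) = -g⁻²a`. -/
def antipodeU : U k →ₐ[k] (U k)ᵐᵒᵖ :=
  presLift (URel k)
    (fun
      | .a => .op (-(gen (URel k) .gInv ^ 2 * gen (URel k) .a))
      | .g => .op (gen (URel k) .gInv)
      | .gInv => .op (gen (URel k) .g)) (by
    rintro _ _ (_ | _ | _)
    · simp [← MulOpposite.op_mul, U_g_gInv]
    · simp [← MulOpposite.op_mul, U_gInv_g]
    · apply MulOpposite.unop_injective
      simp [pow_two, mul_assoc, U_gInv_a, assoc_rule U_gInv_a])

instance : HopfAlgebra k (U k) :=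
  hopfOfGenerators antipodeU (Set.range (gen (URel k))) (adjoin_gen _)
    (by
      rintro _ ⟨_ | _ | _, rfl⟩
      · simp [antipodeU, pow_two, mul_assoc]
      · simp [antipodeU, U_gInv_g]
      · simp [antipodeU, U_g_gInv])
    (by
      rintro _ ⟨_ | _ | _, rfl⟩
      · simp [antipodeU, pow_two, mul_assoc, assoc_rule U_g_gInv]
      · simp [antipodeU, U_g_gInv]
      · simp [antipodeU, U_gInv_g])

end HopfU

section HopfL
variable {k : Type u} [Field k] {α : k}

theorem L_h_hInv : gen (LRel k α) .h * gen (LRel k α) .hInv = 1 := by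
  simpa using rel_gen (LRel.h_hInv (α := α))
theorem L_hInv_h : gen (LRel k α) .hInv * gen (LRel k α) .h = 1 := by
  simpa using rel_gen (LRel.hInv_h (α := α))
theorem L_h_b : gen (LRel k α) .h * gen (LRel k α) .b =
    -(gen (LRel k α) .b * gen (LRel k α) .h) := by
  simpa using rel_gen (LRel.h_b (α := α))
theorem L_h_c : gen (LRel k α) .h * gen (LRel k α) .c =
    -(gen (LRel k α) .c * gen (LRel k α) .h) := by
  simpa using rel_gen (LRel.h_c (α := α))
theorem L_b_c : gen (LRel k α) .b * gen (LRel k α) .c =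
    gen (LRel k α) .c * gen (LRel k α) .b + α • (1 - gen (LRel k α) .h ^ 4) := by
  have := rel_gen (LRel.b_c (α := α))
  simp only [map_sub, map_mul, map_smul, map_one, map_pow, FreeAlgebra.lift_ι_apply] at this
  rw [← this]; abel
theorem L_hInv_b : gen (LRel k α) .hInv * gen (LRel k α) .b =
    -(gen (LRel k α) .b * gen (LRel k α) .hInv) :=
  neg_comm_inv L_h_hInv L_hInv_h L_h_b
theorem L_hInv_c : gen (LRel k α) .hInv * gen (LRel k α) .c =
    -(gen (LRel k α) .c * gen (LRel k α) .hInv) :=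
  neg_comm_inv L_h_hInv L_hInv_h L_h_c

variable (α) in
/-- `Δ(h) = h ⊗ h`, `Δ(b) = b ⊗ 1 + h² ⊗ b`, `Δ(c) = c ⊗ 1 + h² ⊗ c`. -/
def comulL : L k α →ₐ[k] L k α ⊗[k] L k α :=
  presLift (LRel k α)
    (fun
      | .b => gen (LRel k α) .b ⊗ₜ 1 + (gen (LRel k α) .h ^ 2) ⊗ₜ gen (LRel k α) .b
      | .c => gen (LRel k α) .c ⊗ₜ 1 + (gen (LRel k α) .h ^ 2) ⊗ₜ gen (LRel k α) .c
      | .h => gen (LRel k α) .h ⊗ₜ gen (LRel k α) .h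
      | .hInv => gen (LRel k α) .hInv ⊗ₜ gen (LRel k α) .hInv) (by
    rintro _ _ (_ | _ | _ | _ | _)
    · simp [L_h_hInv, Algebra.TensorProduct.one_def]
    · simp [L_hInv_h, Algebra.TensorProduct.one_def]
    · simp only [map_mul, map_neg, FreeAlgebra.lift_ι_apply, mul_add, add_mul,
        Algebra.TensorProduct.tmul_mul_tmul, mul_one, one_mul, L_h_b, TensorProduct.neg_tmul,
        TensorProduct.tmul_neg, pow_two, mul_assoc]
      abel
    · simp only [map_mul, map_neg, FreeAlgebra.lift_ι_apply, mul_add, add_mul,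
        Algebra.TensorProduct.tmul_mul_tmul, mul_one, one_mul, L_h_c, TensorProduct.neg_tmul,
        TensorProduct.tmul_neg, pow_two, mul_assoc]
      abel
    · simp only [map_mul, map_sub, map_smul, map_one, map_pow, FreeAlgebra.lift_ι_apply, mul_add,
        add_mul, Algebra.TensorProduct.tmul_mul_tmul, Algebra.TensorProduct.one_def, mul_one,
        one_mul, L_h_b, L_h_c, assoc_rule L_h_b, assoc_rule L_h_c, mul_neg, neg_mul, neg_neg,
        pow_succ, pow_zero, mul_assoc, L_b_c, TensorProduct.add_tmul, TensorProduct.tmul_add,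
        TensorProduct.sub_tmul, TensorProduct.tmul_sub, smul_sub, TensorProduct.tmul_smul,
        TensorProduct.smul_tmul', mul_sub, mul_smul_comm]
      abel)

variable (α) in
def counitL : L k α →ₐ[k] k :=
  presLift (LRel k α) (fun | .b => 0 | .c => 0 | .h => 1 | .hInv => 1) (by
    rintro _ _ (_ | _ | _ | _ | _) <;> simp)

instance : Bialgebra k (L k α) :=
  Bialgebra.ofAlgHom (comulL α) (counitL α)
    (by
      apply pres_ext
      rintro (_ | _ | _ | _)
      · simp [comulL, TensorProduct.tmul_add, TensorProduct.add_tmul,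
          Algebra.TensorProduct.one_def, pow_two]
        abel
      · simp [comulL, TensorProduct.tmul_add, TensorProduct.add_tmul,
          Algebra.TensorProduct.one_def, pow_two]
        abel
      · simp [comulL]
      · simp [comulL])
    (by
      apply pres_ext
      rintro (_ | _ | _ | _) <;>
      simp [comulL, counitL])
    (by
      apply pres_ext
      rintro (_ | _ | _ | _) <;>
      simp [comulL, counitL])

@[simp] theorem comul_L_b : comul (R := k) (gen (LRel k α) .b) =
    gen (LRel k α) .b ⊗ₜ 1 + (gen (LRel k α) .h ^ 2) ⊗ₜ gen (LRel k α) .b :=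
  presLift_gen _ _ _ _
@[simp] theorem comul_L_c : comul (R := k) (gen (LRel k α) .c) =
    gen (LRel k α) .c ⊗ₜ 1 + (gen (LRel k α) .h ^ 2) ⊗ₜ gen (LRel k α) .c :=
  presLift_gen _ _ _ _
@[simp] theorem comul_L_h : comul (R := k) (gen (LRel k α) .h) =
    gen (LRel k α) .h ⊗ₜ gen (LRel k α) .h :=
  presLift_gen _ _ _ _
@[simp] theorem comul_L_hInv : comul (R := k) (gen (LRel k α) .hInv) =
    gen (LRel k α) .hInv ⊗ₜ gen (LRel k α) .hInv :=
  presLift_gen _ _ _ _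
@[simp] theorem counit_L_b : counit (R := k) (gen (LRel k α) .b) = 0 := presLift_gen _ _ _ _
@[simp] theorem counit_L_c : counit (R := k) (gen (LRel k α) .c) = 0 := presLift_gen _ _ _ _
@[simp] theorem counit_L_h : counit (R := k) (gen (LRel k α) .h) = 1 := presLift_gen _ _ _ _
@[simp] theorem counit_L_hInv : counit (R := k) (gen (LRel k α) .hInv) = 1 :=
  presLift_gen _ _ _ _

variable (α) in
/-- `S(h) = h⁻¹`, `S(b) = -h⁻²b`, `S(c) = -h⁻²c`. -/
def antipodeL : L k α →ₐ[k] (L k α)ᵐᵒᵖ :=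
  presLift (LRel k α)
    (fun
      | .b => .op (-(gen (LRel k α) .hInv ^ 2 * gen (LRel k α) .b))
      | .c => .op (-(gen (LRel k α) .hInv ^ 2 * gen (LRel k α) .c))
      | .h => .op (gen (LRel k α) .hInv)
      | .hInv => .op (gen (LRel k α) .h)) (by
    rintro _ _ (_ | _ | _ | _ | _)
    · simp [← MulOpposite.op_mul, L_h_hInv]
    · simp [← MulOpposite.op_mul, L_hInv_h]
    · apply MulOpposite.unop_injective
      simp [pow_two, mul_assoc, L_hInv_b, assoc_rule L_hInv_b]
    · apply MulOpposite.unop_injective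
      simp [pow_two, mul_assoc, L_hInv_c, assoc_rule L_hInv_c]
    · apply MulOpposite.unop_injective
      simp [pow_succ, mul_assoc, L_hInv_c, assoc_rule L_hInv_c, L_hInv_b, assoc_rule L_hInv_b,
        L_h_b, L_h_c, assoc_rule L_h_b, assoc_rule L_h_c, assoc_rule L_b_c, L_h_hInv,
        assoc_rule L_h_hInv, add_mul, sub_mul, smul_sub])

instance : HopfAlgebra k (L k α) :=
  hopfOfGenerators (antipodeL α) (Set.range (gen (LRel k α))) (adjoin_gen _)
    (by
      rintro _ ⟨_ | _ | _ | _, rfl⟩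
      · simp [antipodeL, pow_two, mul_assoc]
      · simp [antipodeL, pow_two, mul_assoc]
      · simp [antipodeL, L_hInv_h]
      · simp [antipodeL, L_h_hInv])
    (by
      rintro _ ⟨_ | _ | _ | _, rfl⟩
      · simp [antipodeL, pow_two, mul_assoc, assoc_rule L_h_hInv]
      · simp [antipodeL, pow_two, mul_assoc, assoc_rule L_h_hInv]
      · simp [antipodeL, L_h_hInv]
      · simp [antipodeL, L_hInv_h])

end HopfL

section HopfE
variable {k : Type u} [Field k] {α β : k} {l : kˣ}

theorem smul_comm_inv {B : Type*} [Ring B] [Algebra k B] {y y' x z : B} {s : k} (hs : s ≠ 0)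
    (e1 : y * y' = 1) (e2 : y' * y = 1) (h : y * x = -(s • (z * y))) :
    y' * z = -(s⁻¹ • (x * y')) := by
  have h1 : x * y' = -(s • (y' * z)) := by
    calc x * y' = y' * (y * x) * y' := by rw [← mul_assoc, e2, one_mul]
      _ = _ := by simp [h, mul_assoc, e1]
  rw [h1, smul_neg, neg_neg, smul_smul, inv_mul_cancel₀ hs, one_smul]

theorem smul_comm_inv' {B : Type*} [Ring B] [Algebra k B] {y y' x : B} {s : k} (hs : s ≠ 0)
    (e1 : y * y' = 1) (e2 : y' * y = 1) (h : x * y = -(s • (y * x))) :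
    x * y' = -(s⁻¹ • (y' * x)) := by
  have h1 : y' * x = -(s • (x * y')) := by
    calc y' * x = y' * (x * y) * y' := by simp [mul_assoc, e1]
      _ = _ := by rw [h]; simp [← mul_assoc, e2]
  rw [h1, smul_neg, neg_neg, smul_smul, inv_mul_cancel₀ hs, one_smul]

theorem l2_ne : (l : k) ^ 2 ≠ 0 := pow_ne_zero _ l.ne_zero

section Basic
variable {r : FreeAlgebra k EGen → FreeAlgebra k EGen → Prop}
theorem basic_h_hInv (hr : ∀ ⦃x y⦄, BasicRel k l x y → r x y) :
    gen r .h * gen r .hInv = 1 := by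
  simpa using rel_gen (hr BasicRel.h_hInv)
theorem basic_hInv_h (hr : ∀ ⦃x y⦄, BasicRel k l x y → r x y) :
    gen r .hInv * gen r .h = 1 := by
  simpa using rel_gen (hr BasicRel.hInv_h)
theorem basic_g_gInv (hr : ∀ ⦃x y⦄, BasicRel k l x y → r x y) :
    gen r .g * gen r .gInv = 1 := by
  simpa using rel_gen (hr BasicRel.g_gInv)
theorem basic_gInv_g (hr : ∀ ⦃x y⦄, BasicRel k l x y → r x y) :
    gen r .gInv * gen r .g = 1 := by
  simpa using rel_gen (hr BasicRel.gInv_g)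
theorem basic_a_h (hr : ∀ ⦃x y⦄, BasicRel k l x y → r x y) :
    gen r .a * gen r .h = -((l : k) ^ 2 • (gen r .h * gen r .a)) := by
  simpa using rel_gen (hr BasicRel.a_h)
theorem basic_h_b (hr : ∀ ⦃x y⦄, BasicRel k l x y → r x y) :
    gen r .h * gen r .b = -(gen r .b * gen r .h) := by
  simpa using rel_gen (hr BasicRel.h_b)
theorem basic_h_c (hr : ∀ ⦃x y⦄, BasicRel k l x y → r x y) :
    gen r .h * gen r .c = -(gen r .c * gen r .h) := by
  simpa using rel_gen (hr BasicRel.h_c)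
theorem basic_g_a (hr : ∀ ⦃x y⦄, BasicRel k l x y → r x y) :
    gen r .g * gen r .a = -(gen r .a * gen r .g) := by
  simpa using rel_gen (hr BasicRel.g_a)
theorem basic_a_g (hr : ∀ ⦃x y⦄, BasicRel k l x y → r x y) :
    gen r .a * gen r .g = -(gen r .g * gen r .a) := by
  rw [basic_g_a hr, neg_neg]
theorem basic_g_b (hr : ∀ ⦃x y⦄, BasicRel k l x y → r x y) :
    gen r .g * gen r .b = -((l : k) ^ 2 • (gen r .c * gen r .g)) := by
  simpa using rel_gen (hr BasicRel.g_b)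
theorem basic_g_c (hr : ∀ ⦃x y⦄, BasicRel k l x y → r x y) :
    gen r .g * gen r .c = -((l : k) ^ 2 • (gen r .b * gen r .g)) := by
  simpa using rel_gen (hr BasicRel.g_c)
theorem basic_a_hInv (hr : ∀ ⦃x y⦄, BasicRel k l x y → r x y) :
    gen r .a * gen r .hInv = -(((l : k) ^ 2)⁻¹ • (gen r .hInv * gen r .a)) :=
  smul_comm_inv' l2_ne (basic_h_hInv hr) (basic_hInv_h hr) (basic_a_h hr)
theorem basic_a_gInv (hr : ∀ ⦃x y⦄, BasicRel k l x y → r x y) :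
    gen r .a * gen r .gInv = -(gen r .gInv * gen r .a) := by
  rw [neg_comm_inv (basic_g_gInv hr) (basic_gInv_g hr) (basic_g_a hr), neg_neg]
theorem basic_hInv_b (hr : ∀ ⦃x y⦄, BasicRel k l x y → r x y) :
    gen r .hInv * gen r .b = -(gen r .b * gen r .hInv) :=
  neg_comm_inv (basic_h_hInv hr) (basic_hInv_h hr) (basic_h_b hr)
theorem basic_hInv_c (hr : ∀ ⦃x y⦄, BasicRel k l x y → r x y) :
    gen r .hInv * gen r .c = -(gen r .c * gen r .hInv) :=
  neg_comm_inv (basic_h_hInv hr) (basic_hInv_h hr) (basic_h_c hr)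
theorem basic_gInv_b (hr : ∀ ⦃x y⦄, BasicRel k l x y → r x y) :
    gen r .gInv * gen r .b = -(((l : k) ^ 2)⁻¹ • (gen r .c * gen r .gInv)) :=
  smul_comm_inv l2_ne (basic_g_gInv hr) (basic_gInv_g hr) (basic_g_c hr)
theorem basic_gInv_c (hr : ∀ ⦃x y⦄, BasicRel k l x y → r x y) :
    gen r .gInv * gen r .c = -(((l : k) ^ 2)⁻¹ • (gen r .b * gen r .gInv)) :=
  smul_comm_inv l2_ne (basic_g_gInv hr) (basic_gInv_g hr) (basic_g_b hr)
end Basic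

theorem E_basic ⦃x y : FreeAlgebra k EGen⦄ (h : BasicRel k l x y) : ERel k α β l x y := .basic h
theorem A_basic ⦃x y : FreeAlgebra k EGen⦄ (h : BasicRel k l x y) : ARel k α β l x y := .basic h

theorem E_g_h : gen (ERel k α β l) .g * gen (ERel k α β l) .h =
    gen (ERel k α β l) .h * gen (ERel k α β l) .g := by
  simpa using rel_gen (ERel.g_h (α := α) (β := β) (l := l))
theorem E_gInv_h : gen (ERel k α β l) .gInv * gen (ERel k α β l) .h =
    gen (ERel k α β l) .h * gen (ERel k α β l) .gInv := by
  calc gen (ERel k α β l) .gInv * gen (ERel k α β l) .h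
      = gen (ERel k α β l) .gInv * (gen (ERel k α β l) .h * gen (ERel k α β l) .g) *
        gen (ERel k α β l) .gInv := by simp [mul_assoc, basic_g_gInv E_basic]
    _ = _ := by rw [← E_g_h, ← mul_assoc, basic_gInv_g E_basic, one_mul]
theorem E_g_hInv : gen (ERel k α β l) .g * gen (ERel k α β l) .hInv =
    gen (ERel k α β l) .hInv * gen (ERel k α β l) .g := by
  calc gen (ERel k α β l) .g * gen (ERel k α β l) .hInv
      = gen (ERel k α β l) .hInv * (gen (ERel k α β l) .h * gen (ERel k α β l) .g) *
        gen (ERel k α β l) .hInv := by rw [← mul_assoc, basic_hInv_h E_basic, one_mul]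
    _ = _ := by rw [← E_g_h]; simp [mul_assoc, basic_h_hInv E_basic]
theorem E_gInv_hInv : gen (ERel k α β l) .gInv * gen (ERel k α β l) .hInv =
    gen (ERel k α β l) .hInv * gen (ERel k α β l) .gInv := by
  calc gen (ERel k α β l) .gInv * gen (ERel k α β l) .hInv
      = gen (ERel k α β l) .gInv * (gen (ERel k α β l) .hInv * gen (ERel k α β l) .g) *
        gen (ERel k α β l) .gInv := by simp [mul_assoc, basic_g_gInv E_basic]
    _ = _ := by rw [← E_g_hInv, ← mul_assoc, basic_gInv_g E_basic, one_mul]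
theorem E_a_b : gen (ERel k α β l) .a * gen (ERel k α β l) .b =
    (l : k) ^ 4 • (gen (ERel k α β l) .b * gen (ERel k α β l) .a) +
      β • (1 - gen (ERel k α β l) .g ^ 2 * gen (ERel k α β l) .h ^ 2) := by
  have := rel_gen (ERel.a_b (α := α) (β := β) (l := l))
  simp only [map_sub, map_mul, map_smul, map_one, map_pow, FreeAlgebra.lift_ι_apply] at this
  rw [← this]; abel
theorem E_a_c : gen (ERel k α β l) .a * gen (ERel k α β l) .c =
    (l : k) ^ 4 • (gen (ERel k α β l) .c * gen (ERel k α β l) .a) +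
      β • (1 - gen (ERel k α β l) .g ^ 2 * gen (ERel k α β l) .h ^ 2) := by
  have := rel_gen (ERel.a_c (α := α) (β := β) (l := l))
  simp only [map_sub, map_mul, map_smul, map_one, map_pow, FreeAlgebra.lift_ι_apply] at this
  rw [← this]; abel
theorem E_b_c : gen (ERel k α β l) .b * gen (ERel k α β l) .c =
    gen (ERel k α β l) .c * gen (ERel k α β l) .b + α • (1 - gen (ERel k α β l) .h ^ 4) := by
  have := rel_gen (ERel.b_c (α := α) (β := β) (l := l))
  simp only [map_sub, map_mul, map_smul, map_one, map_pow, FreeAlgebra.lift_ι_apply] at this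
  rw [← this]; abel

theorem A_g_h : gen (ARel k α β l) .g * gen (ARel k α β l) .h =
    (l : k) • (gen (ARel k α β l) .h * gen (ARel k α β l) .g) := by
  simpa using rel_gen (ARel.g_h (α := α) (β := β) (l := l))
theorem A_a_b : gen (ARel k α β l) .a * gen (ARel k α β l) .b =
    (l : k) ^ 4 • (gen (ARel k α β l) .b * gen (ARel k α β l) .a) + β • 1 := by
  have := rel_gen (ARel.a_b (α := α) (β := β) (l := l))
  simp only [map_sub, map_mul, map_smul, map_one, map_pow, FreeAlgebra.lift_ι_apply] at this
  rw [← this]; abel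
theorem A_a_c : gen (ARel k α β l) .a * gen (ARel k α β l) .c =
    (l : k) ^ 4 • (gen (ARel k α β l) .c * gen (ARel k α β l) .a) + β • 1 := by
  have := rel_gen (ARel.a_c (α := α) (β := β) (l := l))
  simp only [map_sub, map_mul, map_smul, map_one, map_pow, FreeAlgebra.lift_ι_apply] at this
  rw [← this]; abel
theorem A_b_c : gen (ARel k α β l) .b * gen (ARel k α β l) .c =
    gen (ARel k α β l) .c * gen (ARel k α β l) .b + α • 1 := by
  have := rel_gen (ARel.b_c (α := α) (β := β) (l := l))
  simp only [map_sub, map_mul, map_smul, map_one, map_pow, FreeAlgebra.lift_ι_apply] at this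
  rw [← this]; abel

variable (α β l)

/-- The common shape `Δ(g) = g ⊗ g`, `Δ(h) = h ⊗ h`, `Δ(a) = a ⊗ 1 + g² ⊗ a`,
`Δ(b) = b ⊗ 1 + h² ⊗ b`, `Δ(c) = c ⊗ 1 + h² ⊗ c` of the comultiplication of `E^λ_{α,β}` and
of the two coactions on `A^λ_{α,β}`, as a function on generators. -/
def coactionOnGen (r r' : FreeAlgebra k EGen → FreeAlgebra k EGen → Prop) :
    EGen → Pres r ⊗[k] Pres r'
  | .a => gen r .a ⊗ₜ 1 + (gen r .g ^ 2) ⊗ₜ gen r' .a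
  | .b => gen r .b ⊗ₜ 1 + (gen r .h ^ 2) ⊗ₜ gen r' .b
  | .c => gen r .c ⊗ₜ 1 + (gen r .h ^ 2) ⊗ₜ gen r' .c
  | .h => gen r .h ⊗ₜ gen r' .h
  | .hInv => gen r .hInv ⊗ₜ gen r' .hInv
  | .g => gen r .g ⊗ₜ gen r' .g
  | .gInv => gen r .gInv ⊗ₜ gen r' .gInv

variable {α β l}

theorem coactionOnGen_basic {r r' : FreeAlgebra k EGen → FreeAlgebra k EGen → Prop}
    {l l' : kˣ} (hr : ∀ ⦃x y⦄, BasicRel k l x y → r x y)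
    (hr' : ∀ ⦃x y⦄, BasicRel k l' x y → r' x y)
    (q : k) {q' : k}
    (hq : gen r .g * gen r .h = q • (gen r .h * gen r .g))
    (hq' : gen r' .g * gen r' .h = q' • (gen r' .h * gen r' .g))
    (h2 : q ^ 2 * (l' : k) ^ 2 = (l : k) ^ 2) ⦃x y⦄
    (h : BasicRel k l x y) :
    FreeAlgebra.lift k (coactionOnGen r r') x = FreeAlgebra.lift k (coactionOnGen r r') y := by
  rcases h with _ | _ | _ | _ | _ | _ | _ | _ | _ | _
  · simp [coactionOnGen, basic_h_hInv hr, basic_h_hInv hr', Algebra.TensorProduct.one_def]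
  · simp [coactionOnGen, basic_hInv_h hr, basic_hInv_h hr', Algebra.TensorProduct.one_def]
  · simp [coactionOnGen, basic_g_gInv hr, basic_g_gInv hr', Algebra.TensorProduct.one_def]
  · simp [coactionOnGen, basic_gInv_g hr, basic_gInv_g hr', Algebra.TensorProduct.one_def]
  all_goals
    simp only [coactionOnGen, map_mul, map_neg, map_smul, FreeAlgebra.lift_ι_apply, mul_add,
      add_mul, Algebra.TensorProduct.tmul_mul_tmul, mul_one, one_mul, basic_a_h hr, basic_a_h hr',
      basic_h_b hr, basic_h_b hr', basic_h_c hr, basic_h_c hr', basic_g_a hr, basic_g_a hr',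
      basic_g_b hr, basic_g_b hr', basic_g_c hr, basic_g_c hr', hq, hq', assoc_rule hq,
      TensorProduct.neg_tmul, TensorProduct.tmul_neg, pow_two, mul_assoc, ← TensorProduct.smul_tmul',
      TensorProduct.tmul_smul, smul_mul_assoc, mul_smul_comm, smul_smul]
  all_goals
    match_scalars <;> first | ring1 | linear_combination h2 | linear_combination -h2

variable (α β l) in
def comulE : Edef k α β l →ₐ[k] Edef k α β l ⊗[k] Edef k α β l :=
  presLift (ERel k α β l) (coactionOnGen (ERel k α β l) (ERel k α β l)) (by
    rintro _ _ (h | _ | _ | _ | _)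
    · exact coactionOnGen_basic (l := l) (l' := l) E_basic E_basic 1 (q' := 1) (by simp [E_g_h])
        (by simp [E_g_h]) (by simp) h
    · simp [coactionOnGen, E_g_h]
    all_goals
      simp only [coactionOnGen, map_mul, map_neg, map_smul, map_sub, map_one, map_pow,
        FreeAlgebra.lift_ι_apply, mul_add, Algebra.TensorProduct.one_def,
        add_mul, Algebra.TensorProduct.tmul_mul_tmul, mul_one, one_mul, E_g_h, assoc_rule E_g_h,
        basic_a_h E_basic, assoc_rule (basic_a_h E_basic), basic_h_b E_basic,
        assoc_rule (basic_h_b E_basic), basic_h_c E_basic, assoc_rule (basic_h_c E_basic),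
        basic_g_b E_basic, assoc_rule (basic_g_b E_basic), basic_g_c E_basic,
        assoc_rule (basic_g_c E_basic), E_a_b, E_a_c, E_b_c,
        TensorProduct.neg_tmul, TensorProduct.tmul_neg, pow_succ, pow_zero, mul_assoc,
        ← TensorProduct.smul_tmul', TensorProduct.tmul_smul, smul_mul_assoc, mul_smul_comm,
        smul_smul, TensorProduct.add_tmul, TensorProduct.tmul_add, TensorProduct.sub_tmul,
        TensorProduct.tmul_sub, smul_add, smul_sub, neg_mul, mul_neg, smul_neg]
      module)

variable (α β l) in
def counitE : Edef k α β l →ₐ[k] k :=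
  presLift (ERel k α β l)
    (fun | .a => 0 | .b => 0 | .c => 0 | .h => 1 | .hInv => 1 | .g => 1 | .gInv => 1) (by
    rintro _ _ (⟨_ | _ | _ | _ | _ | _ | _ | _ | _ | _⟩ | _ | _ | _ | _) <;> simp)

instance : Bialgebra k (Edef k α β l) :=
  Bialgebra.ofAlgHom (comulE α β l) (counitE α β l)
    (by
      apply pres_ext
      rintro (_ | _ | _ | _ | _ | _ | _)
      pick_goal 7
      · simp [comulE, coactionOnGen]
      pick_goal 6
      · simp [comulE, coactionOnGen]
      pick_goal 5
      · simp [comulE, coactionOnGen]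
      pick_goal 4
      · simp [comulE, coactionOnGen]
      all_goals
        simp [comulE, coactionOnGen, TensorProduct.tmul_add, TensorProduct.add_tmul,
          Algebra.TensorProduct.one_def, pow_two]
        abel)
    (by
      apply pres_ext
      rintro (_ | _ | _ | _ | _ | _ | _) <;>
      simp [comulE, counitE, coactionOnGen])
    (by
      apply pres_ext
      rintro (_ | _ | _ | _ | _ | _ | _) <;>
      simp [comulE, counitE, coactionOnGen])

@[simp] theorem comul_E_gen (x : EGen) : comul (R := k) (gen (ERel k α β l) x) =
    coactionOnGen (ERel k α β l) (ERel k α β l) x :=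
  presLift_gen _ _ _ _
@[simp] theorem counit_E_a : counit (R := k) (gen (ERel k α β l) .a) = 0 := presLift_gen _ _ _ _
@[simp] theorem counit_E_b : counit (R := k) (gen (ERel k α β l) .b) = 0 := presLift_gen _ _ _ _
@[simp] theorem counit_E_c : counit (R := k) (gen (ERel k α β l) .c) = 0 := presLift_gen _ _ _ _
@[simp] theorem counit_E_h : counit (R := k) (gen (ERel k α β l) .h) = 1 := presLift_gen _ _ _ _
@[simp] theorem counit_E_hInv : counit (R := k) (gen (ERel k α β l) .hInv) = 1 :=
  presLift_gen _ _ _ _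
@[simp] theorem counit_E_g : counit (R := k) (gen (ERel k α β l) .g) = 1 := presLift_gen _ _ _ _
@[simp] theorem counit_E_gInv : counit (R := k) (gen (ERel k α β l) .gInv) = 1 :=
  presLift_gen _ _ _ _

end HopfE

section HopfE
variable {k : Type u} [Field k] {α β : k} {l : kˣ}

theorem E_b_hInv : gen (ERel k α β l) .b * gen (ERel k α β l) .hInv =
    -(gen (ERel k α β l) .hInv * gen (ERel k α β l) .b) := by
  rw [basic_hInv_b E_basic, neg_neg]
theorem E_c_hInv : gen (ERel k α β l) .c * gen (ERel k α β l) .hInv =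
    -(gen (ERel k α β l) .hInv * gen (ERel k α β l) .c) := by
  rw [basic_hInv_c E_basic, neg_neg]
theorem E_b_gInv : gen (ERel k α β l) .b * gen (ERel k α β l) .gInv =
    -((l : k) ^ 2 • (gen (ERel k α β l) .gInv * gen (ERel k α β l) .c)) := by
  rw [basic_gInv_c E_basic, smul_neg, neg_neg, smul_smul, mul_inv_cancel₀ l2_ne, one_smul]
theorem E_c_gInv : gen (ERel k α β l) .c * gen (ERel k α β l) .gInv =
    -((l : k) ^ 2 • (gen (ERel k α β l) .gInv * gen (ERel k α β l) .b)) := by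
  rw [basic_gInv_b E_basic, smul_neg, neg_neg, smul_smul, mul_inv_cancel₀ l2_ne, one_smul]

variable (α β l) in
/-- `S(h) = h⁻¹`, `S(g) = g⁻¹`, `S(a) = -g⁻²a`, `S(b) = -h⁻²b`, `S(c) = -h⁻²c`. -/
def antipodeE : Edef k α β l →ₐ[k] (Edef k α β l)ᵐᵒᵖ :=
  presLift (ERel k α β l)
    (fun
      | .a => .op (-(gen (ERel k α β l) .gInv ^ 2 * gen (ERel k α β l) .a))
      | .b => .op (-(gen (ERel k α β l) .hInv ^ 2 * gen (ERel k α β l) .b))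
      | .c => .op (-(gen (ERel k α β l) .hInv ^ 2 * gen (ERel k α β l) .c))
      | .h => .op (gen (ERel k α β l) .hInv)
      | .hInv => .op (gen (ERel k α β l) .h)
      | .g => .op (gen (ERel k α β l) .gInv)
      | .gInv => .op (gen (ERel k α β l) .g)) (by
    have hl := l.ne_zero
    rintro _ _ (⟨_ | _ | _ | _ | _ | _ | _ | _ | _ | _⟩ | _ | _ | _ | _)
    · simp [← MulOpposite.op_mul, basic_h_hInv E_basic]
    · simp [← MulOpposite.op_mul, basic_hInv_h E_basic]
    · simp [← MulOpposite.op_mul, basic_g_gInv E_basic]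
    · simp [← MulOpposite.op_mul, basic_gInv_g E_basic]
    all_goals
      apply MulOpposite.unop_injective
      simp only [map_mul, map_neg, map_smul, map_sub, map_one, map_pow,
        FreeAlgebra.lift_ι_apply, MulOpposite.unop_op, MulOpposite.unop_mul, MulOpposite.unop_neg,
        MulOpposite.unop_smul, MulOpposite.unop_sub, MulOpposite.unop_one, MulOpposite.unop_pow,
        E_gInv_hInv, assoc_rule E_gInv_hInv,
        basic_a_hInv E_basic, assoc_rule (basic_a_hInv E_basic),
        basic_a_gInv E_basic, assoc_rule (basic_a_gInv E_basic),
        E_b_hInv, assoc_rule E_b_hInv, E_c_hInv, assoc_rule E_c_hInv,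
        E_b_gInv, assoc_rule E_b_gInv, E_c_gInv, assoc_rule E_c_gInv,
        E_a_b, E_a_c, E_b_c, mul_add, mul_sub, mul_one,
        pow_succ, pow_zero, one_mul, mul_assoc, smul_mul_assoc, mul_smul_comm,
        smul_smul, smul_add, smul_sub, neg_mul, mul_neg, smul_neg, neg_neg,
        E_g_h, assoc_rule E_g_h, E_gInv_h, assoc_rule E_gInv_h,
        basic_hInv_h E_basic, assoc_rule (basic_hInv_h E_basic),
        basic_gInv_g E_basic, assoc_rule (basic_gInv_g E_basic)]
    all_goals (match_scalars <;> field_simp <;> ring))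

instance : HopfAlgebra k (Edef k α β l) :=
  hopfOfGenerators (antipodeE α β l) (Set.range (gen (ERel k α β l))) (adjoin_gen _)
    (by
      rintro _ ⟨_ | _ | _ | _ | _ | _ | _, rfl⟩ <;>
      simp [antipodeE, coactionOnGen, pow_two, mul_assoc, basic_hInv_h E_basic,
        basic_h_hInv E_basic, basic_g_gInv E_basic, basic_gInv_g E_basic])
    (by
      rintro _ ⟨_ | _ | _ | _ | _ | _ | _, rfl⟩ <;>
      simp [antipodeE, coactionOnGen, pow_two, mul_assoc, basic_hInv_h E_basic,
        basic_h_hInv E_basic, basic_g_gInv E_basic, basic_gInv_g E_basic,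
        assoc_rule (basic_h_hInv E_basic), assoc_rule (basic_g_gInv E_basic)])

variable (α β l) in
/-- The right `E`-coaction on `A^λ_{α,β}`. -/
def rightCoaction : Adef k α β l →ₐ[k] Adef k α β l ⊗[k] E k :=
  presLift (ARel k α β l) (coactionOnGen (ARel k α β l) (ERel k 0 0 1)) (by
    rintro _ _ (h | _ | _ | _ | _)
    · exact coactionOnGen_basic (l := l) (l' := 1) A_basic E_basic (l : k) (q' := 1) A_g_h
        (by simp [E_g_h]) (by simp) h
    · simp [coactionOnGen, E_g_h, A_g_h, TensorProduct.smul_tmul']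
    all_goals
      simp only [coactionOnGen, map_mul, map_neg, map_smul, map_sub, map_one, map_pow,
        FreeAlgebra.lift_ι_apply, mul_add, Algebra.TensorProduct.one_def,
        add_mul, Algebra.TensorProduct.tmul_mul_tmul, mul_one, one_mul, E_g_h, assoc_rule E_g_h,
        A_g_h, assoc_rule A_g_h, A_a_b, A_a_c, A_b_c,
        basic_a_h A_basic, assoc_rule (basic_a_h A_basic), basic_h_b A_basic,
        assoc_rule (basic_h_b A_basic), basic_h_c A_basic, assoc_rule (basic_h_c A_basic),
        basic_g_b A_basic, assoc_rule (basic_g_b A_basic), basic_g_c A_basic,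
        assoc_rule (basic_g_c A_basic), E_a_b, E_a_c, E_b_c,
        TensorProduct.neg_tmul, TensorProduct.tmul_neg, pow_succ, pow_zero, mul_assoc,
        ← TensorProduct.smul_tmul', TensorProduct.tmul_smul, smul_mul_assoc, mul_smul_comm,
        smul_smul, TensorProduct.add_tmul, TensorProduct.tmul_add, TensorProduct.sub_tmul,
        TensorProduct.tmul_sub, smul_add, smul_sub, neg_mul, mul_neg, smul_neg, Units.val_one]
      module)

variable (α β l) in
/-- The left `E^λ_{α,β}`-coaction on `A^λ_{α,β}`. -/
def leftCoaction : Adef k α β l →ₐ[k] Edef k α β l ⊗[k] Adef k α β l :=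
  presLift (ARel k α β l) (coactionOnGen (ERel k α β l) (ARel k α β l)) (by
    rintro _ _ (h | _ | _ | _ | _)
    · exact coactionOnGen_basic (l := l) (l' := l) E_basic A_basic 1 (by simp [E_g_h])
        A_g_h (by simp) h
    · simp [coactionOnGen, E_g_h, A_g_h]
    all_goals
      simp only [coactionOnGen, map_mul, map_neg, map_smul, map_sub, map_one, map_pow,
        FreeAlgebra.lift_ι_apply, mul_add, Algebra.TensorProduct.one_def,
        add_mul, Algebra.TensorProduct.tmul_mul_tmul, mul_one, one_mul, E_g_h, assoc_rule E_g_h,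
        A_a_b, A_a_c, A_b_c,
        basic_a_h E_basic, assoc_rule (basic_a_h E_basic), basic_h_b E_basic,
        assoc_rule (basic_h_b E_basic), basic_h_c E_basic, assoc_rule (basic_h_c E_basic),
        basic_g_b E_basic, assoc_rule (basic_g_b E_basic), basic_g_c E_basic,
        assoc_rule (basic_g_c E_basic), E_a_b, E_a_c, E_b_c,
        TensorProduct.neg_tmul, TensorProduct.tmul_neg, pow_succ, pow_zero, mul_assoc,
        ← TensorProduct.smul_tmul', TensorProduct.tmul_smul, smul_mul_assoc, mul_smul_comm,
        smul_smul, TensorProduct.add_tmul, TensorProduct.tmul_add, TensorProduct.sub_tmul,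
        TensorProduct.tmul_sub, smul_add, smul_sub, neg_mul, mul_neg, smul_neg]
      module)

end HopfE

section BasisU
variable (k : Type u) [Field k]

/-- The group-like element `g` as a unit of `U`. -/
def gUnit : (U k)ˣ := ⟨gen (URel k) .g, gen (URel k) .gInv, U_g_gInv, U_gInv_g⟩

/-- The monomial `aⁿ g^q`, with `i = (n, q)`. -/
def monU (i : ℕ × ℤ) : U k := gen (URel k) .a ^ i.1 * ((gUnit k ^ i.2 : (U k)ˣ) : U k)

/-- The action of the generators of `U` on its monomials by left multiplication. -/
def regGenU : UGen → Module.End k ((ℕ × ℤ) →₀ k)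
  | .a => Finsupp.linearCombination k fun i => Finsupp.single (i.1 + 1, i.2) 1
  | .g => Finsupp.linearCombination k fun i => Finsupp.single (i.1, i.2 + 1) ((-1) ^ i.1)
  | .gInv => Finsupp.linearCombination k fun i => Finsupp.single (i.1, i.2 - 1) ((-1) ^ i.1)

def regU : U k →ₐ[k] Module.End k ((ℕ × ℤ) →₀ k) :=
  presLift (URel k) (regGenU k) (by
    rintro _ _ (_ | _ | _) <;>
    · apply Finsupp.lhom_ext'
      intro i
      ext
      simp [regGenU, ← mul_pow, pow_succ])

variable {k} in
theorem linComb_regU (x : U k) (v : (ℕ × ℤ) →₀ k) :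
    Finsupp.linearCombination k (monU k) (regU k x v) =
      x * Finsupp.linearCombination k (monU k) v := by
  have hx : x ∈ Algebra.adjoin k (Set.range (gen (URel k))) := by rw [adjoin_gen]; trivial
  induction hx using Algebra.adjoin_induction generalizing v with
  | algebraMap r => simp [Algebra.algebraMap_eq_smul_one]
  | add x y _ _ hx hy => simp [hx, hy, add_mul]
  | mul x y _ _ hx hy => simp [hx, hy, mul_assoc]
  | mem x hx =>
    have hg : ∀ n : ℕ, gen (URel k) .g * gen (URel k) .a ^ n =
        (-1 : k) ^ n • (gen (URel k) .a ^ n * gen (URel k) .g) := by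
      intro n
      induction n with
      | zero => simp
      | succ n ih =>
        rw [pow_succ, ← mul_assoc, ih, smul_mul_assoc, mul_assoc, U_g_a, pow_succ]
        simp [mul_assoc]
    have hg' : ∀ n : ℕ, gen (URel k) .gInv * gen (URel k) .a ^ n =
        (-1 : k) ^ n • (gen (URel k) .a ^ n * gen (URel k) .gInv) := by
      intro n
      induction n with
      | zero => simp
      | succ n ih =>
        rw [pow_succ, ← mul_assoc, ih, smul_mul_assoc, mul_assoc, U_gInv_a, pow_succ]
        simp [mul_assoc]
    have e1 : gen (URel k) .g = (gUnit k : U k) := rfl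
    have e2 : gen (URel k) .gInv = ((gUnit k)⁻¹ : (U k)ˣ) := rfl
    induction v using Finsupp.induction_linear with
    | zero => simp
    | add v w hv hw => simp only [map_add, hv, hw, mul_add]
    | single i t =>
      obtain ⟨n, q⟩ := i
      obtain ⟨_ | _ | _, rfl⟩ := hx
      · simp [regU, regGenU, monU, pow_succ', mul_assoc]
      · simp only [regU, presLift_gen, regGenU, monU, Finsupp.linearCombination_single,
          Finsupp.smul_single, smul_eq_mul, mul_smul_comm, ← mul_assoc, hg, smul_mul_assoc,
          smul_smul]
        rw [e1, mul_assoc _ (gUnit k : U k), ← Units.val_mul, ← zpow_one_add, add_comm]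
      · simp only [regU, presLift_gen, regGenU, monU, Finsupp.linearCombination_single,
          Finsupp.smul_single, smul_eq_mul, mul_smul_comm, ← mul_assoc, hg', smul_mul_assoc,
          smul_smul]
        rw [e2, mul_assoc _ (((gUnit k)⁻¹ : (U k)ˣ) : U k), ← Units.val_mul, ← zpow_neg_one,
          ← zpow_add, sub_eq_neg_add]

theorem regU_monU (i : ℕ × ℤ) : regU k (monU k i) (Finsupp.single (0, 0) 1) =
    Finsupp.single i 1 := by
  obtain ⟨n, q⟩ := i
  have ha : ∀ (n m : ℕ) (q : ℤ), regU k (gen (URel k) .a ^ n) (Finsupp.single (m, q) 1) =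
      Finsupp.single (m + n, q) 1 := by
    intro n m q
    induction n with
    | zero => simp
    | succ n ih => rw [pow_succ', map_mul, Module.End.mul_apply, ih]; simp [regU, regGenU, add_assoc]
  have hg : ∀ q : ℤ, regU k ((gUnit k ^ q : (U k)ˣ) : U k) (Finsupp.single (0, 0) 1) =
      Finsupp.single (0, q) 1 := by
    intro q
    induction q using Int.induction_on with
    | zero => simp
    | succ q ih =>
      rw [add_comm, zpow_add, zpow_one, Units.val_mul, map_mul, Module.End.mul_apply, ih]
      have : (gUnit k : U k) = gen (URel k) .g := rfl
      simp [this, regU, regGenU, add_comm]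
    | pred q ih =>
      rw [sub_eq_neg_add, zpow_add, zpow_neg_one, Units.val_mul, map_mul, Module.End.mul_apply, ih]
      have : (((gUnit k)⁻¹ : (U k)ˣ) : U k) = gen (URel k) .gInv := rfl
      simp [this, regU, regGenU, sub_eq_neg_add]
  rw [monU, map_mul, Module.End.mul_apply, hg, ha, zero_add]

/-- The basis `aⁿ g^q` of `U`. -/
def basisU : Module.Basis (ℕ × ℤ) k (U k) :=
  .ofRepr (LinearEquiv.symm
    { Finsupp.linearCombination k (monU k) with
      invFun := fun x => regU k x (Finsupp.single (0, 0) 1)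
      left_inv := fun v => by
        change regU k (Finsupp.linearCombination k (monU k) v) (Finsupp.single (0, 0) 1) = v
        induction v using Finsupp.induction_linear with
        | zero => simp
        | add v w hv hw => simp only [map_add, LinearMap.add_apply, hv, hw]
        | single i t =>
          rw [Finsupp.linearCombination_single, map_smul, LinearMap.smul_apply, regU_monU]
          simp
      right_inv := fun x => by
        change Finsupp.linearCombination k (monU k) (regU k x (Finsupp.single (0, 0) 1)) = x
        rw [linComb_regU]
        simp [monU] })

@[simp] theorem basisU_apply (i : ℕ × ℤ) : basisU k i = monU k i := by
  simp [basisU]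

end BasisU

section BasisH
variable (k : Type u) [Field k]

/-- The group-like element `h` as a unit of `H`. -/
def hUnit : (H k)ˣ := ⟨gen (LRel k 0) .h, gen (LRel k 0) .hInv, L_h_hInv, L_hInv_h⟩

/-- The monomial `bʳ cˢ h^p`, with `i = (r, s, p)`. -/
def monH (i : ℕ × ℕ × ℤ) : H k :=
  gen (LRel k 0) .b ^ i.1 * gen (LRel k 0) .c ^ i.2.1 * ((hUnit k ^ i.2.2 : (H k)ˣ) : H k)

/-- The action of the generators of `H` on its monomials by left multiplication. -/
def regGenH : LGen → Module.End k ((ℕ × ℕ × ℤ) →₀ k)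
  | .b => Finsupp.linearCombination k fun i => Finsupp.single (i.1 + 1, i.2.1, i.2.2) 1
  | .c => Finsupp.linearCombination k fun i => Finsupp.single (i.1, i.2.1 + 1, i.2.2) 1
  | .h => Finsupp.linearCombination k fun i =>
      Finsupp.single (i.1, i.2.1, i.2.2 + 1) ((-1) ^ (i.1 + i.2.1))
  | .hInv => Finsupp.linearCombination k fun i =>
      Finsupp.single (i.1, i.2.1, i.2.2 - 1) ((-1) ^ (i.1 + i.2.1))

def regH : H k →ₐ[k] Module.End k ((ℕ × ℕ × ℤ) →₀ k) :=
  presLift (LRel k 0) (regGenH k) (by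
    rintro _ _ (_ | _ | _ | _ | _) <;>
    · apply Finsupp.lhom_ext'
      intro i
      ext
      simp [regGenH, ← mul_pow, pow_succ, add_right_comm i.1 1 i.2.1, ← add_assoc])

theorem neg_one_comm_pow {B : Type*} [Ring B] [Algebra k B] {x y : B} (h : y * x = -(x * y))
    (n : ℕ) : y * x ^ n = (-1 : k) ^ n • (x ^ n * y) := by
  induction n with
  | zero => simp
  | succ n ih =>
    rw [pow_succ, ← mul_assoc, ih, smul_mul_assoc, mul_assoc, h, pow_succ]
    simp [mul_assoc]

variable {k} in
theorem linComb_regH (x : H k) (v : (ℕ × ℕ × ℤ) →₀ k) :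
    Finsupp.linearCombination k (monH k) (regH k x v) =
      x * Finsupp.linearCombination k (monH k) v := by
  have hx : x ∈ Algebra.adjoin k (Set.range (gen (LRel k 0))) := by rw [adjoin_gen]; trivial
  induction hx using Algebra.adjoin_induction generalizing v with
  | algebraMap r => simp [Algebra.algebraMap_eq_smul_one]
  | add x y _ _ hx hy => simp [hx, hy, add_mul]
  | mul x y _ _ hx hy => simp [hx, hy, mul_assoc]
  | mem x hx =>
    have hcb : ∀ r : ℕ, gen (LRel k 0) .c * gen (LRel k 0) .b ^ r =
        gen (LRel k 0) .b ^ r * gen (LRel k 0) .c := fun r =>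
      (Commute.pow_right (show Commute (gen (LRel k 0) .c) (gen (LRel k 0) .b) by
        have := L_b_c (k := k) (α := 0)
        rw [zero_smul, add_zero] at this
        exact this.symm) r)
    have e1 : gen (LRel k 0) .h = (hUnit k : H k) := rfl
    have e2 : gen (LRel k 0) .hInv = ((hUnit k)⁻¹ : (H k)ˣ) := rfl
    induction v using Finsupp.induction_linear with
    | zero => simp
    | add v w hv hw => simp only [map_add, hv, hw, mul_add]
    | single i t =>
      obtain ⟨r, s, p⟩ := i
      obtain ⟨_ | _ | _ | _, rfl⟩ := hx
      · simp [regH, regGenH, monH, pow_succ', mul_assoc]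
      · simp [regH, regGenH, monH, pow_succ', mul_assoc, assoc_rule (hcb r)]
      · simp only [regH, presLift_gen, regGenH, monH, Finsupp.linearCombination_single,
          Finsupp.smul_single, smul_eq_mul, mul_smul_comm, mul_assoc,
          assoc_rule (neg_one_comm_pow k L_h_b r), assoc_rule (neg_one_comm_pow k L_h_c s),
          smul_mul_assoc, smul_smul]
        rw [e1, ← Units.val_mul, ← zpow_one_add, add_comm p 1, pow_add]
      · simp only [regH, presLift_gen, regGenH, monH, Finsupp.linearCombination_single,
          Finsupp.smul_single, smul_eq_mul, mul_smul_comm, mul_assoc,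
          assoc_rule (neg_one_comm_pow k L_hInv_b r), assoc_rule (neg_one_comm_pow k L_hInv_c s),
          smul_mul_assoc, smul_smul]
        rw [e2, ← Units.val_mul, ← zpow_neg_one, ← zpow_add, sub_eq_neg_add, pow_add]

theorem regH_monH (i : ℕ × ℕ × ℤ) : regH k (monH k i) (Finsupp.single (0, 0, 0) 1) =
    Finsupp.single i 1 := by
  obtain ⟨r, s, p⟩ := i
  have hb : ∀ (n r s : ℕ) (p : ℤ), regH k (gen (LRel k 0) .b ^ n) (Finsupp.single (r, s, p) 1) =
      Finsupp.single (r + n, s, p) 1 := by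
    intro n r s p
    induction n with
    | zero => simp
    | succ n ih => rw [pow_succ', map_mul, Module.End.mul_apply, ih]; simp [regH, regGenH, add_assoc]
  have hc : ∀ (n r s : ℕ) (p : ℤ), regH k (gen (LRel k 0) .c ^ n) (Finsupp.single (r, s, p) 1) =
      Finsupp.single (r, s + n, p) 1 := by
    intro n r s p
    induction n with
    | zero => simp
    | succ n ih => rw [pow_succ', map_mul, Module.End.mul_apply, ih]; simp [regH, regGenH, add_assoc]
  have hh : ∀ p : ℤ, regH k ((hUnit k ^ p : (H k)ˣ) : H k) (Finsupp.single (0, 0, 0) 1) =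
      Finsupp.single (0, 0, p) 1 := by
    intro q
    induction q using Int.induction_on with
    | zero => simp
    | succ q ih =>
      rw [add_comm, zpow_add, zpow_one, Units.val_mul, map_mul, Module.End.mul_apply, ih]
      have : (hUnit k : H k) = gen (LRel k 0) .h := rfl
      simp [this, regH, regGenH, add_comm]
    | pred q ih =>
      rw [sub_eq_neg_add, zpow_add, zpow_neg_one, Units.val_mul, map_mul, Module.End.mul_apply, ih]
      have : (((hUnit k)⁻¹ : (H k)ˣ) : H k) = gen (LRel k 0) .hInv := rfl
      simp [this, regH, regGenH, sub_eq_neg_add]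
  rw [monH, map_mul, Module.End.mul_apply, map_mul, Module.End.mul_apply, hh, hc, hb, zero_add,
    zero_add]

/-- The basis `bʳ cˢ h^p` of `H`. -/
def basisH : Module.Basis (ℕ × ℕ × ℤ) k (H k) :=
  .ofRepr (LinearEquiv.symm
    { Finsupp.linearCombination k (monH k) with
      invFun := fun x => regH k x (Finsupp.single (0, 0, 0) 1)
      left_inv := fun v => by
        change regH k (Finsupp.linearCombination k (monH k) v) (Finsupp.single (0, 0, 0) 1) = v
        induction v using Finsupp.induction_linear with
        | zero => simp
        | add v w hv hw => simp only [map_add, LinearMap.add_apply, hv, hw]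
        | single i t =>
          rw [Finsupp.linearCombination_single, map_smul, LinearMap.smul_apply, regH_monH]
          simp
      right_inv := fun x => by
        change Finsupp.linearCombination k (monH k) (regH k x (Finsupp.single (0, 0, 0) 1)) = x
        rw [linComb_regH]
        simp [monH] })

@[simp] theorem basisH_apply (i : ℕ × ℕ × ℤ) : basisH k i = monH k i := by
  simp [basisH]

end BasisH

section Convolution
variable {k : Type u} [Field k] {C M : Type*} [AddCommGroup C] [Module k C] [Coalgebra k C]
  [AddCommGroup M] [Module k M]

/-- The convolution `x ↦ f(x₁) φ(x₂)` of a functional `f` with a linear map `φ`. -/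
def conv (f : C →ₗ[k] k) (φ : C →ₗ[k] M) : C →ₗ[k] M :=
  (TensorProduct.lid k M).toLinearMap ∘ₗ TensorProduct.map f φ ∘ₗ comul

/-- The convolution `x ↦ φ(x₁) f(x₂)` of a linear map `φ` with a functional `f`. -/
def convRight (φ : C →ₗ[k] M) (f : C →ₗ[k] k) : C →ₗ[k] M :=
  (TensorProduct.rid k M).toLinearMap ∘ₗ TensorProduct.map φ f ∘ₗ comul

/-- `f'` is the convolution inverse of the functional `f`. -/
def IsConvInverse (f f' : C →ₗ[k] k) : Prop :=
  conv f f' = counit ∧ conv f' f = counit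

end Convolution

section BiGalois
variable (k : Type u) [Field k] {F G A : Type*} [Ring F] [Ring G] [Ring A]
  [HopfAlgebra k F] [HopfAlgebra k G] [Algebra k A]

/-- The algebra `A`, with the algebra maps `lam : A → F ⊗ A` and `rho : A → A ⊗ G`, is an
`F`-`G`-bi-Galois object: it is an `F`-`G`-bicomodule algebra, its coinvariants on either side are
`k`, and both Galois maps `a ⊗ b ↦ a b₍₀₎ ⊗ b₍₁₎` and `a ⊗ b ↦ a₍₋₁₎ ⊗ a₍₀₎ b` are bijective. -/
structure IsBiGalois (lam : A →ₐ[k] F ⊗[k] A) (rho : A →ₐ[k] A ⊗[k] G) : Prop where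
  nontrivial : Nontrivial A
  right_coassoc : ∀ a, TensorProduct.assoc k A G G (rho.toLinearMap.rTensor G (rho a)) =
    (comul (R := k) (A := G)).lTensor A (rho a)
  right_counit : ∀ a, TensorProduct.rid k A ((counit (R := k) (A := G)).lTensor A (rho a)) = a
  left_coassoc : ∀ a, TensorProduct.assoc k F F A ((comul (R := k) (A := F)).rTensor A (lam a)) =
    lam.toLinearMap.lTensor F (lam a)
  left_counit : ∀ a, TensorProduct.lid k A ((counit (R := k) (A := F)).rTensor A (lam a)) = a
  bicomodule : ∀ a, TensorProduct.assoc k F A G (lam.toLinearMap.rTensor G (rho a)) =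
    rho.toLinearMap.lTensor F (lam a)
  right_coinvariants : ∀ a, rho a = a ⊗ₜ 1 → ∃ t : k, a = algebraMap k A t
  left_coinvariants : ∀ a, lam a = 1 ⊗ₜ a → ∃ t : k, a = algebraMap k A t
  right_galois : Function.Bijective (TensorProduct.lift
    ((LinearMap.mul k (A ⊗[k] G)).compl₁₂
      (Algebra.TensorProduct.includeLeft : A →ₐ[k] A ⊗[k] G).toLinearMap rho.toLinearMap))
  left_galois : Function.Bijective (TensorProduct.lift
    ((LinearMap.mul k (F ⊗[k] A)).compl₁₂
      lam.toLinearMap (Algebra.TensorProduct.includeRight : A →ₐ[k] F ⊗[k] A).toLinearMap))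

end BiGalois

section Actions
variable (k : Type u) [Field k]

/-- The algebra automorphism `b ↦ -c`, `c ↦ -b`, `h ↦ h` of `H`. -/
def gAut : H k →ₐ[k] H k :=
  presLift (LRel k 0)
    (fun
      | .b => -gen (LRel k 0) .c
      | .c => -gen (LRel k 0) .b
      | .h => gen (LRel k 0) .h
      | .hInv => gen (LRel k 0) .hInv) (by
    have hbc := L_b_c (k := k) (α := 0)
    rw [zero_smul, add_zero] at hbc
    rintro _ _ (_ | _ | _ | _ | _)
    · simp [L_h_hInv]
    · simp [L_hInv_h]
    · simp [L_h_c]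
    · simp [L_h_b]
    · simp [hbc])

/-- The algebra automorphism `a ↦ -a`, `g ↦ g` of `U`. -/
def hAut : U k →ₐ[k] U k :=
  presLift (URel k)
    (fun
      | .a => -gen (URel k) .a
      | .g => gen (URel k) .g
      | .gInv => gen (URel k) .gInv) (by
    rintro _ _ (_ | _ | _)
    · simp [U_g_gInv]
    · simp [U_gInv_g]
    · simp [U_g_a])

theorem gAut_gAut (f : H k) : gAut k (gAut k f) = f := by
  have : (gAut k).comp (gAut k) = AlgHom.id k (H k) := by
    apply pres_ext
    rintro (_ | _ | _ | _) <;> simp [gAut]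
  exact DFunLike.congr_fun this f

theorem hAut_hAut (x : U k) : hAut k (hAut k x) = x := by
  have : (hAut k).comp (hAut k) = AlgHom.id k (U k) := by
    apply pres_ext
    rintro (_ | _ | _) <;> simp [hAut]
  exact DFunLike.congr_fun this x

/-- The left action `▷` of `U` on `H`: `a` acts by `0`, and `g` acts by the algebra automorphism
`b ↦ -c`, `c ↦ -b`, `h ↦ h`. -/
def leftAction : U k →ₐ[k] Module.End k (H k) :=
  presLift (URel k)
    (fun
      | .a => 0
      | .g => (gAut k).toLinearMap
      | .gInv => (gAut k).toLinearMap) (by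
    rintro _ _ (_ | _ | _)
    · ext; simp [gAut_gAut]
    · ext; simp [gAut_gAut]
    · simp)

/-- The right action `◁` of `H` on `U`: `b` and `c` act by `0`, and `h` acts by the algebra
automorphism `a ↦ -a`, `g ↦ g`. -/
def rightAction : H k →ₐ[k] (Module.End k (U k))ᵐᵒᵖ :=
  presLift (LRel k 0)
    (fun
      | .b => 0
      | .c => 0
      | .h => .op (hAut k).toLinearMap
      | .hInv => .op (hAut k).toLinearMap) (by
    rintro _ _ (_ | _ | _ | _ | _)
    · apply MulOpposite.unop_injective
      ext; simp [hAut_hAut]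
    · apply MulOpposite.unop_injective
      ext; simp [hAut_hAut]
    · simp
    · simp
    · simp)

/-- `f ⊗ x ↦ x ▷ f`. -/
def tri : H k ⊗[k] U k →ₗ[k] H k :=
  TensorProduct.lift (leftAction k).toLinearMap.flip

/-- `f ⊗ x ↦ x ◁ f`. -/
def tle : H k ⊗[k] U k →ₗ[k] U k :=
  TensorProduct.lift
    ((MulOpposite.opLinearEquiv k).symm.toLinearMap ∘ₗ (rightAction k).toLinearMap)

/-- `f ⊗ x ↦ x₁ ▷ f₁ ⊗ x₂ ◁ f₂`, for given maps `f ⊗ x ↦ x ▷ f` and `f ⊗ x ↦ x ◁ f`. -/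
def omega {k : Type u} [Field k] (r : H k ⊗[k] U k →ₗ[k] H k) (s : H k ⊗[k] U k →ₗ[k] U k) :
    H k ⊗[k] U k →ₗ[k] H k ⊗[k] U k :=
  TensorProduct.map r s ∘ₗ comul

end Actions

section Products
variable {k : Type u} [Field k]

/-- `θ_ψ : U ⊗ H → H ⊗ U`, `θ_ψ(x ⊗ f) = ψ(f₁ ⊗ x₁) x₂ ▷ f₂ ⊗ x₃ ◁ f₃`. -/
def theta (ψ : H k ⊗[k] U k →ₗ[k] k) : U k ⊗[k] H k →ₗ[k] H k ⊗[k] U k :=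
  conv ψ (omega (tri k) (tle k)) ∘ₗ (TensorProduct.comm k (U k) (H k)).toLinearMap

/-- The product `(f # x)(f' # x') = f · θ(x ⊗ f') · x'` on `H ⊗ U`, for a product `m` on the space
`H`, the product of `U` and a linear map `θ : U ⊗ H → H ⊗ U`. -/
def twistedMul (m : H k ⊗[k] H k →ₗ[k] H k) (θ : U k ⊗[k] H k →ₗ[k] H k ⊗[k] U k) :
    (H k ⊗[k] U k) ⊗[k] (H k ⊗[k] U k) →ₗ[k] H k ⊗[k] U k :=
  TensorProduct.map m (LinearMap.mul' k (U k)) ∘ₗ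
    (TensorProduct.assoc k (H k) (H k) (U k ⊗[k] U k)).symm.toLinearMap ∘ₗ
    LinearMap.lTensor (H k)
      ((TensorProduct.assoc k (H k) (U k) (U k)).toLinearMap ∘ₗ θ.rTensor (U k) ∘ₗ
        (TensorProduct.assoc k (U k) (H k) (U k)).symm.toLinearMap) ∘ₗ
    (TensorProduct.assoc k (H k) (U k) (H k ⊗[k] U k)).toLinearMap

/-- The product `(f ⋈ x)(f' ⋈ x') = f · (x₁ ▷ f'₁) ⋈ (x₂ ◁ f'₂) · x'` of a bicrossed product on
`H ⊗ U`, for a product `m` on `H`, the product of `U` and actions `f ⊗ x ↦ x ▷ f`,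
`f ⊗ x ↦ x ◁ f`. -/
def bicrossedMul (m : H k ⊗[k] H k →ₗ[k] H k) (r : H k ⊗[k] U k →ₗ[k] H k)
    (s : H k ⊗[k] U k →ₗ[k] U k) :
    (H k ⊗[k] U k) ⊗[k] (H k ⊗[k] U k) →ₗ[k] H k ⊗[k] U k :=
  twistedMul m (omega r s ∘ₗ (TensorProduct.comm k (U k) (H k)).toLinearMap)

/-- The action `x ▷_ψ f = ψ(f₁ ⊗ x₁) (x₂ ▷ f₂) ψ⁻¹(f₃ ⊗ x₃)`, where `ψ'` stands for `ψ⁻¹`. -/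
def triDef (ψ ψ' : H k ⊗[k] U k →ₗ[k] k) : H k ⊗[k] U k →ₗ[k] H k :=
  convRight (conv ψ (tri k)) ψ'

/-- The action `x ◁_ψ f = ψ(f₁ ⊗ x₁) (x₂ ◁ f₂) ψ⁻¹(f₃ ⊗ x₃)`, where `ψ'` stands for `ψ⁻¹`. -/
def tleDef (ψ ψ' : H k ⊗[k] U k →ₗ[k] k) : H k ⊗[k] U k →ₗ[k] U k :=
  convRight (conv ψ (tle k)) ψ'

/-- The product `x . y = σ(x₁ ⊗ y₁) x₂y₂` of `_σH`. -/
def cleftMul (σ : H k ⊗[k] H k →ₗ[k] k) : H k ⊗[k] H k →ₗ[k] H k :=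
  conv σ (LinearMap.mul' k (H k))

/-- The product `x . y = σ(x₁ ⊗ y₁) x₂y₂ σ⁻¹(x₃ ⊗ y₃)` of `H^σ`, where `σ'` stands for `σ⁻¹`. -/
def cocycleMul (σ σ' : H k ⊗[k] H k →ₗ[k] k) : H k ⊗[k] H k →ₗ[k] H k :=
  convRight (conv σ (LinearMap.mul' k (H k))) σ'

/-- The algebra map `H → E` that sends each generator to the generator of the same name. -/
def inclH : H k →ₐ[k] E k :=
  presLift (LRel k 0)
    (fun
      | .b => gen (ERel k 0 0 1) .b
      | .c => gen (ERel k 0 0 1) .c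
      | .h => gen (ERel k 0 0 1) .h
      | .hInv => gen (ERel k 0 0 1) .hInv) (by
    have hbc := E_b_c (k := k) (α := 0) (β := 0) (l := 1)
    rw [zero_smul, add_zero] at hbc
    rintro _ _ (_ | _ | _ | _ | _)
    · simp [basic_h_hInv E_basic]
    · simp [basic_hInv_h E_basic]
    · simp [basic_h_b E_basic]
    · simp [basic_h_c E_basic]
    · simp [hbc])

/-- The algebra map `U → E` that sends each generator to the generator of the same name. -/
def inclU : U k →ₐ[k] E k :=
  presLift (URel k)
    (fun
      | .a => gen (ERel k 0 0 1) .a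
      | .g => gen (ERel k 0 0 1) .g
      | .gInv => gen (ERel k 0 0 1) .gInv) (by
    rintro _ _ (_ | _ | _)
    · simp [basic_g_gInv E_basic]
    · simp [basic_gInv_g E_basic]
    · simp [basic_g_a E_basic])

/-- The linear map `H ⊗ U → E`, `f ⊗ x ↦ ι(f) j(x)`, for `ι = inclH` and `j = inclU`. -/
def factor : H k ⊗[k] U k →ₗ[k] E k :=
  LinearMap.mul' k (E k) ∘ₗ TensorProduct.map inclH.toLinearMap inclU.toLinearMap

end Products

section Pairings
variable {k : Type u} [Field k]

/-- `τ : H ⊗ U → k` is a skew `H ⋈ U`-pairing: it is convolution invertible, with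
`τ(f,1) = ε(f)`, `τ(1,x) = ε(x)`, `τ(f,xy) = τ(f₁,y₁) τ(y₂ ▷ f₂, x)` and
`τ(ff',x) = τ(f₁,x₁) τ(f', x₂ ◁ f₂)`. -/
structure IsSkewPairing (τ : H k ⊗[k] U k →ₗ[k] k) : Prop where
  invertible : ∃ τ', IsConvInverse τ τ'
  map_one_right : ∀ f : H k, τ (f ⊗ₜ 1) = counit f
  map_one_left : ∀ x : U k, τ (1 ⊗ₜ x) = counit x
  map_mul_right : ∀ (f : H k) (x y : U k), τ (f ⊗ₜ (x * y)) =
    conv τ (τ ∘ₗ (TensorProduct.mk k (H k) (U k)).flip x ∘ₗ tri k) (f ⊗ₜ y)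
  map_mul_left : ∀ (f f' : H k) (x : U k), τ ((f * f') ⊗ₜ x) =
    conv τ (τ ∘ₗ TensorProduct.mk k (H k) (U k) f' ∘ₗ tle k) (f ⊗ₜ x)

/-- `ψ : H ⊗ U → k` satisfies the conditions for `θ_ψ` to be a twisting map from `_τU ⊗ _σH` to
`_σH ⊗ _τU`: `ψ(f,1) = ε(f)`, `ψ(1,x) = ε(x)`,
`τ(x₁,y₁) ψ(f,x₂y₂) = ψ(f₁,y₁) ψ(y₂ ▷ f₂, x₁) τ(x₂ ◁ (y₃ ▷ f₃), y₄ ◁ f₄)` and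
`σ(f₁,t₁) ψ(f₂t₂,x) = ψ(f₁,x₁) ψ(t₁, x₂ ◁ f₂) σ(x₃ ▷ f₃, (x₄ ◁ f₄) ▷ t₂)`. -/
structure IsTwistingDatum (σ : H k ⊗[k] H k →ₗ[k] k) (τ : U k ⊗[k] U k →ₗ[k] k)
    (ψ : H k ⊗[k] U k →ₗ[k] k) : Prop where
  map_one_right : ∀ f : H k, ψ (f ⊗ₜ 1) = counit f
  map_one_left : ∀ x : U k, ψ (1 ⊗ₜ x) = counit x
  map_mul_right : ∀ (f : H k) (x y : U k),
    conv τ (ψ ∘ₗ TensorProduct.mk k (H k) (U k) f ∘ₗ LinearMap.mul' k (U k)) (x ⊗ₜ y) =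
      ∑ i ∈ (ℛ k x).index,
        conv ψ (conv (ψ ∘ₗ (TensorProduct.mk k (H k) (U k)).flip ((ℛ k x).left i) ∘ₗ tri k)
          (τ ∘ₗ (tle k ∘ₗ (TensorProduct.mk k (H k) (U k)).flip ((ℛ k x).right i)).rTensor (U k) ∘ₗ
            omega (tri k) (tle k))) (f ⊗ₜ y)
  map_mul_left : ∀ (f t : H k) (x : U k),
    conv σ (ψ ∘ₗ (TensorProduct.mk k (H k) (U k)).flip x ∘ₗ LinearMap.mul' k (H k)) (f ⊗ₜ t) =
      ∑ i ∈ (ℛ k t).index,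
        conv ψ (conv (ψ ∘ₗ TensorProduct.mk k (H k) (U k) ((ℛ k t).left i) ∘ₗ tle k)
          (σ ∘ₗ (tri k ∘ₗ TensorProduct.mk k (H k) (U k) ((ℛ k t).right i)).lTensor (H k) ∘ₗ
            omega (tri k) (tle k))) (f ⊗ₜ x)

/-- `τ_λ(bʳcˢh^p, aⁿg^q) = λ^{pq}` if `r = s = n = 0`, and `0` otherwise. For `λ = ζ` with
`ζ⁴ = -1` this is also `ψ_ζ`. -/
def tauLam (l : kˣ) : H k ⊗[k] U k →ₗ[k] k :=
  ((basisH k).tensorProduct (basisU k)).constr k fun i =>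
    if i.1.1 = 0 ∧ i.1.2.1 = 0 ∧ i.2.1 = 0 then ((l ^ (i.1.2.2 * i.2.2) : kˣ) : k) else 0

/-- `τ_ξ^β(bʳcˢh^p, aⁿg^q) = δ_{r+s,n} (-1)^{qn} ξ^{pq} n! βⁿ`. -/
def tauBeta (ξ : kˣ) (β : k) : H k ⊗[k] U k →ₗ[k] k :=
  ((basisH k).tensorProduct (basisU k)).constr k fun i =>
    if i.1.1 + i.1.2.1 = i.2.1 then
      (((-1) ^ (i.2.2 * (i.2.1 : ℤ)) * ξ ^ (i.1.2.2 * i.2.2) : kˣ) : k) *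
        (i.2.1.factorial : k) * β ^ i.2.1
    else 0

/-- `σ_α(bⁿcᵐh^p, bʳcˢh^q) = δ_{n,s} δ_{m,r} (-1)ᵐ (-1)^{p(n+m)} n! m! (α/2)^{n+m}`. -/
def sigma (α : k) : H k ⊗[k] H k →ₗ[k] k :=
  ((basisH k).tensorProduct (basisH k)).constr k fun i =>
    if i.1.1 = i.2.2.1 ∧ i.1.2.1 = i.2.1 then
      (-1) ^ i.1.2.1 * (((-1) ^ (i.1.2.2 * ((i.1.1 + i.1.2.1 : ℕ) : ℤ)) : kˣ) : k) *
        (i.1.1.factorial : k) * (i.1.2.1.factorial : k) * (α / 2) ^ (i.1.1 + i.1.2.1)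
    else 0

end Pairings

section Realization
variable {k : Type u} [Field k]

/-- For a convolution invertible `ψ : H ⊗ U → k`, a product `mA` on the space `H` (that of a cleft
object for `H`) and a product `mL` on the coalgebra `H` (that of its left Hopf algebra):

* `E^λ_{α,β}` is isomorphic, as a Hopf algebra, to the bicrossed product on the coalgebra `H ⊗ U`
  of `(H, mL)` and `U` with the actions `▷_ψ` and `◁_ψ`;
* `A^λ_{α,β}` is isomorphic, as an algebra, to the twisted tensor product of `(H, mA)` and `U` with
  respect to `θ_ψ`;
* under these isomorphisms and `H ⊗ U ≅ E`, the left and right coactions on `A^λ_{α,β}` become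
  the comultiplication of the coalgebra `H ⊗ U`. -/
def Realizes (mL mA : H k ⊗[k] H k →ₗ[k] H k) (ψ : H k ⊗[k] U k →ₗ[k] k) (α β : k) (l : kˣ) :
    Prop :=
  ∃ ψ', IsConvInverse ψ ψ' ∧
  ∃ (Ψ : Edef k α β l ≃ₗc[k] H k ⊗[k] U k) (Φ : Adef k α β l ≃ₗ[k] H k ⊗[k] U k),
    (Ψ 1 = 1 ⊗ₜ 1 ∧
      ∀ u v, Ψ (u * v) = bicrossedMul mL (triDef ψ ψ') (tleDef ψ ψ') (Ψ u ⊗ₜ Ψ v)) ∧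
    (Φ 1 = 1 ⊗ₜ 1 ∧ ∀ u v, Φ (u * v) = twistedMul mA (theta ψ) (Φ u ⊗ₜ Φ v)) ∧
    (∀ u, TensorProduct.map Φ.toLinearMap LinearMap.id (rightCoaction α β l u) =
      TensorProduct.map LinearMap.id factor (comul (R := k) (Φ u))) ∧
    (∀ u, TensorProduct.map (Ψ : Edef k α β l →ₗ[k] H k ⊗[k] U k) Φ.toLinearMap
      (leftCoaction α β l u) = comul (R := k) (Φ u))

end Realization

end BicrossedExample

end

open BicrossedExample

open scoped TensorProduct
open Coalgebra
set_option linter.unusedSimpArgs false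
set_option linter.unusedVariables false
noncomputable section
namespace BicrossedExample
universe u

/-! ### Induction on words in a presented algebra -/

section PresInduction
variable {k : Type u} [Field k] {X : Type} {r : FreeAlgebra k X → FreeAlgebra k X → Prop}

/-! All algebras involved belong to one family: generators `a, b, c, h, g` subject to the basic
relations and to `bc - cb = 2z` with `z = s - t h⁴`, `gh = q hg` and `ab - λ⁴ba = β - β'h²g² = ac -
λ⁴ca`. The algebra `A^λ_{α,β}` has `s = α/2`, `t = 0`, `q = λ`, `β' = 0`; the algebra `E^λ_{α,β}`
has `s = t = α/2`, `q = 1`, `β' = β`.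

Symmetrization. The cocycle `σ_α` is skew in `b` and `c`, so the right ordering is the Weyl
ordering: `sym` sends `bʳcⁿh^p` to the symmetrized product of `r` factors `b` and `n` factors `c`,
times `h^p`. With the skew derivations `∂_b`, `∂_c` of `H` it satisfies `sym(bf) = b sym(f) - z
sym(∂_c f)` and `sym(cf) = c sym(f) + z sym(∂_b f)`. The cocycle obeys a matching recursion, `σ(bf,
y) = (α/2) σ(sg f, ∂_c y)`, so the products deformed by `σ_α` are Moyal products and `sym` turns
them into the products of `H_α` and `L_α` (`sym_mul_cleft`, `sym_mul_cocycle`). It also respects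
comultiplications and coactions (`sym_coaction`).

Bases. If `α(1 + λ⁴) = 0` and `β(1 - λ²) = 0`, then `f ⊗ x ↦ sym(f) x` is a bijection from `H ⊗ U`
onto each algebra (`pbwEquiv`): the operators by which the generators ought to act on `H ⊗ U`
satisfy the relations, and evaluation at `1 ⊗ 1` inverts the map. The comultiplication of `H ⊗ U`
becomes that of `E^λ_{α,β}` and the coactions on `A^λ_{α,β}`.

Realization. Let `N_A`, `N_E`, `ω` be the maps of `H ⊗ U` that write a product `x f` in ordered form
in `A^λ_{α,β}`, `E^λ_{α,β}` and `E`. The coactions are algebra maps, so `Δ N_A = (N_A ⊗ ω) Δ = (N_E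
⊗ N_A) Δ`. With `ψ = ε N_A` this gives `N_A = ψ * ω = N_E * ψ`, hence `N_E = ψ * ω * ψ⁻¹`. The first
equation says that `A^λ_{α,β}` is a twisted product for `θ_ψ`. A coalgebra endomorphism of `H ⊗ U`
is determined by its two marginals, so the last one says that `E^λ_{α,β}` is the bicrossed product
for `▷_ψ` and `◁_ψ` (`swapE_eq`, `realizes_of_inverse`). A recursion in the second argument
identifies `ψ` with `τ_λ^β` (`pairA_eq`), whose convolution inverse is `τ_{λ⁻¹}^{-β}`.

Classification. That `τ_λ^β` is a twisting datum is associativity `x(ft) = (xf)t` in `A^λ_{α,β}`,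
together with a recursion for the other condition. Conversely, the conditions on a twisting datum
yield recursions for `ψ(·, g)` and `ψ(·, a)`; consistency with `hb = -bh`, `bc = cb` and `ga = -ag`
leaves only `λ = ψ(h, g)` and `β = ψ(b, a)`, with `α(1 + λ⁴) = 0` and `β(1 - λ²) = 0`
(`IsTwistingDatum.exists_eq`). For `α = 0` the cocycle is trivial and twisting data are skew
pairings; for `α ≠ 0` the equations force `λ⁴ = -1` and `β = 0`.

Galois property. The isomorphism `H ⊗ U → A^λ_{α,β}` is colinear and convolution invertible, so both
Galois maps are invertible (`isBiGalois`). -/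

theorem pres_left_induction (S : Submodule k (Pres r)) (h1 : (1 : Pres r) ∈ S)
    (hx : ∀ x, ∀ f ∈ S, gen r x * f ∈ S) (f : Pres r) : f ∈ S := by
  have key : ∀ u ∈ Algebra.adjoin k (Set.range (gen r)), ∀ f ∈ S, u * f ∈ S := by
    intro u hu
    induction hu using Algebra.adjoin_induction with
    | mem x h => obtain ⟨y, rfl⟩ := h; exact hx y
    | algebraMap t =>
      intro f hf
      rw [← Algebra.smul_def]
      exact S.smul_mem _ hf
    | add x y _ _ h h' => intro f hf; rw [add_mul]; exact S.add_mem (h f hf) (h' f hf)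
    | mul x y _ _ h h' => intro f hf; rw [mul_assoc]; exact h _ (h' f hf)
  have := key f (by rw [adjoin_gen]; trivial) 1 h1
  rwa [mul_one] at this

theorem pres_right_induction (S : Submodule k (Pres r)) (h1 : (1 : Pres r) ∈ S)
    (hx : ∀ x, ∀ f ∈ S, f * gen r x ∈ S) (f : Pres r) : f ∈ S := by
  have key : ∀ u ∈ Algebra.adjoin k (Set.range (gen r)), ∀ f ∈ S, f * u ∈ S := by
    intro u hu
    induction hu using Algebra.adjoin_induction with
    | mem x h => obtain ⟨y, rfl⟩ := h; exact hx y
    | algebraMap t =>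
      intro f hf
      rw [← Algebra.commutes, ← Algebra.smul_def]
      exact S.smul_mem _ hf
    | add x y _ _ h h' => intro f hf; rw [mul_add]; exact S.add_mem (h f hf) (h' f hf)
    | mul x y _ _ h h' => intro f hf; rw [← mul_assoc]; exact h' _ (h f hf)
  have := key f (by rw [adjoin_gen]; trivial) 1 h1
  rwa [one_mul] at this

/-- Two linear maps out of a presented algebra agree if they agree at `1` and agreement is
inherited under left multiplication by generators. -/
theorem linearMap_ext_left {M : Type*} [AddCommGroup M] [Module k M] {P Q : Pres r →ₗ[k] M}
    (h1 : P 1 = Q 1) (hx : ∀ x f, P f = Q f → P (gen r x * f) = Q (gen r x * f)) : P = Q :=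
  LinearMap.ext fun f => pres_left_induction (LinearMap.eqLocus P Q) h1 (fun x f h => hx x f h) f

end PresInduction

/-! ### Convolution with functionals -/

section Conv
variable {k : Type u} [Field k] {C D M N : Type*} [AddCommGroup C] [Module k C] [Coalgebra k C]
  [AddCommGroup D] [Module k D] [Coalgebra k D]
  [AddCommGroup M] [Module k M] [AddCommGroup N] [Module k N]

theorem conv_apply (f : C →ₗ[k] k) (φ : C →ₗ[k] M) (x : C) :
    conv f φ x = TensorProduct.lid k M (TensorProduct.map f φ (comul x)) := rfl

theorem convRight_apply (f : C →ₗ[k] k) (φ : C →ₗ[k] M) (x : C) :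
    convRight φ f x = TensorProduct.rid k M (TensorProduct.map φ f (comul x)) := rfl

theorem conv_add_right (f : C →ₗ[k] k) (φ ψ : C →ₗ[k] M) :
    conv f (φ + ψ) = conv f φ + conv f ψ := by
  ext x; simp [conv_apply, TensorProduct.map_add_right]

theorem conv_smul_left (t : k) (f : C →ₗ[k] k) (φ : C →ₗ[k] M) :
    conv (t • f) φ = t • conv f φ := by
  ext x; simp [conv_apply, TensorProduct.map_smul_left]

theorem conv_smul_right (t : k) (f : C →ₗ[k] k) (φ : C →ₗ[k] M) :
    conv f (t • φ) = t • conv f φ := by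
  ext x; simp [conv_apply, TensorProduct.map_smul_right]

theorem comp_conv (L : M →ₗ[k] N) (f : C →ₗ[k] k) (φ : C →ₗ[k] M) :
    L ∘ₗ conv f φ = conv f (L ∘ₗ φ) := by
  ext x
  simp only [conv_apply, LinearMap.comp_apply]
  induction comul (R := k) x using TensorProduct.induction_on with
  | zero => simp
  | add a b ha hb => simp only [map_add, ha, hb]
  | tmul a b => simp

theorem comp_convRight (L : M →ₗ[k] N) (f : C →ₗ[k] k) (φ : C →ₗ[k] M) :
    L ∘ₗ convRight φ f = convRight (L ∘ₗ φ) f := by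
  ext x
  simp only [convRight_apply, LinearMap.comp_apply]
  induction comul (R := k) x using TensorProduct.induction_on with
  | zero => simp
  | add a b ha hb => simp only [map_add, ha, hb]
  | tmul a b => simp

theorem conv_counit_left (φ : C →ₗ[k] M) : conv counit φ = φ := by
  ext x
  have h := congrArg (φ ∘ₗ (TensorProduct.lid k C).toLinearMap) (Coalgebra.rTensor_counit_comul (R := k) x)
  simp only [LinearMap.comp_apply, LinearEquiv.coe_coe, TensorProduct.lid_tmul, one_smul] at h
  rw [← h, conv_apply]
  induction comul (R := k) x using TensorProduct.induction_on with
  | zero => simp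
  | add a b ha hb => simp only [map_add, ha, hb]
  | tmul a b => simp

theorem convRight_counit (φ : C →ₗ[k] M) : convRight φ counit = φ := by
  ext x
  have h := congrArg (φ ∘ₗ (TensorProduct.rid k C).toLinearMap) (Coalgebra.lTensor_counit_comul (R := k) x)
  simp only [LinearMap.comp_apply, LinearEquiv.coe_coe, TensorProduct.rid_tmul, one_smul] at h
  rw [← h, convRight_apply]
  induction comul (R := k) x using TensorProduct.induction_on with
  | zero => simp
  | add a b ha hb => simp only [map_add, ha, hb]
  | tmul a b => simp

theorem convRight_convRight (f g : C →ₗ[k] k) (φ : C →ₗ[k] M) :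
    convRight (convRight φ f) g = convRight φ (conv f g) := by
  ext x
  have h := Coalgebra.coassoc_apply (R := k) x
  have e1 : convRight φ (conv f g) x = ((TensorProduct.rid k M).toLinearMap ∘ₗ TensorProduct.map φ
      ((TensorProduct.lid k k).toLinearMap ∘ₗ TensorProduct.map f g))
        (comul.lTensor C (comul (R := k) x)) := by
    rw [convRight_apply]
    induction comul (R := k) x using TensorProduct.induction_on with
    | zero => simp
    | add a b ha hb => simp only [map_add, ha, hb]
    | tmul a b => simp [conv_apply]
  rw [e1, ← h, convRight_apply]
  induction comul (R := k) x using TensorProduct.induction_on with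
  | zero => simp
  | add a b ha hb => simp only [map_add, ha, hb]
  | tmul a b =>
    simp only [LinearMap.rTensor_tmul, TensorProduct.map_tmul, convRight_apply]
    induction comul (R := k) a using TensorProduct.induction_on with
    | zero => simp
    | add p q hp hq => simp only [map_add, TensorProduct.add_tmul, hp, hq]
    | tmul p q => simp [smul_smul, mul_comm]

/-- The source of the recursions for convolutions of functionals: with `T` a multiplication by a
group-like element the coproduct splits as `T₁ ⊗ T₂`, and for a skew-primitive generator the
two-term version `conv_comp_add` applies. -/
theorem conv_comp {T : D →ₗ[k] C} {T₁ T₂ : D →ₗ[k] C}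
    (hT : comul ∘ₗ T = TensorProduct.map T₁ T₂ ∘ₗ comul) (f : C →ₗ[k] k) (φ : C →ₗ[k] M) :
    conv f φ ∘ₗ T = conv (f ∘ₗ T₁) (φ ∘ₗ T₂) := by
  simp only [conv, LinearMap.comp_assoc, hT, TensorProduct.map_comp]

theorem convRight_comp {T : D →ₗ[k] C} {T₁ T₂ : D →ₗ[k] C}
    (hT : comul ∘ₗ T = TensorProduct.map T₁ T₂ ∘ₗ comul) (f : C →ₗ[k] k) (φ : C →ₗ[k] M) :
    convRight φ f ∘ₗ T = convRight (φ ∘ₗ T₁) (f ∘ₗ T₂) := by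
  simp only [convRight, LinearMap.comp_assoc, hT, TensorProduct.map_comp]

theorem conv_comp_add {T : D →ₗ[k] C} {T₁ T₂ T₃ T₄ : D →ₗ[k] C}
    (hT : comul ∘ₗ T = TensorProduct.map T₁ T₂ ∘ₗ comul + TensorProduct.map T₃ T₄ ∘ₗ comul)
    (f : C →ₗ[k] k) (φ : C →ₗ[k] M) :
    conv f φ ∘ₗ T = conv (f ∘ₗ T₁) (φ ∘ₗ T₂) + conv (f ∘ₗ T₃) (φ ∘ₗ T₄) := by
  simp only [conv, LinearMap.comp_assoc, hT, TensorProduct.map_comp, LinearMap.comp_add]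

theorem convRight_comp_add {T : D →ₗ[k] C} {T₁ T₂ T₃ T₄ : D →ₗ[k] C}
    (hT : comul ∘ₗ T = TensorProduct.map T₁ T₂ ∘ₗ comul + TensorProduct.map T₃ T₄ ∘ₗ comul)
    (f : C →ₗ[k] k) (φ : C →ₗ[k] M) :
    convRight φ f ∘ₗ T = convRight (φ ∘ₗ T₁) (f ∘ₗ T₂) + convRight (φ ∘ₗ T₃) (f ∘ₗ T₄) := by
  simp only [convRight, LinearMap.comp_assoc, hT, TensorProduct.map_comp, LinearMap.comp_add]

/-- An operator that can be carried from the first leg of the coproduct to the second can be carried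
from one factor of a convolution to the other. In the computations of convolution inverses this
makes the two summands coming from a skew-primitive generator comparable. -/
theorem conv_balance {T₁ T₂ : C →ₗ[k] C}
    (hT : T₁.rTensor C ∘ₗ comul = T₂.lTensor C ∘ₗ comul) (f : C →ₗ[k] k) (φ : C →ₗ[k] M) :
    conv (f ∘ₗ T₁) φ = conv f (φ ∘ₗ T₂) := by
  have h := congrArg (fun L => (TensorProduct.lid k M).toLinearMap ∘ₗ TensorProduct.map f φ ∘ₗ L) hT
  simpa only [conv, LinearMap.rTensor, LinearMap.lTensor, ← LinearMap.comp_assoc,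
    ← TensorProduct.map_comp, LinearMap.comp_id, LinearMap.id_comp] using h

theorem convRight_balance {T₁ T₂ : C →ₗ[k] C}
    (hT : T₁.rTensor C ∘ₗ comul = T₂.lTensor C ∘ₗ comul) (f : C →ₗ[k] k) (φ : C →ₗ[k] M) :
    convRight (φ ∘ₗ T₁) f = convRight φ (f ∘ₗ T₂) := by
  have h := congrArg (fun L => (TensorProduct.rid k M).toLinearMap ∘ₗ TensorProduct.map φ f ∘ₗ L) hT
  simpa only [convRight, LinearMap.rTensor, LinearMap.lTensor, ← LinearMap.comp_assoc,
    ← TensorProduct.map_comp, LinearMap.comp_id, LinearMap.id_comp] using h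

theorem comul_comp_map {C' D' : Type*} [AddCommGroup C'] [Module k C'] [Coalgebra k C']
    [AddCommGroup D'] [Module k D'] [Coalgebra k D']
    {T T₁ T₂ : C →ₗ[k] C'} {S S₁ S₂ : D →ₗ[k] D'}
    (hT : comul ∘ₗ T = TensorProduct.map T₁ T₂ ∘ₗ comul)
    (hS : comul ∘ₗ S = TensorProduct.map S₁ S₂ ∘ₗ comul) :
    comul ∘ₗ TensorProduct.map T S =
      TensorProduct.map (TensorProduct.map T₁ S₁) (TensorProduct.map T₂ S₂) ∘ₗ comul := by
  apply TensorProduct.ext'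
  intro x y
  have h1 := LinearMap.congr_fun hT x
  have h2 := LinearMap.congr_fun hS y
  simp only [LinearMap.comp_apply] at h1 h2
  simp only [LinearMap.comp_apply, TensorProduct.map_tmul, TensorProduct.comul_tmul, h1, h2]
  generalize comul (R := k) x = X
  generalize comul (R := k) y = Y
  induction X using TensorProduct.induction_on with
  | zero => simp
  | add a b ha hb => simp only [map_add, TensorProduct.add_tmul, ha, hb]
  | tmul a b =>
    induction Y using TensorProduct.induction_on with
    | zero => simp
    | add p q hp hq => simp only [map_add, TensorProduct.tmul_add, hp, hq]
    | tmul p q => simp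

theorem comul_comp_map_id {T T₁ T₂ : C →ₗ[k] C}
    (hT : comul ∘ₗ T = TensorProduct.map T₁ T₂ ∘ₗ comul) :
    comul ∘ₗ T.rTensor D =
      TensorProduct.map (T₁.rTensor D) (T₂.rTensor D) ∘ₗ comul :=
  comul_comp_map hT (by simp)

end Conv

/-! ### Skew derivations of `H` -/

section OperatorsH
variable {k : Type u} [Field k]

theorem H_b_c : gen (LRel k 0) .b * gen (LRel k 0) .c = gen (LRel k 0) .c * gen (LRel k 0) .b := by
  have h := L_b_c (k := k) (α := 0)
  rwa [zero_smul, add_zero] at h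

theorem b_mul_monH (r s : ℕ) (p : ℤ) : gen (LRel k 0) .b * monH k (r, s, p) = monH k (r + 1, s, p) := by
  simp only [monH, pow_succ', mul_assoc]

theorem c_mul_monH (r s : ℕ) (p : ℤ) : gen (LRel k 0) .c * monH k (r, s, p) = monH k (r, s + 1, p) := by
  have h : Commute (gen (LRel k 0) .c) (gen (LRel k 0) .b ^ r) := (show Commute _ _ from H_b_c.symm).pow_right r
  simp only [monH, pow_succ', mul_assoc]
  rw [← mul_assoc, h.eq, mul_assoc]

theorem h_mul_monH (r s : ℕ) (p : ℤ) : gen (LRel k 0) .h * monH k (r, s, p) =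
    (-1 : k) ^ (r + s) • monH k (r, s, p + 1) := by
  have e1 : gen (LRel k 0) .h = (hUnit k : H k) := rfl
  simp only [monH, mul_assoc, assoc_rule (neg_one_comm_pow k L_h_b r),
    assoc_rule (neg_one_comm_pow k L_h_c s), smul_mul_assoc, mul_smul_comm, smul_smul]
  rw [e1, ← Units.val_mul, ← zpow_one_add, add_comm p 1, pow_add]

theorem hInv_mul_monH (r s : ℕ) (p : ℤ) : gen (LRel k 0) .hInv * monH k (r, s, p) =
    (-1 : k) ^ (r + s) • monH k (r, s, p - 1) := by
  have e1 : gen (LRel k 0) .hInv = ((hUnit k)⁻¹ : (H k)ˣ) := rfl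
  simp only [monH, mul_assoc, assoc_rule (neg_one_comm_pow k L_hInv_b r),
    assoc_rule (neg_one_comm_pow k L_hInv_c s), smul_mul_assoc, mul_smul_comm, smul_smul]
  rw [e1, ← Units.val_mul, ← zpow_neg_one, ← zpow_add, sub_eq_neg_add, pow_add]

theorem monH_zero : monH k (0, 0, 0) = 1 := by simp [monH]

theorem H_ext {M : Type*} [AddCommGroup M] [Module k M] {P Q : H k →ₗ[k] M}
    (h : ∀ r s p, P (monH k (r, s, p)) = Q (monH k (r, s, p))) : P = Q :=
  (basisH k).ext fun i => by simpa using h i.1 i.2.1 i.2.2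

variable (k) in
/-- The skew derivation `∂/∂b` of `H`. -/
def dB : H k →ₗ[k] H k :=
  (basisH k).constr k fun i => (i.1 : k) • monH k (i.1 - 1, i.2.1, i.2.2)

variable (k) in
/-- The skew derivation `∂/∂c` of `H`. -/
def dC : H k →ₗ[k] H k :=
  (basisH k).constr k fun i => (i.2.1 : k) • monH k (i.1, i.2.1 - 1, i.2.2)

variable (k) in
/-- The automorphism `b ↦ b`, `c ↦ c`, `h ↦ -h` of `H`. -/
def sg : H k →ₐ[k] H k :=
  presLift (LRel k 0)
    (fun
      | .b => gen (LRel k 0) .b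
      | .c => gen (LRel k 0) .c
      | .h => -gen (LRel k 0) .h
      | .hInv => -gen (LRel k 0) .hInv) (by
    rintro _ _ (_ | _ | _ | _ | _)
    · simp [L_h_hInv]
    · simp [L_hInv_h]
    · simp [L_h_b]
    · simp [L_h_c]
    · simp [H_b_c])

theorem dB_monH (r s : ℕ) (p : ℤ) : dB k (monH k (r, s, p)) = (r : k) • monH k (r - 1, s, p) := by
  have := (basisH k).constr_basis k (fun i => (i.1 : k) • monH k (i.1 - 1, i.2.1, i.2.2)) (r, s, p)
  rwa [basisH_apply] at this

theorem dC_monH (r s : ℕ) (p : ℤ) : dC k (monH k (r, s, p)) = (s : k) • monH k (r, s - 1, p) := by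
  have := (basisH k).constr_basis k (fun i => (i.2.1 : k) • monH k (i.1, i.2.1 - 1, i.2.2)) (r, s, p)
  rwa [basisH_apply] at this

theorem dB_one : dB k 1 = 0 := by simp [← monH_zero, dB_monH]
theorem dC_one : dC k 1 = 0 := by simp [← monH_zero, dC_monH]

/-- Truncated subtraction does no harm: where `r - 1 + 1` differs from `r`, the coefficient `r` is
zero. -/
theorem natCast_smul_monH_pred (P : ℕ → H k) (r : ℕ) :
    (r : k) • P (r - 1 + 1) = (r : k) • P r := by
  cases r <;> simp

theorem dB_b (f : H k) : dB k (gen (LRel k 0) .b * f) = f + gen (LRel k 0) .b * dB k f := by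
  refine LinearMap.congr_fun (f := dB k ∘ₗ LinearMap.mulLeft k (gen (LRel k 0) .b))
    (g := LinearMap.id + LinearMap.mulLeft k (gen (LRel k 0) .b) ∘ₗ dB k) (H_ext fun r s p => ?_) f
  have := natCast_smul_monH_pred (fun n => monH k (n, s, p)) r
  simp [b_mul_monH, dB_monH, this, add_smul]
  abel

theorem dB_c (f : H k) : dB k (gen (LRel k 0) .c * f) = gen (LRel k 0) .c * dB k f := by
  refine LinearMap.congr_fun (f := dB k ∘ₗ LinearMap.mulLeft k (gen (LRel k 0) .c))
    (g := LinearMap.mulLeft k (gen (LRel k 0) .c) ∘ₗ dB k) (H_ext fun r s p => ?_) f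
  simp [c_mul_monH, dB_monH]

theorem dC_b (f : H k) : dC k (gen (LRel k 0) .b * f) = gen (LRel k 0) .b * dC k f := by
  refine LinearMap.congr_fun (f := dC k ∘ₗ LinearMap.mulLeft k (gen (LRel k 0) .b))
    (g := LinearMap.mulLeft k (gen (LRel k 0) .b) ∘ₗ dC k) (H_ext fun r s p => ?_) f
  simp [b_mul_monH, dC_monH]

theorem dC_c (f : H k) : dC k (gen (LRel k 0) .c * f) = f + gen (LRel k 0) .c * dC k f := by
  refine LinearMap.congr_fun (f := dC k ∘ₗ LinearMap.mulLeft k (gen (LRel k 0) .c))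
    (g := LinearMap.id + LinearMap.mulLeft k (gen (LRel k 0) .c) ∘ₗ dC k) (H_ext fun r s p => ?_) f
  have := natCast_smul_monH_pred (fun n => monH k (r, n, p)) s
  simp [c_mul_monH, dC_monH, this, add_smul]
  abel

theorem dB_h (f : H k) : dB k (gen (LRel k 0) .h * f) = -(gen (LRel k 0) .h * dB k f) := by
  refine LinearMap.congr_fun (f := dB k ∘ₗ LinearMap.mulLeft k (gen (LRel k 0) .h))
    (g := -(LinearMap.mulLeft k (gen (LRel k 0) .h) ∘ₗ dB k)) (H_ext fun r s p => ?_) f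
  cases r <;> simp [h_mul_monH, dB_monH, smul_smul, ← neg_smul]; congr 1; ring

theorem dB_hInv (f : H k) : dB k (gen (LRel k 0) .hInv * f) = -(gen (LRel k 0) .hInv * dB k f) := by
  refine LinearMap.congr_fun (f := dB k ∘ₗ LinearMap.mulLeft k (gen (LRel k 0) .hInv))
    (g := -(LinearMap.mulLeft k (gen (LRel k 0) .hInv) ∘ₗ dB k)) (H_ext fun r s p => ?_) f
  cases r <;> simp [hInv_mul_monH, dB_monH, smul_smul, ← neg_smul]; congr 1; ring

theorem dC_h (f : H k) : dC k (gen (LRel k 0) .h * f) = -(gen (LRel k 0) .h * dC k f) := by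
  refine LinearMap.congr_fun (f := dC k ∘ₗ LinearMap.mulLeft k (gen (LRel k 0) .h))
    (g := -(LinearMap.mulLeft k (gen (LRel k 0) .h) ∘ₗ dC k)) (H_ext fun r s p => ?_) f
  cases s <;> simp [h_mul_monH, dC_monH, smul_smul, ← neg_smul]; congr 1; ring

theorem dC_hInv (f : H k) : dC k (gen (LRel k 0) .hInv * f) = -(gen (LRel k 0) .hInv * dC k f) := by
  refine LinearMap.congr_fun (f := dC k ∘ₗ LinearMap.mulLeft k (gen (LRel k 0) .hInv))
    (g := -(LinearMap.mulLeft k (gen (LRel k 0) .hInv) ∘ₗ dC k)) (H_ext fun r s p => ?_) f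
  cases s <;> simp [hInv_mul_monH, dC_monH, smul_smul, ← neg_smul]; congr 1; ring

theorem dB_dC (f : H k) : dB k (dC k f) = dC k (dB k f) := by
  refine LinearMap.congr_fun (f := dB k ∘ₗ dC k) (g := dC k ∘ₗ dB k) (H_ext fun r s p => ?_) f
  simp [dB_monH, dC_monH, smul_smul, mul_comm]

@[simp] theorem sg_b : sg k (gen (LRel k 0) .b) = gen (LRel k 0) .b := presLift_gen _ _ _ _
@[simp] theorem sg_c : sg k (gen (LRel k 0) .c) = gen (LRel k 0) .c := presLift_gen _ _ _ _
@[simp] theorem sg_h : sg k (gen (LRel k 0) .h) = -gen (LRel k 0) .h := presLift_gen _ _ _ _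
@[simp] theorem sg_hInv : sg k (gen (LRel k 0) .hInv) = -gen (LRel k 0) .hInv := presLift_gen _ _ _ _

/-- An operator on `H` that satisfies the rules of a skew derivation on generators is one. -/
theorem skew_derivation_mul {d : H k →ₗ[k] H k}
    (d1 : d 1 = 0) (hd : ∀ x f, d (gen (LRel k 0) x * f) =
      d (gen (LRel k 0) x) * f + sg k (gen (LRel k 0) x) * d f) (f f' : H k) :
    d (f * f') = d f * f' + sg k f * d f' := by
  refine LinearMap.congr_fun (f := d ∘ₗ LinearMap.mulRight k f')
    (g := LinearMap.mulRight k f' ∘ₗ d + LinearMap.mulRight k (d f') ∘ₗ (sg k).toLinearMap)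
    (linearMap_ext_left (by simp [d1]) fun x v hv => ?_) f
  simp only [LinearMap.comp_apply, LinearMap.add_apply, LinearMap.mulRight_apply,
    AlgHom.toLinearMap_apply, map_mul, mul_assoc, hd] at hv ⊢
  rw [hv, add_mul, mul_add, mul_assoc, mul_assoc, ← add_assoc]

theorem dB_gen (x : LGen) (f : H k) : dB k (gen (LRel k 0) x * f) =
    dB k (gen (LRel k 0) x) * f + sg k (gen (LRel k 0) x) * dB k f := by
  have e := fun x : LGen => (congrArg (dB k) (mul_one (gen (LRel k 0) x)))
  cases x
  · rw [dB_b, ← e, dB_b]; simp [dB_one]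
  · rw [dB_c, ← e, dB_c]; simp [dB_one]
  · rw [dB_h, ← e, dB_h]; simp [dB_one]
  · rw [dB_hInv, ← e, dB_hInv]; simp [dB_one]

theorem dC_gen (x : LGen) (f : H k) : dC k (gen (LRel k 0) x * f) =
    dC k (gen (LRel k 0) x) * f + sg k (gen (LRel k 0) x) * dC k f := by
  have e := fun x : LGen => (congrArg (dC k) (mul_one (gen (LRel k 0) x)))
  cases x
  · rw [dC_b, ← e, dC_b]; simp [dC_one]
  · rw [dC_c, ← e, dC_c]; simp [dC_one]
  · rw [dC_h, ← e, dC_h]; simp [dC_one]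
  · rw [dC_hInv, ← e, dC_hInv]; simp [dC_one]

theorem dB_mul (f f' : H k) : dB k (f * f') = dB k f * f' + sg k f * dB k f' :=
  skew_derivation_mul dB_one dB_gen f f'

theorem dC_mul (f f' : H k) : dC k (f * f') = dC k f * f' + sg k f * dC k f' :=
  skew_derivation_mul dC_one dC_gen f f'

/-- An induction principle for `H` adapted to operators that involve `∂/∂b` and `∂/∂c`. -/
theorem H_induction (S : Submodule k (H k)) (h1 : (1 : H k) ∈ S)
    (hh : ∀ f ∈ S, gen (LRel k 0) .h * f ∈ S) (hi : ∀ f ∈ S, gen (LRel k 0) .hInv * f ∈ S)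
    (hb : ∀ f ∈ S, dC k f ∈ S → gen (LRel k 0) .b * f ∈ S)
    (hc : ∀ f ∈ S, dB k f ∈ S → gen (LRel k 0) .c * f ∈ S) (f : H k) : f ∈ S := by
  have m0 : ∀ p, monH k (0, 0, p) ∈ S := by
    intro p
    induction p using Int.induction_on with
    | zero => rwa [monH_zero]
    | succ p ih => simpa [h_mul_monH] using hh _ ih
    | pred p ih => simpa [hInv_mul_monH] using hi _ ih
  -- Powers of `c` are built before powers of `b`. The proviso on derivatives then holds at each
  -- stage: `∂_b` kills `cˢh^p`, and `∂_c` maps `bʳcˢh^p` to a multiple of a monomial with the same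
  -- power of `b`.
  have m1 : ∀ s p, monH k (0, s, p) ∈ S := by
    intro s p
    induction s with
    | zero => exact m0 p
    | succ s ih =>
      rw [← c_mul_monH]
      exact hc _ ih (by simp [dB_monH])
  have m2 : ∀ r s p, monH k (r, s, p) ∈ S := by
    intro r
    induction r with
    | zero => exact m1
    | succ r ih =>
      intro s p
      rw [← b_mul_monH]
      exact hb _ (ih s p) (by rw [dC_monH]; exact S.smul_mem _ (ih _ _))
  have : S = ⊤ := by
    rw [eq_top_iff, ← (basisH k).span_eq, Submodule.span_le]
    rintro _ ⟨i, rfl⟩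
    rw [basisH_apply]
    exact m2 _ _ _
  rw [this]; trivial

theorem linearMap_ext_H {M : Type*} [AddCommGroup M] [Module k M] {P Q : H k →ₗ[k] M}
    (h1 : P 1 = Q 1)
    (hh : ∀ f, P f = Q f → P (gen (LRel k 0) .h * f) = Q (gen (LRel k 0) .h * f))
    (hi : ∀ f, P f = Q f → P (gen (LRel k 0) .hInv * f) = Q (gen (LRel k 0) .hInv * f))
    (hb : ∀ f, P f = Q f → P (dC k f) = Q (dC k f) →
      P (gen (LRel k 0) .b * f) = Q (gen (LRel k 0) .b * f))
    (hc : ∀ f, P f = Q f → P (dB k f) = Q (dB k f) →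
      P (gen (LRel k 0) .c * f) = Q (gen (LRel k 0) .c * f)) : P = Q :=
  LinearMap.ext fun f => H_induction (LinearMap.eqLocus P Q) h1 hh hi hb hc f

/-- `h²` is central in `H`. -/
theorem hsq_comm (f : H k) : gen (LRel k 0) .h ^ 2 * f = f * gen (LRel k 0) .h ^ 2 := by
  refine LinearMap.congr_fun (f := LinearMap.mulLeft k (gen (LRel k 0) .h ^ 2))
    (g := LinearMap.mulRight k (gen (LRel k 0) .h ^ 2))
    (linearMap_ext_left (by simp) fun x v hv => ?_) f
  have : gen (LRel k 0) .h ^ 2 * gen (LRel k 0) x = gen (LRel k 0) x * gen (LRel k 0) .h ^ 2 := by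
    cases x
    · simp [pow_two, mul_assoc, L_h_b, assoc_rule L_h_b]
    · simp [pow_two, mul_assoc, L_h_c, assoc_rule L_h_c]
    · rw [pow_two, mul_assoc]
    · simp [pow_two, mul_assoc, L_h_hInv, assoc_rule L_hInv_h]
  simp only [LinearMap.mulLeft_apply, LinearMap.mulRight_apply] at hv ⊢
  rw [← mul_assoc, this, mul_assoc, hv, mul_assoc]

end OperatorsH

/-! ### Moving skew derivations across the comultiplication of `H` -/

section CoproductH
variable {k : Type u} [Field k]

/-- `Δ ∂_c = (∂_c ⊗ 1) Δ` on `H`. -/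
theorem comul_dC : comul ∘ₗ dC k = TensorProduct.map (dC k) LinearMap.id ∘ₗ comul (R := k) := by
  refine linearMap_ext_left (by simp [dC_one, Algebra.TensorProduct.one_def]) fun x f hf => ?_
  simp only [LinearMap.comp_apply, Bialgebra.comul_mul] at hf ⊢
  cases x
  · simp only [dC_b, Bialgebra.comul_mul, hf, comul_L_b]
    generalize comul (R := k) f = T
    induction T using TensorProduct.induction_on with
    | zero => simp
    | add a b ha hb => simp only [map_add, mul_add, ha, hb]
    | tmul a b => simp [add_mul, dC_b, dC_h, pow_two, mul_assoc]
  · simp only [dC_c, map_add, Bialgebra.comul_mul, hf, comul_L_c]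
    generalize comul (R := k) f = T
    induction T using TensorProduct.induction_on with
    | zero => simp
    | add a b ha hb => simp only [map_add, mul_add, ← ha, ← hb]; abel
    | tmul a b => simp [add_mul, dC_c, dC_h, pow_two, mul_assoc, TensorProduct.add_tmul]; abel
  · simp only [dC_h, map_neg, Bialgebra.comul_mul, hf, comul_L_h]
    generalize comul (R := k) f = T
    induction T using TensorProduct.induction_on with
    | zero => simp
    | add a b ha hb => simp only [map_add, mul_add, ← ha, ← hb]; abel
    | tmul a b => simp [dC_h, TensorProduct.neg_tmul]
  · simp only [dC_hInv, map_neg, Bialgebra.comul_mul, hf, comul_L_hInv]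
    generalize comul (R := k) f = T
    induction T using TensorProduct.induction_on with
    | zero => simp
    | add a b ha hb => simp only [map_add, mul_add, ← ha, ← hb]; abel
    | tmul a b => simp [dC_hInv, TensorProduct.neg_tmul]

theorem comul_dB : comul ∘ₗ dB k = TensorProduct.map (dB k) LinearMap.id ∘ₗ comul (R := k) := by
  refine linearMap_ext_left (by simp [dB_one, Algebra.TensorProduct.one_def]) fun x f hf => ?_
  simp only [LinearMap.comp_apply, Bialgebra.comul_mul] at hf ⊢
  cases x
  · simp only [dB_b, map_add, Bialgebra.comul_mul, hf, comul_L_b]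
    generalize comul (R := k) f = T
    induction T using TensorProduct.induction_on with
    | zero => simp
    | add a b ha hb => simp only [map_add, mul_add, ← ha, ← hb]; abel
    | tmul a b => simp [add_mul, dB_b, dB_h, pow_two, mul_assoc, TensorProduct.add_tmul]; abel
  · simp only [dB_c, Bialgebra.comul_mul, hf, comul_L_c]
    generalize comul (R := k) f = T
    induction T using TensorProduct.induction_on with
    | zero => simp
    | add a b ha hb => simp only [map_add, mul_add, ha, hb]
    | tmul a b => simp [add_mul, dB_c, dB_h, pow_two, mul_assoc]
  · simp only [dB_h, map_neg, Bialgebra.comul_mul, hf, comul_L_h]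
    generalize comul (R := k) f = T
    induction T using TensorProduct.induction_on with
    | zero => simp
    | add a b ha hb => simp only [map_add, mul_add, ← ha, ← hb]; abel
    | tmul a b => simp [dB_h, TensorProduct.neg_tmul]
  · simp only [dB_hInv, map_neg, Bialgebra.comul_mul, hf, comul_L_hInv]
    generalize comul (R := k) f = T
    induction T using TensorProduct.induction_on with
    | zero => simp
    | add a b ha hb => simp only [map_add, mul_add, ← ha, ← hb]; abel
    | tmul a b => simp [dB_hInv, TensorProduct.neg_tmul]


/-- Agreement propagates because left multiplication by `Δ(x)` enters `P` and `Q` in the same way: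
through a common inhomogeneous term `M` and a common operator `N` applied to the previous value. -/
theorem balance_of_generators {P Q : H k ⊗[k] H k →ₗ[k] H k ⊗[k] H k} (h1 : P (1 ⊗ₜ 1) = Q (1 ⊗ₜ 1))
    (hx : ∀ x, ∃ M N : H k ⊗[k] H k →ₗ[k] H k ⊗[k] H k,
      (∀ a b, P (comul (R := k) (gen (LRel k 0) x) * a ⊗ₜ b) = M (a ⊗ₜ b) + N (P (a ⊗ₜ b))) ∧
      ∀ a b, Q (comul (R := k) (gen (LRel k 0) x) * a ⊗ₜ b) = M (a ⊗ₜ b) + N (Q (a ⊗ₜ b))) :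
    P ∘ₗ comul = Q ∘ₗ comul := by
  refine linearMap_ext_left (by simpa [Algebra.TensorProduct.one_def] using h1) fun x f hf => ?_
  obtain ⟨M, N, hP, hQ⟩ := hx x
  have aux : ∀ P : H k ⊗[k] H k →ₗ[k] H k ⊗[k] H k,
      (∀ a b, P (comul (R := k) (gen (LRel k 0) x) * a ⊗ₜ b) = M (a ⊗ₜ b) + N (P (a ⊗ₜ b))) →
      ∀ T, P (comul (R := k) (gen (LRel k 0) x) * T) = M T + N (P T) := fun P h T => by
    induction T using TensorProduct.induction_on with
    | zero => simp
    | add a b ha hb => simp only [map_add, mul_add, ha, hb]; abel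
    | tmul a b => exact h a b
  simp only [LinearMap.comp_apply, Bialgebra.comul_mul] at hf ⊢
  rw [aux P hP, aux Q hQ, hf]

/-- The coproduct balances a skew derivation on the right leg with `h²` times it on the left leg. -/
theorem balance_skew {d : H k →ₗ[k] H k} {eb ec : k} (d1 : d 1 = 0)
    (hb : ∀ f, d (gen (LRel k 0) .b * f) = eb • f + gen (LRel k 0) .b * d f)
    (hc : ∀ f, d (gen (LRel k 0) .c * f) = ec • f + gen (LRel k 0) .c * d f)
    (hh : ∀ f, d (gen (LRel k 0) .h * f) = -(gen (LRel k 0) .h * d f))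
    (hi : ∀ f, d (gen (LRel k 0) .hInv * f) = -(gen (LRel k 0) .hInv * d f)) :
    (LinearMap.mulLeft k (gen (LRel k 0) .h ^ 2) ∘ₗ d).rTensor (H k) ∘ₗ comul =
      d.lTensor (H k) ∘ₗ comul (R := k) := by
  refine balance_of_generators (by simp [d1]) fun x => ?_
  cases x
  · refine ⟨eb • LinearMap.rTensor _ (LinearMap.mulLeft k (gen (LRel k 0) .h ^ 2)),
      LinearMap.mulLeft k (comul (R := k) (gen (LRel k 0) .b)), fun a b => ?_, fun a b => ?_⟩
    · simp [add_mul, mul_add, hb, hh, pow_two, mul_assoc, L_h_b, assoc_rule L_h_b,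
        TensorProduct.add_tmul, TensorProduct.smul_tmul', add_assoc]
    · simp [add_mul, hb, TensorProduct.tmul_add]; abel
  · refine ⟨ec • LinearMap.rTensor _ (LinearMap.mulLeft k (gen (LRel k 0) .h ^ 2)),
      LinearMap.mulLeft k (comul (R := k) (gen (LRel k 0) .c)), fun a b => ?_, fun a b => ?_⟩
    · simp [add_mul, mul_add, hc, hh, pow_two, mul_assoc, L_h_c, assoc_rule L_h_c,
        TensorProduct.add_tmul, TensorProduct.smul_tmul', add_assoc]
    · simp [add_mul, hc, TensorProduct.tmul_add]; abel
  · exact ⟨0, -LinearMap.mulLeft k (comul (R := k) (gen (LRel k 0) .h)),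
      fun a b => by simp [hh, pow_two, mul_assoc, TensorProduct.neg_tmul],
      fun a b => by simp [hh, TensorProduct.tmul_neg]⟩
  · exact ⟨0, -LinearMap.mulLeft k (comul (R := k) (gen (LRel k 0) .hInv)),
      fun a b => by simp [hi, pow_two, mul_assoc, L_h_hInv, L_hInv_h, assoc_rule L_h_hInv,
        assoc_rule L_hInv_h, TensorProduct.neg_tmul],
      fun a b => by simp [hi, TensorProduct.tmul_neg]⟩

theorem balance_dC : (LinearMap.mulLeft k (gen (LRel k 0) .h ^ 2) ∘ₗ dC k).rTensor (H k) ∘ₗ comul =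
    (dC k).lTensor (H k) ∘ₗ comul (R := k) :=
  balance_skew (eb := 0) (ec := 1) dC_one (by simp [dC_b]) (by simp [dC_c]) dC_h dC_hInv

theorem balance_dB : (LinearMap.mulLeft k (gen (LRel k 0) .h ^ 2) ∘ₗ dB k).rTensor (H k) ∘ₗ comul =
    (dB k).lTensor (H k) ∘ₗ comul (R := k) :=
  balance_skew (eb := 1) (ec := 0) dB_one (by simp [dB_b]) (by simp [dB_c]) dB_h dB_hInv

/-- Both sides are algebra maps composed with `Δ`, so generators suffice: `sg` fixes `b`, `c` and
`h²`, and the sign of `h ⊗ h` may be taken from either leg. -/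
theorem balance_sg : (sg k).toLinearMap.rTensor (H k) ∘ₗ comul =
    (sg k).toLinearMap.lTensor (H k) ∘ₗ comul (R := k) := by
  have e : ∀ x, Algebra.TensorProduct.map (sg k) (AlgHom.id k (H k)) (comul (R := k) (gen (LRel k 0) x)) =
      Algebra.TensorProduct.map (AlgHom.id k (H k)) (sg k) (comul (R := k) (gen (LRel k 0) x)) := by
    rintro (_ | _ | _ | _) <;> simp [TensorProduct.neg_tmul, TensorProduct.tmul_neg]
  have : (Algebra.TensorProduct.map (sg k) (AlgHom.id k (H k))).comp (Bialgebra.comulAlgHom k (H k)) =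
      (Algebra.TensorProduct.map (AlgHom.id k (H k)) (sg k)).comp (Bialgebra.comulAlgHom k (H k)) :=
    pres_ext e
  exact congrArg AlgHom.toLinearMap this

theorem comul_sg : comul ∘ₗ (sg k).toLinearMap =
    TensorProduct.map (sg k).toLinearMap LinearMap.id ∘ₗ comul (R := k) := by
  have : (Bialgebra.comulAlgHom k (H k)).comp (sg k) =
      (Algebra.TensorProduct.map (sg k) (AlgHom.id k (H k))).comp (Bialgebra.comulAlgHom k (H k)) := by
    apply pres_ext
    rintro (_ | _ | _ | _) <;> simp [TensorProduct.neg_tmul, TensorProduct.tmul_neg]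
  exact congrArg AlgHom.toLinearMap this

theorem comul_mulLeft_b : comul ∘ₗ LinearMap.mulLeft k (gen (LRel k 0) .b) =
    TensorProduct.map (LinearMap.mulLeft k (gen (LRel k 0) .b)) LinearMap.id ∘ₗ comul +
    TensorProduct.map (LinearMap.mulLeft k (gen (LRel k 0) .h ^ 2))
      (LinearMap.mulLeft k (gen (LRel k 0) .b)) ∘ₗ comul (R := k) := by
  ext f
  simp only [LinearMap.comp_apply, LinearMap.mulLeft_apply, Bialgebra.comul_mul, LinearMap.add_apply,
    comul_L_b]
  induction comul (R := k) f using TensorProduct.induction_on with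
  | zero => simp
  | add a b ha hb => simp only [map_add, mul_add, ha, hb]; abel
  | tmul a b => simp [add_mul]

theorem comul_mulLeft_c : comul ∘ₗ LinearMap.mulLeft k (gen (LRel k 0) .c) =
    TensorProduct.map (LinearMap.mulLeft k (gen (LRel k 0) .c)) LinearMap.id ∘ₗ comul +
    TensorProduct.map (LinearMap.mulLeft k (gen (LRel k 0) .h ^ 2))
      (LinearMap.mulLeft k (gen (LRel k 0) .c)) ∘ₗ comul (R := k) := by
  ext f
  simp only [LinearMap.comp_apply, LinearMap.mulLeft_apply, Bialgebra.comul_mul, LinearMap.add_apply,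
    comul_L_c]
  induction comul (R := k) f using TensorProduct.induction_on with
  | zero => simp
  | add a b ha hb => simp only [map_add, mul_add, ha, hb]; abel
  | tmul a b => simp [add_mul]

theorem comul_mulLeft_grouplike {u : H k} (hu : comul (R := k) u = u ⊗ₜ u) :
    comul ∘ₗ LinearMap.mulLeft k u =
      TensorProduct.map (LinearMap.mulLeft k u) (LinearMap.mulLeft k u) ∘ₗ comul (R := k) := by
  ext f
  simp only [LinearMap.comp_apply, LinearMap.mulLeft_apply, Bialgebra.comul_mul, hu]
  induction comul (R := k) f using TensorProduct.induction_on with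
  | zero => simp
  | add a b ha hb => simp only [map_add, mul_add, ha, hb]
  | tmul a b => simp

end CoproductH

/-! ### Weyl ordering -/

section Weyl
variable {k : Type u} [Field k]

/-- `b`, `c` and a unit `h` satisfy `hb = -bh`, `hc = -ch` and `bc - cb = 2(s - t h⁴)`. -/
structure IsWeyl {R : Type*} [Ring R] [Algebra k R] (s t : k) (b c : R) (h : Rˣ) : Prop where
  h_b : (h : R) * b = -(b * h)
  h_c : (h : R) * c = -(c * h)
  b_c : b * c = c * b + (2 : k) • (s • 1 - t • (h : R) ^ 4)

/-- The symmetrized product of `r` factors `b` and `n` factors `c`, when `bc - cb = 2z` is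
central. -/
def weyl {R : Type*} [Ring R] (b c z : R) : ℕ → ℕ → R
  | 0, n => c ^ n
  | r + 1, n => b * weyl b c z r n - n • (z * weyl b c z r (n - 1))

/-- The linear map on `H` that sends `bʳ cˢ h^p` to the symmetrized product of `b`s and `c`s times
`h^p`. -/
def sym {R : Type*} [Ring R] [Algebra k R] (s t : k) (b c : R) (h : Rˣ) : H k →ₗ[k] R :=
  (basisH k).constr k fun i =>
    weyl b c (s • 1 - t • (h : R) ^ 4) i.1 i.2.1 * ((h ^ i.2.2 : Rˣ) : R)

variable {R : Type*} [Ring R] [Algebra k R] {s t : k} {b c : R} {h : Rˣ}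

theorem sym_monH (r n : ℕ) (p : ℤ) : sym s t b c h (monH k (r, n, p)) =
    weyl b c (s • 1 - t • (h : R) ^ 4) r n * ((h ^ p : Rˣ) : R) := by
  have := (basisH k).constr_basis k (fun i => weyl b c (s • 1 - t • (h : R) ^ 4) i.1 i.2.1 *
    ((h ^ i.2.2 : Rˣ) : R)) (r, n, p)
  rwa [basisH_apply] at this

theorem sym_one : sym s t b c h (1 : H k) = 1 := by
  rw [← monH_zero, sym_monH]; simp [weyl]

/-- The defining recursion of `weyl` read as an identity of linear maps: the term `n · z · weyl r (n
- 1)` is `z` times the image of `∂_c (bʳcⁿ)`. -/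
theorem sym_b (f : H k) : sym s t b c h (gen (LRel k 0) .b * f) =
    b * sym s t b c h f - (s • 1 - t • (h : R) ^ 4) * sym s t b c h (dC k f) := by
  refine LinearMap.congr_fun (f := sym s t b c h ∘ₗ LinearMap.mulLeft k (gen (LRel k 0) .b))
    (g := LinearMap.mulLeft k b ∘ₗ sym s t b c h -
      LinearMap.mulLeft k (s • 1 - t • (h : R) ^ 4) ∘ₗ sym s t b c h ∘ₗ dC k)
    (H_ext fun r n p => ?_) f
  simp only [LinearMap.comp_apply, LinearMap.mulLeft_apply, LinearMap.sub_apply, b_mul_monH,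
    sym_monH, dC_monH, map_smul, weyl]
  generalize s • (1 : R) - t • (h : R) ^ 4 = z
  rw [sub_mul, mul_assoc, smul_mul_assoc, mul_assoc, Nat.cast_smul_eq_nsmul]

theorem IsWeyl.hInv_b (W : IsWeyl s t b c h) :
    ((h⁻¹ : Rˣ) : R) * b = -(b * ((h⁻¹ : Rˣ) : R)) :=
  neg_comm_inv h.mul_inv h.inv_mul W.h_b

theorem IsWeyl.hInv_c (W : IsWeyl s t b c h) :
    ((h⁻¹ : Rˣ) : R) * c = -(c * ((h⁻¹ : Rˣ) : R)) :=
  neg_comm_inv h.mul_inv h.inv_mul W.h_c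

theorem pow_four_comm_of_neg {x y : R} (e : x * y = -(y * x)) : x ^ 4 * y = y * x ^ 4 := by
  have e2 : x ^ 2 * y = y * x ^ 2 := by
    rw [pow_two, mul_assoc, e, mul_neg, ← mul_assoc, e]; simp [mul_assoc]
  rw [show (4 : ℕ) = 2 + 2 from rfl, pow_add, mul_assoc, e2, ← mul_assoc, e2, mul_assoc]

theorem IsWeyl.z_b (W : IsWeyl s t b c h) :
    (s • 1 - t • (h : R) ^ 4) * b = b * (s • 1 - t • (h : R) ^ 4) := by
  simp [sub_mul, mul_sub, pow_four_comm_of_neg W.h_b]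

theorem IsWeyl.z_c (W : IsWeyl s t b c h) :
    (s • 1 - t • (h : R) ^ 4) * c = c * (s • 1 - t • (h : R) ^ 4) := by
  simp [sub_mul, mul_sub, pow_four_comm_of_neg W.h_c]

theorem z_h : (s • 1 - t • (h : R) ^ 4) * h = h * (s • 1 - t • (h : R) ^ 4) := by
  simp [sub_mul, mul_sub, ← pow_succ, ← pow_succ']

theorem z_hInv : (s • 1 - t • (h : R) ^ 4) * ((h⁻¹ : Rˣ) : R) =
    ((h⁻¹ : Rˣ) : R) * (s • 1 - t • (h : R) ^ 4) := by
  have : (h : R) ^ 4 * ((h⁻¹ : Rˣ) : R) = ((h⁻¹ : Rˣ) : R) * (h : R) ^ 4 := by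
    simp [pow_succ', mul_assoc]
  simp [sub_mul, mul_sub, this]

/-- Although `weyl` is defined by peeling off factors `b`, peeling off `c` obeys the mirror
recursion with `-z` in place of `z`. In the inductive step the coefficient of `z · weyl r n` is `n +
1` from restoring the recursion, `-2` from the commutator and `-n` from the recursion for `c`, in
total `-1`. -/
theorem weyl_c {z : R} (hzb : z * b = b * z) (hzc : z * c = c * z)
    (hbc : b * c = c * b + (2 : ℕ) • z) (r n : ℕ) :
    c * weyl b c z r n = weyl b c z r (n + 1) - r • (z * weyl b c z (r - 1) n) := by
  induction r generalizing n with
  | zero => simp [weyl, pow_succ']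
  | succ r ih =>
    have e1 : c * (b * weyl b c z r n) = b * (c * weyl b c z r n) - (2 : ℕ) • (z * weyl b c z r n) := by
      rw [← mul_assoc, ← mul_assoc, hbc]; simp [add_mul, two_mul, add_sub_cancel_right]
    have e2 : ∀ w, c * (z * w) = z * (c * w) := fun w => by rw [← mul_assoc, ← hzc, mul_assoc]
    have e3 : ∀ w, b * (z * w) = z * (b * w) := fun w => by rw [← mul_assoc, ← hzb, mul_assoc]
    have e4 : n • (z * (c * weyl b c z r (n - 1))) =
        n • (z * weyl b c z r n) - n • (z * r • (z * weyl b c z (r - 1) (n - 1))) := by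
      cases n with
      | zero => simp
      | succ n => rw [ih]; simp [mul_sub, smul_sub]
    have e5 : r • (z * weyl b c z r n) = r • (z * (b * weyl b c z (r - 1) n)) -
        r • (z * n • (z * weyl b c z (r - 1) (n - 1))) := by
      cases r with
      | zero => simp
      | succ r => simp [weyl, mul_sub, smul_sub]
    have e6 : r • (z * n • (z * weyl b c z (r - 1) (n - 1))) =
        n • (z * r • (z * weyl b c z (r - 1) (n - 1))) := by
      simp only [mul_smul_comm, smul_smul, mul_comm]
    simp only [weyl, mul_sub, mul_smul_comm, e1, e2, e4, ih n, e3, add_tsub_cancel_right]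
    simp only [mul_smul_comm] at e4 e5 e6
    rw [e6] at e5
    simp only [add_smul, e5, one_smul, two_smul, mul_smul_comm]
    abel

/-- Symmetrized products are homogeneous: `u` anticommutes with `b` and `c` and commutes with `z`,
so the correction, which has two factors fewer, picks up the same sign. The unit `u` stands for `h`
or `h⁻¹`. -/
theorem weyl_h (W : IsWeyl s t b c h) (u : Rˣ) (hb : (u : R) * b = -(b * u))
    (hc : (u : R) * c = -(c * u)) (hz : (s • 1 - t • (h : R) ^ 4) * u =
      u * (s • 1 - t • (h : R) ^ 4)) (r n : ℕ) :
    (u : R) * weyl b c (s • 1 - t • (h : R) ^ 4) r n =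
      (-1 : k) ^ (r + n) • (weyl b c (s • 1 - t • (h : R) ^ 4) r n * u) := by
  generalize s • (1 : R) - t • (h : R) ^ 4 = z at *
  induction r generalizing n with
  | zero => simpa [weyl] using neg_one_comm_pow k hc n
  | succ r ih =>
    rw [weyl, mul_sub, ← mul_assoc, hb, neg_mul, mul_assoc, ih, mul_smul_comm, mul_smul_comm,
      ← mul_assoc _ z, ← hz, mul_assoc z, ih]
    cases n with
    | zero => simp [pow_succ, mul_assoc]
    | succ n =>
      simp [sub_mul, smul_sub, mul_assoc, add_right_comm r 1 n, ← add_assoc, pow_succ]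

theorem IsWeyl.sym_c (W : IsWeyl s t b c h) (f : H k) : sym s t b c h (gen (LRel k 0) .c * f) =
    c * sym s t b c h f + (s • 1 - t • (h : R) ^ 4) * sym s t b c h (dB k f) := by
  refine LinearMap.congr_fun (f := sym s t b c h ∘ₗ LinearMap.mulLeft k (gen (LRel k 0) .c))
    (g := LinearMap.mulLeft k c ∘ₗ sym s t b c h +
      LinearMap.mulLeft k (s • 1 - t • (h : R) ^ 4) ∘ₗ sym s t b c h ∘ₗ dB k)
    (H_ext fun r n p => ?_) f
  simp only [LinearMap.comp_apply, LinearMap.mulLeft_apply, LinearMap.add_apply, c_mul_monH,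
    sym_monH, dB_monH, map_smul]
  have h1 := W.z_b
  have h2 := W.z_c
  have h3 := W.b_c
  generalize s • (1 : R) - t • (h : R) ^ 4 = z at *
  rw [ofNat_smul_eq_nsmul] at h3
  rw [← mul_assoc c, weyl_c h1 h2 h3, sub_mul, smul_mul_assoc, mul_assoc, Nat.cast_smul_eq_nsmul]
  abel

theorem IsWeyl.sym_h (W : IsWeyl s t b c h) (f : H k) : sym s t b c h (gen (LRel k 0) .h * f) =
    h * sym s t b c h f := by
  refine LinearMap.congr_fun (f := sym s t b c h ∘ₗ LinearMap.mulLeft k (gen (LRel k 0) .h))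
    (g := LinearMap.mulLeft k (h : R) ∘ₗ sym s t b c h) (H_ext fun r n p => ?_) f
  simp only [LinearMap.comp_apply, LinearMap.mulLeft_apply, h_mul_monH, sym_monH, map_smul]
  rw [← mul_assoc, weyl_h W h W.h_b W.h_c z_h, smul_mul_assoc, mul_assoc, ← Units.val_mul,
    ← zpow_one_add, add_comm 1 p]

theorem IsWeyl.sym_hInv (W : IsWeyl s t b c h) (f : H k) :
    sym s t b c h (gen (LRel k 0) .hInv * f) = ((h⁻¹ : Rˣ) : R) * sym s t b c h f := by
  refine LinearMap.congr_fun (f := sym s t b c h ∘ₗ LinearMap.mulLeft k (gen (LRel k 0) .hInv))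
    (g := LinearMap.mulLeft k ((h⁻¹ : Rˣ) : R) ∘ₗ sym s t b c h) (H_ext fun r n p => ?_) f
  simp only [LinearMap.comp_apply, LinearMap.mulLeft_apply, hInv_mul_monH, sym_monH, map_smul]
  rw [← mul_assoc, weyl_h W h⁻¹ W.hInv_b W.hInv_c z_hInv, smul_mul_assoc, mul_assoc,
    ← Units.val_mul, ← zpow_neg_one, ← zpow_add, neg_add_eq_sub]

theorem IsWeyl.sym_gen_b (W : IsWeyl s t b c h) : sym s t b c h (gen (LRel k 0) .b) = b := by
  rw [← mul_one (gen (LRel k 0) LGen.b), sym_b]; simp [sym_one, dC_one]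

theorem IsWeyl.sym_gen_c (W : IsWeyl s t b c h) : sym s t b c h (gen (LRel k 0) .c) = c := by
  rw [← mul_one (gen (LRel k 0) LGen.c), W.sym_c]; simp [sym_one, dB_one]

theorem IsWeyl.sym_gen_h (W : IsWeyl s t b c h) : sym s t b c h (gen (LRel k 0) .h) = h := by
  rw [← mul_one (gen (LRel k 0) LGen.h), W.sym_h]; simp [sym_one]

theorem IsWeyl.sym_gen_hInv (W : IsWeyl s t b c h) :
    sym s t b c h (gen (LRel k 0) .hInv) = ((h⁻¹ : Rˣ) : R) := by
  rw [← mul_one (gen (LRel k 0) LGen.hInv), W.sym_hInv]; simp [sym_one]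

/-- An algebra map of the shape of a coaction corresponds to the comultiplication of `H` under the
symmetrization maps. -/
theorem sym_coaction {R' R'' : Type*} [Ring R'] [Algebra k R'] [Ring R''] [Algebra k R'']
    {s' t' s'' t'' : k} {b' c' : R'} {h' : R'ˣ} {b'' c'' : R''} {h'' : R''ˣ}
    (W : IsWeyl s t b c h) (W' : IsWeyl s' t' b' c' h') (W'' : IsWeyl s'' t'' b'' c'' h'')
    (hs : s' = s) (ht : t'' = t) (hst : t' = s'')
    (ρ : R →ₐ[k] R' ⊗[k] R'') (ρb : ρ b = b' ⊗ₜ 1 + ((h' : R') ^ 2) ⊗ₜ b'')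
    (ρc : ρ c = c' ⊗ₜ 1 + ((h' : R') ^ 2) ⊗ₜ c'') (ρh : ρ h = (h' : R') ⊗ₜ (h'' : R''))
    (ρi : ρ ((h⁻¹ : Rˣ) : R) = ((h'⁻¹ : R'ˣ) : R') ⊗ₜ ((h''⁻¹ : R''ˣ) : R'')) (f : H k) :
    ρ (sym s t b c h f) =
      TensorProduct.map (sym s' t' b' c' h') (sym s'' t'' b'' c'' h'') (comul (R := k) f) := by
  -- The parameters compose like arrows, `(s, t)` being mapped to `(s, m) ⊗ (m, t)`, because `s - t
  -- h⁴ ⊗ h⁴ = (s - m h⁴) ⊗ 1 + h⁴ ⊗ (m - t h⁴)`.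
  subst hs ht hst
  refine LinearMap.congr_fun (f := ρ.toLinearMap ∘ₗ sym s' t'' b c h)
    (g := TensorProduct.map (sym s' t' b' c' h') (sym t' t'' b'' c'' h'') ∘ₗ comul)
    (linearMap_ext_H ?_ ?_ ?_ ?_ ?_) f
  · simp [sym_one, Algebra.TensorProduct.one_def]
  · intro f hf
    simp only [LinearMap.comp_apply, AlgHom.toLinearMap_apply, W.sym_h, map_mul, ρh,
      Bialgebra.comul_mul, comul_L_h] at hf ⊢
    rw [hf]
    induction comul (R := k) f using TensorProduct.induction_on with
    | zero => simp
    | add x y hx hy => simp only [map_add, mul_add, hx, hy]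
    | tmul x y => simp [W'.sym_h, W''.sym_h]
  · intro f hf
    simp only [LinearMap.comp_apply, AlgHom.toLinearMap_apply, W.sym_hInv, map_mul, ρi,
      Bialgebra.comul_mul, comul_L_hInv] at hf ⊢
    rw [hf]
    induction comul (R := k) f using TensorProduct.induction_on with
    | zero => simp
    | add x y hx hy => simp only [map_add, mul_add, hx, hy]
    | tmul x y => simp [W'.sym_hInv, W''.sym_hInv]
  · intro f hf hd
    have h1 := LinearMap.congr_fun comul_dC f
    have h2 := LinearMap.congr_fun balance_dC f
    simp only [LinearMap.comp_apply, AlgHom.toLinearMap_apply, sym_b, map_mul, map_sub, map_smul,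
      map_one, map_pow, ρb, ρh, Bialgebra.comul_mul, comul_L_b] at hf hd h1 h2 ⊢
    rw [hf, hd, h1]
    -- For arbitrary `T` the two sides differ by a multiple of `(1 ⊗ ∂_c)T - (h²∂_c ⊗ 1)T`, and this
    -- defect vanishes for `T = Δ(f)` by `balance_dC`.
    have e : ∀ T : H k ⊗[k] H k,
      (b' ⊗ₜ 1 + ((h' : R') ^ 2) ⊗ₜ b'') * TensorProduct.map (sym s' t' b' c' h') (sym t' t'' b'' c'' h'') T
        - (s' • 1 - t'' • ((h' : R') ⊗ₜ[k] (h'' : R'')) ^ 4) *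
          TensorProduct.map (sym s' t' b' c' h') (sym t' t'' b'' c'' h'')
            (TensorProduct.map (dC k) LinearMap.id T) -
       TensorProduct.map (sym s' t' b' c' h') (sym t' t'' b'' c'' h'')
        ((gen (LRel k 0) LGen.b ⊗ₜ 1 + (gen (LRel k 0) LGen.h ^ 2) ⊗ₜ gen (LRel k 0) LGen.b) * T) =
       (((h' : R') ^ 2) ⊗ₜ[k] (t' • 1 - t'' • (h'' : R'') ^ 4)) *
        (TensorProduct.map (sym s' t' b' c' h') (sym t' t'' b'' c'' h'')
          (LinearMap.lTensor (H k) (dC k) T -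
           LinearMap.rTensor (H k) (LinearMap.mulLeft k (gen (LRel k 0) .h ^ 2) ∘ₗ dC k) T)) := by
      intro T
      induction T using TensorProduct.induction_on with
      | zero => simp
      | add x y hx hy =>
        simp only [map_add, mul_add, map_sub, mul_sub] at hx hy ⊢
        rw [add_sub_add_comm, add_sub_add_comm, hx, hy]; abel
      | tmul x y =>
        simp [add_mul, sym_b, W'.sym_h, pow_two, mul_assoc, sub_mul, mul_sub, TensorProduct.sub_tmul,
          TensorProduct.tmul_sub, TensorProduct.smul_tmul', pow_succ]
        abel
    rw [← sub_eq_zero, e, h2]; simp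
  · intro f hf hd
    have h1 := LinearMap.congr_fun comul_dB f
    have h2 := LinearMap.congr_fun balance_dB f
    simp only [LinearMap.comp_apply, AlgHom.toLinearMap_apply, W.sym_c, map_mul, map_add, map_sub, map_smul,
      map_one, map_pow, ρc, ρh, Bialgebra.comul_mul, comul_L_c] at hf hd h1 h2 ⊢
    rw [hf, hd, h1]
    have e : ∀ T : H k ⊗[k] H k,
      (c' ⊗ₜ 1 + ((h' : R') ^ 2) ⊗ₜ c'') * TensorProduct.map (sym s' t' b' c' h') (sym t' t'' b'' c'' h'') T
        + (s' • 1 - t'' • ((h' : R') ⊗ₜ[k] (h'' : R'')) ^ 4) *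
          TensorProduct.map (sym s' t' b' c' h') (sym t' t'' b'' c'' h'')
            (TensorProduct.map (dB k) LinearMap.id T) -
       TensorProduct.map (sym s' t' b' c' h') (sym t' t'' b'' c'' h'')
        ((gen (LRel k 0) LGen.c ⊗ₜ 1 + (gen (LRel k 0) LGen.h ^ 2) ⊗ₜ gen (LRel k 0) LGen.c) * T) =
       (((h' : R') ^ 2) ⊗ₜ[k] (t' • 1 - t'' • (h'' : R'') ^ 4)) *
        (TensorProduct.map (sym s' t' b' c' h') (sym t' t'' b'' c'' h'')
          (LinearMap.rTensor (H k) (LinearMap.mulLeft k (gen (LRel k 0) .h ^ 2) ∘ₗ dB k) T -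
           LinearMap.lTensor (H k) (dB k) T)) := by
      intro T
      induction T using TensorProduct.induction_on with
      | zero => simp
      | add x y hx hy =>
        simp only [map_add, mul_add, map_sub, mul_sub] at hx hy ⊢
        rw [add_add_add_comm, add_sub_add_comm, hx, hy]; abel
      | tmul x y =>
        simp [add_mul, W'.sym_c, W''.sym_c, TensorProduct.add_tmul, TensorProduct.tmul_add, W'.sym_h, pow_two, mul_assoc, sub_mul, mul_sub, TensorProduct.sub_tmul,
          TensorProduct.tmul_sub, TensorProduct.smul_tmul', pow_succ]
        abel
    rw [← sub_eq_zero, e, h2]; simp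
end Weyl

/-! ### Comultiplication of a tensor product of coalgebras -/

section ConvTensor
variable {k : Type u} [Field k] {C D : Type*} [AddCommGroup C] [Module k C] [Coalgebra k C]
  [AddCommGroup D] [Module k D] [Coalgebra k D]

theorem comul_comp_map_id_add {T T₁ T₂ T₃ T₄ : C →ₗ[k] C}
    (hT : comul ∘ₗ T = TensorProduct.map T₁ T₂ ∘ₗ comul + TensorProduct.map T₃ T₄ ∘ₗ comul) :
    comul ∘ₗ T.rTensor D =
      TensorProduct.map (T₁.rTensor D) (T₂.rTensor D) ∘ₗ comul +
      TensorProduct.map (T₃.rTensor D) (T₄.rTensor D) ∘ₗ comul := by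
  apply TensorProduct.ext'
  intro x y
  have h1 := LinearMap.congr_fun hT x
  simp only [LinearMap.comp_apply, LinearMap.add_apply] at h1
  simp only [LinearMap.comp_apply, LinearMap.rTensor_tmul, TensorProduct.comul_tmul, h1,
    LinearMap.add_apply]
  generalize comul (R := k) x = X
  generalize comul (R := k) y = Y
  induction X using TensorProduct.induction_on with
  | zero => simp
  | add a b ha hb => simp only [map_add, TensorProduct.add_tmul] at ha hb ⊢; rw [add_add_add_comm, ha, hb]; abel
  | tmul a b =>
    induction Y using TensorProduct.induction_on with
    | zero => simp
    | add p q hp hq => simp only [map_add, TensorProduct.tmul_add, hp, hq]; abel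
    | tmul p q => simp [TensorProduct.add_tmul]

theorem balance_map {T₁ T₂ : C →ₗ[k] C} {S₁ S₂ : D →ₗ[k] D}
    (hT : T₁.rTensor C ∘ₗ comul = T₂.lTensor C ∘ₗ comul)
    (hS : S₁.rTensor D ∘ₗ comul = S₂.lTensor D ∘ₗ comul) :
    (TensorProduct.map T₁ S₁).rTensor (C ⊗[k] D) ∘ₗ comul =
      (TensorProduct.map T₂ S₂).lTensor (C ⊗[k] D) ∘ₗ comul := by
  apply TensorProduct.ext'
  intro x y
  have h1 := LinearMap.congr_fun hT x
  have h2 := LinearMap.congr_fun hS y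
  simp only [LinearMap.comp_apply] at h1 h2
  simp only [LinearMap.comp_apply, TensorProduct.comul_tmul]
  have e1 : ∀ X Y, (TensorProduct.map T₁ S₁).rTensor (C ⊗[k] D)
      (TensorProduct.AlgebraTensorModule.tensorTensorTensorComm k k k k C C D D (X ⊗ₜ Y)) =
      TensorProduct.AlgebraTensorModule.tensorTensorTensorComm k k k k C C D D
        (T₁.rTensor C X ⊗ₜ S₁.rTensor D Y) := by
    intro X Y
    induction X using TensorProduct.induction_on with
    | zero => simp
    | add a b ha hb => simp only [map_add, TensorProduct.add_tmul, ha, hb]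
    | tmul a b =>
      induction Y using TensorProduct.induction_on with
      | zero => simp
      | add p q hp hq => simp only [map_add, TensorProduct.tmul_add, hp, hq]
      | tmul p q => simp
  have e2 : ∀ X Y, (TensorProduct.map T₂ S₂).lTensor (C ⊗[k] D)
      (TensorProduct.AlgebraTensorModule.tensorTensorTensorComm k k k k C C D D (X ⊗ₜ Y)) =
      TensorProduct.AlgebraTensorModule.tensorTensorTensorComm k k k k C C D D
        (T₂.lTensor C X ⊗ₜ S₂.lTensor D Y) := by
    intro X Y
    induction X using TensorProduct.induction_on with
    | zero => simp
    | add a b ha hb => simp only [map_add, TensorProduct.add_tmul, ha, hb]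
    | tmul a b =>
      induction Y using TensorProduct.induction_on with
      | zero => simp
      | add p q hp hq => simp only [map_add, TensorProduct.tmul_add, hp, hq]
      | tmul p q => simp
  rw [e1, e2, h1, h2]

theorem balance_id : (LinearMap.id (R := k) (M := C)).rTensor C ∘ₗ comul =
    (LinearMap.id (R := k) (M := C)).lTensor C ∘ₗ comul (R := k) := by simp

theorem comul_comp_mk_right {u : D} (hu : comul (R := k) u = u ⊗ₜ u) :
    comul ∘ₗ (TensorProduct.mk k C D).flip u =
      TensorProduct.map ((TensorProduct.mk k C D).flip u) ((TensorProduct.mk k C D).flip u) ∘ₗ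
        comul (R := k) := by
  ext x
  simp only [LinearMap.comp_apply, LinearMap.flip_apply, TensorProduct.mk_apply,
    TensorProduct.comul_tmul, hu]
  induction comul (R := k) x using TensorProduct.induction_on with
  | zero => simp
  | add a b ha hb => simp only [map_add, TensorProduct.add_tmul, ha, hb]
  | tmul a b => simp

theorem comul_comp_mk_left {u : C} (hu : comul (R := k) u = u ⊗ₜ u) :
    comul ∘ₗ TensorProduct.mk k C D u =
      TensorProduct.map (TensorProduct.mk k C D u) (TensorProduct.mk k C D u) ∘ₗ
        comul (R := k) := by
  ext x
  simp only [LinearMap.comp_apply, TensorProduct.mk_apply,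
    TensorProduct.comul_tmul, hu]
  induction comul (R := k) x using TensorProduct.induction_on with
  | zero => simp
  | add a b ha hb => simp only [map_add, TensorProduct.tmul_add, ha, hb]
  | tmul a b => simp

end ConvTensor

/-! ### The cocycle `σ_α` and the product of `H_α` -/

section Sigma
variable {k : Type u} [Field k]

theorem sg_monH (r s : ℕ) (p : ℤ) :
    sg k (monH k (r, s, p)) = (((-1) ^ p : kˣ) : k) • monH k (r, s, p) := by
  induction r with
  | zero =>
    induction s with
    | zero =>
      induction p using Int.induction_on with
      | zero => simp [monH_zero]
      | succ p ih =>
        have e : monH k (0, 0, (p : ℤ) + 1) = gen (LRel k 0) .h * monH k (0, 0, (p : ℤ)) := by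
          simp [h_mul_monH]
        rw [e, map_mul, ih, sg_h, zpow_add]
        simp
      | pred p ih =>
        have e : monH k (0, 0, -(p : ℤ) - 1) = gen (LRel k 0) .hInv * monH k (0, 0, -(p : ℤ)) := by
          simp [hInv_mul_monH]
        rw [e, map_mul, ih, sg_hInv, zpow_sub]
        simp
    | succ s ih => rw [← c_mul_monH, map_mul, ih, sg_c, mul_smul_comm]
  | succ r ih => rw [← b_mul_monH, map_mul, ih, sg_b, mul_smul_comm]

theorem sigma_mon (α : k) (n m : ℕ) (p : ℤ) (r s : ℕ) (q : ℤ) :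
    sigma α (monH k (n, m, p) ⊗ₜ monH k (r, s, q)) = if n = s ∧ m = r then
      (-1) ^ m * ((((-1) ^ p : kˣ) : k) ^ (n + m)) * (n.factorial : k) * (m.factorial : k) *
        (α / 2) ^ (n + m) else 0 := by
  have := ((basisH k).tensorProduct (basisH k)).constr_basis k
    (fun i : (ℕ × ℕ × ℤ) × ℕ × ℕ × ℤ => if i.1.1 = i.2.2.1 ∧ i.1.2.1 = i.2.1 then
      (-1) ^ i.1.2.1 * (((-1) ^ (i.1.2.2 * ((i.1.1 + i.1.2.1 : ℕ) : ℤ)) : kˣ) : k) *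
        (i.1.1.factorial : k) * (i.1.2.1.factorial : k) * (α / 2) ^ (i.1.1 + i.1.2.1)
    else 0) ((n, m, p), (r, s, q))
  rw [Module.Basis.tensorProduct_apply, basisH_apply, basisH_apply] at this
  rw [sigma, this]
  simp only [zpow_mul, zpow_natCast, Units.val_pow_eq_pow_val]

theorem HH_ext {M : Type*} [AddCommGroup M] [Module k M] {P Q : H k ⊗[k] H k →ₗ[k] M}
    (h : ∀ n m p r s q, P (monH k (n, m, p) ⊗ₜ monH k (r, s, q)) =
      Q (monH k (n, m, p) ⊗ₜ monH k (r, s, q))) : P = Q :=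
  ((basisH k).tensorProduct (basisH k)).ext fun i => by
    obtain ⟨⟨n, m, p⟩, r, s, q⟩ := i
    rw [Module.Basis.tensorProduct_apply, basisH_apply, basisH_apply]
    exact h n m p r s q

theorem tensor_ext_left {M N : Type*} [AddCommGroup M] [Module k M] [AddCommGroup N] [Module k N]
    {P Q : H k ⊗[k] M →ₗ[k] N} (h1 : ∀ y, P (1 ⊗ₜ y) = Q (1 ⊗ₜ y))
    (hx : ∀ x f, (∀ y, P (f ⊗ₜ y) = Q (f ⊗ₜ y)) → ∀ y, P ((gen (LRel k 0) x * f) ⊗ₜ y) =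
      Q ((gen (LRel k 0) x * f) ⊗ₜ y)) : P = Q := by
  have : TensorProduct.curry P = TensorProduct.curry Q :=
    linearMap_ext_left (LinearMap.ext h1) fun x f hf =>
      LinearMap.ext (hx x f fun y => LinearMap.congr_fun hf y)
  exact TensorProduct.ext' fun f y => LinearMap.congr_fun (LinearMap.congr_fun this f) y

/-- The factorials make multiplication by `b` in the first argument adjoint to `∂_c` in the second.
Together with the rules for `c` and `h^{±1}` this is a recursion that determines `σ_α` from its
values on `1 ⊗ y`. -/
theorem sigma_b (α : k) : sigma α ∘ₗ (LinearMap.mulLeft k (gen (LRel k 0) .b)).rTensor (H k) =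
    (α / 2) • sigma α ∘ₗ TensorProduct.map (sg k).toLinearMap (dC k) := by
  refine HH_ext fun n m p r s q => ?_
  simp only [LinearMap.comp_apply, LinearMap.rTensor_tmul, LinearMap.mulLeft_apply, b_mul_monH,
    LinearMap.smul_apply, TensorProduct.map_tmul, AlgHom.toLinearMap_apply, sg_monH, dC_monH,
    ← TensorProduct.smul_tmul', TensorProduct.tmul_smul, map_smul, sigma_mon]
  rcases s with _ | s
  · simp
  · by_cases h : n = s ∧ m = r
    · simp [h.1, h.2, Nat.factorial_succ]; ring
    · simp [h]

theorem sigma_c (α : k) : sigma α ∘ₗ (LinearMap.mulLeft k (gen (LRel k 0) .c)).rTensor (H k) =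
    (-(α / 2)) • sigma α ∘ₗ TensorProduct.map (sg k).toLinearMap (dB k) := by
  refine HH_ext fun n m p r s q => ?_
  simp only [LinearMap.comp_apply, LinearMap.rTensor_tmul, LinearMap.mulLeft_apply, c_mul_monH,
    LinearMap.smul_apply, TensorProduct.map_tmul, AlgHom.toLinearMap_apply, sg_monH, dB_monH,
    ← TensorProduct.smul_tmul', TensorProduct.tmul_smul, map_smul, sigma_mon]
  rcases r with _ | r
  · simp
  · by_cases h : n = s ∧ m = r
    · simp [h.1, h.2, Nat.factorial_succ]; ring
    · simp [h]

/-- The sign `(-1)^{p(n+m)}` in `σ_α` is chosen so that it absorbs the sign produced when `h` passes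
`n + m` factors `b` and `c`. -/
theorem sigma_h (α : k) : sigma α ∘ₗ (LinearMap.mulLeft k (gen (LRel k 0) .h)).rTensor (H k) =
    sigma α := by
  refine HH_ext fun n m p r s q => ?_
  simp only [LinearMap.comp_apply, LinearMap.rTensor_tmul, LinearMap.mulLeft_apply, h_mul_monH,
    ← TensorProduct.smul_tmul', map_smul, sigma_mon, zpow_add, zpow_one]
  split_ifs
  · simp only [Units.val_mul, Units.val_neg, Units.val_one, mul_pow, smul_eq_mul]
    have : ((-1 : k) ^ (n + m)) * (-1) ^ (n + m) = 1 := by rw [← mul_pow]; simp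
    linear_combination ((-1) ^ m * ((((-1) ^ p : kˣ) : k) ^ (n + m)) * (n.factorial : k) *
      (m.factorial : k) * (α / 2) ^ (n + m)) * this
  · simp

theorem sigma_hInv (α : k) :
    sigma α ∘ₗ (LinearMap.mulLeft k (gen (LRel k 0) .hInv)).rTensor (H k) = sigma α := by
  conv_lhs => rw [← sigma_h α]
  rw [LinearMap.comp_assoc, ← LinearMap.rTensor_comp]
  convert LinearMap.comp_id _ using 2
  ext x y
  simp [assoc_rule L_h_hInv]

theorem sigma_hsq (α : k) :
    sigma α ∘ₗ (LinearMap.mulLeft k (gen (LRel k 0) .h ^ 2)).rTensor (H k) = sigma α := by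
  conv_rhs => rw [← sigma_h α, ← sigma_h α]
  rw [LinearMap.comp_assoc, ← LinearMap.rTensor_comp, pow_two, LinearMap.mulLeft_mul]

theorem hsq_mul_monH (r s : ℕ) (p : ℤ) : gen (LRel k 0) .h ^ 2 * monH k (r, s, p) =
    monH k (r, s, p + 2) := by
  rw [pow_two, mul_assoc, h_mul_monH, mul_smul_comm, h_mul_monH, smul_smul, ← mul_pow]
  simp [add_assoc]

theorem sigma_hsq_right (α : k) :
    sigma α ∘ₗ (LinearMap.mulLeft k (gen (LRel k 0) .h ^ 2)).lTensor (H k) = sigma α := by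
  refine HH_ext fun n m p r s q => ?_
  simp only [LinearMap.comp_apply, LinearMap.lTensor_tmul, LinearMap.mulLeft_apply, hsq_mul_monH,
    sigma_mon]

theorem sigma_one (α : k) : sigma α ∘ₗ TensorProduct.mk k (H k) (H k) 1 = counit := by
  refine H_ext fun r s p => ?_
  have e : counit (R := k) (monH k (r, s, p)) = if r = 0 ∧ s = 0 then 1 else 0 := by
    have hu : ∀ p : ℤ, counit (R := k) ((hUnit k ^ p : (H k)ˣ) : H k) = 1 := by
      intro p
      have h1 : Units.map (Bialgebra.counitAlgHom k (H k) : H k →* k) (hUnit k) = 1 :=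
        Units.ext counit_L_h
      have h2 := congrArg (Units.val) (map_zpow (Units.map (Bialgebra.counitAlgHom k (H k) : H k →* k)) (hUnit k) p)
      rw [h1, one_zpow] at h2
      exact h2
    simp only [monH, Bialgebra.counit_mul, Bialgebra.counit_pow, counit_L_b, counit_L_c, hu]
    by_cases hr : r = 0 <;> by_cases hs : s = 0 <;> simp [hr, hs]
  rw [LinearMap.comp_apply, TensorProduct.mk_apply, ← monH_zero, sigma_mon, e]
  by_cases hr : r = 0 <;> by_cases hs : s = 0 <;> simp [hr, hs, eq_comm]

theorem sigma_zero : sigma (0 : k) = counit := by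
  refine tensor_ext_left (fun y => ?_) fun x f hf y => ?_
  · simpa using LinearMap.congr_fun (sigma_one (0 : k)) y
  · have hb := LinearMap.congr_fun (sigma_b (0 : k)) (f ⊗ₜ y)
    have hc := LinearMap.congr_fun (sigma_c (0 : k)) (f ⊗ₜ y)
    have hh := LinearMap.congr_fun (sigma_h (0 : k)) (f ⊗ₜ y)
    have hi := LinearMap.congr_fun (sigma_hInv (0 : k)) (f ⊗ₜ y)
    simp only [LinearMap.comp_apply, LinearMap.rTensor_tmul, LinearMap.mulLeft_apply, zero_div,
      zero_smul, neg_zero, LinearMap.zero_apply] at hb hc hh hi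
    cases x
    · rw [hb]; simp
    · rw [hc]; simp
    · rw [hh, hf]; simp
    · rw [hi, hf]; simp

theorem sigma_map_skew (α : k) (d : H k →ₗ[k] H k) :
    sigma α ∘ₗ TensorProduct.map (sg k).toLinearMap
      (LinearMap.mulLeft k (gen (LRel k 0) .h ^ 2) ∘ₗ d) =
    sigma α ∘ₗ TensorProduct.map (sg k).toLinearMap d := by
  conv_rhs => rw [← sigma_hsq_right α, LinearMap.comp_assoc, LinearMap.lTensor_comp_map]

/-- The map `sg` moves freely between the legs of the coproduct, and `d` moves at the price of a
factor `h²`, to which `σ_α` is insensitive in its second argument. -/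
theorem conv_sigma_skew {M : Type*} [AddCommGroup M] [Module k M] (α : k) {d : H k →ₗ[k] H k}
    (hd : (LinearMap.mulLeft k (gen (LRel k 0) .h ^ 2) ∘ₗ d).rTensor (H k) ∘ₗ comul =
      d.lTensor (H k) ∘ₗ comul (R := k))
    (φ : H k ⊗[k] H k →ₗ[k] M) :
    conv (sigma α) (φ ∘ₗ TensorProduct.map (sg k).toLinearMap d) =
      conv (sigma α ∘ₗ TensorProduct.map (sg k).toLinearMap d) φ := by
  have e := balance_map (C := H k) (D := H k) balance_sg hd
  have h := conv_balance e (sigma α) φ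
  rw [sigma_map_skew] at h
  exact h.symm

theorem comul_rTensor_b (M : Type*) [AddCommGroup M] [Module k M] [Coalgebra k M] :
    comul ∘ₗ (LinearMap.mulLeft k (gen (LRel k 0) .b)).rTensor M =
      TensorProduct.map ((LinearMap.mulLeft k (gen (LRel k 0) .b)).rTensor M)
        (LinearMap.id.rTensor M) ∘ₗ comul +
      TensorProduct.map ((LinearMap.mulLeft k (gen (LRel k 0) .h ^ 2)).rTensor M)
        ((LinearMap.mulLeft k (gen (LRel k 0) .b)).rTensor M) ∘ₗ comul (R := k) :=
  comul_comp_map_id_add (D := M) (comul_mulLeft_b (k := k))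

theorem comul_rTensor_c (M : Type*) [AddCommGroup M] [Module k M] [Coalgebra k M] :
    comul ∘ₗ (LinearMap.mulLeft k (gen (LRel k 0) .c)).rTensor M =
      TensorProduct.map ((LinearMap.mulLeft k (gen (LRel k 0) .c)).rTensor M)
        (LinearMap.id.rTensor M) ∘ₗ comul +
      TensorProduct.map ((LinearMap.mulLeft k (gen (LRel k 0) .h ^ 2)).rTensor M)
        ((LinearMap.mulLeft k (gen (LRel k 0) .c)).rTensor M) ∘ₗ comul (R := k) :=
  comul_comp_map_id_add (D := M) (comul_mulLeft_c (k := k))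

theorem comul_rTensor_h (M : Type*) [AddCommGroup M] [Module k M] [Coalgebra k M] :
    comul ∘ₗ (LinearMap.mulLeft k (gen (LRel k 0) .h)).rTensor M =
      TensorProduct.map ((LinearMap.mulLeft k (gen (LRel k 0) .h)).rTensor M)
        ((LinearMap.mulLeft k (gen (LRel k 0) .h)).rTensor M) ∘ₗ comul (R := k) :=
  comul_comp_map_id (D := M) (comul_mulLeft_grouplike (comul_L_h (k := k) (α := 0)))

theorem comul_rTensor_hInv (M : Type*) [AddCommGroup M] [Module k M] [Coalgebra k M] :
    comul ∘ₗ (LinearMap.mulLeft k (gen (LRel k 0) .hInv)).rTensor M =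
      TensorProduct.map ((LinearMap.mulLeft k (gen (LRel k 0) .hInv)).rTensor M)
        ((LinearMap.mulLeft k (gen (LRel k 0) .hInv)).rTensor M) ∘ₗ comul (R := k) :=
  comul_comp_map_id (D := M) (comul_mulLeft_grouplike (comul_L_hInv (k := k) (α := 0)))

/-- Recursion in the first argument. At `b` the two summands of `Δ(b)` contribute `α/2` and `-α/2`
times the same convolution, once the derivation is moved across by `conv_sigma_skew`; likewise at
`c`. Hence the convolution vanishes on multiples of `b` and `c`, as `ε` does. -/
theorem conv_sigma_neg (α : k) : conv (sigma α) (sigma (-α)) = counit := by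
  have hb : conv (sigma α) (sigma (-α)) ∘ₗ (LinearMap.mulLeft k (gen (LRel k 0) .b)).rTensor (H k) =
      0 := by
    have e := comul_rTensor_b (k := k) (H k)
    rw [conv_comp_add e, sigma_b, sigma_hsq, sigma_b, conv_smul_left,
      conv_smul_right, conv_sigma_skew α balance_dC, LinearMap.rTensor_id, LinearMap.comp_id,
      ← add_smul, neg_div, add_neg_cancel, zero_smul]
  have hc : conv (sigma α) (sigma (-α)) ∘ₗ (LinearMap.mulLeft k (gen (LRel k 0) .c)).rTensor (H k) =
      0 := by
    have e := comul_rTensor_c (k := k) (H k)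
    rw [conv_comp_add e, sigma_c, sigma_hsq, sigma_c, conv_smul_left,
      conv_smul_right, conv_sigma_skew α balance_dB, LinearMap.rTensor_id, LinearMap.comp_id,
      ← add_smul, neg_div, add_neg_cancel, zero_smul]
  have hh : conv (sigma α) (sigma (-α)) ∘ₗ (LinearMap.mulLeft k (gen (LRel k 0) .h)).rTensor (H k) =
      conv (sigma α) (sigma (-α)) := by
    have e := comul_rTensor_h (k := k) (H k)
    rw [conv_comp e, sigma_h, sigma_h]
  have hi : conv (sigma α) (sigma (-α)) ∘ₗ (LinearMap.mulLeft k (gen (LRel k 0) .hInv)).rTensor (H k) =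
      conv (sigma α) (sigma (-α)) := by
    have e := comul_rTensor_hInv (k := k) (H k)
    rw [conv_comp e, sigma_hInv, sigma_hInv]
  refine tensor_ext_left (fun y => ?_) fun x f hf y => ?_
  · have h1 : conv (sigma α) (sigma (-α)) ∘ₗ TensorProduct.mk k (H k) (H k) 1 = counit := by
      have e := comul_comp_mk_left (C := H k) (D := H k) (Bialgebra.comul_one (R := k))
      rw [conv_comp e, sigma_one, sigma_one, conv_counit_left]
    simpa using LinearMap.congr_fun h1 y
  · have hb := LinearMap.congr_fun hb (f ⊗ₜ y)
    have hc := LinearMap.congr_fun hc (f ⊗ₜ y)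
    have hh := LinearMap.congr_fun hh (f ⊗ₜ y)
    have hi := LinearMap.congr_fun hi (f ⊗ₜ y)
    simp only [LinearMap.comp_apply, LinearMap.rTensor_tmul, LinearMap.mulLeft_apply,
      LinearMap.zero_apply] at hb hc hh hi
    cases x
    · rw [hb]; simp
    · rw [hc]; simp
    · rw [hh, hf]; simp
    · rw [hi, hf]; simp

theorem isConvInverse_sigma (α : k) : IsConvInverse (sigma α) (sigma (-α)) :=
  ⟨conv_sigma_neg α, by simpa using conv_sigma_neg (-α)⟩

theorem mul'_comp_rTensor_mulLeft (u : H k) :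
    LinearMap.mul' k (H k) ∘ₗ (LinearMap.mulLeft k u).rTensor (H k) =
      LinearMap.mulLeft k u ∘ₗ LinearMap.mul' k (H k) := by
  apply TensorProduct.ext'; intro x y; simp [mul_assoc]

theorem dC_comp_mul' : dC k ∘ₗ LinearMap.mul' k (H k) =
    LinearMap.mul' k (H k) ∘ₗ (dC k).rTensor (H k) +
      LinearMap.mul' k (H k) ∘ₗ TensorProduct.map (sg k).toLinearMap (dC k) := by
  apply TensorProduct.ext'; intro x y; simp [dC_mul]

theorem dB_comp_mul' : dB k ∘ₗ LinearMap.mul' k (H k) =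
    LinearMap.mul' k (H k) ∘ₗ (dB k).rTensor (H k) +
      LinearMap.mul' k (H k) ∘ₗ TensorProduct.map (sg k).toLinearMap (dB k) := by
  apply TensorProduct.ext'; intro x y; simp [dB_mul]

/-- A skew derivation of `H` is a skew derivation for the product deformed by `σ_α`. -/
theorem skew_cleftMul (α : k) {d : H k →ₗ[k] H k}
    (hc : comul ∘ₗ d = TensorProduct.map d LinearMap.id ∘ₗ comul (R := k))
    (hd : (LinearMap.mulLeft k (gen (LRel k 0) .h ^ 2) ∘ₗ d).rTensor (H k) ∘ₗ comul =
      d.lTensor (H k) ∘ₗ comul (R := k))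
    (hm : d ∘ₗ LinearMap.mul' k (H k) = LinearMap.mul' k (H k) ∘ₗ d.rTensor (H k) +
      LinearMap.mul' k (H k) ∘ₗ TensorProduct.map (sg k).toLinearMap d) :
    d ∘ₗ cleftMul (sigma α) = cleftMul (sigma α) ∘ₗ d.rTensor (H k) +
      cleftMul (sigma α) ∘ₗ TensorProduct.map (sg k).toLinearMap d := by
  have e1 : comul ∘ₗ d.rTensor (H k) = TensorProduct.map (d.rTensor (H k)) LinearMap.id ∘ₗ comul := by
    simpa using comul_comp_map_id (D := H k) hc
  have e2 : comul ∘ₗ TensorProduct.map (sg k).toLinearMap d =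
      TensorProduct.map (TensorProduct.map (sg k).toLinearMap d) LinearMap.id ∘ₗ comul := by
    simpa using comul_comp_map comul_sg hc
  have e3 : sigma α ∘ₗ (LinearMap.mulLeft k (gen (LRel k 0) .h ^ 2) ∘ₗ d).rTensor (H k) =
      sigma α ∘ₗ d.rTensor (H k) := by
    rw [LinearMap.rTensor_comp, ← LinearMap.comp_assoc, sigma_hsq]
  have e4 := balance_map (C := H k) (D := H k) hd balance_id
  have e5 : conv (sigma α) (LinearMap.mul' k (H k) ∘ₗ d.rTensor (H k)) =
      conv (sigma α ∘ₗ d.rTensor (H k)) (LinearMap.mul' k (H k)) := by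
    rw [← e3]
    exact (conv_balance e4 (sigma α) (LinearMap.mul' k (H k))).symm
  rw [cleftMul, comp_conv, hm, conv_add_right, conv_sigma_skew α hd, conv_comp e1, conv_comp e2,
    LinearMap.comp_id, e5]

/-- The summand `b ⊗ 1` of `Δ(b)` is absorbed by `σ_α` and yields the derivative term; the summand
`h² ⊗ b` yields ordinary multiplication. This is the Moyal form of the deformed product. -/
theorem cleftMul_b (α : k) : cleftMul (sigma α) ∘ₗ (LinearMap.mulLeft k (gen (LRel k 0) .b)).rTensor (H k) =
    LinearMap.mulLeft k (gen (LRel k 0) .b) ∘ₗ cleftMul (sigma α) +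
      (α / 2) • (cleftMul (sigma α) ∘ₗ TensorProduct.map (sg k).toLinearMap (dC k)) := by
  have e2 : comul ∘ₗ TensorProduct.map (sg k).toLinearMap (dC k) =
      TensorProduct.map (TensorProduct.map (sg k).toLinearMap (dC k)) LinearMap.id ∘ₗ comul := by
    simpa using comul_comp_map comul_sg comul_dC
  have e := comul_rTensor_b (k := k) (H k)
  rw [cleftMul, conv_comp_add e, sigma_b, sigma_hsq, mul'_comp_rTensor_mulLeft,
    comp_conv, conv_comp e2, conv_smul_left, LinearMap.rTensor_id, LinearMap.comp_id, add_comm]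

theorem cleftMul_c (α : k) : cleftMul (sigma α) ∘ₗ (LinearMap.mulLeft k (gen (LRel k 0) .c)).rTensor (H k) =
    LinearMap.mulLeft k (gen (LRel k 0) .c) ∘ₗ cleftMul (sigma α) -
      (α / 2) • (cleftMul (sigma α) ∘ₗ TensorProduct.map (sg k).toLinearMap (dB k)) := by
  have e2 : comul ∘ₗ TensorProduct.map (sg k).toLinearMap (dB k) =
      TensorProduct.map (TensorProduct.map (sg k).toLinearMap (dB k)) LinearMap.id ∘ₗ comul := by
    simpa using comul_comp_map comul_sg comul_dB
  have e := comul_rTensor_c (k := k) (H k)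
  rw [cleftMul, conv_comp_add e, sigma_c, sigma_hsq, mul'_comp_rTensor_mulLeft,
    comp_conv, conv_comp e2, conv_smul_left, LinearMap.rTensor_id, LinearMap.comp_id, add_comm]
  exact (congrArg _ (neg_smul _ _)).trans (sub_eq_add_neg _ _).symm

theorem cleftMul_h (α : k) : cleftMul (sigma α) ∘ₗ (LinearMap.mulLeft k (gen (LRel k 0) .h)).rTensor (H k) =
    LinearMap.mulLeft k (gen (LRel k 0) .h) ∘ₗ cleftMul (sigma α) := by
  have e := comul_rTensor_h (k := k) (H k)
  rw [cleftMul, conv_comp e, sigma_h, mul'_comp_rTensor_mulLeft, comp_conv]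

theorem cleftMul_hInv (α : k) : cleftMul (sigma α) ∘ₗ (LinearMap.mulLeft k (gen (LRel k 0) .hInv)).rTensor (H k) =
    LinearMap.mulLeft k (gen (LRel k 0) .hInv) ∘ₗ cleftMul (sigma α) := by
  have e := comul_rTensor_hInv (k := k) (H k)
  rw [cleftMul, conv_comp e, sigma_hInv, mul'_comp_rTensor_mulLeft, comp_conv]

theorem cleftMul_one (α : k) (f : H k) : cleftMul (sigma α) (1 ⊗ₜ f) = f := by
  have h1 : cleftMul (sigma α) ∘ₗ TensorProduct.mk k (H k) (H k) 1 = LinearMap.id := by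
    have e := comul_comp_mk_left (C := H k) (D := H k) (Bialgebra.comul_one (R := k))
    rw [cleftMul, conv_comp e, sigma_one, conv_counit_left]
    ext; simp
  exact LinearMap.congr_fun h1 f

variable {R : Type*} [Ring R] [Algebra k R] {b c : R} {h : Rˣ}

/-- Induction on `f` along `linearMap_ext_H`. For `bf` the correction `-z sym(∂_c(f · f'))` is split
by the skew Leibniz rule of the deformed product; as `z = α/2`, its second half cancels the
derivative term of `cleftMul_b`, and the first half belongs to `sym(bf)`. -/
theorem sym_mul_cleft {α : k} (W : IsWeyl (α / 2) 0 b c h) (f f' : H k) :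
    sym (α / 2) 0 b c h f * sym (α / 2) 0 b c h f' =
      sym (α / 2) 0 b c h (cleftMul (sigma α) (f ⊗ₜ f')) := by
  refine LinearMap.congr_fun (f := LinearMap.mulRight k (sym (α / 2) 0 b c h f') ∘ₗ sym (α / 2) 0 b c h)
    (g := sym (α / 2) 0 b c h ∘ₗ cleftMul (sigma α) ∘ₗ (TensorProduct.mk k (H k) (H k)).flip f')
    (linearMap_ext_H ?_ ?_ ?_ ?_ ?_) f
  · simp [sym_one, cleftMul_one]
  · intro f hf
    have := LinearMap.congr_fun (cleftMul_h α) (f ⊗ₜ f')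
    simp only [LinearMap.comp_apply, LinearMap.mulRight_apply, LinearMap.flip_apply,
      TensorProduct.mk_apply, LinearMap.rTensor_tmul, LinearMap.mulLeft_apply] at this hf ⊢
    rw [this, W.sym_h, W.sym_h, mul_assoc, hf]
  · intro f hf
    have := LinearMap.congr_fun (cleftMul_hInv α) (f ⊗ₜ f')
    simp only [LinearMap.comp_apply, LinearMap.mulRight_apply, LinearMap.flip_apply,
      TensorProduct.mk_apply, LinearMap.rTensor_tmul, LinearMap.mulLeft_apply] at this hf ⊢
    rw [this, W.sym_hInv, W.sym_hInv, mul_assoc, hf]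
  · intro f hf hd
    have h1 := LinearMap.congr_fun (cleftMul_b α) (f ⊗ₜ f')
    have h2 := LinearMap.congr_fun (skew_cleftMul α comul_dC balance_dC dC_comp_mul') (f ⊗ₜ f')
    simp only [LinearMap.comp_apply, LinearMap.mulRight_apply, LinearMap.flip_apply,
      TensorProduct.mk_apply, LinearMap.rTensor_tmul, LinearMap.mulLeft_apply, LinearMap.add_apply,
      LinearMap.smul_apply] at h1 h2 hf hd ⊢
    rw [h1, sym_b, map_add, sym_b, h2, map_smul, map_add, ← hd, sub_mul, mul_assoc, hf]
    simp [mul_assoc]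
    abel
  · intro f hf hd
    have h1 := LinearMap.congr_fun (cleftMul_c α) (f ⊗ₜ f')
    have h2 := LinearMap.congr_fun (skew_cleftMul α comul_dB balance_dB dB_comp_mul') (f ⊗ₜ f')
    simp only [LinearMap.comp_apply, LinearMap.mulRight_apply, LinearMap.flip_apply,
      TensorProduct.mk_apply, LinearMap.rTensor_tmul, LinearMap.mulLeft_apply, LinearMap.add_apply,
      LinearMap.sub_apply, LinearMap.smul_apply] at h1 h2 hf hd ⊢
    rw [h1, W.sym_c, map_sub, W.sym_c, h2, map_smul, map_add, ← hd, add_mul, mul_assoc, hf]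
    simp [mul_assoc, mul_add]
    abel

end Sigma

/-! ### The two-sided deformation and the product of `L_α` -/

section Cocycle
variable {k : Type u} [Field k]

theorem comul_hsq : comul (R := k) (gen (LRel k 0) .h ^ 2) =
    (gen (LRel k 0) .h ^ 2) ⊗ₜ (gen (LRel k 0) .h ^ 2) := by
  rw [Bialgebra.comul_pow, comul_L_h, Algebra.TensorProduct.tmul_pow]

theorem cleftMul_hsq (α : k) :
    cleftMul (sigma α) ∘ₗ (LinearMap.mulLeft k (gen (LRel k 0) .h ^ 2)).rTensor (H k) =
      LinearMap.mulLeft k (gen (LRel k 0) .h ^ 2) ∘ₗ cleftMul (sigma α) := by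
  have e := comul_comp_map_id (D := H k) (comul_mulLeft_grouplike (comul_hsq (k := k)))
  rw [cleftMul, conv_comp e, sigma_hsq, mul'_comp_rTensor_mulLeft, comp_conv]

theorem cleftMul_hsq_right (α : k) :
    cleftMul (sigma α) ∘ₗ (LinearMap.mulLeft k (gen (LRel k 0) .h ^ 2)).lTensor (H k) =
      LinearMap.mulLeft k (gen (LRel k 0) .h ^ 2) ∘ₗ cleftMul (sigma α) := by
  have e : comul ∘ₗ (LinearMap.mulLeft k (gen (LRel k 0) .h ^ 2)).lTensor (H k) =
      TensorProduct.map ((LinearMap.mulLeft k (gen (LRel k 0) .h ^ 2)).lTensor (H k))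
        ((LinearMap.mulLeft k (gen (LRel k 0) .h ^ 2)).lTensor (H k)) ∘ₗ comul (R := k) :=
    comul_comp_map (C := H k) (by simp) (comul_mulLeft_grouplike (comul_hsq (k := k)))
  have e' : LinearMap.mul' k (H k) ∘ₗ (LinearMap.mulLeft k (gen (LRel k 0) .h ^ 2)).lTensor (H k) =
      LinearMap.mulLeft k (gen (LRel k 0) .h ^ 2) ∘ₗ LinearMap.mul' k (H k) := by
    apply TensorProduct.ext'
    intro x y
    simp only [LinearMap.comp_apply, LinearMap.lTensor_tmul, LinearMap.mulLeft_apply,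
      LinearMap.mul'_apply]
    rw [← mul_assoc, ← hsq_comm, mul_assoc]
  rw [cleftMul, conv_comp e, sigma_hsq_right, e', comp_conv]

theorem skew_cocycleMul (α : k) {d : H k →ₗ[k] H k}
    (hc : comul ∘ₗ d = TensorProduct.map d LinearMap.id ∘ₗ comul (R := k))
    (hd : (LinearMap.mulLeft k (gen (LRel k 0) .h ^ 2) ∘ₗ d).rTensor (H k) ∘ₗ comul =
      d.lTensor (H k) ∘ₗ comul (R := k))
    (hm : d ∘ₗ LinearMap.mul' k (H k) = LinearMap.mul' k (H k) ∘ₗ d.rTensor (H k) +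
      LinearMap.mul' k (H k) ∘ₗ TensorProduct.map (sg k).toLinearMap d) :
    d ∘ₗ cocycleMul (sigma α) (sigma (-α)) = cocycleMul (sigma α) (sigma (-α)) ∘ₗ d.rTensor (H k) +
      cocycleMul (sigma α) (sigma (-α)) ∘ₗ TensorProduct.map (sg k).toLinearMap d := by
  have e1 : comul ∘ₗ d.rTensor (H k) = TensorProduct.map (d.rTensor (H k)) LinearMap.id ∘ₗ comul := by
    simpa using comul_comp_map_id (D := H k) hc
  have e2 : comul ∘ₗ TensorProduct.map (sg k).toLinearMap d =
      TensorProduct.map (TensorProduct.map (sg k).toLinearMap d) LinearMap.id ∘ₗ comul := by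
    simpa using comul_comp_map comul_sg hc
  have h := skew_cleftMul α hc hd hm
  rw [cleftMul] at h
  rw [cocycleMul, comp_convRight, h, convRight_comp e1, convRight_comp e2, LinearMap.comp_id]
  ext x
  simp [convRight_apply, TensorProduct.map_add_left]

theorem convRight_add_left {C M : Type*} [AddCommGroup C] [Module k C] [Coalgebra k C]
    [AddCommGroup M] [Module k M] (f : C →ₗ[k] k) (φ ψ : C →ₗ[k] M) :
    convRight (φ + ψ) f = convRight φ f + convRight ψ f := by
  ext x; simp [convRight_apply, TensorProduct.map_add_left]

theorem convRight_smul_left {C M : Type*} [AddCommGroup C] [Module k C] [Coalgebra k C]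
    [AddCommGroup M] [Module k M] (t : k) (f : C →ₗ[k] k) (φ : C →ₗ[k] M) :
    convRight (t • φ) f = t • convRight φ f := by
  ext x; simp [convRight_apply, TensorProduct.map_smul_left]

theorem convRight_smul_right {C M : Type*} [AddCommGroup C] [Module k C] [Coalgebra k C]
    [AddCommGroup M] [Module k M] (t : k) (f : C →ₗ[k] k) (φ : C →ₗ[k] M) :
    convRight φ (t • f) = t • convRight φ f := by
  ext x; simp [convRight_apply, TensorProduct.map_smul_right]

/-- The part of the deformed product by `b` or `c` that comes from the right cocycle. -/
theorem cocycleMul_aux (α : k) {d : H k →ₗ[k] H k}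
    (hc : comul ∘ₗ d = TensorProduct.map d LinearMap.id ∘ₗ comul (R := k))
    (hd : (LinearMap.mulLeft k (gen (LRel k 0) .h ^ 2) ∘ₗ d).rTensor (H k) ∘ₗ comul =
      d.lTensor (H k) ∘ₗ comul (R := k)) :
    convRight (cleftMul (sigma α) ∘ₗ (LinearMap.mulLeft k (gen (LRel k 0) .h ^ 2)).rTensor (H k))
      (sigma (-α) ∘ₗ TensorProduct.map (sg k).toLinearMap d) =
    LinearMap.mulLeft k (gen (LRel k 0) .h ^ 4) ∘ₗ cocycleMul (sigma α) (sigma (-α)) ∘ₗ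
      TensorProduct.map (sg k).toLinearMap d := by
  have e2 : comul ∘ₗ TensorProduct.map (sg k).toLinearMap d =
      TensorProduct.map (TensorProduct.map (sg k).toLinearMap d) LinearMap.id ∘ₗ comul := by
    simpa using comul_comp_map comul_sg hc
  have e := balance_map (C := H k) (D := H k) balance_sg hd
  have e' : TensorProduct.map (sg k).toLinearMap (LinearMap.mulLeft k (gen (LRel k 0) .h ^ 2) ∘ₗ d) =
      (LinearMap.mulLeft k (gen (LRel k 0) .h ^ 2)).lTensor (H k) ∘ₗ
        TensorProduct.map (sg k).toLinearMap d := by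
    rw [LinearMap.lTensor_comp_map]
  -- The factor `h⁴` arises as two factors `h²`: one is the left leg of the summand `h² ⊗ b` or `h²
  -- ⊗ c` of the coproduct, the other is the price of moving `d` from the right cocycle to the
  -- product.
  have h2 := convRight_balance e (sigma (-α)) (cleftMul (sigma α))
  rw [e', ← LinearMap.comp_assoc, cleftMul_hsq_right] at h2
  rw [cleftMul_hsq, ← comp_convRight, ← h2]
  rw [LinearMap.comp_assoc, ← comp_convRight, ← LinearMap.comp_assoc, ← LinearMap.mulLeft_mul,
    ← pow_add, cocycleMul, ← cleftMul, convRight_comp e2, LinearMap.comp_id]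

theorem cocycleMul_b (α : k) :
    cocycleMul (sigma α) (sigma (-α)) ∘ₗ (LinearMap.mulLeft k (gen (LRel k 0) .b)).rTensor (H k) =
    LinearMap.mulLeft k (gen (LRel k 0) .b) ∘ₗ cocycleMul (sigma α) (sigma (-α)) +
      (α / 2) • (cocycleMul (sigma α) (sigma (-α)) ∘ₗ TensorProduct.map (sg k).toLinearMap (dC k)) -
      (α / 2) • (LinearMap.mulLeft k (gen (LRel k 0) .h ^ 4) ∘ₗ cocycleMul (sigma α) (sigma (-α)) ∘ₗ
        TensorProduct.map (sg k).toLinearMap (dC k)) := by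
  have e2 : comul ∘ₗ TensorProduct.map (sg k).toLinearMap (dC k) =
      TensorProduct.map (TensorProduct.map (sg k).toLinearMap (dC k)) LinearMap.id ∘ₗ comul := by
    simpa using comul_comp_map comul_sg comul_dC
  have e := comul_rTensor_b (k := k) (H k)
  have h := cocycleMul_aux α comul_dC balance_dC
  rw [← h, cocycleMul, ← cleftMul, convRight_comp_add e, LinearMap.rTensor_id, LinearMap.comp_id,
    cleftMul_b, convRight_add_left, convRight_smul_left, comp_convRight, convRight_comp e2,
    LinearMap.comp_id, sigma_b, convRight_smul_right, neg_div]
  exact (congrArg _ (neg_smul _ _)).trans (sub_eq_add_neg _ _).symm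

theorem cocycleMul_c (α : k) :
    cocycleMul (sigma α) (sigma (-α)) ∘ₗ (LinearMap.mulLeft k (gen (LRel k 0) .c)).rTensor (H k) =
    LinearMap.mulLeft k (gen (LRel k 0) .c) ∘ₗ cocycleMul (sigma α) (sigma (-α)) +
      (-(α / 2)) • (cocycleMul (sigma α) (sigma (-α)) ∘ₗ TensorProduct.map (sg k).toLinearMap (dB k)) +
      (α / 2) • (LinearMap.mulLeft k (gen (LRel k 0) .h ^ 4) ∘ₗ cocycleMul (sigma α) (sigma (-α)) ∘ₗ
        TensorProduct.map (sg k).toLinearMap (dB k)) := by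
  have e2 : comul ∘ₗ TensorProduct.map (sg k).toLinearMap (dB k) =
      TensorProduct.map (TensorProduct.map (sg k).toLinearMap (dB k)) LinearMap.id ∘ₗ comul := by
    simpa using comul_comp_map comul_sg comul_dB
  have e := comul_rTensor_c (k := k) (H k)
  have h := cocycleMul_aux α comul_dB balance_dB
  have h' : cleftMul (sigma α) ∘ₗ (LinearMap.mulLeft k (gen (LRel k 0) .c)).rTensor (H k) =
      LinearMap.mulLeft k (gen (LRel k 0) .c) ∘ₗ cleftMul (sigma α) +
      (-(α / 2)) • (cleftMul (sigma α) ∘ₗ TensorProduct.map (sg k).toLinearMap (dB k)) :=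
    (cleftMul_c α).trans ((sub_eq_add_neg _ _).trans (congrArg _ (neg_smul _ _).symm))
  rw [← h, cocycleMul, ← cleftMul, convRight_comp_add e, LinearMap.rTensor_id, LinearMap.comp_id,
    h', convRight_add_left, convRight_smul_left, comp_convRight, convRight_comp e2,
    LinearMap.comp_id, sigma_c, convRight_smul_right, neg_div, neg_neg]

theorem cocycleMul_h (α : k) :
    cocycleMul (sigma α) (sigma (-α)) ∘ₗ (LinearMap.mulLeft k (gen (LRel k 0) .h)).rTensor (H k) =
    LinearMap.mulLeft k (gen (LRel k 0) .h) ∘ₗ cocycleMul (sigma α) (sigma (-α)) := by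
  have e := comul_rTensor_h (k := k) (H k)
  rw [cocycleMul, ← cleftMul, convRight_comp e, sigma_h, cleftMul_h,
    comp_convRight]

theorem cocycleMul_hInv (α : k) :
    cocycleMul (sigma α) (sigma (-α)) ∘ₗ (LinearMap.mulLeft k (gen (LRel k 0) .hInv)).rTensor (H k) =
    LinearMap.mulLeft k (gen (LRel k 0) .hInv) ∘ₗ cocycleMul (sigma α) (sigma (-α)) := by
  have e := comul_rTensor_hInv (k := k) (H k)
  rw [cocycleMul, ← cleftMul, convRight_comp e, sigma_hInv, cleftMul_hInv,
    comp_convRight]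

theorem cocycleMul_one (α : k) (f : H k) : cocycleMul (sigma α) (sigma (-α)) (1 ⊗ₜ f) = f := by
  have h1 : cocycleMul (sigma α) (sigma (-α)) ∘ₗ TensorProduct.mk k (H k) (H k) 1 = LinearMap.id := by
    have e := comul_comp_mk_left (C := H k) (D := H k) (Bialgebra.comul_one (R := k))
    rw [cocycleMul, ← cleftMul, convRight_comp e, sigma_one, convRight_counit]
    ext; simp [cleftMul_one]
  exact LinearMap.congr_fun h1 f

variable {R : Type*} [Ring R] [Algebra k R] {b c : R} {h : Rˣ}

theorem IsWeyl.sym_hpow {s t : k} (W : IsWeyl s t b c h) (n : ℕ) (f : H k) :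
    sym s t b c h (gen (LRel k 0) .h ^ n * f) = (h : R) ^ n * sym s t b c h f := by
  induction n with
  | zero => simp
  | succ n ih => rw [pow_succ', mul_assoc, W.sym_h, ih, pow_succ', mul_assoc]

/-- The argument of `sym_mul_cleft` with `z = (α/2)(1 - h⁴)`: the left cocycle supplies the part
`α/2`, the right cocycle the part `-(α/2)h⁴`, and together they cancel the second half of the
Leibniz rule. -/
theorem sym_mul_cocycle {α : k} (W : IsWeyl (α / 2) (α / 2) b c h) (f f' : H k) :
    sym (α / 2) (α / 2) b c h f * sym (α / 2) (α / 2) b c h f' =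
      sym (α / 2) (α / 2) b c h (cocycleMul (sigma α) (sigma (-α)) (f ⊗ₜ f')) := by
  refine LinearMap.congr_fun
    (f := LinearMap.mulRight k (sym (α / 2) (α / 2) b c h f') ∘ₗ sym (α / 2) (α / 2) b c h)
    (g := sym (α / 2) (α / 2) b c h ∘ₗ cocycleMul (sigma α) (sigma (-α)) ∘ₗ
      (TensorProduct.mk k (H k) (H k)).flip f')
    (linearMap_ext_H ?_ ?_ ?_ ?_ ?_) f
  · simp [sym_one, cocycleMul_one]
  · intro f hf
    have := LinearMap.congr_fun (cocycleMul_h α) (f ⊗ₜ f')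
    simp only [LinearMap.comp_apply, LinearMap.mulRight_apply, LinearMap.flip_apply,
      TensorProduct.mk_apply, LinearMap.rTensor_tmul, LinearMap.mulLeft_apply] at this hf ⊢
    rw [this, W.sym_h, W.sym_h, mul_assoc, hf]
  · intro f hf
    have := LinearMap.congr_fun (cocycleMul_hInv α) (f ⊗ₜ f')
    simp only [LinearMap.comp_apply, LinearMap.mulRight_apply, LinearMap.flip_apply,
      TensorProduct.mk_apply, LinearMap.rTensor_tmul, LinearMap.mulLeft_apply] at this hf ⊢
    rw [this, W.sym_hInv, W.sym_hInv, mul_assoc, hf]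
  · intro f hf hd
    have h1 := LinearMap.congr_fun (cocycleMul_b α) (f ⊗ₜ f')
    have h2 := LinearMap.congr_fun (skew_cocycleMul α comul_dC balance_dC dC_comp_mul') (f ⊗ₜ f')
    simp only [LinearMap.comp_apply, LinearMap.mulRight_apply, LinearMap.flip_apply,
      TensorProduct.mk_apply, LinearMap.rTensor_tmul, LinearMap.mulLeft_apply, LinearMap.add_apply,
      LinearMap.sub_apply, LinearMap.smul_apply] at h1 h2 hf hd ⊢
    rw [h1, sym_b, map_sub, map_add, sym_b, h2, map_smul, map_smul, W.sym_hpow, map_add, ← hd,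
      sub_mul, mul_assoc, hf]
    simp [mul_assoc, sub_mul, mul_add]
    abel
  · intro f hf hd
    have h1 := LinearMap.congr_fun (cocycleMul_c α) (f ⊗ₜ f')
    have h2 := LinearMap.congr_fun (skew_cocycleMul α comul_dB balance_dB dB_comp_mul') (f ⊗ₜ f')
    simp only [LinearMap.comp_apply, LinearMap.mulRight_apply, LinearMap.flip_apply,
      TensorProduct.mk_apply, LinearMap.rTensor_tmul, LinearMap.mulLeft_apply, LinearMap.add_apply,
      LinearMap.sub_apply, LinearMap.smul_apply] at h1 h2 hf hd ⊢
    rw [h1, W.sym_c, map_add, map_add, W.sym_c, h2, map_smul, map_smul, W.sym_hpow, map_add, ← hd,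
      add_mul, mul_assoc, hf]
    simp [mul_assoc, sub_mul, mul_add]
    abel

end Cocycle

/-! ### Bijectivity of the symmetrization map -/

section Isomorphisms
variable {k : Type u} [Field k]

/-- The central element `s - t h⁴` of `H`. -/
def zH (s t : k) : H k := s • 1 - t • gen (LRel k 0) .h ^ 4

/-- The operators on `H` by which `b`, `c`, `h`, `h⁻¹` act on the symmetrized monomials. -/
def weylOp (s t : k) : LGen → Module.End k (H k)
  | .b => LinearMap.mulLeft k (gen (LRel k 0) .b) +
      LinearMap.mulLeft k (zH s t) ∘ₗ dC k
  | .c => LinearMap.mulLeft k (gen (LRel k 0) .c) -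
      LinearMap.mulLeft k (zH s t) ∘ₗ dB k
  | .h => LinearMap.mulLeft k (gen (LRel k 0) .h)
  | .hInv => LinearMap.mulLeft k (gen (LRel k 0) .hInv)

theorem weylOp_b (s t : k) (f : H k) : weylOp s t .b f = gen (LRel k 0) .b * f +
    zH s t * dC k f := rfl
theorem weylOp_c (s t : k) (f : H k) : weylOp s t .c f = gen (LRel k 0) .c * f -
    zH s t * dB k f := rfl
theorem weylOp_h (s t : k) (f : H k) : weylOp s t .h f = gen (LRel k 0) .h * f := rfl
theorem weylOp_hInv (s t : k) (f : H k) : weylOp s t .hInv f = gen (LRel k 0) .hInv * f := rfl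

theorem dC_hpow_four (f : H k) : dC k (gen (LRel k 0) .h ^ 4 * f) = gen (LRel k 0) .h ^ 4 * dC k f := by
  simp [pow_succ, mul_assoc, dC_h]

theorem dB_hpow_four (f : H k) : dB k (gen (LRel k 0) .h ^ 4 * f) = gen (LRel k 0) .h ^ 4 * dB k f := by
  simp [pow_succ, mul_assoc, dB_h]

theorem hpow_four_comm (f : H k) : gen (LRel k 0) .h ^ 4 * f = f * gen (LRel k 0) .h ^ 4 := by
  rw [show (4 : ℕ) = 2 + 2 from rfl, pow_add, mul_assoc, hsq_comm f, ← mul_assoc, hsq_comm f,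
    mul_assoc]

theorem zH_comm (s t : k) (f : H k) : zH s t * f = f * zH s t := by
  simp [zH, sub_mul, mul_sub, hpow_four_comm f]

theorem dC_zH (s t : k) (f : H k) : dC k (zH s t * f) = zH s t * dC k f := by
  simp [zH, sub_mul, dC_hpow_four]

theorem dB_zH (s t : k) (f : H k) : dB k (zH s t * f) = zH s t * dB k f := by
  simp [zH, sub_mul, dB_hpow_four]

theorem weylOp_h_b (s t : k) (f : H k) : weylOp s t .h (weylOp s t .b f) =
    -weylOp s t .b (weylOp s t .h f) := by
  simp only [weylOp_b, weylOp_h, dC_h]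
  simp only [mul_add, ← mul_assoc, L_h_b, zH_comm s t (gen (LRel k 0) .h), mul_neg, neg_mul, neg_add,
    neg_neg]

theorem weylOp_h_c (s t : k) (f : H k) : weylOp s t .h (weylOp s t .c f) =
    -weylOp s t .c (weylOp s t .h f) := by
  simp only [weylOp_c, weylOp_h, dB_h]
  simp only [mul_sub, ← mul_assoc, L_h_c, zH_comm s t (gen (LRel k 0) .h), mul_neg, neg_mul, neg_sub,
    neg_neg]
  abel

/-- Since `z` is central and the derivations are linear over it, the commutator of `b + z∂_c` and `c
- z∂_b` reduces to `[z∂_c, c] + [b, -z∂_b] = z + z`. -/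
theorem weylOp_b_c (s t : k) (f : H k) : weylOp s t .b (weylOp s t .c f) =
    weylOp s t .c (weylOp s t .b f) + (2 : k) • (zH s t * f) := by
  simp only [weylOp_b, weylOp_c, map_add, map_sub, dC_c, dB_b, dC_zH, dB_zH, dB_dC, mul_add,
    mul_sub, two_smul]
  rw [← mul_assoc (gen (LRel k 0) .b) (gen (LRel k 0) .c), H_b_c, ← mul_assoc (gen (LRel k 0) .b),
    ← mul_assoc (gen (LRel k 0) .c) (zH s t), ← zH_comm, ← zH_comm]
  simp only [mul_assoc]
  abel

/-- The representation criterion: if a presented algebra acts on `V` by operators `T`, and a linear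
map `I : V → Pres r` intertwines `T` with left multiplication, then evaluation at a vector `v₀` with
`I v₀ = 1` is inverse to `I`, provided it is a left inverse. -/
theorem presLift_apply_intertwine {X : Type} {r : FreeAlgebra k X → FreeAlgebra k X → Prop}
    {V : Type*} [AddCommGroup V] [Module k V] (T : X → Module.End k V)
    (hT : ∀ ⦃x y⦄, r x y → FreeAlgebra.lift k T x = FreeAlgebra.lift k T y)
    (I : V →ₗ[k] Pres r) (hI : ∀ x v, I (T x v) = gen r x * I v) (u : Pres r) (v : V) :
    I (presLift r T hT u v) = u * I v := by
  refine LinearMap.congr_fun (f := I ∘ₗ LinearMap.applyₗ v ∘ₗ (presLift r T hT).toLinearMap)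
    (g := LinearMap.mulRight k (I v)) (linearMap_ext_left ?_ fun x f hf => ?_) u
  · simp
  · simp only [LinearMap.comp_apply, AlgHom.toLinearMap_apply, LinearMap.applyₗ_apply_apply,
      LinearMap.mulRight_apply] at hf ⊢
    rw [map_mul, presLift_gen, Module.End.mul_apply, hI, hf, mul_assoc]

/-- The symmetrization map out of `H` is bijective for an algebra presented by Weyl relations. -/
def symEquiv {r : FreeAlgebra k LGen → FreeAlgebra k LGen → Prop} {s t : k} {h : (Pres r)ˣ}
    (W : IsWeyl s t (gen r .b) (gen r .c) h) (e1 : (h : Pres r) = gen r .h)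
    (e2 : ((h⁻¹ : (Pres r)ˣ) : Pres r) = gen r .hInv)
    (hT : ∀ ⦃x y⦄, r x y → FreeAlgebra.lift k (weylOp s t) x = FreeAlgebra.lift k (weylOp s t) y) :
    H k ≃ₗ[k] Pres r :=
  have hI : ∀ x v, sym s t (gen r .b) (gen r .c) h (weylOp s t x v) =
      gen r x * sym s t (gen r .b) (gen r .c) h v := by
    have hz : ∀ v, sym s t (gen r .b) (gen r .c) h (zH s t * v) =
        (s • 1 - t • (h : Pres r) ^ 4) * sym s t (gen r .b) (gen r .c) h v := fun v => by
      simp only [zH, sub_mul, smul_mul_assoc, one_mul, map_sub, map_smul, W.sym_hpow]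
    rintro (_ | _ | _ | _) v
    · rw [weylOp_b, map_add, sym_b, hz]; abel
    · rw [weylOp_c, map_sub, W.sym_c, hz]; abel
    · rw [weylOp_h, W.sym_h, e1]
    · rw [weylOp_hInv, W.sym_hInv, e2]
  { sym s t (gen r .b) (gen r .c) h with
    invFun := fun u => presLift r (weylOp s t) hT u 1
    left_inv := by
      intro f
      have key := fun (u : Pres r) v => presLift r (weylOp s t) hT u v
      refine LinearMap.congr_fun (f := LinearMap.applyₗ 1 ∘ₗ
        (presLift r (weylOp s t) hT).toLinearMap ∘ₗ sym s t (gen r .b) (gen r .c) h)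
        (g := LinearMap.id) (linearMap_ext_H ?_ ?_ ?_ ?_ ?_) f
      · simp [sym_one]
      · intro f hf
        simp only [LinearMap.comp_apply, AlgHom.toLinearMap_apply, LinearMap.applyₗ_apply_apply,
          LinearMap.id_apply] at hf ⊢
        rw [W.sym_h, e1, map_mul, presLift_gen, Module.End.mul_apply, hf, weylOp_h]
      · intro f hf
        simp only [LinearMap.comp_apply, AlgHom.toLinearMap_apply, LinearMap.applyₗ_apply_apply,
          LinearMap.id_apply] at hf ⊢
        rw [W.sym_hInv, e2, map_mul, presLift_gen, Module.End.mul_apply, hf, weylOp_hInv]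
      -- The recursion of `sym` and the operator for `b` undo each other: evaluation at `1` gives
      -- `(bf + z∂_c f) - z∂_c f`. The case of `c` is the same with the opposite sign.
      · intro f hf hd
        simp only [LinearMap.comp_apply, AlgHom.toLinearMap_apply, LinearMap.applyₗ_apply_apply,
          LinearMap.id_apply] at hf hd ⊢
        rw [sym_b, e1]
        simp only [map_sub, map_mul, map_smul, map_pow, map_one, presLift_gen, LinearMap.sub_apply,
          Module.End.mul_apply, hf, hd, LinearMap.smul_apply, Module.End.one_apply, weylOp_b, zH,
          pow_succ, pow_zero, weylOp_h, one_mul, mul_assoc, sub_mul, smul_mul_assoc]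
        abel
      · intro f hf hd
        simp only [LinearMap.comp_apply, AlgHom.toLinearMap_apply, LinearMap.applyₗ_apply_apply,
          LinearMap.id_apply] at hf hd ⊢
        rw [W.sym_c, e1]
        simp only [map_sub, map_add, map_mul, map_smul, map_pow, map_one, presLift_gen,
          LinearMap.sub_apply, LinearMap.add_apply,
          Module.End.mul_apply, hf, hd, LinearMap.smul_apply, Module.End.one_apply, weylOp_c, zH,
          pow_succ, pow_zero, weylOp_h, one_mul, mul_assoc, sub_mul, smul_mul_assoc]
        abel
    right_inv := by
      intro u
      have := presLift_apply_intertwine (weylOp s t) hT _ hI u 1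
      rwa [sym_one, mul_one] at this }

end Isomorphisms

/-! ### `H_α` and `L_α` as deformations of `H` -/

section Deformations
variable {k : Type u} [Field k]

/-- Symmetrization splits the commutator evenly as `α = 2 · (α/2)`; this is one place where the
characteristic must differ from 2. -/
theorem alpha_half (h2 : (2 : k) ≠ 0) (α : k) : (2 : k) * (α / 2) = α := by
  field_simp

/-- A character that kills `b`, `c` and sends `h` to `1` restricts to the counit of `H`. -/
theorem character_sym {R : Type*} [Ring R] [Algebra k R] {s : k} {b c : R} {h : Rˣ}
    (W : IsWeyl s s b c h) (χ : R →ₐ[k] k) (hb : χ b = 0) (hc : χ c = 0) (hh : χ h = 1) (f : H k) :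
    χ (sym s s b c h f) = counit (R := k) f := by
  have hi : χ ((h⁻¹ : Rˣ) : R) = 1 := by
    have := congrArg χ h.mul_inv
    rwa [map_mul, hh, one_mul, map_one] at this
  refine LinearMap.congr_fun (f := χ.toLinearMap ∘ₗ sym s s b c h) (g := counit)
    (linearMap_ext_H ?_ ?_ ?_ ?_ ?_) f
  · simp [sym_one]
  · intro f hf
    simp only [LinearMap.comp_apply, AlgHom.toLinearMap_apply] at hf ⊢
    simp [W.sym_h, hh, hf]
  · intro f hf
    simp only [LinearMap.comp_apply, AlgHom.toLinearMap_apply] at hf ⊢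
    simp [W.sym_hInv, hi, hf]
  · intro f hf hd
    simp only [LinearMap.comp_apply, AlgHom.toLinearMap_apply] at hf hd ⊢
    simp [sym_b, hb, hh]
  · intro f hf hd
    simp only [LinearMap.comp_apply, AlgHom.toLinearMap_apply] at hf hd ⊢
    simp [W.sym_c, hc, hh]

theorem C_h_hInv {α : k} : gen (HRel k α) .h * gen (HRel k α) .hInv = 1 := by
  simpa using rel_gen (HRel.h_hInv (α := α))
theorem C_hInv_h {α : k} : gen (HRel k α) .hInv * gen (HRel k α) .h = 1 := by
  simpa using rel_gen (HRel.hInv_h (α := α))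

/-- The unit `h` of `H_α`. -/
def hUnitC (α : k) : (HCleft k α)ˣ := ⟨gen (HRel k α) .h, gen (HRel k α) .hInv, C_h_hInv, C_hInv_h⟩

/-- The unit `h` of `L_α`. -/
def hUnitL (α : k) : (L k α)ˣ := ⟨gen (LRel k α) .h, gen (LRel k α) .hInv, L_h_hInv, L_hInv_h⟩

theorem isWeyl_C (h2 : (2 : k) ≠ 0) (α : k) :
    IsWeyl (α / 2) 0 (gen (HRel k α) .b) (gen (HRel k α) .c) (hUnitC α) where
  h_b := by
    have := rel_gen (HRel.h_b (α := α))
    simp only [map_mul, map_neg, FreeAlgebra.lift_ι_apply] at this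
    exact this
  h_c := by
    have := rel_gen (HRel.h_c (α := α))
    simp only [map_mul, map_neg, FreeAlgebra.lift_ι_apply] at this
    exact this
  b_c := by
    have := rel_gen (HRel.b_c (α := α))
    simp only [map_sub, map_mul, map_smul, map_one, map_pow, FreeAlgebra.lift_ι_apply] at this
    rw [zero_smul, sub_zero, smul_smul, alpha_half h2, ← this]; abel

theorem isWeyl_L (h2 : (2 : k) ≠ 0) (α : k) :
    IsWeyl (α / 2) (α / 2) (gen (LRel k α) .b) (gen (LRel k α) .c) (hUnitL α) where
  h_b := L_h_b
  h_c := L_h_c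
  b_c := by
    rw [L_b_c, ← smul_sub, smul_smul, alpha_half h2]; rfl

theorem weylOp_C (h2 : (2 : k) ≠ 0) (α : k) ⦃x y : FreeAlgebra k LGen⦄ (h : HRel k α x y) :
    FreeAlgebra.lift k (weylOp (α / 2) 0) x = FreeAlgebra.lift k (weylOp (α / 2) 0) y := by
  rcases h with _ | _ | _ | _ | _
  all_goals
    ext1 f
    simp only [map_mul, map_neg, map_sub, map_smul, map_one, FreeAlgebra.lift_ι_apply,
      Module.End.mul_apply, LinearMap.neg_apply, LinearMap.sub_apply, LinearMap.smul_apply,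
      Module.End.one_apply]
  · simp [weylOp_h, weylOp_hInv, assoc_rule L_h_hInv]
  · simp [weylOp_h, weylOp_hInv, assoc_rule L_hInv_h]
  · exact weylOp_h_b _ _ f
  · exact weylOp_h_c _ _ f
  · rw [weylOp_b_c, add_sub_cancel_left]
    simp [zH, smul_smul, alpha_half h2]

theorem weylOp_L (h2 : (2 : k) ≠ 0) (α : k) ⦃x y : FreeAlgebra k LGen⦄ (h : LRel k α x y) :
    FreeAlgebra.lift k (weylOp (α / 2) (α / 2)) x = FreeAlgebra.lift k (weylOp (α / 2) (α / 2)) y := by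
  rcases h with _ | _ | _ | _ | _
  all_goals
    ext1 f
    simp only [map_mul, map_neg, map_sub, map_smul, map_one, map_pow, FreeAlgebra.lift_ι_apply,
      Module.End.mul_apply, LinearMap.neg_apply, LinearMap.sub_apply, LinearMap.smul_apply,
      Module.End.one_apply]
  · simp [weylOp_h, weylOp_hInv, assoc_rule L_h_hInv]
  · simp [weylOp_h, weylOp_hInv, assoc_rule L_hInv_h]
  · exact weylOp_h_b _ _ f
  · exact weylOp_h_c _ _ f
  · rw [weylOp_b_c, add_sub_cancel_left, zH, ← smul_sub, smul_mul_assoc, smul_smul, alpha_half h2]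
    simp [sub_mul, pow_succ, weylOp_h, mul_assoc]

/-- The isomorphism is inverse symmetrization. It fixes the generators because a single factor needs
no reordering. -/
theorem exists_cleft_equiv (h2 : (2 : k) ≠ 0) (α : k) :
    ∃ j : HCleft k α ≃ₗ[k] H k, j 1 = 1 ∧
        (∀ x, j (gen (HRel k α) x) = gen (LRel k 0) x) ∧
        ∀ x y, j (x * y) = cleftMul (sigma α) (j x ⊗ₜ j y) := by
  have W := isWeyl_C h2 α
  let J := symEquiv W rfl rfl (weylOp_C h2 α)
  have hJ : ∀ f, J f = sym (α / 2) 0 (gen (HRel k α) .b) (gen (HRel k α) .c) (hUnitC α) f :=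
    fun _ => rfl
  refine ⟨J.symm, ?_, ?_, fun x y => ?_⟩
  · rw [LinearEquiv.symm_apply_eq, hJ, sym_one]
  · rintro (_ | _ | _ | _) <;> rw [LinearEquiv.symm_apply_eq, hJ]
    · rw [W.sym_gen_b]
    · rw [W.sym_gen_c]
    · rw [W.sym_gen_h]; rfl
    · rw [W.sym_gen_hInv]; rfl
  · rw [LinearEquiv.symm_apply_eq, hJ, ← sym_mul_cleft W, ← hJ, ← hJ, LinearEquiv.apply_symm_apply,
      LinearEquiv.apply_symm_apply]

theorem exists_cocycle_equiv (h2 : (2 : k) ≠ 0) (α : k) :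
    ∃ e : L k α ≃ₗc[k] H k, e 1 = 1 ∧
        (∀ x, e (gen (LRel k α) x) = gen (LRel k 0) x) ∧
        ∀ x y, e (x * y) = cocycleMul (sigma α) (sigma (-α)) (e x ⊗ₜ e y) := by
  have W := isWeyl_L h2 α
  let J := symEquiv W rfl rfl (weylOp_L h2 α)
  have hJ : ∀ f, J f = sym (α / 2) (α / 2) (gen (LRel k α) .b) (gen (LRel k α) .c) (hUnitL α) f :=
    fun _ => rfl
  let J' : H k ≃ₗc[k] L k α :=
    { J with
      counit_comp := LinearMap.ext fun f =>
        character_sym W (Bialgebra.counitAlgHom k (L k α)) counit_L_b counit_L_c counit_L_h f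
      map_comp_comul := LinearMap.ext fun f =>
        (sym_coaction W W W rfl rfl rfl (Bialgebra.comulAlgHom k (L k α)) comul_L_b comul_L_c
          comul_L_h comul_L_hInv f).symm }
  have hJ' : ∀ f, J' f = sym (α / 2) (α / 2) (gen (LRel k α) .b) (gen (LRel k α) .c) (hUnitL α) f :=
    fun _ => rfl
  have key : ∀ x f, J' f = x → J'.symm x = f := fun x f h => by
    rw [← h, CoalgEquiv.symm_apply_apply]
  refine ⟨J'.symm, key _ _ ?_, ?_, fun x y => key _ _ ?_⟩
  · rw [hJ', sym_one]
  · rintro (_ | _ | _ | _) <;> refine key _ _ ?_ <;> rw [hJ']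
    · rw [W.sym_gen_b]
    · rw [W.sym_gen_c]
    · rw [W.sym_gen_h]; rfl
    · rw [W.sym_gen_hInv]; rfl
  · rw [hJ', ← sym_mul_cocycle W, ← hJ', ← hJ', CoalgEquiv.apply_symm_apply,
      CoalgEquiv.apply_symm_apply]

end Deformations

/-! ### Operators of the generators on `H ⊗ U` -/

section Twists
variable {k : Type u} [Field k]

/-- The automorphism `b ↦ -λ²c`, `c ↦ -λ²b`, `h ↦ qh` of `H`. -/
def gTw (l q : kˣ) : H k →ₐ[k] H k :=
  presLift (LRel k 0)
    (fun
      | .b => -((l : k) ^ 2 • gen (LRel k 0) .c)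
      | .c => -((l : k) ^ 2 • gen (LRel k 0) .b)
      | .h => (q : k) • gen (LRel k 0) .h
      | .hInv => ((q⁻¹ : kˣ) : k) • gen (LRel k 0) .hInv) (by
    rintro _ _ (_ | _ | _ | _ | _)
    · simp [L_h_hInv, smul_smul]
    · simp [L_hInv_h, smul_smul]
    · simp [L_h_c, smul_smul, mul_comm]
    · simp [L_h_b, smul_smul, mul_comm]
    · simp [H_b_c])

/-- The automorphism `b ↦ λ⁴b`, `c ↦ λ⁴c`, `h ↦ -λ²h` of `H`. -/
def aTw (l : kˣ) : H k →ₐ[k] H k :=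
  presLift (LRel k 0)
    (fun
      | .b => (l : k) ^ 4 • gen (LRel k 0) .b
      | .c => (l : k) ^ 4 • gen (LRel k 0) .c
      | .h => -((l : k) ^ 2 • gen (LRel k 0) .h)
      | .hInv => -(((l⁻¹ : kˣ) : k) ^ 2 • gen (LRel k 0) .hInv)) (by
    have hl := l.ne_zero
    rintro _ _ (_ | _ | _ | _ | _)
    · simp [L_h_hInv, smul_smul, hl]
    · simp [L_hInv_h, smul_smul, hl]
    · simp [L_h_b, smul_smul, mul_comm]
    · simp [L_h_c, smul_smul, mul_comm]
    · simp [H_b_c])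

variable (l q : kˣ)

@[simp] theorem gTw_b : gTw l q (gen (LRel k 0) .b) = -((l : k) ^ 2 • gen (LRel k 0) .c) :=
  presLift_gen _ _ _ _
@[simp] theorem gTw_c : gTw l q (gen (LRel k 0) .c) = -((l : k) ^ 2 • gen (LRel k 0) .b) :=
  presLift_gen _ _ _ _
@[simp] theorem gTw_h : gTw l q (gen (LRel k 0) .h) = (q : k) • gen (LRel k 0) .h :=
  presLift_gen _ _ _ _
@[simp] theorem gTw_hInv : gTw l q (gen (LRel k 0) .hInv) =
    ((q⁻¹ : kˣ) : k) • gen (LRel k 0) .hInv :=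
  presLift_gen _ _ _ _
@[simp] theorem aTw_b : aTw l (gen (LRel k 0) .b) = (l : k) ^ 4 • gen (LRel k 0) .b :=
  presLift_gen _ _ _ _
@[simp] theorem aTw_c : aTw l (gen (LRel k 0) .c) = (l : k) ^ 4 • gen (LRel k 0) .c :=
  presLift_gen _ _ _ _
@[simp] theorem aTw_h : aTw l (gen (LRel k 0) .h) = -((l : k) ^ 2 • gen (LRel k 0) .h) :=
  presLift_gen _ _ _ _
@[simp] theorem aTw_hInv : aTw l (gen (LRel k 0) .hInv) =
    -(((l⁻¹ : kˣ) : k) ^ 2 • gen (LRel k 0) .hInv) :=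
  presLift_gen _ _ _ _

theorem gTw_inv (f : H k) : gTw l⁻¹ q⁻¹ (gTw l q f) = f := by
  have hl := l.ne_zero
  have : (gTw l⁻¹ q⁻¹).comp (gTw l q) = AlgHom.id k (H k) := by
    apply pres_ext
    rintro (_ | _ | _ | _) <;> simp [smul_smul, hl]
  exact DFunLike.congr_fun this f

theorem gTw_inv' (f : H k) : gTw l q (gTw l⁻¹ q⁻¹ f) = f := by
  simpa using gTw_inv l⁻¹ q⁻¹ f

theorem gTw_aTw (f : H k) : gTw l q (aTw l f) = aTw l (gTw l q f) := by
  have : (gTw l q).comp (aTw l) = (aTw l).comp (gTw l q) := by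
    apply pres_ext
    rintro (_ | _ | _ | _) <;> simp [smul_smul, mul_comm]
  exact DFunLike.congr_fun this f

theorem dC_gTw (f : H k) : dC k (gTw l q f) = -((l : k) ^ 2 • gTw l q (dB k f)) := by
  refine LinearMap.congr_fun (f := dC k ∘ₗ (gTw l q).toLinearMap)
    (g := -((l : k) ^ 2 • (gTw l q).toLinearMap ∘ₗ dB k)) (linearMap_ext_left ?_ fun x f hf => ?_) f
  · simp [dC_one, dB_one]
  · simp only [LinearMap.comp_apply, LinearMap.neg_apply, LinearMap.smul_apply,
      AlgHom.toLinearMap_apply] at hf ⊢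
    cases x
    · simp [dC_c, dB_b, hf, smul_smul]
    · simp [dC_b, dB_c, hf, smul_smul]
    · simp [dC_h, dB_h, hf, smul_smul, mul_comm]
    · simp [dC_hInv, dB_hInv, hf, smul_smul, mul_comm]

theorem dB_gTw (f : H k) : dB k (gTw l q f) = -((l : k) ^ 2 • gTw l q (dC k f)) := by
  refine LinearMap.congr_fun (f := dB k ∘ₗ (gTw l q).toLinearMap)
    (g := -((l : k) ^ 2 • (gTw l q).toLinearMap ∘ₗ dC k)) (linearMap_ext_left ?_ fun x f hf => ?_) f
  · simp [dC_one, dB_one]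
  · simp only [LinearMap.comp_apply, LinearMap.neg_apply, LinearMap.smul_apply,
      AlgHom.toLinearMap_apply] at hf ⊢
    cases x
    · simp [dB_c, dC_b, hf, smul_smul]
    · simp [dB_b, dC_c, hf, smul_smul]
    · simp [dB_h, dC_h, hf, smul_smul, mul_comm]
    · simp [dB_hInv, dC_hInv, hf, smul_smul, mul_comm]

theorem dC_aTw (f : H k) : dC k (aTw l f) = (l : k) ^ 4 • aTw l (dC k f) := by
  refine LinearMap.congr_fun (f := dC k ∘ₗ (aTw l).toLinearMap)
    (g := (l : k) ^ 4 • (aTw l).toLinearMap ∘ₗ dC k) (linearMap_ext_left ?_ fun x f hf => ?_) f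
  · simp [dC_one]
  · simp only [LinearMap.comp_apply, LinearMap.smul_apply, AlgHom.toLinearMap_apply] at hf ⊢
    cases x
    · simp [dC_b, hf, smul_smul]
    · simp [dC_c, hf, smul_smul]
    · simp [dC_h, hf, smul_smul, mul_comm]
    · simp [dC_hInv, hf, smul_smul, mul_comm]

theorem dB_aTw (f : H k) : dB k (aTw l f) = (l : k) ^ 4 • aTw l (dB k f) := by
  refine LinearMap.congr_fun (f := dB k ∘ₗ (aTw l).toLinearMap)
    (g := (l : k) ^ 4 • (aTw l).toLinearMap ∘ₗ dB k) (linearMap_ext_left ?_ fun x f hf => ?_) f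
  · simp [dB_one]
  · simp only [LinearMap.comp_apply, LinearMap.smul_apply, AlgHom.toLinearMap_apply] at hf ⊢
    cases x
    · simp [dB_b, hf, smul_smul]
    · simp [dB_c, hf, smul_smul]
    · simp [dB_h, hf, smul_smul, mul_comm]
    · simp [dB_hInv, hf, smul_smul, mul_comm]

variable (k) in
/-- The skew derivation `∂/∂b + ∂/∂c` of `H`. -/
def dD : H k →ₗ[k] H k := dB k + dC k

theorem dD_apply (f : H k) : dD k f = dB k f + dC k f := rfl

theorem dD_one : dD k 1 = 0 := by simp [dD_apply, dB_one, dC_one]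
theorem dD_b (f : H k) : dD k (gen (LRel k 0) .b * f) = f + gen (LRel k 0) .b * dD k f := by
  simp only [dD_apply, dB_b, dC_b, mul_add]; abel
theorem dD_c (f : H k) : dD k (gen (LRel k 0) .c * f) = f + gen (LRel k 0) .c * dD k f := by
  simp only [dD_apply, dB_c, dC_c, mul_add]; abel
theorem dD_h (f : H k) : dD k (gen (LRel k 0) .h * f) = -(gen (LRel k 0) .h * dD k f) := by
  simp only [dD_apply, dB_h, dC_h, mul_add, neg_add]
theorem dD_hInv (f : H k) : dD k (gen (LRel k 0) .hInv * f) = -(gen (LRel k 0) .hInv * dD k f) := by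
  simp only [dD_apply, dB_hInv, dC_hInv, mul_add, neg_add]
theorem dD_gTw (f : H k) : dD k (gTw l q f) = -((l : k) ^ 2 • gTw l q (dD k f)) := by
  simp only [dD_apply, dB_gTw, dC_gTw, map_add, smul_add]; abel
theorem dC_dD (f : H k) : dC k (dD k f) = dD k (dC k f) := by
  simp only [dD_apply, map_add, dB_dC]
theorem dB_dD (f : H k) : dB k (dD k f) = dD k (dB k f) := by
  simp only [dD_apply, map_add, dB_dC]
theorem dD_zH (s t : k) (f : H k) : dD k (zH s t * f) = zH s t * dD k f := by
  simp only [dD_apply, dB_zH, dC_zH, mul_add]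
theorem dC_hsq (f : H k) : dC k (gen (LRel k 0) .h ^ 2 * f) = gen (LRel k 0) .h ^ 2 * dC k f := by
  simp [pow_two, mul_assoc, dC_h]
theorem dB_hsq (f : H k) : dB k (gen (LRel k 0) .h ^ 2 * f) = gen (LRel k 0) .h ^ 2 * dB k f := by
  simp [pow_two, mul_assoc, dB_h]
/-- The conditions on the parameters under which the relations have a basis of monomials. -/
structure Admissible (s t : k) (l q : kˣ) (β β' : k) : Prop where
  s_mul : s * (1 + (l : k) ^ 4) = 0
  t_mul : t * (1 + (l : k) ^ 4) = 0
  β_mul : β * (1 - (l : k) ^ 2) = 0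
  β'_mul : β' * (1 - (l : k) ^ 2) = 0
  q_eq : q = 1 ∨ t = 0 ∧ β' = 0

variable {l q} {s t β β' : k}

theorem Admissible.s_eq (P : Admissible s t l q β β') : (l : k) ^ 4 * s = -s := by
  linear_combination P.s_mul
theorem Admissible.t_eq (P : Admissible s t l q β β') : (l : k) ^ 4 * t = -t := by
  linear_combination P.t_mul
theorem Admissible.β_eq (P : Admissible s t l q β β') : (l : k) ^ 2 * β = β := by
  linear_combination -P.β_mul
theorem Admissible.β'_eq (P : Admissible s t l q β β') : (l : k) ^ 2 * β' = β' := by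
  linear_combination -P.β'_mul
theorem Admissible.β_eq4 (P : Admissible s t l q β β') : (l : k) ^ 4 * β = β := by
  linear_combination (1 + (l : k) ^ 2) * P.β_eq
theorem Admissible.β'_eq4 (P : Admissible s t l q β β') : (l : k) ^ 4 * β' = β' := by
  linear_combination (1 + (l : k) ^ 2) * P.β'_eq
theorem Admissible.t_q (P : Admissible s t l q β β') (n : ℕ) : (q : k) ^ n * t = t := by
  rcases P.q_eq with h | ⟨h, -⟩ <;> simp [h]
theorem Admissible.β'_q (P : Admissible s t l q β β') (n : ℕ) : (q : k) ^ n * β' = β' := by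
  rcases P.q_eq with h | ⟨-, h⟩ <;> simp [h]

/-- Here `α(1 + λ⁴) = 0` enters. Conjugation by `g` exchanges `b` and `c` and multiplies `bc - cb`
by `-λ⁴`; the twist that belongs to `a` multiplies it by `λ⁸`. Both twists fix `z`, so consistency
requires `λ⁴z = -z`. -/
theorem Admissible.smul_zH (P : Admissible s t l q β β') : (l : k) ^ 4 • zH s t = -zH s t := by
  simp only [zH, smul_sub, smul_smul, P.s_eq, P.t_eq]; simp only [neg_smul]; abel

theorem Admissible.smul_zH_mul (P : Admissible s t l q β β') (f : H k) :
    (l : k) ^ 4 • (zH s t * f) = -(zH s t * f) := by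
  rw [← smul_mul_assoc, P.smul_zH, neg_mul]

theorem Admissible.gTw_zH (P : Admissible s t l q β β') : gTw l q (zH s t) = zH s t := by
  simp only [zH, map_sub, map_smul, map_one, map_pow, gTw_h, smul_pow, smul_smul]
  rw [mul_comm t, P.t_q]

theorem Admissible.aTw_zH (P : Admissible s t l q β β') : aTw l (zH s t) = zH s t := by
  simp only [zH, map_sub, map_smul, map_one, map_pow, aTw_h]
  rw [neg_pow, smul_pow, ← pow_mul, Even.neg_one_pow (by decide), one_mul, smul_smul]
  have : t * (l : k) ^ (2 * 4) = t := by linear_combination ((l : k) ^ 4 - 1) * P.t_eq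
  rw [this]

/-- If `β' ≠ 0`, then `q = 1` and `λ⁴ = 1`, and `gTw` is an involution. Up to the factor `β'`, then,
`g²` commutes with the image of `H`. -/
theorem Admissible.smul_gTw_gTw (P : Admissible s t l q β β') (f : H k) :
    β' • gTw l q (gTw l q f) = β' • f := by
  by_cases hβ : β' = 0
  · simp [hβ]
  · have hq : q = 1 := P.q_eq.resolve_right fun h => hβ h.2
    have hl : (l : k) ^ 4 = 1 := mul_right_cancel₀ hβ (by rw [P.β'_eq4, one_mul])
    have hl' : (l : k) ^ 2 * (l : k) ^ 2 = 1 := by rw [← hl]; ring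
    have : (gTw l q).comp (gTw l q) = AlgHom.id k (H k) := by
      apply pres_ext
      rintro (_ | _ | _ | _) <;> simp [smul_smul, hl', hq]
    rw [← AlgHom.comp_apply, this]; rfl

/-- The operators by which the generators of `A^λ_{α,β}` and `E^λ_{α,β}` act on `H ⊗ U`. -/
def pbwOp (s t : k) (l q : kˣ) (β β' : k) : EGen → Module.End k (H k ⊗[k] U k)
  | .a => β • (dD k).rTensor (U k) +
      TensorProduct.map (aTw l).toLinearMap (LinearMap.mulLeft k (gen (URel k) .a)) -
      β' • TensorProduct.map (LinearMap.mulLeft k (gen (LRel k 0) .h ^ 2) ∘ₗ dD k)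
        (LinearMap.mulLeft k (gen (URel k) .g ^ 2))
  | .b => (weylOp s t .b).rTensor (U k)
  | .c => (weylOp s t .c).rTensor (U k)
  | .h => (weylOp s t .h).rTensor (U k)
  | .hInv => (weylOp s t .hInv).rTensor (U k)
  | .g => TensorProduct.map (gTw l q).toLinearMap (LinearMap.mulLeft k (gen (URel k) .g))
  | .gInv => TensorProduct.map (gTw l⁻¹ q⁻¹).toLinearMap (LinearMap.mulLeft k (gen (URel k) .gInv))

theorem pbwOp_a (f : H k) (x : U k) : pbwOp s t l q β β' .a (f ⊗ₜ x) =
    β • (dD k f ⊗ₜ x) + aTw l f ⊗ₜ (gen (URel k) .a * x) -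
      β' • ((gen (LRel k 0) .h ^ 2 * dD k f) ⊗ₜ (gen (URel k) .g ^ 2 * x)) := rfl
theorem pbwOp_b (f : H k) (x : U k) : pbwOp s t l q β β' .b (f ⊗ₜ x) =
    weylOp s t .b f ⊗ₜ x := rfl
theorem pbwOp_c (f : H k) (x : U k) : pbwOp s t l q β β' .c (f ⊗ₜ x) =
    weylOp s t .c f ⊗ₜ x := rfl
theorem pbwOp_h (f : H k) (x : U k) : pbwOp s t l q β β' .h (f ⊗ₜ x) =
    (gen (LRel k 0) .h * f) ⊗ₜ x := rfl
theorem pbwOp_hInv (f : H k) (x : U k) : pbwOp s t l q β β' .hInv (f ⊗ₜ x) =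
    (gen (LRel k 0) .hInv * f) ⊗ₜ x := rfl
theorem pbwOp_g (f : H k) (x : U k) : pbwOp s t l q β β' .g (f ⊗ₜ x) =
    gTw l q f ⊗ₜ (gen (URel k) .g * x) := rfl
theorem pbwOp_gInv (f : H k) (x : U k) : pbwOp s t l q β β' .gInv (f ⊗ₜ x) =
    gTw l⁻¹ q⁻¹ f ⊗ₜ (gen (URel k) .gInv * x) := rfl

/-- Exchanging `b` and `c` turns `b + z∂_c` into a multiple of `c + λ⁴z∂_b`, which is `c - z∂_b`
because `λ⁴z = -z`. -/
theorem Admissible.gTw_weylOp_b (P : Admissible s t l q β β') (f : H k) :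
    gTw l q (weylOp s t .b f) = -((l : k) ^ 2 • weylOp s t .c (gTw l q f)) := by
  rw [weylOp_b, weylOp_c, map_add, map_mul, map_mul, P.gTw_zH, dB_gTw, gTw_b, mul_neg, sub_neg_eq_add,
    mul_smul_comm, smul_add, smul_smul, ← pow_add, P.smul_zH_mul, neg_mul, smul_mul_assoc]
  abel

theorem Admissible.gTw_weylOp_c (P : Admissible s t l q β β') (f : H k) :
    gTw l q (weylOp s t .c f) = -((l : k) ^ 2 • weylOp s t .b (gTw l q f)) := by
  rw [weylOp_b, weylOp_c, map_sub, map_mul, map_mul, P.gTw_zH, dC_gTw, gTw_c, mul_neg,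
    mul_smul_comm, smul_add, smul_neg, smul_smul, ← pow_add, P.smul_zH_mul, neg_mul, smul_mul_assoc]
  abel

theorem Admissible.aTw_weylOp_b (P : Admissible s t l q β β') (f : H k) :
    aTw l (weylOp s t .b f) = (l : k) ^ 4 • weylOp s t .b (aTw l f) := by
  rw [weylOp_b, weylOp_b, map_add, map_mul, map_mul, P.aTw_zH, dC_aTw, aTw_b,
    mul_smul_comm, smul_add, P.smul_zH_mul, smul_neg, P.smul_zH_mul, smul_mul_assoc, neg_neg]

theorem Admissible.aTw_weylOp_c (P : Admissible s t l q β β') (f : H k) :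
    aTw l (weylOp s t .c f) = (l : k) ^ 4 • weylOp s t .c (aTw l f) := by
  rw [weylOp_c, weylOp_c, map_sub, map_mul, map_mul, P.aTw_zH, dB_aTw, aTw_c,
    mul_smul_comm, smul_sub, P.smul_zH_mul, smul_neg, P.smul_zH_mul, smul_mul_assoc, neg_neg]

theorem dD_weylOp_b (f : H k) : dD k (weylOp s t .b f) = f + weylOp s t .b (dD k f) := by
  rw [weylOp_b, weylOp_b, map_add, dD_b, dD_zH, dC_dD, add_assoc]

theorem dD_weylOp_c (f : H k) : dD k (weylOp s t .c f) = f + weylOp s t .c (dD k f) := by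
  rw [weylOp_c, weylOp_c, map_sub, dD_c, dD_zH, dB_dD, add_sub_assoc]

theorem weylOp_b_hsq (f : H k) : weylOp s t .b (gen (LRel k 0) .h ^ 2 * f) =
    gen (LRel k 0) .h ^ 2 * weylOp s t .b f := by
  rw [weylOp_b, weylOp_b, dC_hsq, mul_add, ← mul_assoc, ← mul_assoc, ← mul_assoc, ← mul_assoc,
    hsq_comm, zH_comm]

theorem weylOp_c_hsq (f : H k) : weylOp s t .c (gen (LRel k 0) .h ^ 2 * f) =
    gen (LRel k 0) .h ^ 2 * weylOp s t .c f := by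
  rw [weylOp_c, weylOp_c, dB_hsq, mul_sub, ← mul_assoc, ← mul_assoc, ← mul_assoc, ← mul_assoc,
    hsq_comm, zH_comm]

/-- The inhomogeneous terms come from `D(bf) = f + b D(f)` with `D = ∂_b + ∂_c`, once for `β` and
once for `β'`. The factor `λ⁴` produced by `aTw` can be pulled out of the remaining terms because
`λ⁴β = β` and `λ⁴β' = β'`. -/
theorem Admissible.pbwOp_a_b (P : Admissible s t l q β β') (v : H k ⊗[k] U k) :
    pbwOp s t l q β β' .a (pbwOp s t l q β β' .b v) =
      (l : k) ^ 4 • pbwOp s t l q β β' .b (pbwOp s t l q β β' .a v) + β • v -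
      β' • pbwOp s t l q β β' .h (pbwOp s t l q β β' .h
        (pbwOp s t l q β β' .g (pbwOp s t l q β β' .g v))) := by
  induction v using TensorProduct.induction_on with
  | zero => simp
  | add x y hx hy => simp only [map_add, smul_add, hx, hy]; abel
  | tmul f x =>
    simp only [pbwOp_a, pbwOp_b, pbwOp_g, pbwOp_h, map_add, map_sub, map_smul, dD_weylOp_b,
      P.aTw_weylOp_b, weylOp_b_hsq, mul_add, TensorProduct.add_tmul, smul_add, smul_sub, smul_smul,
      P.β_eq4, P.β'_eq4, TensorProduct.smul_tmul']
    rw [← mul_assoc (gen (LRel k 0) .h), ← pow_two, ← mul_smul_comm β' _ (gTw l q (gTw l q f)),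
      P.smul_gTw_gTw, mul_smul_comm, ← mul_assoc (gen (URel k) .g), ← pow_two]
    abel

theorem Admissible.pbwOp_a_c (P : Admissible s t l q β β') (v : H k ⊗[k] U k) :
    pbwOp s t l q β β' .a (pbwOp s t l q β β' .c v) =
      (l : k) ^ 4 • pbwOp s t l q β β' .c (pbwOp s t l q β β' .a v) + β • v -
      β' • pbwOp s t l q β β' .h (pbwOp s t l q β β' .h
        (pbwOp s t l q β β' .g (pbwOp s t l q β β' .g v))) := by
  induction v using TensorProduct.induction_on with
  | zero => simp
  | add x y hx hy => simp only [map_add, smul_add, hx, hy]; abel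
  | tmul f x =>
    simp only [pbwOp_a, pbwOp_c, pbwOp_g, pbwOp_h, map_add, map_sub, map_smul, dD_weylOp_c,
      P.aTw_weylOp_c, weylOp_c_hsq, mul_add, TensorProduct.add_tmul, smul_add, smul_sub, smul_smul,
      P.β_eq4, P.β'_eq4, TensorProduct.smul_tmul']
    rw [← mul_assoc (gen (LRel k 0) .h), ← pow_two, ← mul_smul_comm β' _ (gTw l q (gTw l q f)),
      P.smul_gTw_gTw, mul_smul_comm, ← mul_assoc (gen (URel k) .g), ← pow_two]
    abel

theorem Admissible.pbwOp_basic (P : Admissible s t l q β β') ⦃x y : FreeAlgebra k EGen⦄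
    (h : BasicRel k l x y) : FreeAlgebra.lift k (pbwOp s t l q β β') x =
      FreeAlgebra.lift k (pbwOp s t l q β β') y := by
  rcases h with _ | _ | _ | _ | _ | _ | _ | _ | _ | _
  all_goals
    apply TensorProduct.ext'
    intro f x
    simp only [map_mul, map_neg, map_smul, map_one, FreeAlgebra.lift_ι_apply,
      Module.End.mul_apply, LinearMap.neg_apply, LinearMap.smul_apply, Module.End.one_apply]
  · simp only [pbwOp_h, pbwOp_hInv, assoc_rule L_h_hInv, one_mul]
  · simp only [pbwOp_h, pbwOp_hInv, assoc_rule L_hInv_h, one_mul]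
  · simp only [pbwOp_g, pbwOp_gInv, gTw_inv', assoc_rule U_g_gInv, one_mul]
  · simp only [pbwOp_g, pbwOp_gInv, gTw_inv, assoc_rule U_gInv_g, one_mul]
  · have e : ∀ v, gen (LRel k 0) .h ^ 2 * (gen (LRel k 0) .h * v) =
        gen (LRel k 0) .h * (gen (LRel k 0) .h ^ 2 * v) := fun v => by
      simp only [pow_two, mul_assoc]
    simp only [pbwOp_a, pbwOp_h, map_add, map_sub, map_smul, dD_h, map_mul, aTw_h, neg_mul, mul_neg,
      smul_mul_assoc, mul_smul_comm, TensorProduct.neg_tmul, smul_add, smul_sub, smul_smul, P.β_eq,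
      P.β'_eq, smul_neg, TensorProduct.smul_tmul', e]
    abel
  · rw [pbwOp_b, pbwOp_h, pbwOp_h, pbwOp_b, ← TensorProduct.neg_tmul]
    exact congrArg (· ⊗ₜ x) (weylOp_h_b s t f)
  · rw [pbwOp_c, pbwOp_h, pbwOp_h, pbwOp_c, ← TensorProduct.neg_tmul]
    exact congrArg (· ⊗ₜ x) (weylOp_h_c s t f)
  · have e : ∀ v, gen (URel k) .g * (gen (URel k) .g ^ 2 * v) =
        gen (URel k) .g ^ 2 * (gen (URel k) .g * v) := fun v => by
      simp only [pow_two, mul_assoc]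
    simp only [pbwOp_a, pbwOp_g, map_add, map_sub, map_smul, dD_gTw, map_mul, map_pow, gTw_h,
      gTw_aTw, smul_pow, neg_mul, mul_neg, assoc_rule U_g_a, mul_assoc, TensorProduct.tmul_neg, e,
      smul_mul_assoc, mul_smul_comm, TensorProduct.neg_tmul, smul_add, smul_sub, smul_smul,
      smul_neg, ← TensorProduct.smul_tmul']
    rw [mul_comm β, P.β_eq, mul_comm β' (_ ^ 2), P.β'_q, mul_comm β' (_ ^ 2), P.β'_eq]
    abel
  · rw [pbwOp_b, pbwOp_g, pbwOp_g, pbwOp_c, TensorProduct.smul_tmul', ← TensorProduct.neg_tmul,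
      P.gTw_weylOp_b]
  · rw [pbwOp_c, pbwOp_g, pbwOp_g, pbwOp_b, TensorProduct.smul_tmul', ← TensorProduct.neg_tmul,
      P.gTw_weylOp_c]

theorem pbwOp_b_c (v : H k ⊗[k] U k) :
    pbwOp s t l q β β' .b (pbwOp s t l q β β' .c v) =
      pbwOp s t l q β β' .c (pbwOp s t l q β β' .b v) +
        (2 : k) • (LinearMap.mulLeft k (zH s t)).rTensor (U k) v := by
  induction v using TensorProduct.induction_on with
  | zero => simp
  | add x y hx hy => simp only [map_add, smul_add, hx, hy]; abel
  | tmul f x =>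
    rw [pbwOp_b, pbwOp_c, pbwOp_c, pbwOp_b, weylOp_b_c, TensorProduct.add_tmul]; rfl

theorem pbwOp_g_h (v : H k ⊗[k] U k) :
    pbwOp s t l q β β' .g (pbwOp s t l q β β' .h v) =
      (q : k) • pbwOp s t l q β β' .h (pbwOp s t l q β β' .g v) := by
  induction v using TensorProduct.induction_on with
  | zero => simp
  | add x y hx hy => simp only [map_add, smul_add, hx, hy]
  | tmul f x =>
    simp only [pbwOp_h, pbwOp_g, map_mul, gTw_h, smul_mul_assoc, TensorProduct.smul_tmul']

end Twists

/-! ### Commutation of `a` and `g` with symmetrized elements -/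

section PBW
variable {k : Type u} [Field k] {R : Type*} [Ring R] [Algebra k R]

/-- The common form of the relations of `A^λ_{α,β}` and `E^λ_{α,β}`. -/
structure IsPBW (s t : k) (l q : kˣ) (β β' : k) (a b c : R) (h g : Rˣ) : Prop
    extends IsWeyl s t b c h where
  g_h : (g : R) * h = (q : k) • ((h : R) * g)
  a_h : a * h = -((l : k) ^ 2 • ((h : R) * a))
  g_a : (g : R) * a = -(a * g)
  g_b : (g : R) * b = -((l : k) ^ 2 • (c * g))
  g_c : (g : R) * c = -((l : k) ^ 2 • (b * g))
  a_b : a * b = (l : k) ^ 4 • (b * a) + β • 1 - β' • ((h : R) ^ 2 * (g : R) ^ 2)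
  a_c : a * c = (l : k) ^ 4 • (c * a) + β • 1 - β' • ((h : R) ^ 2 * (g : R) ^ 2)

/-- The algebra map `U → R` given by elements `a`, `g` with `ga = -ag`. -/
def uIncl {a : R} {g : Rˣ} (e : (g : R) * a = -(a * g)) : U k →ₐ[k] R :=
  presLift (URel k) (fun | .a => a | .g => g | .gInv => ((g⁻¹ : Rˣ) : R)) (by
    rintro _ _ (_ | _ | _) <;> simp [e])

@[simp] theorem uIncl_a {a : R} {g : Rˣ} (e : (g : R) * a = -(a * g)) :
    uIncl (k := k) e (gen (URel k) .a) = a := presLift_gen _ _ _ _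
@[simp] theorem uIncl_g {a : R} {g : Rˣ} (e : (g : R) * a = -(a * g)) :
    uIncl (k := k) e (gen (URel k) .g) = g := presLift_gen _ _ _ _
@[simp] theorem uIncl_gInv {a : R} {g : Rˣ} (e : (g : R) * a = -(a * g)) :
    uIncl (k := k) e (gen (URel k) .gInv) = ((g⁻¹ : Rˣ) : R) := presLift_gen _ _ _ _

variable {s t : k} {l q : kˣ} {β β' : k} {a b c : R} {h g : Rˣ}

theorem IsWeyl.sym_zH (W : IsWeyl s t b c h) (f : H k) : sym s t b c h (zH s t * f) =
    (s • 1 - t • (h : R) ^ 4) * sym s t b c h f := by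
  simp only [zH, sub_mul, smul_mul_assoc, one_mul, map_sub, map_smul, W.sym_hpow]

theorem IsPBW.g_z (D : IsPBW s t l q β β' a b c h g) (P : Admissible s t l q β β') :
    (g : R) * (s • 1 - t • (h : R) ^ 4) = (s • 1 - t • (h : R) ^ 4) * g := by
  have e : (g : R) * (h : R) ^ 4 = (q : k) ^ 4 • ((h : R) ^ 4 * g) := by
    simp only [pow_succ, pow_zero, one_mul, mul_assoc, D.g_h, assoc_rule D.g_h, smul_mul_assoc,
      mul_smul_comm, smul_smul]
  rw [mul_sub, sub_mul, mul_smul_comm, mul_smul_comm, smul_mul_assoc, smul_mul_assoc, e, smul_smul,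
    mul_comm t, P.t_q, mul_one, one_mul]

theorem IsPBW.a_z (D : IsPBW s t l q β β' a b c h g) (P : Admissible s t l q β β') :
    a * (s • 1 - t • (h : R) ^ 4) = (s • 1 - t • (h : R) ^ 4) * a := by
  have e : a * (h : R) ^ 4 = (l : k) ^ 8 • ((h : R) ^ 4 * a) := by
    simp only [pow_succ, pow_zero, one_mul, mul_assoc, D.a_h, assoc_rule D.a_h, smul_mul_assoc,
      mul_smul_comm, smul_smul, neg_mul, mul_neg, smul_neg, neg_neg]
  have e' : t * (l : k) ^ 8 = t := by linear_combination ((l : k) ^ 4 - 1) * P.t_eq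
  rw [mul_sub, sub_mul, mul_smul_comm, mul_smul_comm, smul_mul_assoc, smul_mul_assoc, e, smul_smul,
    e', mul_one, one_mul]

theorem Admissible.smul_z (P : Admissible s t l q β β') (h x : R) :
    (l : k) ^ 4 • ((s • 1 - t • h ^ 4) * x) = -((s • 1 - t • h ^ 4) * x) := by
  simp only [← smul_mul_assoc, ← neg_mul, smul_sub, smul_smul, P.s_eq, P.t_eq, neg_smul]
  congr 1; abel

theorem IsPBW.gInv_h (D : IsPBW s t l q β β' a b c h g) :
    (g : R) * ((h⁻¹ : Rˣ) : R) = ((q⁻¹ : kˣ) : k) • (((h⁻¹ : Rˣ) : R) * g) := by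
  calc (g : R) * ((h⁻¹ : Rˣ) : R) = ((h⁻¹ : Rˣ) : R) * ((q⁻¹ : kˣ) : k) • ((q : k) • ((h : R) * g)) *
        ((h⁻¹ : Rˣ) : R) := by simp [smul_smul]
    _ = _ := by rw [← D.g_h]; simp [mul_assoc]

theorem IsPBW.a_hInv (D : IsPBW s t l q β β' a b c h g) :
    a * ((h⁻¹ : Rˣ) : R) = -(((l⁻¹ : kˣ) : k) ^ 2 • (((h⁻¹ : Rˣ) : R) * a)) := by
  simpa using smul_comm_inv' (k := k) l2_ne h.mul_inv h.inv_mul D.a_h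

/-- Conjugation by `g` exchanges the recursions of `sym` for `b` and `c`, which differ by the sign
of `z`; the sign is supplied by `λ⁴z = -z`. -/
theorem IsPBW.g_sym (D : IsPBW s t l q β β' a b c h g) (P : Admissible s t l q β β') (f : H k) :
    g * sym s t b c h f = sym s t b c h (gTw l q f) * g := by
  have W := D.toIsWeyl
  refine LinearMap.congr_fun (f := LinearMap.mulLeft k (g : R) ∘ₗ sym s t b c h)
    (g := LinearMap.mulRight k (g : R) ∘ₗ sym s t b c h ∘ₗ (gTw l q).toLinearMap)
    (linearMap_ext_H ?_ ?_ ?_ ?_ ?_) f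
  · simp [sym_one]
  · intro f hf
    simp only [LinearMap.comp_apply, AlgHom.toLinearMap_apply, LinearMap.mulLeft_apply,
      LinearMap.mulRight_apply, map_mul, gTw_h, smul_mul_assoc, map_smul] at hf ⊢
    rw [W.sym_h, W.sym_h, ← mul_assoc, D.g_h, smul_mul_assoc, mul_assoc, mul_assoc, hf]
  · intro f hf
    simp only [LinearMap.comp_apply, AlgHom.toLinearMap_apply, LinearMap.mulLeft_apply,
      LinearMap.mulRight_apply, map_mul, gTw_hInv, smul_mul_assoc, map_smul] at hf ⊢
    rw [W.sym_hInv, W.sym_hInv, ← mul_assoc, D.gInv_h, smul_mul_assoc, mul_assoc, mul_assoc, hf]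
  · intro f hf hd
    simp only [LinearMap.comp_apply, AlgHom.toLinearMap_apply, LinearMap.mulLeft_apply,
      LinearMap.mulRight_apply, map_mul, gTw_b, smul_mul_assoc, neg_mul, map_neg, map_smul] at hf hd ⊢
    rw [sym_b, W.sym_c, mul_sub, ← mul_assoc, D.g_b, ← mul_assoc, D.g_z P, mul_assoc, hd, dB_gTw]
    simp only [neg_mul, smul_mul_assoc, mul_assoc, hf, map_neg, map_smul, mul_neg, mul_smul_comm,
      add_mul, smul_add, smul_neg, smul_smul, ← pow_add, P.smul_z]
    abel
  · intro f hf hd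
    simp only [LinearMap.comp_apply, AlgHom.toLinearMap_apply, LinearMap.mulLeft_apply,
      LinearMap.mulRight_apply, map_mul, gTw_c, smul_mul_assoc, neg_mul, map_neg, map_smul] at hf hd ⊢
    rw [sym_b, W.sym_c, mul_add, ← mul_assoc, D.g_c, ← mul_assoc, D.g_z P, mul_assoc, hd, dC_gTw]
    have hz := P.smul_z (h : R)
    generalize s • (1 : R) - t • (h : R) ^ 4 = z at hz ⊢
    simp only [neg_mul, smul_mul_assoc, mul_assoc, hf, map_neg, map_smul, mul_neg, mul_smul_comm,
      sub_mul, smul_sub, smul_neg, smul_smul, ← pow_add, hz]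
    abel

theorem IsPBW.gInv_sym (D : IsPBW s t l q β β' a b c h g) (P : Admissible s t l q β β') (f : H k) :
    ((g⁻¹ : Rˣ) : R) * sym s t b c h f = sym s t b c h (gTw l⁻¹ q⁻¹ f) * ((g⁻¹ : Rˣ) : R) := by
  have := D.g_sym P (gTw l⁻¹ q⁻¹ f)
  rw [gTw_inv'] at this
  calc ((g⁻¹ : Rˣ) : R) * sym s t b c h f
      = ((g⁻¹ : Rˣ) : R) * (sym s t b c h f * g) * ((g⁻¹ : Rˣ) : R) := by simp [mul_assoc]
    _ = _ := by rw [← this]; simp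

theorem IsPBW.gsq_sym (D : IsPBW s t l q β β' a b c h g) (P : Admissible s t l q β β') (f : H k) :
    β' • ((g : R) ^ 2 * sym s t b c h f) = β' • (sym s t b c h f * (g : R) ^ 2) := by
  rw [pow_two, mul_assoc, D.g_sym P, ← mul_assoc, D.g_sym P, mul_assoc, ← smul_mul_assoc, ← map_smul,
    P.smul_gTw_gTw, map_smul, smul_mul_assoc]

/-- Passing one factor `b` or `c` leaves behind `β - β'h²g²`, so the remainders add up to the skew
derivation `∂_b + ∂_c`. The factor `g²` is carried to the far right by `IsPBW.gsq_sym`. -/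
theorem IsPBW.a_sym (D : IsPBW s t l q β β' a b c h g) (P : Admissible s t l q β β') (f : H k) :
    a * sym s t b c h f = β • sym s t b c h (dD k f) + sym s t b c h (aTw l f) * a -
      β' • ((h : R) ^ 2 * sym s t b c h (dD k f) * (g : R) ^ 2) := by
  have W := D.toIsWeyl
  refine LinearMap.congr_fun (f := LinearMap.mulLeft k a ∘ₗ sym s t b c h)
    (g := β • sym s t b c h ∘ₗ dD k + LinearMap.mulRight k a ∘ₗ sym s t b c h ∘ₗ (aTw l).toLinearMap -
      β' • LinearMap.mulRight k ((g : R) ^ 2) ∘ₗ LinearMap.mulLeft k ((h : R) ^ 2) ∘ₗ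
        sym s t b c h ∘ₗ dD k)
    (linearMap_ext_H ?_ ?_ ?_ ?_ ?_) f
  · simp [sym_one, dD_one]
  · intro f hf
    simp only [LinearMap.comp_apply, AlgHom.toLinearMap_apply, LinearMap.mulLeft_apply,
      LinearMap.add_apply, LinearMap.sub_apply, LinearMap.smul_apply,
      LinearMap.mulRight_apply, map_mul, aTw_h, smul_mul_assoc, map_smul, dD_h, map_neg, neg_mul,
      W.sym_h] at hf ⊢
    rw [← mul_assoc, D.a_h, neg_mul, smul_mul_assoc, mul_assoc, hf]
    have e : ∀ v, (h : R) ^ 2 * (h * v) = h * ((h : R) ^ 2 * v) := fun v => by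
      simp only [pow_two, mul_assoc]
    simp only [mul_add, mul_sub, mul_smul_comm, smul_add, smul_sub, smul_smul, P.β_eq, P.β'_eq,
      smul_neg, mul_assoc, e, neg_mul, mul_neg]
    abel
  · intro f hf
    simp only [LinearMap.comp_apply, AlgHom.toLinearMap_apply, LinearMap.mulLeft_apply,
      LinearMap.add_apply, LinearMap.sub_apply, LinearMap.smul_apply,
      LinearMap.mulRight_apply, map_mul, aTw_hInv, smul_mul_assoc, map_smul, dD_hInv, map_neg, neg_mul,
      W.sym_hInv] at hf ⊢
    rw [← mul_assoc, D.a_hInv, neg_mul, smul_mul_assoc, mul_assoc, hf]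
    have e : ∀ v, (h : R) ^ 2 * (((h⁻¹ : Rˣ) : R) * v) = ((h⁻¹ : Rˣ) : R) * ((h : R) ^ 2 * v) :=
      fun v => by simp [pow_two, mul_assoc]
    have hl := l.ne_zero
    have e1 : ((l⁻¹ : kˣ) : k) ^ 2 * β = β := by
      nth_rw 1 [← P.β_eq]; rw [← mul_assoc, ← mul_pow, Units.inv_mul, one_pow, one_mul]
    have e2 : ((l⁻¹ : kˣ) : k) ^ 2 * β' = β' := by
      nth_rw 1 [← P.β'_eq]; rw [← mul_assoc, ← mul_pow, Units.inv_mul, one_pow, one_mul]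
    simp only [mul_add, mul_sub, mul_smul_comm, smul_add, smul_sub, smul_smul, e1, e2,
      smul_neg, mul_assoc, e, neg_mul, mul_neg]
    abel
  · intro f hf hd
    simp only [LinearMap.comp_apply, AlgHom.toLinearMap_apply, LinearMap.mulLeft_apply,
      LinearMap.add_apply, LinearMap.sub_apply, LinearMap.smul_apply,
      LinearMap.mulRight_apply, map_mul, aTw_b, smul_mul_assoc, map_smul, map_add, dD_b,
      sym_b, dC_aTw, dC_dD] at hf hd ⊢
    have e : ∀ v, (h : R) ^ 2 * (b * v) = b * ((h : R) ^ 2 * v) := fun v => by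
      simp only [pow_two, mul_assoc, W.h_b, assoc_rule W.h_b, neg_mul, mul_neg, neg_neg]
    have hz := P.smul_z (h : R)
    have e' : ∀ v, (h : R) ^ 2 * ((s • (1 : R) - t • (h : R) ^ 4) * v) = (s • (1 : R) - t • (h : R) ^ 4) * ((h : R) ^ 2 * v) :=
      fun v => by
        rw [← mul_assoc, ((show Commute (h : R) (s • (1 : R) - t • (h : R) ^ 4) from z_h.symm).pow_left 2).eq, mul_assoc]
    have e3 : β' • ((h : R) ^ 2 * ((g : R) ^ 2 * sym s t b c h f)) =
        β' • ((h : R) ^ 2 * (sym s t b c h f * (g : R) ^ 2)) := by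
      rw [← mul_smul_comm, D.gsq_sym P, mul_smul_comm]
    rw [mul_sub, ← mul_assoc, D.a_b, ← mul_assoc, D.a_z P, mul_assoc (s • (1 : R) - t • (h : R) ^ 4), hd]
    generalize s • (1 : R) - t • (h : R) ^ 4 = z at hz e' ⊢
    simp only [sub_mul, add_mul, smul_mul_assoc, one_mul, mul_assoc, hf, e3, mul_add, mul_sub,
      mul_smul_comm, smul_add, smul_sub, smul_smul, P.β_eq4, P.β'_eq4, e, e', hz, smul_neg, neg_mul, neg_neg]
    abel
  · intro f hf hd
    simp only [LinearMap.comp_apply, AlgHom.toLinearMap_apply, LinearMap.mulLeft_apply,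
      LinearMap.add_apply, LinearMap.sub_apply, LinearMap.smul_apply,
      LinearMap.mulRight_apply, map_mul, aTw_c, smul_mul_assoc, map_smul, map_add, dD_c,
      W.sym_c, dB_aTw, dB_dD] at hf hd ⊢
    have e : ∀ v, (h : R) ^ 2 * (c * v) = c * ((h : R) ^ 2 * v) := fun v => by
      simp only [pow_two, mul_assoc, W.h_c, assoc_rule W.h_c, neg_mul, mul_neg, neg_neg]
    have hz := P.smul_z (h : R)
    have e' : ∀ v, (h : R) ^ 2 * ((s • (1 : R) - t • (h : R) ^ 4) * v) = (s • (1 : R) - t • (h : R) ^ 4) * ((h : R) ^ 2 * v) :=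
      fun v => by
        rw [← mul_assoc, ((show Commute (h : R) (s • (1 : R) - t • (h : R) ^ 4) from z_h.symm).pow_left 2).eq, mul_assoc]
    have e3 : β' • ((h : R) ^ 2 * ((g : R) ^ 2 * sym s t b c h f)) =
        β' • ((h : R) ^ 2 * (sym s t b c h f * (g : R) ^ 2)) := by
      rw [← mul_smul_comm, D.gsq_sym P, mul_smul_comm]
    rw [← mul_assoc, D.a_c, ← mul_assoc a (_ - _), D.a_z P, mul_assoc (s • (1 : R) - t • (h : R) ^ 4), hd]
    generalize s • (1 : R) - t • (h : R) ^ 4 = z at hz e' ⊢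
    simp only [sub_mul, add_mul, smul_mul_assoc, one_mul, mul_assoc, hf, e3, mul_add, mul_sub,
      mul_smul_comm, smul_add, smul_sub, smul_smul, P.β_eq4, P.β'_eq4, e, e', hz, smul_neg, neg_mul, neg_neg]
    abel

/-- The linear map `f ⊗ x ↦ f x` from `H ⊗ U` to `R`, on symmetrized monomials. -/
def pbwMap (D : IsPBW s t l q β β' a b c h g) : H k ⊗[k] U k →ₗ[k] R :=
  LinearMap.mul' k R ∘ₗ TensorProduct.map (sym s t b c h) (uIncl D.g_a).toLinearMap

theorem pbwMap_tmul (D : IsPBW s t l q β β' a b c h g) (f : H k) (x : U k) :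
    pbwMap D (f ⊗ₜ x) = sym s t b c h f * uIncl D.g_a x := rfl

end PBW

/-! ### The Poincaré–Birkhoff–Witt isomorphism -/

section PBWEquiv
variable {k : Type u} [Field k] {r : FreeAlgebra k EGen → FreeAlgebra k EGen → Prop}
  {s t : k} {l q : kˣ} {β β' : k} {h g : (Pres r)ˣ}

/-- The operators `pbwOp` are read off from this identity: they are left multiplications by
generators, expressed on ordered products `sym(f) x`. -/
theorem pbwMap_pbwOp (D : IsPBW s t l q β β' (gen r .a) (gen r .b) (gen r .c) h g)
    (P : Admissible s t l q β β')
    (h1 : (h : Pres r) = gen r .h) (h2 : ((h⁻¹ : (Pres r)ˣ) : Pres r) = gen r .hInv)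
    (g1 : (g : Pres r) = gen r .g) (g2 : ((g⁻¹ : (Pres r)ˣ) : Pres r) = gen r .gInv)
    (x : EGen) (v : H k ⊗[k] U k) :
    pbwMap D (pbwOp s t l q β β' x v) = gen r x * pbwMap D v := by
  have W := D.toIsWeyl
  induction v using TensorProduct.induction_on with
  | zero => simp
  | add x y hx hy => simp only [map_add, mul_add, hx, hy]
  | tmul f y =>
    rcases x with _ | _ | _ | _ | _ | _ | _
    · simp only [pbwOp_a, map_add, map_sub, map_smul, pbwMap_tmul, W.sym_hpow, map_mul, uIncl_a,
        map_pow, uIncl_g]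
      rw [← mul_assoc (gen r .a), D.a_sym P]
      simp only [sub_mul, add_mul, smul_mul_assoc, mul_assoc]
    · rw [pbwOp_b, pbwMap_tmul, pbwMap_tmul, weylOp_b, map_add, sym_b, W.sym_zH, sub_add_cancel,
        mul_assoc]
    · rw [pbwOp_c, pbwMap_tmul, pbwMap_tmul, weylOp_c, map_sub, W.sym_c, W.sym_zH, add_sub_cancel_right,
        mul_assoc]
    · rw [pbwOp_h, pbwMap_tmul, pbwMap_tmul, W.sym_h, h1, mul_assoc]
    · rw [pbwOp_hInv, pbwMap_tmul, pbwMap_tmul, W.sym_hInv, h2, mul_assoc]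
    · rw [pbwOp_g, pbwMap_tmul, pbwMap_tmul, map_mul, uIncl_g, ← mul_assoc, ← mul_assoc, ← D.g_sym P, g1]
    · rw [pbwOp_gInv, pbwMap_tmul, pbwMap_tmul, map_mul, uIncl_gInv, ← mul_assoc, ← mul_assoc,
        ← D.gInv_sym P, g2]

/-- Acting on `1 ⊗ 1`, elements of `U` build up the second factor and leave the first one alone,
since the twists fix `1` and `D` kills it. Symmetrized elements then build up the first factor, the
corrections in `sym` cancelling those in `weylOp`. -/
theorem presLift_pbwMap (D : IsPBW s t l q β β' (gen r .a) (gen r .b) (gen r .c) h g)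
    (h1 : (h : Pres r) = gen r .h) (h2 : ((h⁻¹ : (Pres r)ˣ) : Pres r) = gen r .hInv)
    (g1 : (g : Pres r) = gen r .g) (g2 : ((g⁻¹ : (Pres r)ˣ) : Pres r) = gen r .gInv)
    (hT : ∀ ⦃x y⦄, r x y → FreeAlgebra.lift k (pbwOp s t l q β β') x =
      FreeAlgebra.lift k (pbwOp s t l q β β') y) (v : H k ⊗[k] U k) :
    presLift r (pbwOp s t l q β β') hT (pbwMap D v) (1 ⊗ₜ 1) = v := by
  have W := D.toIsWeyl
  have eU : ∀ x, presLift r (pbwOp s t l q β β') hT (uIncl D.g_a x) (1 ⊗ₜ 1) = 1 ⊗ₜ x := fun x => by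
    refine LinearMap.congr_fun (f := LinearMap.applyₗ ((1 : H k) ⊗ₜ[k] (1 : U k)) ∘ₗ
      (presLift r (pbwOp s t l q β β') hT).toLinearMap ∘ₗ (uIncl D.g_a).toLinearMap)
      (g := TensorProduct.mk k (H k) (U k) 1) (linearMap_ext_left ?_ fun x f hf => ?_) x
    · simp
    · simp only [LinearMap.comp_apply, AlgHom.toLinearMap_apply, LinearMap.applyₗ_apply_apply,
        TensorProduct.mk_apply] at hf ⊢
      cases x
      · rw [map_mul, uIncl_a, map_mul, presLift_gen, Module.End.mul_apply, hf, pbwOp_a, dD_one]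
        simp
      · rw [map_mul, uIncl_g, map_mul, g1, presLift_gen, Module.End.mul_apply, hf, pbwOp_g, map_one]
      · rw [map_mul, uIncl_gInv, map_mul, g2, presLift_gen, Module.End.mul_apply, hf, pbwOp_gInv,
          map_one]
  have eH : ∀ f x, presLift r (pbwOp s t l q β β') hT (sym s t (gen r .b) (gen r .c) h f) (1 ⊗ₜ x) =
      f ⊗ₜ x := fun f x => by
    refine LinearMap.congr_fun (f := LinearMap.applyₗ ((1 : H k) ⊗ₜ[k] x) ∘ₗ
      (presLift r (pbwOp s t l q β β') hT).toLinearMap ∘ₗ sym s t (gen r .b) (gen r .c) h)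
      (g := (TensorProduct.mk k (H k) (U k)).flip x) (linearMap_ext_H ?_ ?_ ?_ ?_ ?_) f
    · simp [sym_one]
    · intro f hf
      simp only [LinearMap.comp_apply, AlgHom.toLinearMap_apply, LinearMap.applyₗ_apply_apply,
        LinearMap.flip_apply, TensorProduct.mk_apply] at hf ⊢
      rw [W.sym_h, h1, map_mul, presLift_gen, Module.End.mul_apply, hf, pbwOp_h]
    · intro f hf
      simp only [LinearMap.comp_apply, AlgHom.toLinearMap_apply, LinearMap.applyₗ_apply_apply,
        LinearMap.flip_apply, TensorProduct.mk_apply] at hf ⊢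
      rw [W.sym_hInv, h2, map_mul, presLift_gen, Module.End.mul_apply, hf, pbwOp_hInv]
    · intro f hf hd
      simp only [LinearMap.comp_apply, AlgHom.toLinearMap_apply, LinearMap.applyₗ_apply_apply,
        LinearMap.flip_apply, TensorProduct.mk_apply] at hf hd ⊢
      rw [sym_b, h1]
      simp only [map_sub, map_mul, map_smul, map_pow, map_one, presLift_gen, LinearMap.sub_apply,
        Module.End.mul_apply, hf, hd, LinearMap.smul_apply, Module.End.one_apply, pbwOp_b, weylOp_b,
        zH, pow_succ, pow_zero, pbwOp_h, one_mul, mul_assoc, sub_mul, smul_mul_assoc,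
        TensorProduct.add_tmul, TensorProduct.sub_tmul, TensorProduct.smul_tmul']
      abel
    · intro f hf hd
      simp only [LinearMap.comp_apply, AlgHom.toLinearMap_apply, LinearMap.applyₗ_apply_apply,
        LinearMap.flip_apply, TensorProduct.mk_apply] at hf hd ⊢
      rw [W.sym_c, h1]
      simp only [map_sub, map_add, map_mul, map_smul, map_pow, map_one, presLift_gen,
        LinearMap.sub_apply, LinearMap.add_apply,
        Module.End.mul_apply, hf, hd, LinearMap.smul_apply, Module.End.one_apply, pbwOp_c, weylOp_c,
        zH, pow_succ, pow_zero, pbwOp_h, one_mul, mul_assoc, sub_mul, smul_mul_assoc,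
        TensorProduct.add_tmul, TensorProduct.sub_tmul, TensorProduct.smul_tmul']
      abel
  induction v using TensorProduct.induction_on with
  | zero => simp
  | add x y hx hy => simp only [map_add, LinearMap.add_apply, hx, hy]
  | tmul f x => rw [pbwMap_tmul, map_mul, Module.End.mul_apply, eU, eH]

/-- The Poincaré–Birkhoff–Witt isomorphism. -/
def pbwEquiv (D : IsPBW s t l q β β' (gen r .a) (gen r .b) (gen r .c) h g)
    (P : Admissible s t l q β β')
    (h1 : (h : Pres r) = gen r .h) (h2 : ((h⁻¹ : (Pres r)ˣ) : Pres r) = gen r .hInv)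
    (g1 : (g : Pres r) = gen r .g) (g2 : ((g⁻¹ : (Pres r)ˣ) : Pres r) = gen r .gInv)
    (hT : ∀ ⦃x y⦄, r x y → FreeAlgebra.lift k (pbwOp s t l q β β') x =
      FreeAlgebra.lift k (pbwOp s t l q β β') y) : H k ⊗[k] U k ≃ₗ[k] Pres r :=
  { pbwMap D with
    invFun := fun u => presLift r (pbwOp s t l q β β') hT u (1 ⊗ₜ 1)
    left_inv := presLift_pbwMap D h1 h2 g1 g2 hT
    right_inv := fun u => by
      have := presLift_apply_intertwine (pbwOp s t l q β β') hT (pbwMap D)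
        (pbwMap_pbwOp D P h1 h2 g1 g2) u (1 ⊗ₜ 1)
      rwa [pbwMap_tmul, sym_one, map_one, mul_one, mul_one] at this }

end PBWEquiv

/-! ### Ordered bases of `A^λ_{α,β}` and `E^λ_{α,β}` -/

section PBWInstances
variable {k : Type u} [Field k] {α β : k} {l : kˣ}

/-- The unit `h` of an algebra that satisfies the basic relations. -/
def hUnitP {r : FreeAlgebra k EGen → FreeAlgebra k EGen → Prop}
    (hr : ∀ ⦃x y⦄, BasicRel k l x y → r x y) : (Pres r)ˣ :=
  ⟨gen r .h, gen r .hInv, basic_h_hInv hr, basic_hInv_h hr⟩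

/-- The unit `g` of an algebra that satisfies the basic relations. -/
def gUnitP {r : FreeAlgebra k EGen → FreeAlgebra k EGen → Prop}
    (hr : ∀ ⦃x y⦄, BasicRel k l x y → r x y) : (Pres r)ˣ :=
  ⟨gen r .g, gen r .gInv, basic_g_gInv hr, basic_gInv_g hr⟩

/-- Here `t = β' = 0`: neither `h⁴` nor `h²g²` occurs in the relations, and so `q = λ` is not
restricted further. -/
theorem admissible_A (hα : α * (1 + (l : k) ^ 4) = 0) (hβ : β * (1 - (l : k) ^ 2) = 0) :
    Admissible (α / 2) 0 l l β 0 where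
  s_mul := by rw [div_mul_eq_mul_div, hα, zero_div]
  t_mul := zero_mul _
  β_mul := hβ
  β'_mul := zero_mul _
  q_eq := Or.inr ⟨rfl, rfl⟩

theorem admissible_E (hα : α * (1 + (l : k) ^ 4) = 0) (hβ : β * (1 - (l : k) ^ 2) = 0) :
    Admissible (α / 2) (α / 2) l 1 β β where
  s_mul := by rw [div_mul_eq_mul_div, hα, zero_div]
  t_mul := by rw [div_mul_eq_mul_div, hα, zero_div]
  β_mul := hβ
  β'_mul := hβ
  q_eq := Or.inl rfl

theorem isPBW_A (h2 : (2 : k) ≠ 0) (α β : k) (l : kˣ) : IsPBW (α / 2) 0 l l β 0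
    (gen (ARel k α β l) .a) (gen (ARel k α β l) .b) (gen (ARel k α β l) .c)
    (hUnitP A_basic) (gUnitP A_basic) where
  h_b := basic_h_b A_basic
  h_c := basic_h_c A_basic
  b_c := by rw [zero_smul, sub_zero, smul_smul, alpha_half h2, A_b_c]
  g_h := A_g_h
  a_h := basic_a_h A_basic
  g_a := basic_g_a A_basic
  g_b := basic_g_b A_basic
  g_c := basic_g_c A_basic
  a_b := by rw [zero_smul, sub_zero, A_a_b]
  a_c := by rw [zero_smul, sub_zero, A_a_c]

theorem E_gsq_hsq : gen (ERel k α β l) .g ^ 2 * gen (ERel k α β l) .h ^ 2 =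
    gen (ERel k α β l) .h ^ 2 * gen (ERel k α β l) .g ^ 2 :=
  ((show Commute (gen (ERel k α β l) .g) (gen (ERel k α β l) .h) from E_g_h).pow_pow 2 2).eq

theorem isPBW_E (h2 : (2 : k) ≠ 0) (α β : k) (l : kˣ) : IsPBW (α / 2) (α / 2) l 1 β β
    (gen (ERel k α β l) .a) (gen (ERel k α β l) .b) (gen (ERel k α β l) .c)
    (hUnitP E_basic) (gUnitP E_basic) where
  h_b := basic_h_b E_basic
  h_c := basic_h_c E_basic
  b_c := by rw [← smul_sub, smul_smul, alpha_half h2, E_b_c]; rfl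
  g_h := by rw [Units.val_one, one_smul]; exact E_g_h
  a_h := basic_a_h E_basic
  g_a := basic_g_a E_basic
  g_b := basic_g_b E_basic
  g_c := basic_g_c E_basic
  a_b := by rw [E_a_b, smul_sub, E_gsq_hsq, add_sub_assoc]; rfl
  a_c := by rw [E_a_c, smul_sub, E_gsq_hsq, add_sub_assoc]; rfl

theorem pbwOp_A (h2 : (2 : k) ≠ 0) (P : Admissible (α / 2) 0 l l β 0)
    ⦃x y : FreeAlgebra k EGen⦄ (h : ARel k α β l x y) :
    FreeAlgebra.lift k (pbwOp (α / 2) 0 l l β 0) x =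
      FreeAlgebra.lift k (pbwOp (α / 2) 0 l l β 0) y := by
  rcases h with h | _ | _ | _ | _
  · exact P.pbwOp_basic h
  all_goals
    refine LinearMap.ext fun v => ?_
    simp only [map_mul, map_neg, map_sub, map_smul, map_one, map_pow, FreeAlgebra.lift_ι_apply,
      Module.End.mul_apply, LinearMap.neg_apply, LinearMap.sub_apply, LinearMap.smul_apply,
      Module.End.one_apply]
  · exact pbwOp_g_h v
  · rw [P.pbwOp_a_b, zero_smul, sub_zero, add_sub_cancel_left]
  · rw [P.pbwOp_a_c, zero_smul, sub_zero, add_sub_cancel_left]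
  · rw [pbwOp_b_c, add_sub_cancel_left]
    induction v using TensorProduct.induction_on with
    | zero => simp
    | add x y hx hy => simp only [map_add, smul_add, hx, hy]
    | tmul f x => simp [zH, TensorProduct.smul_tmul', smul_smul, alpha_half h2]

theorem pbwOp_E (h2 : (2 : k) ≠ 0) (P : Admissible (α / 2) (α / 2) l 1 β β)
    ⦃x y : FreeAlgebra k EGen⦄ (h : ERel k α β l x y) :
    FreeAlgebra.lift k (pbwOp (α / 2) (α / 2) l 1 β β) x =
      FreeAlgebra.lift k (pbwOp (α / 2) (α / 2) l 1 β β) y := by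
  have hgh := fun v => pbwOp_g_h (s := α / 2) (t := α / 2) (l := l) (q := 1) (β := β) (β' := β) v
  simp only [Units.val_one, one_smul] at hgh
  rcases h with h | _ | _ | _ | _
  · exact P.pbwOp_basic h
  all_goals
    refine LinearMap.ext fun v => ?_
    simp only [map_mul, map_neg, map_sub, map_smul, map_one, map_pow, FreeAlgebra.lift_ι_apply,
      Module.End.mul_apply, LinearMap.neg_apply, LinearMap.sub_apply, LinearMap.smul_apply,
      Module.End.one_apply, pow_two]
  · exact hgh v
  · rw [P.pbwOp_a_b, smul_sub, hgh, hgh, hgh, hgh]; abel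
  · rw [P.pbwOp_a_c, smul_sub, hgh, hgh, hgh, hgh]; abel
  · rw [pbwOp_b_c, add_sub_cancel_left]
    induction v using TensorProduct.induction_on with
    | zero => simp
    | add x y hx hy => simp only [map_add, smul_add, hx, hy, smul_sub] ; abel
    | tmul f x =>
      rw [LinearMap.rTensor_tmul, LinearMap.mulLeft_apply, zH, ← smul_sub, smul_mul_assoc,
        TensorProduct.smul_tmul', smul_smul, alpha_half h2]
      simp [sub_mul, pow_succ, pbwOp_h, mul_assoc, TensorProduct.sub_tmul, smul_sub,
        TensorProduct.smul_tmul']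

variable (α β l)

/-- The linear isomorphism `H ⊗ U → A^λ_{α,β}`. -/
def equivA (h2 : (2 : k) ≠ 0) (hα : α * (1 + (l : k) ^ 4) = 0) (hβ : β * (1 - (l : k) ^ 2) = 0) :
    H k ⊗[k] U k ≃ₗ[k] Adef k α β l :=
  pbwEquiv (isPBW_A h2 α β l) (admissible_A hα hβ) rfl rfl rfl rfl
    (pbwOp_A h2 (admissible_A hα hβ))

/-- The linear isomorphism `H ⊗ U → E^λ_{α,β}`. -/
def equivE (h2 : (2 : k) ≠ 0) (hα : α * (1 + (l : k) ^ 4) = 0) (hβ : β * (1 - (l : k) ^ 2) = 0) :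
    H k ⊗[k] U k ≃ₗ[k] Edef k α β l :=
  pbwEquiv (isPBW_E h2 α β l) (admissible_E hα hβ) rfl rfl rfl rfl
    (pbwOp_E h2 (admissible_E hα hβ))

end PBWInstances

/-! ### Coactions in terms of the comultiplication of `H ⊗ U` -/

section Coactions
variable {k : Type u} [Field k] {R R' R'' : Type*} [Ring R] [Algebra k R] [Ring R'] [Algebra k R']
  [Ring R''] [Algebra k R'']

/-- An algebra map of the shape of a coaction corresponds to the comultiplication of `U` under the
inclusions of `U`. -/
theorem uIncl_coaction {a : R} {g : Rˣ} (e : (g : R) * a = -(a * g)) {a' : R'} {g' : R'ˣ}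
    (e' : (g' : R') * a' = -(a' * g')) {a'' : R''} {g'' : R''ˣ} (e'' : (g'' : R'') * a'' = -(a'' * g''))
    (ρ : R →ₐ[k] R' ⊗[k] R'') (ρa : ρ a = a' ⊗ₜ 1 + ((g' : R') ^ 2) ⊗ₜ a'')
    (ρg : ρ g = (g' : R') ⊗ₜ (g'' : R''))
    (ρi : ρ ((g⁻¹ : Rˣ) : R) = ((g'⁻¹ : R'ˣ) : R') ⊗ₜ ((g''⁻¹ : R''ˣ) : R'')) (x : U k) :
    ρ (uIncl e x) = Algebra.TensorProduct.map (uIncl e') (uIncl e'') (comul (R := k) x) := by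
  have : ρ.comp (uIncl e) =
      (Algebra.TensorProduct.map (uIncl e') (uIncl e'')).comp (Bialgebra.comulAlgHom k (U k)) := by
    apply pres_ext
    rintro (_ | _ | _) <;> simp [ρa, ρg, ρi]
  exact DFunLike.congr_fun this x

variable {s t s' t' s'' t'' : k} {l q l' q' l'' q'' : kˣ} {β β₁ β' β₁' β'' β₁'' : k}
  {a b c : R} {h g : Rˣ} {a' b' c' : R'} {h' g' : R'ˣ} {a'' b'' c'' : R''} {h'' g'' : R''ˣ}

/-- An algebra map of the shape of a coaction corresponds to the comultiplication of `H ⊗ U` under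
the Poincaré–Birkhoff–Witt maps. -/
theorem pbwMap_coaction (D : IsPBW s t l q β β₁ a b c h g) (D' : IsPBW s' t' l' q' β' β₁' a' b' c' h' g')
    (D'' : IsPBW s'' t'' l'' q'' β'' β₁'' a'' b'' c'' h'' g'')
    (hs : s' = s) (ht : t'' = t) (hst : t' = s'')
    (ρ : R →ₐ[k] R' ⊗[k] R'') (ρa : ρ a = a' ⊗ₜ 1 + ((g' : R') ^ 2) ⊗ₜ a'')
    (ρb : ρ b = b' ⊗ₜ 1 + ((h' : R') ^ 2) ⊗ₜ b'')
    (ρc : ρ c = c' ⊗ₜ 1 + ((h' : R') ^ 2) ⊗ₜ c'') (ρh : ρ h = (h' : R') ⊗ₜ (h'' : R''))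
    (ρhi : ρ ((h⁻¹ : Rˣ) : R) = ((h'⁻¹ : R'ˣ) : R') ⊗ₜ ((h''⁻¹ : R''ˣ) : R''))
    (ρg : ρ g = (g' : R') ⊗ₜ (g'' : R''))
    (ρgi : ρ ((g⁻¹ : Rˣ) : R) = ((g'⁻¹ : R'ˣ) : R') ⊗ₜ ((g''⁻¹ : R''ˣ) : R''))
    (v : H k ⊗[k] U k) :
    ρ (pbwMap D v) = TensorProduct.map (pbwMap D') (pbwMap D'') (comul (R := k) v) := by
  induction v using TensorProduct.induction_on with
  | zero => simp
  | add x y hx hy => simp only [map_add, hx, hy]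
  | tmul f x =>
    rw [pbwMap_tmul, map_mul, sym_coaction D.toIsWeyl D'.toIsWeyl D''.toIsWeyl hs ht hst ρ ρb ρc ρh ρhi,
      uIncl_coaction D.g_a D'.g_a D''.g_a ρ ρa ρg ρgi, TensorProduct.comul_tmul]
    generalize comul (R := k) f = F
    generalize comul (R := k) x = X
    induction F using TensorProduct.induction_on with
    | zero => simp
    | add p p' hp hp' => simp only [map_add, add_mul, TensorProduct.add_tmul, hp, hp']
    | tmul p p' =>
      induction X using TensorProduct.induction_on with
      | zero => simp
      | add p p' hp hp' => simp only [map_add, mul_add, TensorProduct.tmul_add, hp, hp']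
      | tmul y y' => simp [pbwMap_tmul]

end Coactions

section CoactionInstances
variable {k : Type u} [Field k] {α β : k} {l : kˣ}

theorem E_comul_equivE (h2 : (2 : k) ≠ 0) (hα : α * (1 + (l : k) ^ 4) = 0)
    (hβ : β * (1 - (l : k) ^ 2) = 0) (v : H k ⊗[k] U k) :
    comul (R := k) (equivE α β l h2 hα hβ v) =
      TensorProduct.map (equivE α β l h2 hα hβ).toLinearMap (equivE α β l h2 hα hβ).toLinearMap
        (comul (R := k) v) :=
  pbwMap_coaction (isPBW_E h2 α β l) (isPBW_E h2 α β l) (isPBW_E h2 α β l) rfl rfl rfl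
    (Bialgebra.comulAlgHom k (Edef k α β l)) (comul_E_gen .a) (comul_E_gen .b) (comul_E_gen .c)
    (comul_E_gen .h) (comul_E_gen .hInv) (comul_E_gen .g) (comul_E_gen .gInv) v

theorem E_counit_equivE (h2 : (2 : k) ≠ 0) (hα : α * (1 + (l : k) ^ 4) = 0)
    (hβ : β * (1 - (l : k) ^ 2) = 0) (v : H k ⊗[k] U k) :
    counit (R := k) (equivE α β l h2 hα hβ v) = counit (R := k) v := by
  induction v using TensorProduct.induction_on with
  | zero => simp
  | add x y hx hy => simp only [map_add, hx, hy]
  | tmul f x =>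
    have e1 := character_sym (isPBW_E h2 α β l).toIsWeyl (Bialgebra.counitAlgHom k (Edef k α β l))
      counit_E_b counit_E_c counit_E_h f
    have e2 : (Bialgebra.counitAlgHom k (Edef k α β l)).comp (uIncl (isPBW_E h2 α β l).g_a) =
        Bialgebra.counitAlgHom k (U k) := by
      apply pres_ext
      rintro (_ | _ | _)
      · simp
      · rw [AlgHom.comp_apply, uIncl_g]; exact (counit_E_g (α := α) (β := β) (l := l)).trans counit_U_g.symm
      · rw [AlgHom.comp_apply, uIncl_gInv]
        exact (counit_E_gInv (α := α) (β := β) (l := l)).trans counit_U_gInv.symm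
    have e3 := DFunLike.congr_fun e2 x
    change counit (R := k) (pbwMap (isPBW_E h2 α β l) (f ⊗ₜ x)) = _
    rw [pbwMap_tmul, Bialgebra.counit_mul]
    simp only [Bialgebra.counitAlgHom_apply, AlgHom.comp_apply] at e1 e3
    rw [e1, e3, TensorProduct.counit_tmul, smul_eq_mul, mul_comm]

@[simp] theorem inclH_b : inclH (gen (LRel k 0) .b) = gen (ERel k 0 0 1) .b := presLift_gen _ _ _ _
@[simp] theorem inclH_c : inclH (gen (LRel k 0) .c) = gen (ERel k 0 0 1) .c := presLift_gen _ _ _ _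
@[simp] theorem inclH_h : inclH (gen (LRel k 0) .h) = gen (ERel k 0 0 1) .h := presLift_gen _ _ _ _
@[simp] theorem inclH_hInv : inclH (gen (LRel k 0) .hInv) = gen (ERel k 0 0 1) .hInv := presLift_gen _ _ _ _
@[simp] theorem inclU_a : inclU (gen (URel k) .a) = gen (ERel k 0 0 1) .a := presLift_gen _ _ _ _
@[simp] theorem inclU_g : inclU (gen (URel k) .g) = gen (ERel k 0 0 1) .g := presLift_gen _ _ _ _
@[simp] theorem inclU_gInv : inclU (gen (URel k) .gInv) = gen (ERel k 0 0 1) .gInv := presLift_gen _ _ _ _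

/-- For `z = 0` the generators `b` and `c` commute and symmetrization is just the algebra map. The
parameters have the form `0 / 2` because they are `α / 2` at `α = 0`. -/
theorem sym_zero_eq_inclH (h2 : (2 : k) ≠ 0) (f : H k) :
    sym (0 / 2) (0 / 2) (gen (ERel k 0 0 1) .b) (gen (ERel k 0 0 1) .c) (hUnitP E_basic) f =
      inclH f := by
  have W := (isPBW_E h2 (0 : k) 0 1).toIsWeyl
  refine LinearMap.congr_fun (g := inclH.toLinearMap) (linearMap_ext_H ?_ ?_ ?_ ?_ ?_) f
  · simp [sym_one]
  · intro f hf
    rw [W.sym_h, hf, AlgHom.toLinearMap_apply, AlgHom.toLinearMap_apply, map_mul]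
    rw [inclH_h]; rfl
  · intro f hf
    rw [W.sym_hInv, hf, AlgHom.toLinearMap_apply, AlgHom.toLinearMap_apply, map_mul]
    rw [inclH_hInv]; rfl
  · intro f hf hd
    rw [sym_b, hf, AlgHom.toLinearMap_apply, AlgHom.toLinearMap_apply, map_mul, zero_div, zero_smul,
      zero_smul, sub_zero, zero_mul, sub_zero]
    rw [inclH_b]
  · intro f hf hd
    rw [W.sym_c, hf, AlgHom.toLinearMap_apply, AlgHom.toLinearMap_apply, map_mul, zero_div, zero_smul,
      zero_smul, sub_zero, zero_mul, add_zero]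
    rw [inclH_c]

theorem uIncl_eq_inclU (h2 : (2 : k) ≠ 0) : uIncl (isPBW_E h2 (0 : k) 0 1).g_a = inclU := by
  apply pres_ext
  rintro (_ | _ | _)
  · rw [uIncl_a, inclU_a]
  · rw [uIncl_g, inclU_g]; rfl
  · rw [uIncl_gInv, inclU_gInv]; rfl

theorem equivE_zero (h2 : (2 : k) ≠ 0) :
    (equivE (0 : k) 0 1 h2 (zero_mul _) (zero_mul _)).toLinearMap = factor := by
  apply TensorProduct.ext'
  intro f x
  change pbwMap (isPBW_E h2 (0 : k) 0 1) (f ⊗ₜ x) = _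
  rw [pbwMap_tmul, sym_zero_eq_inclH h2, uIncl_eq_inclU h2]
  rfl

/-- The parameters `(s, t)` of the Weyl relation compose as `(α/2, 0) → (α/2, 0) ⊗ (0, 0)` here, and
as `(α/2, 0) → (α/2, α/2) ⊗ (α/2, 0)` for the left coaction. -/
theorem rightCoaction_equivA (h2 : (2 : k) ≠ 0) (hα : α * (1 + (l : k) ^ 4) = 0)
    (hβ : β * (1 - (l : k) ^ 2) = 0) (v : H k ⊗[k] U k) :
    rightCoaction α β l (equivA α β l h2 hα hβ v) =
      TensorProduct.map (equivA α β l h2 hα hβ).toLinearMap factor (comul (R := k) v) := by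
  rw [← equivE_zero h2]
  exact pbwMap_coaction (isPBW_A h2 α β l) (isPBW_A h2 α β l) (isPBW_E h2 0 0 1) rfl (zero_div _)
    (zero_div _).symm (rightCoaction α β l) (presLift_gen _ _ _ _) (presLift_gen _ _ _ _)
    (presLift_gen _ _ _ _) (presLift_gen _ _ _ _) (presLift_gen _ _ _ _) (presLift_gen _ _ _ _)
    (presLift_gen _ _ _ _) v

theorem leftCoaction_equivA (h2 : (2 : k) ≠ 0) (hα : α * (1 + (l : k) ^ 4) = 0)
    (hβ : β * (1 - (l : k) ^ 2) = 0) (v : H k ⊗[k] U k) :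
    leftCoaction α β l (equivA α β l h2 hα hβ v) =
      TensorProduct.map (equivE α β l h2 hα hβ).toLinearMap (equivA α β l h2 hα hβ).toLinearMap
        (comul (R := k) v) :=
  pbwMap_coaction (isPBW_A h2 α β l) (isPBW_E h2 α β l) (isPBW_A h2 α β l) rfl rfl rfl
    (leftCoaction α β l) (presLift_gen _ _ _ _) (presLift_gen _ _ _ _)
    (presLift_gen _ _ _ _) (presLift_gen _ _ _ _) (presLift_gen _ _ _ _) (presLift_gen _ _ _ _)
    (presLift_gen _ _ _ _) v

end CoactionInstances

/-! ### Reordering a product `x f` as a sum of products `f x` -/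

section Swap
variable {k : Type u} [Field k] {R R' R'' : Type*} [Ring R] [Algebra k R] [Ring R'] [Algebra k R']
  [Ring R''] [Algebra k R'']
  {s t s' t' s'' t'' : k} {l q l' q' l'' q'' : kˣ} {β β₁ β' β₁' β'' β₁'' : k}
  {a b c : R} {h g : Rˣ} {a' b' c' : R'} {h' g' : R'ˣ} {a'' b'' c'' : R''} {h'' g'' : R''ˣ}

/-- The linear map `f ⊗ x ↦ x f` from `H ⊗ U` to `R`, on symmetrized monomials. -/
def swapMap (D : IsPBW s t l q β β₁ a b c h g) : H k ⊗[k] U k →ₗ[k] R :=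
  LinearMap.mul' k R ∘ₗ (TensorProduct.comm k R R).toLinearMap ∘ₗ
    TensorProduct.map (sym s t b c h) (uIncl D.g_a).toLinearMap

theorem swapMap_tmul (D : IsPBW s t l q β β₁ a b c h g) (f : H k) (x : U k) :
    swapMap D (f ⊗ₜ x) = uIncl D.g_a x * sym s t b c h f := rfl

theorem swapMap_coaction (D : IsPBW s t l q β β₁ a b c h g) (D' : IsPBW s' t' l' q' β' β₁' a' b' c' h' g')
    (D'' : IsPBW s'' t'' l'' q'' β'' β₁'' a'' b'' c'' h'' g'')
    (hs : s' = s) (ht : t'' = t) (hst : t' = s'')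
    (ρ : R →ₐ[k] R' ⊗[k] R'') (ρa : ρ a = a' ⊗ₜ 1 + ((g' : R') ^ 2) ⊗ₜ a'')
    (ρb : ρ b = b' ⊗ₜ 1 + ((h' : R') ^ 2) ⊗ₜ b'')
    (ρc : ρ c = c' ⊗ₜ 1 + ((h' : R') ^ 2) ⊗ₜ c'') (ρh : ρ h = (h' : R') ⊗ₜ (h'' : R''))
    (ρhi : ρ ((h⁻¹ : Rˣ) : R) = ((h'⁻¹ : R'ˣ) : R') ⊗ₜ ((h''⁻¹ : R''ˣ) : R''))
    (ρg : ρ g = (g' : R') ⊗ₜ (g'' : R''))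
    (ρgi : ρ ((g⁻¹ : Rˣ) : R) = ((g'⁻¹ : R'ˣ) : R') ⊗ₜ ((g''⁻¹ : R''ˣ) : R''))
    (v : H k ⊗[k] U k) :
    ρ (swapMap D v) = TensorProduct.map (swapMap D') (swapMap D'') (comul (R := k) v) := by
  induction v using TensorProduct.induction_on with
  | zero => simp
  | add x y hx hy => simp only [map_add, hx, hy]
  | tmul f x =>
    rw [swapMap_tmul, map_mul, sym_coaction D.toIsWeyl D'.toIsWeyl D''.toIsWeyl hs ht hst ρ ρb ρc ρh ρhi,
      uIncl_coaction D.g_a D'.g_a D''.g_a ρ ρa ρg ρgi, TensorProduct.comul_tmul]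
    generalize comul (R := k) f = F
    generalize comul (R := k) x = X
    induction F using TensorProduct.induction_on with
    | zero => simp
    | add p p' hp hp' => simp only [map_add, mul_add, TensorProduct.add_tmul, hp, hp']
    | tmul p p' =>
      induction X using TensorProduct.induction_on with
      | zero => simp
      | add p p' hp hp' => simp only [map_add, add_mul, TensorProduct.tmul_add, hp, hp']
      | tmul y y' => simp [swapMap_tmul]

/-- The map `f ⊗ x ↦ Σ fᵢ ⊗ xᵢ` for which `x f = Σ fᵢ xᵢ`, given the inverse of `f ⊗ x ↦ f x`. -/
def swapN (D : IsPBW s t l q β β₁ a b c h g) (I : H k ⊗[k] U k ≃ₗ[k] R) :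
    H k ⊗[k] U k →ₗ[k] H k ⊗[k] U k :=
  I.symm.toLinearMap ∘ₗ swapMap D

variable {D : IsPBW s t l q β β₁ a b c h g} {I : H k ⊗[k] U k ≃ₗ[k] R}

theorem apply_swapN (v : H k ⊗[k] U k) : I (swapN D I v) = swapMap D v :=
  I.apply_symm_apply _

theorem swapN_one (hI : ∀ v, I v = pbwMap D v) (f : H k) : swapN D I (f ⊗ₜ 1) = f ⊗ₜ 1 := by
  apply I.injective
  rw [apply_swapN, hI, swapMap_tmul, pbwMap_tmul, map_one, mul_one, one_mul]

theorem apply_lTensor_mulRight (hI : ∀ v, I v = pbwMap D v) (v : H k ⊗[k] U k) (y : U k) :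
    I ((LinearMap.mulRight k y).lTensor (H k) v) = I v * uIncl D.g_a y := by
  rw [hI, hI]
  induction v using TensorProduct.induction_on with
  | zero => simp
  | add p p' hp hp' => simp only [map_add, add_mul, hp, hp']
  | tmul f x => simp [pbwMap_tmul, mul_assoc]

/-- Generators are peeled off the right end of `x`, because the last letter of `x` is the one that
meets `f`. This makes reordering a recursion in the second argument. -/
theorem swapN_mul_g (hI : ∀ v, I v = pbwMap D v) (P : Admissible s t l q β β₁) (f : H k) (y : U k) :
    swapN D I (f ⊗ₜ (y * gen (URel k) .g)) =
      (LinearMap.mulRight k (gen (URel k) .g)).lTensor (H k) (swapN D I (gTw l q f ⊗ₜ y)) := by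
  apply I.injective
  rw [apply_swapN, apply_lTensor_mulRight hI, apply_swapN, swapMap_tmul, swapMap_tmul, map_mul,
    uIncl_g, mul_assoc, mul_assoc, D.g_sym P]

theorem swapN_mul_gInv (hI : ∀ v, I v = pbwMap D v) (P : Admissible s t l q β β₁) (f : H k) (y : U k) :
    swapN D I (f ⊗ₜ (y * gen (URel k) .gInv)) =
      (LinearMap.mulRight k (gen (URel k) .gInv)).lTensor (H k) (swapN D I (gTw l⁻¹ q⁻¹ f ⊗ₜ y)) := by
  apply I.injective
  rw [apply_swapN, apply_lTensor_mulRight hI, apply_swapN, swapMap_tmul, swapMap_tmul, map_mul,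
    uIncl_gInv, mul_assoc, mul_assoc, D.gInv_sym P]

/-- Without the term `β'h²g²` the letter `a` leaves only a skew derivation behind. This covers
`A^λ_{α,β}` and `E`; for the general `E^λ_{α,β}` the reordering map is found by convolution in
`swapE_eq`. -/
theorem swapN_mul_a {D : IsPBW s t l q β 0 a b c h g} (hI : ∀ v, I v = pbwMap D v)
    (P : Admissible s t l q β 0) (f : H k) (y : U k) :
    swapN D I (f ⊗ₜ (y * gen (URel k) .a)) = β • swapN D I (dD k f ⊗ₜ y) +
      (LinearMap.mulRight k (gen (URel k) .a)).lTensor (H k) (swapN D I (aTw l f ⊗ₜ y)) := by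
  apply I.injective
  rw [map_add, map_smul, apply_swapN, apply_lTensor_mulRight hI, apply_swapN, apply_swapN,
    swapMap_tmul, swapMap_tmul, swapMap_tmul, map_mul, uIncl_a, mul_assoc, mul_assoc, D.a_sym P,
    zero_smul, sub_zero, mul_add, mul_smul_comm]

/-- In `(f x)(f' x') = f (x f') x'` only the inner product needs reordering; the outer ones are the
product `m` on `H`, to which `sym` is adapted, and the product of `U`. -/
theorem pbwMap_mul {m : H k ⊗[k] H k →ₗ[k] H k}
    (hm : ∀ f f', sym s t b c h f * sym s t b c h f' = sym s t b c h (m (f ⊗ₜ f')))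
    (hI : ∀ v, I v = pbwMap D v) (u v : H k ⊗[k] U k) :
    I u * I v = I (twistedMul m (swapN D I ∘ₗ (TensorProduct.comm k (U k) (H k)).toLinearMap)
      (u ⊗ₜ v)) := by
  induction u using TensorProduct.induction_on with
  | zero => simp
  | add p p' hp hp' => simp only [map_add, add_mul, TensorProduct.add_tmul, hp, hp']
  | tmul f x =>
    induction v using TensorProduct.induction_on with
    | zero => simp
    | add p p' hp hp' => simp only [map_add, mul_add, TensorProduct.tmul_add, hp, hp']
    | tmul f' x' =>
      have e : I (f ⊗ₜ x) * I (f' ⊗ₜ x') = sym s t b c h f * I (swapN D I (f' ⊗ₜ x)) *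
          uIncl D.g_a x' := by
        rw [apply_swapN, hI, hI, pbwMap_tmul, pbwMap_tmul, swapMap_tmul]
        simp only [mul_assoc]
      rw [e]
      simp only [twistedMul, LinearMap.comp_apply, LinearEquiv.coe_coe, TensorProduct.assoc_tmul,
        LinearMap.lTensor_tmul, TensorProduct.assoc_symm_tmul, LinearMap.rTensor_tmul,
        TensorProduct.comm_tmul]
      induction swapN D I (f' ⊗ₜ x) using TensorProduct.induction_on with
      | zero => simp
      | add p p' hp hp' =>
        simp only [map_add, mul_add, add_mul, TensorProduct.tmul_add, TensorProduct.add_tmul, hp, hp']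
      | tmul p y =>
        simp only [TensorProduct.assoc_tmul, TensorProduct.assoc_symm_tmul, TensorProduct.map_tmul,
          LinearMap.mul'_apply, hI, pbwMap_tmul, map_mul, ← hm, mul_assoc]

/-- The comultiplication intertwines the swap maps, if it intertwines the coactions. -/
theorem comul_swapN {D' : IsPBW s' t' l' q' β' β₁' a' b' c' h' g'}
    {D'' : IsPBW s'' t'' l'' q'' β'' β₁'' a'' b'' c'' h'' g''}
    {I' : H k ⊗[k] U k ≃ₗ[k] R'} {I'' : H k ⊗[k] U k ≃ₗ[k] R''} (ρ : R →ₐ[k] R' ⊗[k] R'')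
    (hρ : ∀ v, ρ (I v) = TensorProduct.map I'.toLinearMap I''.toLinearMap (comul (R := k) v))
    (hρ' : ∀ v, ρ (swapMap D v) = TensorProduct.map (swapMap D') (swapMap D'') (comul (R := k) v)) :
    comul ∘ₗ swapN D I = TensorProduct.map (swapN D' I') (swapN D'' I'') ∘ₗ comul (R := k) := by
  refine LinearMap.ext fun v => ?_
  have h1 := hρ (swapN D I v)
  rw [apply_swapN, hρ'] at h1
  apply (TensorProduct.congr I' I'').injective
  change TensorProduct.map I'.toLinearMap I''.toLinearMap _ =
    TensorProduct.map I'.toLinearMap I''.toLinearMap _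
  have e : TensorProduct.map I'.toLinearMap I''.toLinearMap ∘ₗ
      TensorProduct.map (swapN D' I') (swapN D'' I'') = TensorProduct.map (swapMap D') (swapMap D'') := by
    rw [← TensorProduct.map_comp]
    congr 1
    · exact LinearMap.ext fun v => apply_swapN v
    · exact LinearMap.ext fun v => apply_swapN v
  rw [LinearMap.comp_apply, ← h1, ← e]
  rfl

end Swap

/-! ### Maps determined by their marginals -/

section Marginals
variable {k : Type u} [Field k]

variable (k) in
/-- `f ⊗ x ↦ ε(x) f`. -/
def pH : H k ⊗[k] U k →ₗ[k] H k :=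
  (TensorProduct.rid k (H k)).toLinearMap ∘ₗ counit.lTensor (H k)

variable (k) in
/-- `f ⊗ x ↦ ε(f) x`. -/
def pU : H k ⊗[k] U k →ₗ[k] U k :=
  (TensorProduct.lid k (U k)).toLinearMap ∘ₗ counit.rTensor (U k)

theorem pH_tmul (f : H k) (x : U k) : pH k (f ⊗ₜ x) = counit (R := k) x • f := by
  simp [pH]
theorem pU_tmul (f : H k) (x : U k) : pU k (f ⊗ₜ x) = counit (R := k) f • x := by
  simp [pU]

theorem map_pH_pU_comul (v : H k ⊗[k] U k) : TensorProduct.map (pH k) (pU k) (comul (R := k) v) = v := by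
  induction v using TensorProduct.induction_on with
  | zero => simp
  | add p p' hp hp' => simp only [map_add, hp, hp']
  | tmul f x =>
    have h1 := congrArg (TensorProduct.rid k (H k)) (Coalgebra.lTensor_counit_comul (R := k) f)
    have h2 := congrArg (TensorProduct.lid k (U k)) (Coalgebra.rTensor_counit_comul (R := k) x)
    rw [TensorProduct.rid_tmul, one_smul] at h1
    rw [TensorProduct.lid_tmul, one_smul] at h2
    rw [TensorProduct.comul_tmul]
    conv_rhs => rw [← h1, ← h2]
    generalize comul (R := k) f = F
    generalize comul (R := k) x = X
    induction F using TensorProduct.induction_on with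
    | zero => simp
    | add p p' hp hp' => simp only [map_add, TensorProduct.add_tmul, hp, hp']
    | tmul p p' =>
      induction X using TensorProduct.induction_on with
      | zero => simp
      | add p p' hp hp' => simp only [map_add, TensorProduct.tmul_add, hp, hp']
      | tmul y y' =>
        simp only [TensorProduct.AlgebraTensorModule.tensorTensorTensorComm_tmul, TensorProduct.map_tmul, pH_tmul, pU_tmul,
          LinearMap.lTensor_tmul, LinearMap.rTensor_tmul, TensorProduct.rid_tmul, TensorProduct.lid_tmul]
        simp only [TensorProduct.smul_tmul, smul_smul, mul_comm, TensorProduct.tmul_smul,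
          ← TensorProduct.smul_tmul']

/-- A map that is compatible with the comultiplications is determined by its marginals. -/
theorem eq_omega_of_comul {N : H k ⊗[k] U k →ₗ[k] H k ⊗[k] U k}
    (hN : comul ∘ₗ N = TensorProduct.map N N ∘ₗ comul (R := k)) :
    N = omega (pH k ∘ₗ N) (pU k ∘ₗ N) := by
  refine LinearMap.ext fun v => ?_
  have h := LinearMap.congr_fun hN v
  simp only [LinearMap.comp_apply] at h
  rw [omega, LinearMap.comp_apply, TensorProduct.map_comp, LinearMap.comp_apply, ← h, map_pH_pU_comul]

/-- Apply the counit to the first leg. The mirror statement `convRight_of_comul` applies it to the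
second leg. -/
theorem conv_of_comul {C : Type*} [AddCommGroup C] [Module k C] [Coalgebra k C]
    {N N' : C →ₗ[k] C} (hN : comul ∘ₗ N = TensorProduct.map N N' ∘ₗ comul (R := k)) :
    N = conv (counit ∘ₗ N) N' := by
  have := conv_comp hN (counit (R := k)) LinearMap.id
  rw [conv_counit_left] at this
  simpa using this

theorem convRight_of_comul {C : Type*} [AddCommGroup C] [Module k C] [Coalgebra k C]
    {N N' : C →ₗ[k] C} (hN : comul ∘ₗ N = TensorProduct.map N' N ∘ₗ comul (R := k)) :
    N = convRight N' (counit ∘ₗ N) := by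
  have := convRight_comp hN (counit (R := k)) LinearMap.id
  rw [convRight_counit] at this
  simpa using this

end Marginals

/-! ### The actions of `H` and `U` on each other from reordering in `E` -/

section Omega
variable {k : Type u} [Field k]

theorem leftAction_a (f : H k) : leftAction k (gen (URel k) .a) f = 0 := by
  rw [leftAction, presLift_gen]; rfl
theorem leftAction_g (f : H k) : leftAction k (gen (URel k) .g) f = gAut k f := by
  rw [leftAction, presLift_gen]; rfl
theorem leftAction_gInv (f : H k) : leftAction k (gen (URel k) .gInv) f = gAut k f := by
  rw [leftAction, presLift_gen]; rfl

theorem tri_tmul (f : H k) (x : U k) : tri k (f ⊗ₜ x) = leftAction k x f := rfl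
theorem tle_tmul (f : H k) (x : U k) : tle k (f ⊗ₜ x) = (rightAction k f).unop x := rfl

theorem gTw_one : gTw (1 : kˣ) 1 = gAut k := by
  apply pres_ext
  rintro (_ | _ | _ | _) <;> simp [gAut]

theorem rightAction_b : rightAction k (gen (LRel k 0) .b) = 0 := presLift_gen _ _ _ _
theorem rightAction_c : rightAction k (gen (LRel k 0) .c) = 0 := presLift_gen _ _ _ _
theorem rightAction_h : rightAction k (gen (LRel k 0) .h) = .op (hAut k).toLinearMap :=
  presLift_gen _ _ _ _
theorem rightAction_hInv : rightAction k (gen (LRel k 0) .hInv) = .op (hAut k).toLinearMap :=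
  presLift_gen _ _ _ _

theorem hAut_a : hAut k (gen (URel k) .a) = -gen (URel k) .a := presLift_gen _ _ _ _
theorem hAut_g : hAut k (gen (URel k) .g) = gen (URel k) .g := presLift_gen _ _ _ _
theorem hAut_gInv : hAut k (gen (URel k) .gInv) = gen (URel k) .gInv := presLift_gen _ _ _ _

/-- In `E` a letter `y` of `U` passes `f` as `y f = T(f) y`, where `T` is `aTw 1` for `a` and `gTw 1
1` for `g^{±1}`; the identity is the shadow of `(xy)f = x T(f) y` on `U`. On generators it is
checked by hand, and induction on `f` from the left does the rest. -/
theorem tle_mul_right {T : H k →ₐ[k] H k} {y : U k}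
    (hb : rightAction k (T (gen (LRel k 0) .b)) = 0) (hc : rightAction k (T (gen (LRel k 0) .c)) = 0)
    (hh : ∀ x, hAut k (x * y) = (rightAction k (T (gen (LRel k 0) .h))).unop x * y)
    (hi : ∀ x, hAut k (x * y) = (rightAction k (T (gen (LRel k 0) .hInv))).unop x * y)
    (f : H k) (x : U k) : tle k (f ⊗ₜ (x * y)) = tle k (T f ⊗ₜ x) * y := by
  let S : Submodule k (H k) :=
    { carrier := {f | ∀ x, tle k (f ⊗ₜ (x * y)) = tle k (T f ⊗ₜ x) * y}
      add_mem' := fun {p p'} hp hp' x => by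
        rw [TensorProduct.add_tmul, map_add, map_add, TensorProduct.add_tmul, map_add, add_mul, hp, hp']
      zero_mem' := fun x => by simp
      smul_mem' := fun r p hp x => by
        rw [← TensorProduct.smul_tmul', map_smul, map_smul, ← TensorProduct.smul_tmul', map_smul,
          smul_mul_assoc, hp] }
  refine pres_left_induction S ?_ ?_ f x
  · intro x; simp [tle_tmul]
  · intro z f hf x
    simp only [S, Submodule.mem_mk, AddSubmonoid.mem_mk, Set.mem_ofPred_eq, tle_tmul, map_mul,
      MulOpposite.unop_mul, Module.End.mul_apply] at hf ⊢
    cases z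
    · simp [rightAction_b, hb]
    · simp [rightAction_c, hc]
    · rw [← hf, ← hh, rightAction_h]; rfl
    · rw [← hf, ← hi, rightAction_hInv]; rfl

theorem tle_mul_a (f : H k) (x : U k) :
    tle k (f ⊗ₜ (x * gen (URel k) .a)) = tle k (aTw 1 f ⊗ₜ x) * gen (URel k) .a := by
  refine tle_mul_right ?_ ?_ ?_ ?_ f x <;>
    simp [rightAction_b, rightAction_c, rightAction_h, rightAction_hInv, hAut_a]

theorem tle_mul_g (f : H k) (x : U k) :
    tle k (f ⊗ₜ (x * gen (URel k) .g)) = tle k (gTw 1 1 f ⊗ₜ x) * gen (URel k) .g := by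
  refine tle_mul_right ?_ ?_ ?_ ?_ f x <;>
    simp [rightAction_b, rightAction_c, rightAction_h, rightAction_hInv, hAut_g]

theorem tle_mul_gInv (f : H k) (x : U k) :
    tle k (f ⊗ₜ (x * gen (URel k) .gInv)) = tle k (gTw 1 1 f ⊗ₜ x) * gen (URel k) .gInv := by
  refine tle_mul_right ?_ ?_ ?_ ?_ f x <;>
    simp [rightAction_b, rightAction_c, rightAction_h, rightAction_hInv, hAut_gInv]

theorem counit_gTw (l : kˣ) (f : H k) : counit (R := k) (gTw l 1 f) = counit (R := k) f := by
  have : (Bialgebra.counitAlgHom k (H k)).comp (gTw l 1) = Bialgebra.counitAlgHom k (H k) := by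
    apply pres_ext
    rintro (_ | _ | _ | _) <;> simp
  exact DFunLike.congr_fun this f

variable {R : Type*} [Ring R] [Algebra k R] {a b c : R} {h g : Rˣ}
  {D : IsPBW (0 : k) 0 1 1 0 0 a b c h g} {I : H k ⊗[k] U k ≃ₗ[k] R}

theorem admissible_zero : Admissible (0 : k) 0 1 1 0 0 := by
  constructor <;> simp

theorem pU_lTensor_mulRight (v : H k ⊗[k] U k) (y : U k) :
    pU k ((LinearMap.mulRight k y).lTensor (H k) v) = pU k v * y := by
  induction v using TensorProduct.induction_on with
  | zero => simp
  | add p p' hp hp' => simp only [map_add, add_mul, hp, hp']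
  | tmul f x => simp [pU_tmul]

theorem pH_lTensor_mulRight (v : H k ⊗[k] U k) (y : U k) :
    pH k ((LinearMap.mulRight k y).lTensor (H k) v) = counit (R := k) y • pH k v := by
  induction v using TensorProduct.induction_on with
  | zero => simp
  | add p p' hp hp' => simp only [map_add, smul_add, hp, hp']
  | tmul f x => simp [pH_tmul, smul_smul, mul_comm]

theorem tle_one (f : H k) : tle k (f ⊗ₜ 1) = counit (R := k) f • 1 := by
  refine LinearMap.congr_fun (f := tle k ∘ₗ (TensorProduct.mk k (H k) (U k)).flip 1)
    (g := (counit (R := k)).smulRight 1) (linearMap_ext_left ?_ fun x f hf => ?_) f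
  · simp [tle_tmul]
  · simp only [LinearMap.comp_apply, LinearMap.flip_apply, TensorProduct.mk_apply,
      LinearMap.smulRight_apply, Bialgebra.counit_mul, tle_tmul, map_mul, MulOpposite.unop_mul,
      Module.End.mul_apply] at hf ⊢
    cases x
    · simp [rightAction_b]
    · simp [rightAction_c]
    · simp [rightAction_h, hf]
    · simp [rightAction_hInv, hf]

/-- Both sides satisfy the same recursion under right multiplication of `x` by generators. In the
companion `pH_swapN` the letter `a` contributes `ε(a) = 0`, which matches its zero action on `H`. -/
theorem pU_swapN (hI : ∀ v, I v = pbwMap D v) : pU k ∘ₗ swapN D I = tle k := by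
  apply TensorProduct.ext
  have P := admissible_zero (k := k)
  let S : Submodule k (U k) :=
    { carrier := {x | ∀ f, pU k (swapN D I (f ⊗ₜ x)) = tle k (f ⊗ₜ x)}
      add_mem' := fun {p p'} hp hp' x => by
        rw [TensorProduct.tmul_add, map_add, map_add, map_add, hp, hp']
      zero_mem' := fun x => by simp
      smul_mem' := fun r p hp x => by
        rw [TensorProduct.tmul_smul, map_smul, map_smul, map_smul, hp] }
  refine LinearMap.ext fun f => LinearMap.ext fun x => pres_right_induction S ?_ ?_ x f
  · intro f
    rw [swapN_one hI, pU_tmul, tle_one]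
  · intro z x hx f
    simp only [S, Submodule.mem_mk, AddSubmonoid.mem_mk, Set.mem_ofPred_eq] at hx
    cases z
    · rw [swapN_mul_a hI P, zero_smul, zero_add, pU_lTensor_mulRight, hx, tle_mul_a]
    · rw [swapN_mul_g hI P, pU_lTensor_mulRight, hx, tle_mul_g]
    · rw [swapN_mul_gInv hI P, pU_lTensor_mulRight, hx, inv_one, tle_mul_gInv]

theorem pH_swapN (hI : ∀ v, I v = pbwMap D v) : pH k ∘ₗ swapN D I = tri k := by
  apply TensorProduct.ext
  have P := admissible_zero (k := k)
  let S : Submodule k (U k) :=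
    { carrier := {x | ∀ f, pH k (swapN D I (f ⊗ₜ x)) = tri k (f ⊗ₜ x)}
      add_mem' := fun {p p'} hp hp' x => by
        rw [TensorProduct.tmul_add, map_add, map_add, map_add, hp, hp']
      zero_mem' := fun x => by simp
      smul_mem' := fun r p hp x => by
        rw [TensorProduct.tmul_smul, map_smul, map_smul, map_smul, hp] }
  refine LinearMap.ext fun f => LinearMap.ext fun x => pres_right_induction S ?_ ?_ x f
  · intro f
    rw [swapN_one hI, pH_tmul, tri_tmul]
    simp
  · intro z x hx f
    simp only [S, Submodule.mem_mk, AddSubmonoid.mem_mk, Set.mem_ofPred_eq] at hx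
    cases z
    · rw [swapN_mul_a hI P, zero_smul, zero_add, pH_lTensor_mulRight, counit_U_a, zero_smul, tri_tmul,
        map_mul, Module.End.mul_apply, leftAction_a, map_zero]
    · rw [swapN_mul_g hI P, pH_lTensor_mulRight, counit_U_g, one_smul, hx, tri_tmul, tri_tmul, map_mul,
        Module.End.mul_apply, leftAction_g, gTw_one]
    · rw [swapN_mul_gInv hI P, pH_lTensor_mulRight, counit_U_gInv, one_smul, hx, tri_tmul, tri_tmul,
        map_mul, Module.End.mul_apply, leftAction_gInv, inv_one, gTw_one]

end Omega

/-! ### Twisted and bicrossed products from the reordering maps -/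

section Realizations
variable {k : Type u} [Field k]

/-- The parameters are given by equations `s = 0`, `t = 0` rather than literally, so that the result
applies to `E` with its parameters in the form `0 / 2`. -/
theorem swapN_eq_omega {R : Type*} [Ring R] [Algebra k R] {s t : k} {a b c : R} {h g : Rˣ}
    {D : IsPBW s t 1 1 (0 : k) 0 a b c h g} {I : H k ⊗[k] U k ≃ₗ[k] R} (hs : s = 0) (ht : t = 0)
    (hI : ∀ v, I v = pbwMap D v)
    (hN : comul ∘ₗ swapN D I = TensorProduct.map (swapN D I) (swapN D I) ∘ₗ comul (R := k)) :
    swapN D I = omega (tri k) (tle k) ∧ pH k ∘ₗ swapN D I = tri k ∧ pU k ∘ₗ swapN D I = tle k := by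
  subst hs ht
  refine ⟨?_, pH_swapN hI, pU_swapN hI⟩
  rw [eq_omega_of_comul hN, pH_swapN hI, pU_swapN hI]

variable (h2 : (2 : k) ≠ 0) (α β : k) (l : kˣ) (hα : α * (1 + (l : k) ^ 4) = 0)
  (hβ : β * (1 - (l : k) ^ 2) = 0)

/-- The map `x f ↦ f x` for `A^λ_{α,β}`. -/
def swapA : H k ⊗[k] U k →ₗ[k] H k ⊗[k] U k :=
  swapN (isPBW_A h2 α β l) (equivA α β l h2 hα hβ)

/-- The map `x f ↦ f x` for `E^λ_{α,β}`. -/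
def swapE : H k ⊗[k] U k →ₗ[k] H k ⊗[k] U k :=
  swapN (isPBW_E h2 α β l) (equivE α β l h2 hα hβ)

theorem comul_swapE : comul ∘ₗ swapE h2 α β l hα hβ =
    TensorProduct.map (swapE h2 α β l hα hβ) (swapE h2 α β l hα hβ) ∘ₗ comul (R := k) :=
  comul_swapN (Bialgebra.comulAlgHom k (Edef k α β l)) (E_comul_equivE h2 hα hβ)
    (swapMap_coaction (isPBW_E h2 α β l) (isPBW_E h2 α β l) (isPBW_E h2 α β l) rfl rfl rfl
      (Bialgebra.comulAlgHom k (Edef k α β l)) (comul_E_gen .a) (comul_E_gen .b) (comul_E_gen .c)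
      (comul_E_gen .h) (comul_E_gen .hInv) (comul_E_gen .g) (comul_E_gen .gInv))

theorem swapE_zero (h2 : (2 : k) ≠ 0) : swapE h2 (0 : k) 0 1 (zero_mul _) (zero_mul _) = omega (tri k) (tle k) :=
  (swapN_eq_omega (zero_div _) (zero_div _) (fun _ => rfl) (comul_swapE h2 0 0 1 _ _)).1

theorem pH_omega (h2 : (2 : k) ≠ 0) : pH k ∘ₗ omega (tri k) (tle k) = tri k := by
  rw [← swapE_zero h2]
  exact (swapN_eq_omega (zero_div _) (zero_div _) (fun _ => rfl) (comul_swapE h2 0 0 1 _ _)).2.1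

theorem pU_omega (h2 : (2 : k) ≠ 0) : pU k ∘ₗ omega (tri k) (tle k) = tle k := by
  rw [← swapE_zero h2]
  exact (swapN_eq_omega (zero_div _) (zero_div _) (fun _ => rfl) (comul_swapE h2 0 0 1 _ _)).2.2

theorem comul_omega (h2 : (2 : k) ≠ 0) : comul ∘ₗ omega (tri k) (tle k) =
    TensorProduct.map (omega (tri k) (tle k)) (omega (tri k) (tle k)) ∘ₗ comul (R := k) := by
  rw [← swapE_zero h2, comul_swapE]

/-- The left coaction is multiplicative, so in the image of `x f` the first legs are multiplied in
`E^λ_{α,β}` and the second legs in `A^λ_{α,β}`. The right coaction gives `comul_swapA` in the same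
way, with `E` acting on the second leg. -/
theorem comul_swapA_left : comul ∘ₗ swapA h2 α β l hα hβ =
    TensorProduct.map (swapE h2 α β l hα hβ) (swapA h2 α β l hα hβ) ∘ₗ comul (R := k) :=
  comul_swapN (leftCoaction α β l) (leftCoaction_equivA h2 hα hβ)
    (swapMap_coaction (isPBW_A h2 α β l) (isPBW_E h2 α β l) (isPBW_A h2 α β l) rfl rfl rfl
      (leftCoaction α β l) (presLift_gen _ _ _ _) (presLift_gen _ _ _ _)
      (presLift_gen _ _ _ _) (presLift_gen _ _ _ _) (presLift_gen _ _ _ _) (presLift_gen _ _ _ _)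
      (presLift_gen _ _ _ _))

theorem comul_swapA : comul ∘ₗ swapA h2 α β l hα hβ =
    TensorProduct.map (swapA h2 α β l hα hβ) (omega (tri k) (tle k)) ∘ₗ comul (R := k) := by
  rw [← swapE_zero h2]
  refine comul_swapN (rightCoaction α β l) (fun v => ?_)
    (swapMap_coaction (isPBW_A h2 α β l) (isPBW_A h2 α β l) (isPBW_E h2 0 0 1) rfl (zero_div _)
      (zero_div _).symm (rightCoaction α β l) (presLift_gen _ _ _ _) (presLift_gen _ _ _ _)
      (presLift_gen _ _ _ _) (presLift_gen _ _ _ _) (presLift_gen _ _ _ _) (presLift_gen _ _ _ _)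
      (presLift_gen _ _ _ _))
  rw [rightCoaction_equivA h2, equivE_zero h2]

/-- The functional `ψ(f, x) = ε(x f)` on `H ⊗ U`, with the product of `A^λ_{α,β}`. -/
def pairA : H k ⊗[k] U k →ₗ[k] k := counit ∘ₗ swapA h2 α β l hα hβ

/-- The right coaction followed by `ε` on the first leg. In other words, the twisting map of
`A^λ_{α,β}` is `θ_ψ` for `ψ = pairA`. -/
theorem swapA_eq : swapA h2 α β l hα hβ = conv (pairA h2 α β l hα hβ) (omega (tri k) (tle k)) :=
  conv_of_comul (comul_swapA h2 α β l hα hβ)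

/-- The left coaction gives `N_A = N_E * ψ` and the right one `N_A = ψ * ω`, so cancelling `ψ`
leaves `N_E = ψ * ω * ψ⁻¹`. The marginals of this convolution are the deformed actions, and they
determine the coalgebra map `N_E`. -/
theorem swapE_eq {ψ' : H k ⊗[k] U k →ₗ[k] k} (hψ : conv (pairA h2 α β l hα hβ) ψ' = counit) :
    swapE h2 α β l hα hβ = omega (triDef (pairA h2 α β l hα hβ) ψ') (tleDef (pairA h2 α β l hα hβ) ψ') := by
  have e0 : swapE h2 α β l hα hβ =
      convRight (conv (pairA h2 α β l hα hβ) (omega (tri k) (tle k))) ψ' := by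
    rw [← swapA_eq, convRight_of_comul (comul_swapA_left h2 α β l hα hβ), convRight_convRight]
    exact (congrArg _ hψ).trans (convRight_counit _) |>.symm
  conv_lhs => rw [eq_omega_of_comul (comul_swapE h2 α β l hα hβ), e0]
  rw [comp_convRight, comp_convRight, comp_conv, comp_conv, pH_omega h2, pU_omega h2, triDef, tleDef]

theorem E_bicrossed (h2 : (2 : k) ≠ 0) :
    Function.Bijective (factor (k := k)) ∧
      (∀ z : H k ⊗[k] U k, comul (R := k) (factor z) =
        TensorProduct.map factor factor (comul (R := k) z)) ∧
      (∀ z : H k ⊗[k] U k, counit (R := k) (factor z) = counit (R := k) z) ∧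
      factor ((1 : H k) ⊗ₜ[k] (1 : U k)) = 1 ∧
      ∀ u v : H k ⊗[k] U k, factor u * factor v =
        factor (bicrossedMul (LinearMap.mul' k (H k)) (tri k) (tle k) (u ⊗ₜ[k] v)) := by
  rw [← equivE_zero h2]
  refine ⟨LinearEquiv.bijective _, E_comul_equivE h2 _ _, E_counit_equivE h2 _ _, ?_, ?_⟩
  · rw [equivE_zero h2]; simp [factor]
  · intro u v
    rw [bicrossedMul, ← swapE_zero h2]
    refine pbwMap_mul (fun f f' => ?_) (fun _ => rfl) u v
    rw [sym_zero_eq_inclH h2, sym_zero_eq_inclH h2, sym_zero_eq_inclH h2, LinearMap.mul'_apply, map_mul]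

/-- Everything is transported along the ordered bases: products by `pbwMap_mul` with the reordering
maps just found, where `H` carries the deformed product adapted to `sym`, and coactions by
`rightCoaction_equivA` and `leftCoaction_equivA`. -/
theorem realizes_of_inverse {ψ' : H k ⊗[k] U k →ₗ[k] k}
    (hψ : IsConvInverse (pairA h2 α β l hα hβ) ψ') :
    Realizes (cocycleMul (sigma α) (sigma (-α))) (cleftMul (sigma α)) (pairA h2 α β l hα hβ) α β l := by
  let J : H k ⊗[k] U k ≃ₗc[k] Edef k α β l :=
    { equivE α β l h2 hα hβ with
      counit_comp := LinearMap.ext (E_counit_equivE h2 hα hβ)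
      map_comp_comul := LinearMap.ext fun v => (E_comul_equivE h2 hα hβ v).symm }
  have hJ : ∀ v, J v = equivE α β l h2 hα hβ v := fun _ => rfl
  have hJ' : ∀ v, J.symm (equivE α β l h2 hα hβ v) = v := fun v => J.symm_apply_apply v
  refine ⟨ψ', hψ, J.symm, (equivA α β l h2 hα hβ).symm, ⟨?_, fun u v => ?_⟩, ⟨?_, fun u v => ?_⟩,
    fun u => ?_, fun u => ?_⟩
  · have : equivE α β l h2 hα hβ (1 ⊗ₜ 1) = 1 := by
      change pbwMap (isPBW_E h2 α β l) (1 ⊗ₜ 1) = 1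
      rw [pbwMap_tmul, sym_one, map_one, one_mul]
    rw [← this, hJ']
  · obtain ⟨u, rfl⟩ := (equivE α β l h2 hα hβ).surjective u
    obtain ⟨v, rfl⟩ := (equivE α β l h2 hα hβ).surjective v
    rw [hJ', hJ', bicrossedMul, ← swapE_eq h2 α β l hα hβ hψ.1]
    rw [pbwMap_mul (sym_mul_cocycle (isPBW_E h2 α β l).toIsWeyl) (fun _ => rfl) u v, hJ']
    rfl
  · have : equivA α β l h2 hα hβ (1 ⊗ₜ 1) = 1 := by
      change pbwMap (isPBW_A h2 α β l) (1 ⊗ₜ 1) = 1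
      rw [pbwMap_tmul, sym_one, map_one, one_mul]
    rw [← this, LinearEquiv.symm_apply_apply]
  · obtain ⟨u, rfl⟩ := (equivA α β l h2 hα hβ).surjective u
    obtain ⟨v, rfl⟩ := (equivA α β l h2 hα hβ).surjective v
    rw [LinearEquiv.symm_apply_apply, LinearEquiv.symm_apply_apply, theta, ← swapA_eq]
    rw [pbwMap_mul (sym_mul_cleft (isPBW_A h2 α β l).toIsWeyl) (fun _ => rfl) u v,
      LinearEquiv.symm_apply_apply]
    rfl
  · obtain ⟨v, rfl⟩ := (equivA α β l h2 hα hβ).surjective u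
    rw [rightCoaction_equivA h2, LinearEquiv.symm_apply_apply, ← LinearMap.comp_apply (TensorProduct.map _ _),
      ← TensorProduct.map_comp]
    simp
  · obtain ⟨v, rfl⟩ := (equivA α β l h2 hα hβ).surjective u
    rw [leftCoaction_equivA h2, LinearEquiv.symm_apply_apply, ← LinearMap.comp_apply (TensorProduct.map _ _),
      ← TensorProduct.map_comp]
    have e1 : (J.symm : Edef k α β l →ₗ[k] H k ⊗[k] U k) ∘ₗ (equivE α β l h2 hα hβ).toLinearMap =
      LinearMap.id := LinearMap.ext hJ'
    rw [e1]
    simp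

end Realizations

/-! ### The functionals `τ_λ^β` by recursion in the second argument -/

section TauRecursion
variable {k : Type u} [Field k]

theorem tauBeta_mon (ξ : kˣ) (β : k) (r s : ℕ) (p : ℤ) (n : ℕ) (q : ℤ) :
    tauBeta ξ β (monH k (r, s, p) ⊗ₜ monU k (n, q)) =
      if r + s = n then (((-1) ^ (q * (n : ℤ)) * ξ ^ (p * q) : kˣ) : k) * (n.factorial : k) * β ^ n
      else 0 := by
  have := ((basisH k).tensorProduct (basisU k)).constr_basis k
    (fun i => if i.1.1 + i.1.2.1 = i.2.1 then
      (((-1) ^ (i.2.2 * (i.2.1 : ℤ)) * ξ ^ (i.1.2.2 * i.2.2) : kˣ) : k) *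
        (i.2.1.factorial : k) * β ^ i.2.1 else 0) ((r, s, p), (n, q))
  rwa [Module.Basis.tensorProduct_apply, basisH_apply, basisU_apply] at this

theorem tauLam_mon (l : kˣ) (r s : ℕ) (p : ℤ) (n : ℕ) (q : ℤ) :
    tauLam l (monH k (r, s, p) ⊗ₜ monU k (n, q)) =
      if r = 0 ∧ s = 0 ∧ n = 0 then ((l ^ (p * q) : kˣ) : k) else 0 := by
  have := ((basisH k).tensorProduct (basisU k)).constr_basis k
    (fun i => if i.1.1 = 0 ∧ i.1.2.1 = 0 ∧ i.2.1 = 0 then ((l ^ (i.1.2.2 * i.2.2) : kˣ) : k) else 0)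
    ((r, s, p), (n, q))
  rwa [Module.Basis.tensorProduct_apply, basisH_apply, basisU_apply] at this

theorem HU_ext {M : Type*} [AddCommGroup M] [Module k M] {P Q : H k ⊗[k] U k →ₗ[k] M}
    (h : ∀ r s p n q, P (monH k (r, s, p) ⊗ₜ monU k (n, q)) = Q (monH k (r, s, p) ⊗ₜ monU k (n, q))) :
    P = Q :=
  ((basisH k).tensorProduct (basisU k)).ext fun i => by
    obtain ⟨⟨r, s, p⟩, n, q⟩ := i
    rw [Module.Basis.tensorProduct_apply, basisH_apply, basisU_apply]
    exact h _ _ _ _ _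

theorem tauBeta_zero (l : kˣ) : tauBeta l 0 = tauLam l := by
  refine HU_ext fun r s p n q => ?_
  rw [tauBeta_mon, tauLam_mon]
  rcases n with _ | n
  · rcases r with _ | r <;> rcases s with _ | s <;> simp
  · simp

theorem monU_zero : monU k (0, 0) = 1 := by simp [monU]

theorem monU_mul_g (n : ℕ) (q : ℤ) : monU k (n, q) * gen (URel k) .g = monU k (n, q + 1) := by
  have e : gen (URel k) .g = (gUnit k : U k) := rfl
  rw [monU, monU, e, mul_assoc, ← Units.val_mul, ← zpow_add_one]

theorem gUnit_zpow_a (q : ℤ) : ((gUnit k ^ q : (U k)ˣ) : U k) * gen (URel k) .a =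
    (((-1) ^ q : kˣ) : k) • (gen (URel k) .a * ((gUnit k ^ q : (U k)ˣ) : U k)) := by
  induction q using Int.induction_on with
  | zero => simp
  | succ q ih =>
    have e : (gUnit k : U k) = gen (URel k) .g := rfl
    rw [zpow_add_one, Units.val_mul, mul_assoc, e, U_g_a, mul_neg, ← mul_assoc, ih, zpow_add_one]
    simp [mul_assoc, e]
  | pred q ih =>
    have e : ((gUnit k)⁻¹ : (U k)ˣ) = gen (URel k) .gInv := rfl
    rw [zpow_sub_one, Units.val_mul, mul_assoc, e, U_gInv_a, mul_neg, ← mul_assoc, ih, zpow_sub_one]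
    simp [mul_assoc, e]

theorem monU_mul_a (n : ℕ) (q : ℤ) : monU k (n, q) * gen (URel k) .a =
    (((-1) ^ q : kˣ) : k) • monU k (n + 1, q) := by
  simp only [monU, mul_assoc, gUnit_zpow_a, mul_smul_comm, pow_succ]

theorem U_ext {M : Type*} [AddCommGroup M] [Module k M] {P Q : U k →ₗ[k] M}
    (h : ∀ n q, P (monU k (n, q)) = Q (monU k (n, q))) : P = Q :=
  (basisU k).ext fun i => by simpa using h i.1 i.2

theorem gTw_monH (m l : kˣ) (r s : ℕ) (p : ℤ) : gTw m l (monH k (r, s, p)) =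
    ((-(m : k) ^ 2) ^ (r + s) * ((l ^ p : kˣ) : k)) • monH k (s, r, p) := by
  have h1 : ∀ p : ℤ, gTw m l ((hUnit k ^ p : (H k)ˣ) : H k) = ((l ^ p : kˣ) : k) • ((hUnit k ^ p : (H k)ˣ) : H k) := by
    intro p
    induction p using Int.induction_on with
    | zero => simp
    | succ p ih =>
      have e : (hUnit k : H k) = gen (LRel k 0) .h := rfl
      rw [zpow_add_one, Units.val_mul, map_mul, ih, e, gTw_h, zpow_add_one]
      simp [smul_smul, mul_comm]
    | pred p ih =>
      have e : ((hUnit k)⁻¹ : (H k)ˣ) = gen (LRel k 0) .hInv := rfl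
      rw [zpow_sub_one, Units.val_mul, map_mul, ih, e, gTw_hInv, zpow_sub_one]
      simp [smul_smul, mul_comm]
  have hc : Commute (gen (LRel k 0) .c) (gen (LRel k 0) .b) := H_b_c.symm
  simp only [monH, map_mul, map_pow, h1, gTw_b, gTw_c, ← neg_smul, smul_pow, smul_mul_assoc,
    mul_smul_comm, smul_smul, (hc.pow_pow r s).eq]
  congr 1
  ring

theorem tauBeta_one (l : kˣ) (β : k) (f : H k) : tauBeta l β (f ⊗ₜ 1) = counit (R := k) f := by
  refine LinearMap.congr_fun (f := tauBeta l β ∘ₗ (TensorProduct.mk k (H k) (U k)).flip 1)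
    (H_ext fun r s p => ?_) f
  have e := LinearMap.congr_fun (sigma_one (0 : k)) (monH k (r, s, p))
  rw [LinearMap.comp_apply, TensorProduct.mk_apply, ← monH_zero, sigma_mon] at e
  rw [← e, LinearMap.comp_apply, LinearMap.flip_apply, TensorProduct.mk_apply, ← monU_zero, tauBeta_mon]
  rcases r with _ | r <;> rcases s with _ | s <;> simp

/-- The parameter `m` enters only through `(-m²)ⁿβⁿ`, hence it may be any unit with `βm² = β`. This
freedom is used: `m = λ` is the twist in `A^λ_{α,β}`, and the computation of the inverse needs `m =
1` as well. -/
theorem tauBeta_mul_g {m : kˣ} (l : kˣ) {β : k} (hm : β * (1 - (m : k) ^ 2) = 0) (f : H k) (y : U k) :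
    tauBeta l β (f ⊗ₜ (y * gen (URel k) .g)) = tauBeta l β (gTw m l f ⊗ₜ y) := by
  refine LinearMap.congr_fun (f := tauBeta l β ∘ₗ (LinearMap.mulRight k (gen (URel k) .g)).lTensor (H k))
    (g := tauBeta l β ∘ₗ (gTw m l).toLinearMap.rTensor (U k)) (HU_ext fun r s p n q => ?_) (f ⊗ₜ y)
  have hm' : (m : k) ^ 2 * β = β := by linear_combination -hm
  simp only [LinearMap.comp_apply, LinearMap.lTensor_tmul, LinearMap.rTensor_tmul,
    LinearMap.mulRight_apply, AlgHom.toLinearMap_apply, monU_mul_g, gTw_monH,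
    ← TensorProduct.smul_tmul', map_smul, tauBeta_mon, add_comm s r, smul_eq_mul]
  split_ifs with h
  · subst h
    have e : ∀ n : ℕ, (-(m : k) ^ 2) ^ n * β ^ n = (-1) ^ n * β ^ n := by
      intro n; rw [← mul_pow, ← mul_pow, neg_mul, hm', neg_one_mul]
    rw [mul_add, mul_one, add_mul, one_mul, zpow_add, zpow_add]
    simp only [Units.val_mul, zpow_natCast, Units.val_pow_eq_pow_val, Units.val_neg, Units.val_one]
    linear_combination (-((((-1) ^ (q * ((r + s : ℕ) : ℤ)) : kˣ) : k) * ((l ^ (p * q) : kˣ) : k) *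
      ((l ^ p : kˣ) : k) * ((r + s).factorial : k))) * e (r + s)
  · simp

/-- For `r + s = n + 1` the factorial splits as `(n + 1)! = (r + s) n!`, and `r` and `s` are the
coefficients of `∂_b` and `∂_c`. -/
theorem tauBeta_mul_a (l : kˣ) (β : k) (f : H k) (y : U k) :
    tauBeta l β (f ⊗ₜ (y * gen (URel k) .a)) = β * tauBeta l β (dD k f ⊗ₜ y) := by
  refine LinearMap.congr_fun (f := tauBeta l β ∘ₗ (LinearMap.mulRight k (gen (URel k) .a)).lTensor (H k))
    (g := β • tauBeta l β ∘ₗ (dD k).rTensor (U k)) (HU_ext fun r s p n q => ?_) (f ⊗ₜ y)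
  simp only [LinearMap.comp_apply, LinearMap.lTensor_tmul, LinearMap.rTensor_tmul,
    LinearMap.mulRight_apply, LinearMap.smul_apply, monU_mul_a, dD_apply, dB_monH, dC_monH,
    TensorProduct.tmul_smul, TensorProduct.add_tmul, map_add,
    ← TensorProduct.smul_tmul', map_smul, tauBeta_mon, smul_eq_mul]
  -- Moving `a` past `g^q` gives `(-1)^q`, which reduces the sign `(-1)^{q(n+1)}` to `(-1)^{qn}`.
  have e : (((-1) ^ q : kˣ) : k) * (((-1) ^ (q * ((n + 1 : ℕ) : ℤ)) : kˣ) : k) =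
      (((-1) ^ (q * (n : ℤ)) : kˣ) : k) := by
    have h1 : (((-1) ^ q : kˣ) : k) * (((-1) ^ q : kˣ) : k) = 1 := by
      rw [← Units.val_mul, ← mul_zpow]; simp
    rw [Nat.cast_add, Nat.cast_one, mul_add, mul_one, zpow_add, Units.val_mul, mul_left_comm, h1, mul_one]
  simp only [Units.val_mul]
  generalize (((-1) ^ q : kˣ) : k) = u at e ⊢
  generalize (((-1) ^ (q * ((n + 1 : ℕ) : ℤ)) : kˣ) : k) = v at e ⊢
  rw [← e]
  rcases r with _ | r <;> rcases s with _ | s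
  · simp
  · by_cases h : s = n
    · subst h; simp [Nat.factorial_succ, pow_succ]; ring
    · simp [h]
  · by_cases h : r = n
    · subst h; simp [Nat.factorial_succ, pow_succ]; ring
    · simp [h]
  · have i1 : (r + 1 + (s + 1) = n + 1) = (r + s + 1 = n) := by simp; omega
    have i2 : (r + 1 - 1 + (s + 1) = n) = (r + s + 1 = n) := by simp; omega
    have i3 : (r + 1 + (s + 1 - 1) = n) = (r + s + 1 = n) := by simp; omega
    simp only [i1, i2, i3]
    split_ifs with h
    · subst h
      simp only [Nat.factorial_succ, pow_succ]; push_cast; ring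
    · simp

/-- The recursion in the second argument that determines `τ_λ^β`. -/
structure IsRec (m l : kˣ) (β : k) (θ : H k →ₗ[k] k) (ψ : H k ⊗[k] U k →ₗ[k] k) : Prop where
  one : ∀ f, ψ (f ⊗ₜ 1) = θ f
  mul_g : ∀ f y, ψ (f ⊗ₜ (y * gen (URel k) .g)) = ψ (gTw m l f ⊗ₜ y)
  mul_a : ∀ f y, ψ (f ⊗ₜ (y * gen (URel k) .a)) = β * ψ (dD k f ⊗ₜ y)

theorem IsRec.mul_gInv {m l : kˣ} {β : k} {θ : H k →ₗ[k] k} {ψ : H k ⊗[k] U k →ₗ[k] k} (h : IsRec m l β θ ψ) (f y) :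
    ψ (f ⊗ₜ (y * gen (URel k) .gInv)) = ψ (gTw m⁻¹ l⁻¹ f ⊗ₜ y) := by
  have := h.mul_g (gTw m⁻¹ l⁻¹ f) (y * gen (URel k) .gInv)
  rwa [mul_assoc, U_gInv_g, mul_one, gTw_inv', eq_comm] at this

/-- Right multiplication by generators reaches all of `U` from `1`. No separate rule for `g⁻¹` is
needed, because `gTw` is invertible. -/
theorem IsRec.ext {m l : kˣ} {β : k} {θ : H k →ₗ[k] k} {ψ ψ' : H k ⊗[k] U k →ₗ[k] k}
    (h : IsRec m l β θ ψ) (h' : IsRec m l β θ ψ') : ψ = ψ' := by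
  let S : Submodule k (U k) :=
    { carrier := {x | ∀ f, ψ (f ⊗ₜ x) = ψ' (f ⊗ₜ x)}
      add_mem' := fun {p p'} hp hp' f => by
        rw [TensorProduct.tmul_add, map_add, map_add, hp, hp']
      zero_mem' := fun f => by simp
      smul_mem' := fun t p hp f => by rw [TensorProduct.tmul_smul, map_smul, map_smul, hp] }
  refine TensorProduct.ext' fun f x => pres_right_induction S (fun f => ?_) (fun x y hy f => ?_) x f
  · rw [h.one, h'.one]
  · cases x
    · rw [h.mul_a, h'.mul_a, hy]
    · rw [h.mul_g, h'.mul_g, hy]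
    · rw [h.mul_gInv, h'.mul_gInv, hy]

theorem isRec_tauBeta {m : kˣ} (l : kˣ) {β : k} (hm : β * (1 - (m : k) ^ 2) = 0) :
    IsRec m l β counit (tauBeta l β) :=
  ⟨tauBeta_one l β, tauBeta_mul_g l hm, tauBeta_mul_a l β⟩

theorem counit_lTensor_mulRight (v : H k ⊗[k] U k) (y : U k) :
    counit (R := k) ((LinearMap.mulRight k y).lTensor (H k) v) = counit (R := k) y * counit (R := k) v := by
  induction v using TensorProduct.induction_on with
  | zero => simp
  | add v w hv hw => simp only [map_add, hv, hw, mul_add]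
  | tmul f x => simp [mul_comm, mul_left_comm, mul_assoc]

theorem isRec_counit : IsRec 1 1 0 counit (counit : H k ⊗[k] U k →ₗ[k] k) where
  one f := by simp
  mul_g f y := by
    have := counit_gTw (k := k) 1 f
    simp [this]
  mul_a f y := by simp

/-- The counit applied to the recursion of the reordering map: `ε(g) = 1` leaves the twist by `g`,
and `ε(a) = 0` leaves only the derivative term. -/
theorem pairA_eq (h2 : (2 : k) ≠ 0) {α β : k} {l : kˣ} (hα : α * (1 + (l : k) ^ 4) = 0)
    (hβ : β * (1 - (l : k) ^ 2) = 0) : pairA h2 α β l hα hβ = tauBeta l β := by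
  refine IsRec.ext ⟨fun f => ?_, fun f y => ?_, fun f y => ?_⟩ (isRec_tauBeta l hβ)
  · rw [pairA, LinearMap.comp_apply, swapA, swapN_one (fun _ => rfl)]; simp
  · rw [pairA, LinearMap.comp_apply, swapA, swapN_mul_g (fun _ => rfl) (admissible_A hα hβ),
      counit_lTensor_mulRight, counit_U_g, one_mul]; rfl
  · rw [pairA, LinearMap.comp_apply, swapA, swapN_mul_a (fun _ => rfl) (admissible_A hα hβ), map_add,
      counit_lTensor_mulRight, counit_U_a, zero_mul, add_zero, map_smul]; rfl

end TauRecursion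

/-! ### The convolution inverse of `τ_λ^β` -/

section TauInverse
variable {k : Type u} [Field k]

theorem comul_comp_lTensor {C D : Type*} [AddCommGroup C] [Module k C] [Coalgebra k C]
    [AddCommGroup D] [Module k D] [Coalgebra k D] {T T₁ T₂ : D →ₗ[k] D}
    (hT : comul ∘ₗ T = TensorProduct.map T₁ T₂ ∘ₗ comul) :
    comul ∘ₗ T.lTensor C =
      TensorProduct.map (T₁.lTensor C) (T₂.lTensor C) ∘ₗ comul (R := k) :=
  comul_comp_map (T := LinearMap.id) (T₁ := LinearMap.id) (T₂ := LinearMap.id) (by simp) hT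

theorem comul_comp_lTensor_add {C D : Type*} [AddCommGroup C] [Module k C] [Coalgebra k C]
    [AddCommGroup D] [Module k D] [Coalgebra k D] {T T₁ T₂ T₃ T₄ : D →ₗ[k] D}
    (hT : comul ∘ₗ T = TensorProduct.map T₁ T₂ ∘ₗ comul + TensorProduct.map T₃ T₄ ∘ₗ comul) :
    comul ∘ₗ T.lTensor C =
      TensorProduct.map (T₁.lTensor C) (T₂.lTensor C) ∘ₗ comul +
      TensorProduct.map (T₃.lTensor C) (T₄.lTensor C) ∘ₗ comul (R := k) := by
  ext x y
  have h := LinearMap.congr_fun hT y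
  simp only [LinearMap.comp_apply, LinearMap.add_apply] at h
  simp only [TensorProduct.AlgebraTensorModule.curry_apply, LinearMap.restrictScalars_self,
    TensorProduct.curry_apply, LinearMap.comp_apply, LinearMap.lTensor_tmul, LinearMap.add_apply,
    TensorProduct.comul_tmul, h, map_add]
  induction comul (R := k) x using TensorProduct.induction_on with
  | zero => simp
  | add a b ha hb => simp only [TensorProduct.add_tmul, map_add] at ha hb ⊢; rw [add_add_add_comm, ha, hb]
  | tmul a b =>
    induction comul (R := k) y using TensorProduct.induction_on with
    | zero => simp
    | add a b ha hb => simp only [TensorProduct.tmul_add, map_add] at ha hb ⊢; rw [add_add_add_comm, ha, hb, add_add_add_comm]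
    | tmul a b => simp [TensorProduct.tmul_add]

theorem comul_mulRight_grouplike {u : U k} (hu : comul (R := k) u = u ⊗ₜ u) :
    comul ∘ₗ LinearMap.mulRight k u =
      TensorProduct.map (LinearMap.mulRight k u) (LinearMap.mulRight k u) ∘ₗ comul (R := k) := by
  ext f
  simp only [LinearMap.comp_apply, LinearMap.mulRight_apply, Bialgebra.comul_mul, hu]
  induction comul (R := k) f using TensorProduct.induction_on with
  | zero => simp
  | add a b ha hb => simp only [map_add, add_mul, ha, hb]
  | tmul a b => simp

theorem comul_mulRight_a : comul ∘ₗ LinearMap.mulRight k (gen (URel k) .a) =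
    TensorProduct.map (LinearMap.mulRight k (gen (URel k) .a)) LinearMap.id ∘ₗ comul +
    TensorProduct.map (LinearMap.mulRight k (gen (URel k) .g ^ 2))
      (LinearMap.mulRight k (gen (URel k) .a)) ∘ₗ comul (R := k) := by
  ext f
  simp only [LinearMap.comp_apply, LinearMap.mulRight_apply, Bialgebra.comul_mul, LinearMap.add_apply,
    comul_U_a]
  induction comul (R := k) f using TensorProduct.induction_on with
  | zero => simp
  | add a b ha hb => simp only [map_add, add_mul, ha, hb]; abel
  | tmul a b => simp [mul_add]

/-- The twist is distributed over the legs to fit `τ_λ` on the left and its inverse on the right: in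
`h ⊗ h` the factors `λ` and `λ⁻¹` cancel, and in `h² ⊗ b` the factors `λ²` and `λ⁻²`. -/
theorem comul_gAut (l : kˣ) : comul ∘ₗ (gAut k).toLinearMap =
    TensorProduct.map (gTw 1 l).toLinearMap (gTw l⁻¹ l⁻¹).toLinearMap ∘ₗ comul (R := k) := by
  have hl := l.ne_zero
  have : (Bialgebra.comulAlgHom k (H k)).comp (gAut k) =
      (Algebra.TensorProduct.map (gTw 1 l) (gTw l⁻¹ l⁻¹)).comp (Bialgebra.comulAlgHom k (H k)) := by
    apply pres_ext
    rintro (_ | _ | _ | _) <;>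
      simp [gAut, smul_pow, TensorProduct.neg_tmul, TensorProduct.tmul_neg, TensorProduct.smul_tmul,
        smul_smul, hl]
    all_goals abel
  exact congrArg AlgHom.toLinearMap this

theorem tauBeta_mul_hsq (l : kˣ) {β : k} (hβ : β * (1 - (l : k) ^ 2) = 0) (f : H k) (y : U k) :
    β * tauBeta l β ((gen (LRel k 0) .h ^ 2 * f) ⊗ₜ y) = β * tauBeta l β (f ⊗ₜ y) := by
  rcases mul_eq_zero.1 hβ with rfl | h
  · simp
  · have hl : l ^ 2 = 1 := by ext; push_cast; linear_combination -h
    suffices key : tauBeta l β ∘ₗ (LinearMap.mulLeft k (gen (LRel k 0) .h ^ 2)).rTensor (U k) =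
        tauBeta l β by
      have := LinearMap.congr_fun key (f ⊗ₜ y)
      rw [LinearMap.comp_apply, LinearMap.rTensor_tmul, LinearMap.mulLeft_apply] at this
      rw [this]
    have e : ∀ p q : ℤ, l ^ ((p + 2) * q) = l ^ (p * q) := by
      intro p q
      rw [add_mul, zpow_add, zpow_mul l 2, (zpow_ofNat l 2).trans hl, one_zpow, mul_one]
    refine HU_ext fun r s p n q => ?_
    rw [LinearMap.comp_apply, LinearMap.rTensor_tmul, LinearMap.mulLeft_apply, hsq_mul_monH, tauBeta_mon,
      tauBeta_mon, e]

theorem tauBeta_mul_gsq (l : kˣ) {β : k} (hβ : β * (1 - (l : k) ^ 2) = 0) (f : H k) (y : U k) :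
    β * tauBeta l β (f ⊗ₜ (y * gen (URel k) .g ^ 2)) = β * tauBeta l β (f ⊗ₜ y) := by
  rcases mul_eq_zero.1 hβ with rfl | h
  · simp
  · have hl : (l : k) ^ 2 = 1 := by linear_combination -h
    have e : (gTw l l).comp (gTw l l) = AlgHom.id k (H k) := by
      apply pres_ext
      rintro (_ | _ | _ | _) <;> simp [smul_smul, hl, ← pow_two]
    rw [pow_two, ← mul_assoc, tauBeta_mul_g l hβ, tauBeta_mul_g l hβ, ← AlgHom.comp_apply, e]
    rfl

theorem tauBeta_comp_g {m : kˣ} (l : kˣ) {β : k} (hm : β * (1 - (m : k) ^ 2) = 0) :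
    tauBeta l β ∘ₗ (LinearMap.mulRight k (gen (URel k) .g)).lTensor (H k) =
      tauBeta l β ∘ₗ (gTw m l).toLinearMap.rTensor (U k) := by
  refine TensorProduct.ext' fun f y => ?_
  rw [LinearMap.comp_apply, LinearMap.comp_apply, LinearMap.lTensor_tmul, LinearMap.rTensor_tmul,
    LinearMap.mulRight_apply, tauBeta_mul_g l hm, AlgHom.toLinearMap_apply]

theorem tauBeta_comp_a (l : kˣ) (β : k) :
    tauBeta l β ∘ₗ (LinearMap.mulRight k (gen (URel k) .a)).lTensor (H k) =
      β • (tauBeta l β ∘ₗ (dD k).rTensor (U k)) := by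
  refine TensorProduct.ext' fun f y => ?_
  rw [LinearMap.comp_apply, LinearMap.smul_apply, LinearMap.comp_apply, LinearMap.lTensor_tmul,
    LinearMap.rTensor_tmul, LinearMap.mulRight_apply, tauBeta_mul_a, smul_eq_mul]

theorem tauBeta_comp_gsq (l : kˣ) {β : k} (hβ : β * (1 - (l : k) ^ 2) = 0) :
    β • (tauBeta l β ∘ₗ (LinearMap.mulRight k (gen (URel k) .g ^ 2)).lTensor (H k)) =
      β • tauBeta l β := by
  refine TensorProduct.ext' fun f y => ?_
  rw [LinearMap.smul_apply, LinearMap.smul_apply, LinearMap.comp_apply, LinearMap.lTensor_tmul,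
    LinearMap.mulRight_apply, smul_eq_mul, smul_eq_mul, tauBeta_mul_gsq l hβ]

theorem tauBeta_comp_hsq (l : kˣ) {β : k} (hβ : β * (1 - (l : k) ^ 2) = 0) :
    β • (tauBeta l β ∘ₗ (LinearMap.mulLeft k (gen (LRel k 0) .h ^ 2) ∘ₗ dD k).rTensor (U k)) =
      β • (tauBeta l β ∘ₗ (dD k).rTensor (U k)) := by
  refine TensorProduct.ext' fun f y => ?_
  rw [LinearMap.smul_apply, LinearMap.smul_apply, LinearMap.comp_apply, LinearMap.comp_apply,
    LinearMap.rTensor_tmul, LinearMap.rTensor_tmul, LinearMap.comp_apply,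
    LinearMap.mulLeft_apply, smul_eq_mul, smul_eq_mul, tauBeta_mul_hsq l hβ]

theorem balance_dD : (LinearMap.mulLeft k (gen (LRel k 0) .h ^ 2) ∘ₗ dD k).rTensor (H k) ∘ₗ comul =
    (dD k).lTensor (H k) ∘ₗ comul (R := k) :=
  balance_skew (eb := 1) (ec := 1) dD_one (by simp [dD_b]) (by simp [dD_c]) dD_h dD_hInv

theorem conv_tauBeta_comp_g (l : kˣ) {β : k} (hβ : -β * (1 - ((l⁻¹ : kˣ) : k) ^ 2) = 0) :
    conv (tauBeta l β) (tauBeta l⁻¹ (-β)) ∘ₗ (LinearMap.mulRight k (gen (URel k) .g)).lTensor (H k) =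
      conv (tauBeta l β) (tauBeta l⁻¹ (-β)) ∘ₗ (gAut k).toLinearMap.rTensor (U k) := by
  have e := comul_comp_lTensor (C := H k) (comul_mulRight_grouplike (comul_U_g (k := k)))
  have e' := comul_comp_map_id (D := U k) (comul_gAut l)
  rw [conv_comp e, conv_comp e', tauBeta_comp_g (m := 1) l (by simp), tauBeta_comp_g l⁻¹ hβ]

/-- The summands of `Δ(a) = a ⊗ 1 + g² ⊗ a` contribute `β` with the derivation `D = ∂_b + ∂_c` in
the left factor and `-β` with `D` in the right one. Moving `D` to the left costs `h²`. Both `g²` and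
`h²` can be dropped next to a factor `β`, because `β ≠ 0` forces `λ² = 1`; so the contributions
cancel. -/
theorem conv_tauBeta_comp_a (l : kˣ) {β : k} (hβ : β * (1 - (l : k) ^ 2) = 0) :
    conv (tauBeta l β) (tauBeta l⁻¹ (-β)) ∘ₗ (LinearMap.mulRight k (gen (URel k) .a)).lTensor (H k) =
      0 := by
  have e := comul_comp_lTensor_add (C := H k) (comul_mulRight_a (k := k))
  have b := balance_map (C := H k) (D := U k) balance_dD balance_id
  have b' := conv_balance b (tauBeta l β) (tauBeta l⁻¹ (-β))
  have e3 := tauBeta_comp_hsq l hβ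
  rw [LinearMap.rTensor] at e3
  have e2 : β • conv (tauBeta l β ∘ₗ (LinearMap.mulRight k (gen (URel k) .g ^ 2)).lTensor (H k))
      (tauBeta l⁻¹ (-β) ∘ₗ (dD k).rTensor (U k)) =
      β • conv (tauBeta l β ∘ₗ (dD k).rTensor (U k)) (tauBeta l⁻¹ (-β)) := by
    rw [← conv_smul_left, tauBeta_comp_gsq l hβ, conv_smul_left, ← conv_smul_left β (_ ∘ₗ _), ← e3,
      conv_smul_left, b']
    rfl
  have key : ∀ A B : H k ⊗[k] U k →ₗ[k] k, β • B = β • A → β • A + -β • B = 0 := by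
    intro A B h
    ext x y
    have := LinearMap.congr_fun h (x ⊗ₜ y)
    simp only [LinearMap.smul_apply, smul_eq_mul] at this
    simp [this]
  rw [conv_comp_add e, tauBeta_comp_a, tauBeta_comp_a, LinearMap.lTensor_id, LinearMap.comp_id,
    conv_smul_right, conv_smul_left]
  exact key _ _ e2

/-- The convolution satisfies the recursion that characterizes `ε`: the twists of the two factors
combine to `gAut`, and `a` gives zero. -/
theorem conv_tauBeta (l : kˣ) {β : k} (hβ : β * (1 - (l : k) ^ 2) = 0) :
    conv (tauBeta l β) (tauBeta l⁻¹ (-β)) = counit := by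
  have hβ' : -β * (1 - ((l⁻¹ : kˣ) : k) ^ 2) = 0 := by
    rcases mul_eq_zero.1 hβ with rfl | h
    · simp
    · have hl : l ^ 2 = 1 := by ext; push_cast; linear_combination -h
      rw [← Units.val_pow_eq_pow_val, inv_pow, hl]; simp
  refine IsRec.ext ⟨fun f => ?_, fun f y => ?_, fun f y => ?_⟩ isRec_counit
  · have e := comul_comp_mk_right (C := H k) (D := U k) (Bialgebra.comul_one (R := k))
    have e1 : ∀ (l : kˣ) (β : k), tauBeta l β ∘ₗ (TensorProduct.mk k (H k) (U k)).flip 1 = counit :=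
      fun l β => LinearMap.ext (tauBeta_one l β)
    have := LinearMap.congr_fun (conv_comp e (tauBeta l β) (tauBeta l⁻¹ (-β))) f
    rwa [e1, e1, conv_counit_left] at this
  · have := LinearMap.congr_fun (conv_tauBeta_comp_g l hβ') (f ⊗ₜ y)
    rwa [← gTw_one] at this
  · have := LinearMap.congr_fun (conv_tauBeta_comp_a l hβ) (f ⊗ₜ y)
    rw [zero_mul]
    exact this

theorem isConvInverse_tauBeta (l : kˣ) {β : k} (hβ : β * (1 - (l : k) ^ 2) = 0) :
    IsConvInverse (tauBeta l β) (tauBeta l⁻¹ (-β)) := by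
  refine ⟨conv_tauBeta l hβ, ?_⟩
  have hβ' : -β * (1 - ((l⁻¹ : kˣ) : k) ^ 2) = 0 := by
    rcases mul_eq_zero.1 hβ with rfl | h
    · simp
    · have hl : l ^ 2 = 1 := by ext; push_cast; linear_combination -h
      rw [← Units.val_pow_eq_pow_val, inv_pow, hl]; simp
  simpa using conv_tauBeta l⁻¹ hβ'

theorem realizes_tauBeta (h2 : (2 : k) ≠ 0) {α β : k} {l : kˣ} (hα : α * (1 + (l : k) ^ 4) = 0)
    (hβ : β * (1 - (l : k) ^ 2) = 0) :
    Realizes (cocycleMul (sigma α) (sigma (-α))) (cleftMul (sigma α)) (tauBeta l β) α β l := by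
  rw [← pairA_eq h2 hα hβ]
  refine realizes_of_inverse h2 α β l hα hβ (ψ' := tauBeta l⁻¹ (-β)) ?_
  rw [pairA_eq]
  exact isConvInverse_tauBeta l hβ

theorem cleftMul_zero : cleftMul (sigma (0 : k)) = LinearMap.mul' k (H k) := by
  rw [cleftMul, sigma_zero, conv_counit_left]

theorem cocycleMul_zero : cocycleMul (sigma (0 : k)) (sigma 0) = LinearMap.mul' k (H k) := by
  rw [cocycleMul, sigma_zero, conv_counit_left, convRight_counit]

end TauInverse

/-! ### The functionals `τ_λ^β` are twisting data -/

section TwistingData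
variable {k : Type u} [Field k]

theorem conv_counit_right {C : Type*} [AddCommGroup C] [Module k C] [Coalgebra k C] (φ : C →ₗ[k] k) :
    conv φ counit = φ := by
  conv_rhs => rw [← convRight_counit φ]
  ext x
  rw [conv_apply, convRight_apply]
  induction comul (R := k) x using TensorProduct.induction_on with
  | zero => simp
  | add a b ha hb => simp only [map_add, ha, hb]
  | tmul a b => simp [mul_comm]

/-- Expands `Δ(t)` along a chosen representative, the form in which the conditions on a twisting
datum are stated. -/
theorem conv_tmul_sum {C D M : Type*} [AddCommGroup C] [Module k C] [Coalgebra k C]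
    [AddCommGroup D] [Module k D] [Coalgebra k D]
    [AddCommGroup M] [Module k M] (φ : C ⊗[k] D →ₗ[k] k) (χ : C ⊗[k] D →ₗ[k] M) (t : C) (y : D) :
    conv φ χ (t ⊗ₜ y) = ∑ i ∈ (ℛ k t).index, conv (φ ∘ₗ TensorProduct.mk k C D ((ℛ k t).left i))
      (χ ∘ₗ TensorProduct.mk k C D ((ℛ k t).right i)) y := by
  simp only [conv_apply, TensorProduct.comul_tmul]
  conv_lhs => rw [← (ℛ k t).eq]
  rw [TensorProduct.sum_tmul, map_sum, map_sum, map_sum]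
  refine Finset.sum_congr rfl fun i _ => ?_
  induction comul (R := k) y using TensorProduct.induction_on with
  | zero => simp
  | add a b ha hb => simp only [TensorProduct.tmul_add, map_add, ha, hb]
  | tmul a b => simp

theorem lTensor_conv (φ : U k →ₗ[k] k) (χ : U k →ₗ[k] H k) :
    (conv φ χ).lTensor (H k) = conv (φ ∘ₗ pU k) (χ.lTensor (H k)) := by
  refine TensorProduct.ext' fun p y => ?_
  have h1 := congrArg (TensorProduct.lid k (H k)) (Coalgebra.rTensor_counit_comul (R := k) p)
  rw [TensorProduct.lid_tmul, one_smul] at h1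
  rw [LinearMap.lTensor_tmul, conv_apply, conv_apply, TensorProduct.comul_tmul]
  conv_lhs => rw [← h1]
  induction comul (R := k) p using TensorProduct.induction_on with
  | zero => simp
  | add a b ha hb => simp only [TensorProduct.add_tmul, map_add, ha, hb]
  | tmul a b =>
    induction comul (R := k) y using TensorProduct.induction_on with
    | zero => simp
    | add c d hc hd => simp only [TensorProduct.tmul_add, map_add, hc, hd]
    | tmul c d => simp [pU_tmul, TensorProduct.smul_tmul', smul_smul, mul_comm]

theorem counit_tri (v : H k ⊗[k] U k) : counit (R := k) (tri k v) = counit (R := k) v := by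
  refine LinearMap.congr_fun (f := counit ∘ₗ tri k) (IsRec.ext ⟨fun f => ?_, fun f y => ?_, fun f y => ?_⟩
    isRec_counit) v
  · simp [tri_tmul]
  · rw [LinearMap.comp_apply, LinearMap.comp_apply, tri_tmul, tri_tmul, map_mul, Module.End.mul_apply,
      leftAction_g, gTw_one]
  · rw [LinearMap.comp_apply, tri_tmul, map_mul, Module.End.mul_apply, leftAction_a, map_zero, map_zero,
      zero_mul]

theorem counit_tle (v : H k ⊗[k] U k) : counit (R := k) (tle k v) = counit (R := k) v := by
  refine LinearMap.congr_fun (f := counit ∘ₗ tle k) (IsRec.ext ⟨fun f => ?_, fun f y => ?_, fun f y => ?_⟩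
    isRec_counit) v
  · simp [tle_one]
  · rw [LinearMap.comp_apply, LinearMap.comp_apply, tle_mul_g, Bialgebra.counit_mul, counit_U_g, mul_one]
  · rw [LinearMap.comp_apply, tle_mul_a, Bialgebra.counit_mul, counit_U_a, mul_zero, zero_mul]

theorem counit_pH (v : H k ⊗[k] U k) : counit (R := k) (pH k v) = counit (R := k) v := by
  induction v using TensorProduct.induction_on with
  | zero => simp
  | add a b ha hb => simp only [map_add, ha, hb]
  | tmul a b => simp [pH_tmul, mul_comm]

theorem counit_omega (h2 : (2 : k) ≠ 0) (v : H k ⊗[k] U k) :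
    counit (R := k) (omega (tri k) (tle k) v) = counit (R := k) v := by
  rw [← counit_pH, ← LinearMap.comp_apply (pH k), pH_omega h2, counit_tri]

/-- The second half of the conditions of a twisting datum, for the trivial `τ`. -/
theorem twisting_right_sum (h2 : (2 : k) ≠ 0) (ψ : H k ⊗[k] U k →ₗ[k] k) (f : H k) (x y : U k) :
    ∑ i ∈ (ℛ k x).index,
        conv ψ (conv (ψ ∘ₗ (TensorProduct.mk k (H k) (U k)).flip ((ℛ k x).left i) ∘ₗ tri k)
          ((counit (R := k) (A := U k ⊗[k] U k)) ∘ₗ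
            (tle k ∘ₗ (TensorProduct.mk k (H k) (U k)).flip ((ℛ k x).right i)).rTensor (U k) ∘ₗ
            omega (tri k) (tle k))) (f ⊗ₜ y) =
      conv ψ (ψ ∘ₗ (TensorProduct.mk k (H k) (U k)).flip x ∘ₗ tri k) (f ⊗ₜ y) := by
  have e1 : ∀ z : U k, (counit (R := k) (A := U k ⊗[k] U k)) ∘ₗ
      (tle k ∘ₗ (TensorProduct.mk k (H k) (U k)).flip z).rTensor (U k) ∘ₗ omega (tri k) (tle k) =
      counit (R := k) z • counit := by
    intro z
    have e : (counit (R := k) (A := U k ⊗[k] U k)) ∘ₗ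
        (tle k ∘ₗ (TensorProduct.mk k (H k) (U k)).flip z).rTensor (U k) =
        counit (R := k) z • counit := by
      refine TensorProduct.ext' fun p q => ?_
      simp [counit_tle]; ring
    rw [← LinearMap.comp_assoc, e]
    refine LinearMap.ext fun v => ?_
    rw [LinearMap.comp_apply, LinearMap.smul_apply, LinearMap.smul_apply, counit_omega h2]
  let Λ : U k →ₗ[k] k :=
    { toFun := fun z => conv ψ (ψ ∘ₗ (TensorProduct.mk k (H k) (U k)).flip z ∘ₗ tri k) (f ⊗ₜ y)
      map_add' := fun z w => by
        rw [map_add, LinearMap.add_comp, LinearMap.comp_add, conv_add_right, LinearMap.add_apply]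
      map_smul' := fun r z => by
        rw [map_smul, LinearMap.smul_comp, LinearMap.comp_smul, conv_smul_right, LinearMap.smul_apply,
          RingHom.id_apply] }
  have e2 : Λ x = ∑ i ∈ (ℛ k x).index, counit (R := k) ((ℛ k x).right i) • Λ ((ℛ k x).left i) := by
    have := congrArg (TensorProduct.rid k k) (Coalgebra.sum_map_tmul_counit_eq Λ x (repr := ℛ k x))
    rw [TensorProduct.rid_tmul, one_smul, map_sum] at this
    rw [← this]
    rfl
  refine Eq.trans ?_ e2.symm
  refine Finset.sum_congr rfl fun i _ => ?_
  rw [e1, conv_smul_right, conv_counit_right, (conv_smul_right _ _ _ : conv ψ (_ • _) = _)]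
  rfl

/-- Write `θ_ψ(x ⊗ f)` as a sum of `f' ⊗ x'`; the sum then becomes `σ` of `f'` and the `H`-part of
`θ_ψ(x' ⊗ t)`. The factor `ψ(t₁, x₂ ◁ f₂)` is absorbed because `ω` is a coalgebra map with marginal
`◁`. -/
theorem twisting_left_sum_conv (h2 : (2 : k) ≠ 0) (σ : H k ⊗[k] H k →ₗ[k] k)
    (ψ : H k ⊗[k] U k →ₗ[k] k) (f t : H k) (x : U k) :
    ∑ i ∈ (ℛ k t).index,
        conv ψ (conv (ψ ∘ₗ TensorProduct.mk k (H k) (U k) ((ℛ k t).left i) ∘ₗ tle k)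
          (σ ∘ₗ (tri k ∘ₗ TensorProduct.mk k (H k) (U k) ((ℛ k t).right i)).lTensor (H k) ∘ₗ
            omega (tri k) (tle k))) (f ⊗ₜ x) =
      σ ((conv ψ (tri k) ∘ₗ TensorProduct.mk k (H k) (U k) t).lTensor (H k)
        (conv ψ (omega (tri k) (tle k)) (f ⊗ₜ x))) := by
  have e1 : conv ψ (tri k) ∘ₗ TensorProduct.mk k (H k) (U k) t = ∑ i ∈ (ℛ k t).index,
      conv (ψ ∘ₗ TensorProduct.mk k (H k) (U k) ((ℛ k t).left i))
        (tri k ∘ₗ TensorProduct.mk k (H k) (U k) ((ℛ k t).right i)) := by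
    ext y
    rw [LinearMap.comp_apply, TensorProduct.mk_apply, conv_tmul_sum, LinearMap.sum_apply]
  have e2 : ∀ φ : U k →ₗ[k] k, ∀ χ : U k →ₗ[k] H k, σ ∘ₗ (conv φ χ).lTensor (H k) ∘ₗ omega (tri k) (tle k) =
      conv (φ ∘ₗ tle k) (σ ∘ₗ χ.lTensor (H k) ∘ₗ omega (tri k) (tle k)) := by
    intro φ χ
    rw [lTensor_conv, ← LinearMap.comp_assoc, comp_conv, conv_comp (comul_omega h2), LinearMap.comp_assoc,
      pU_omega h2, LinearMap.comp_assoc]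
  let Λ : (U k →ₗ[k] H k) →ₗ[k] k :=
    { toFun := fun T => conv ψ (σ ∘ₗ T.lTensor (H k) ∘ₗ omega (tri k) (tle k)) (f ⊗ₜ x)
      map_add' := fun z w => by
        rw [LinearMap.lTensor_add, LinearMap.add_comp, LinearMap.comp_add, conv_add_right,
          LinearMap.add_apply]
      map_smul' := fun r z => by
        rw [LinearMap.lTensor_smul, LinearMap.smul_comp, LinearMap.comp_smul, conv_smul_right,
          LinearMap.smul_apply, RingHom.id_apply] }
  have e3 : ∀ T : U k →ₗ[k] H k, σ (T.lTensor (H k) (conv ψ (omega (tri k) (tle k)) (f ⊗ₜ x))) = Λ T := by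
    intro T
    rw [← LinearMap.comp_apply (LinearMap.lTensor _ _), ← LinearMap.comp_apply, comp_conv, comp_conv]
    rfl
  rw [e3, e1, map_sum]
  refine Finset.sum_congr rfl fun i _ => ?_
  have e4 : ∀ T : U k →ₗ[k] H k, Λ T = conv ψ (σ ∘ₗ T.lTensor (H k) ∘ₗ omega (tri k) (tle k)) (f ⊗ₜ x) :=
    fun _ => rfl
  rw [e4, e2, LinearMap.comp_assoc]

theorem twisting_left_sum (h2 : (2 : k) ≠ 0) (ψ : H k ⊗[k] U k →ₗ[k] k) (f t : H k) (x : U k) :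
    ∑ i ∈ (ℛ k t).index,
        conv ψ (conv (ψ ∘ₗ TensorProduct.mk k (H k) (U k) ((ℛ k t).left i) ∘ₗ tle k)
          ((counit (R := k) (A := H k ⊗[k] H k)) ∘ₗ
            (tri k ∘ₗ TensorProduct.mk k (H k) (U k) ((ℛ k t).right i)).lTensor (H k) ∘ₗ
            omega (tri k) (tle k))) (f ⊗ₜ x) =
      conv ψ (ψ ∘ₗ TensorProduct.mk k (H k) (U k) t ∘ₗ tle k) (f ⊗ₜ x) := by
  rw [twisting_left_sum_conv h2]
  have e1 : (counit (R := k) (A := H k ⊗[k] H k)) ∘ₗ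
      (conv ψ (tri k) ∘ₗ TensorProduct.mk k (H k) (U k) t).lTensor (H k) =
      ψ ∘ₗ TensorProduct.mk k (H k) (U k) t ∘ₗ pU k := by
    have e0 : counit ∘ₗ conv ψ (tri k) = ψ := by
      rw [comp_conv, (LinearMap.ext counit_tri : counit ∘ₗ tri k = counit), conv_counit_right]
    refine TensorProduct.ext' fun p y => ?_
    have e0' := LinearMap.congr_fun e0 (t ⊗ₜ y)
    rw [LinearMap.comp_apply] at e0'
    simp [pU_tmul, e0', mul_comm]
  rw [← LinearMap.comp_apply counit, e1, ← LinearMap.comp_apply, comp_conv, LinearMap.comp_assoc,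
    LinearMap.comp_assoc, pU_omega h2]


theorem isTwistingDatum_counit_iff (h2 : (2 : k) ≠ 0) (ψ : H k ⊗[k] U k →ₗ[k] k) :
    IsTwistingDatum (sigma 0) (counit (R := k) (A := U k ⊗[k] U k)) ψ ↔
      (∀ f : H k, ψ (f ⊗ₜ 1) = counit (R := k) f) ∧ (∀ x : U k, ψ (1 ⊗ₜ x) = counit (R := k) x) ∧
      (∀ (f : H k) (x y : U k), ψ (f ⊗ₜ (x * y)) =
        conv ψ (ψ ∘ₗ (TensorProduct.mk k (H k) (U k)).flip x ∘ₗ tri k) (f ⊗ₜ y)) ∧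
      ∀ (f f' : H k) (x : U k), ψ ((f * f') ⊗ₜ x) =
        conv ψ (ψ ∘ₗ TensorProduct.mk k (H k) (U k) f' ∘ₗ tle k) (f ⊗ₜ x) := by
  rw [sigma_zero]
  constructor
  · rintro ⟨h1, h1', hr, hl⟩
    refine ⟨h1, h1', fun f x y => ?_, fun f t x => ?_⟩
    · rw [← twisting_right_sum h2, ← hr, conv_counit_left]; rfl
    · rw [← twisting_left_sum h2, ← hl, conv_counit_left]; rfl
  · rintro ⟨h1, h1', hr, hl⟩
    refine ⟨h1, h1', fun f x y => ?_, fun f t x => ?_⟩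
    · rw [twisting_right_sum h2, ← hr, conv_counit_left]; rfl
    · rw [twisting_left_sum h2, ← hl, conv_counit_left]; rfl

theorem isSkewPairing_iff (h2 : (2 : k) ≠ 0) (ψ : H k ⊗[k] U k →ₗ[k] k) :
    IsSkewPairing ψ ↔ (∃ ψ', IsConvInverse ψ ψ') ∧
      IsTwistingDatum (sigma 0) (counit (R := k) (A := U k ⊗[k] U k)) ψ := by
  rw [isTwistingDatum_counit_iff h2]
  exact ⟨fun h => ⟨h.1, h.2, h.3, h.4, h.5⟩, fun h => ⟨h.1, h.2.1, h.2.2.1, h.2.2.2.1, h.2.2.2.2⟩⟩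

/-- The factor `λ²` in the image of `b` is carried by the left leg in both summands, as `λ²c ⊗ 1`
and as `(λh)² ⊗ c`. Hence `gTw l l` is the convolution of `ε ∘ gTw l l` with `gAut`. -/
theorem comul_gTw (l : kˣ) : comul ∘ₗ (gTw l l).toLinearMap =
    TensorProduct.map (gTw l l).toLinearMap (gAut k).toLinearMap ∘ₗ comul (R := k) := by
  have : (Bialgebra.comulAlgHom k (H k)).comp (gTw l l) =
      (Algebra.TensorProduct.map (gTw l l) (gAut k)).comp (Bialgebra.comulAlgHom k (H k)) := by
    apply pres_ext
    rintro (_ | _ | _ | _) <;>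
      simp [gAut, smul_pow, TensorProduct.neg_tmul, TensorProduct.tmul_neg, TensorProduct.smul_tmul']
    all_goals abel
  exact congrArg AlgHom.toLinearMap this

/-- Both sides obey the recursion of `τ_λ^β` in `y`, with initial value `τ_λ^β(·, x)` at `y = 1`. As
`a` acts by zero on `H`, only the summand `a ⊗ 1` of its coproduct matters on the right-hand side.
-/
theorem tauBeta_mul_right {l : kˣ} {β : k} (hβ : β * (1 - (l : k) ^ 2) = 0) (f : H k) (x y : U k) :
    tauBeta l β (f ⊗ₜ (x * y)) =
      conv (tauBeta l β) (tauBeta l β ∘ₗ (TensorProduct.mk k (H k) (U k)).flip x ∘ₗ tri k) (f ⊗ₜ y) := by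
  have eg : tri k ∘ₗ (LinearMap.mulRight k (gen (URel k) .g)).lTensor (H k) =
      tri k ∘ₗ (gAut k).toLinearMap.rTensor (U k) := by
    refine TensorProduct.ext' fun f y => ?_
    rw [LinearMap.comp_apply, LinearMap.comp_apply, LinearMap.lTensor_tmul, LinearMap.rTensor_tmul,
      LinearMap.mulRight_apply, tri_tmul, tri_tmul, map_mul, Module.End.mul_apply, leftAction_g,
      AlgHom.toLinearMap_apply]
  have ea : tri k ∘ₗ (LinearMap.mulRight k (gen (URel k) .a)).lTensor (H k) = 0 := by
    refine TensorProduct.ext' fun f y => ?_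
    rw [LinearMap.comp_apply, LinearMap.lTensor_tmul,
      LinearMap.mulRight_apply, tri_tmul, map_mul, Module.End.mul_apply, leftAction_a, map_zero,
      LinearMap.zero_apply]
  set X := tauBeta l β ∘ₗ (TensorProduct.mk k (H k) (U k)).flip x with hX
  have Hg : ∀ f y, conv (tauBeta l β) (X ∘ₗ tri k) (f ⊗ₜ (y * gen (URel k) .g)) =
      conv (tauBeta l β) (X ∘ₗ tri k) (gTw l l f ⊗ₜ y) := by
    intro f y
    have e := comul_comp_lTensor (C := H k) (comul_mulRight_grouplike (comul_U_g (k := k)))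
    have e' := comul_comp_map_id (D := U k) (comul_gTw l)
    have := LinearMap.congr_fun ((conv_comp e (tauBeta l β) (X ∘ₗ tri k)).trans
      (by rw [tauBeta_comp_g l hβ, LinearMap.comp_assoc, eg, ← LinearMap.comp_assoc _ _ X, ← conv_comp e'])) (f ⊗ₜ y)
    exact this
  have Ha : ∀ f y, conv (tauBeta l β) (X ∘ₗ tri k) (f ⊗ₜ (y * gen (URel k) .a)) =
      β * conv (tauBeta l β) (X ∘ₗ tri k) (dD k f ⊗ₜ y) := by
    intro f y
    have e := comul_comp_lTensor_add (C := H k) (comul_mulRight_a (k := k))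
    have c0 : comul ∘ₗ dD k = TensorProduct.map (dD k) LinearMap.id ∘ₗ comul (R := k) := by
      rw [dD, LinearMap.comp_add, comul_dB, comul_dC, TensorProduct.map_add_left, LinearMap.add_comp]
    have e' := comul_comp_map_id (D := U k) c0
    have e1 := conv_comp e' (tauBeta l β) (X ∘ₗ tri k)
    have e2 := conv_comp_add e (tauBeta l β) (X ∘ₗ tri k)
    have z : ∀ φ : H k ⊗[k] U k →ₗ[k] k, conv φ (0 : H k ⊗[k] U k →ₗ[k] k) = 0 := by
      intro φ; ext; simp [conv_apply]
    have ea' : (X ∘ₗ tri k) ∘ₗ (LinearMap.mulRight k (gen (URel k) .a)).lTensor (H k) = 0 := by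
      rw [LinearMap.comp_assoc, ea, LinearMap.comp_zero]
    rw [tauBeta_comp_a, ea', z, add_zero, conv_smul_left,
      LinearMap.lTensor_id, LinearMap.comp_id] at e2
    rw [LinearMap.rTensor_id, LinearMap.comp_id] at e1
    rw [← e1] at e2
    exact LinearMap.congr_fun e2 (f ⊗ₜ y)
  have P1 : IsRec l l β X (conv (tauBeta l β) (X ∘ₗ tri k)) := by
    refine ⟨fun f => ?_, Hg, Ha⟩
    have e := comul_comp_mk_right (C := H k) (D := U k) (Bialgebra.comul_one (R := k))
    have e1 : tauBeta l β ∘ₗ (TensorProduct.mk k (H k) (U k)).flip 1 = counit :=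
      LinearMap.ext (tauBeta_one l β)
    have e2 : (X ∘ₗ tri k) ∘ₗ (TensorProduct.mk k (H k) (U k)).flip 1 = X := by
      ext f; simp [tri_tmul]
    have := LinearMap.congr_fun (conv_comp e (tauBeta l β) (X ∘ₗ tri k)) f
    rwa [e1, e2, conv_counit_left] at this
  have P2 : IsRec l l β X (tauBeta l β ∘ₗ (LinearMap.mulLeft k x).lTensor (H k)) := by
    refine ⟨fun f => ?_, fun f y => ?_, fun f y => ?_⟩
    · simp [hX]
    · rw [LinearMap.comp_apply, LinearMap.comp_apply, LinearMap.lTensor_tmul, LinearMap.lTensor_tmul,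
        LinearMap.mulLeft_apply, LinearMap.mulLeft_apply, ← mul_assoc, tauBeta_mul_g l hβ]
    · rw [LinearMap.comp_apply, LinearMap.comp_apply, LinearMap.lTensor_tmul, LinearMap.lTensor_tmul,
        LinearMap.mulLeft_apply, LinearMap.mulLeft_apply, ← mul_assoc, tauBeta_mul_a]
  exact LinearMap.congr_fun (P2.ext P1) (f ⊗ₜ y)

theorem counit_cleftMul (α : k) (f t : H k) :
    counit (R := k) (cleftMul (sigma α) (f ⊗ₜ t)) = sigma α (f ⊗ₜ t) := by
  have e : counit ∘ₗ LinearMap.mul' k (H k) = counit (R := k) := TensorProduct.ext' fun f t => by simp [mul_comm]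
  rw [← LinearMap.comp_apply counit, cleftMul, comp_conv, e, conv_counit_right]

/-- Associativity `x(f · t) = (xf)t` in `A^λ_{α,β}`, followed by the counit in ordered form. The
cocycle appears because `ε` of a product in `H_α` is `σ_α`. -/
theorem pairA_mul_left (h2 : (2 : k) ≠ 0) {α β : k} {l : kˣ} (hα : α * (1 + (l : k) ^ 4) = 0)
    (hβ : β * (1 - (l : k) ^ 2) = 0) (f t : H k) (x : U k) :
    pairA h2 α β l hα hβ (cleftMul (sigma α) (f ⊗ₜ t) ⊗ₜ x) =
      sigma α ((pH k ∘ₗ swapA h2 α β l hα hβ ∘ₗ TensorProduct.mk k (H k) (U k) t).lTensor (H k)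
        (swapA h2 α β l hα hβ (f ⊗ₜ x))) := by
  set D := isPBW_A h2 α β l
  set I := equivA α β l h2 hα hβ
  have hI : ∀ v, I v = pbwMap D v := fun _ => rfl
  have hN : ∀ v, I (swapA h2 α β l hα hβ v) = swapMap D v := apply_swapN
  have e1 : I (swapA h2 α β l hα hβ (cleftMul (sigma α) (f ⊗ₜ t) ⊗ₜ x)) =
      I (swapA h2 α β l hα hβ (f ⊗ₜ x)) * sym (α / 2) 0 (gen (ARel k α β l) .b) (gen (ARel k α β l) .c) (hUnitP A_basic) t := by
    rw [hN, hN, swapMap_tmul, swapMap_tmul, ← sym_mul_cleft D.toIsWeyl, mul_assoc]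
  have e2 : ∀ p w, counit (R := k) (I.symm (sym (α / 2) 0 (gen (ARel k α β l) .b) (gen (ARel k α β l) .c) (hUnitP A_basic) p * I w)) =
      sigma α (p ⊗ₜ pH k w) := by
    intro p w
    induction w using TensorProduct.induction_on with
    | zero => simp
    | add a b ha hb => simp only [map_add, mul_add, TensorProduct.tmul_add, ha, hb]
    | tmul q z =>
      rw [hI, pbwMap_tmul, ← mul_assoc, sym_mul_cleft D.toIsWeyl, ← pbwMap_tmul D, ← hI,
        LinearEquiv.symm_apply_apply, TensorProduct.counit_tmul, counit_cleftMul, pH_tmul]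
      simp [mul_comm]
  have e3 : ∀ v, counit (R := k) (I.symm (I v * sym (α / 2) 0 (gen (ARel k α β l) .b) (gen (ARel k α β l) .c) (hUnitP A_basic) t)) =
      sigma α ((pH k ∘ₗ swapA h2 α β l hα hβ ∘ₗ TensorProduct.mk k (H k) (U k) t).lTensor (H k) v) := by
    intro v
    induction v using TensorProduct.induction_on with
    | zero => simp
    | add a b ha hb => simp only [map_add, add_mul, ha, hb]
    | tmul p y =>
      rw [hI, pbwMap_tmul, mul_assoc, ← swapMap_tmul D, ← hN, e2]
      rfl
  rw [← e3, ← e1, LinearEquiv.symm_apply_apply]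
  rfl

theorem isTwistingDatum_tauBeta (h2 : (2 : k) ≠ 0) {α β : k} {l : kˣ} (hα : α * (1 + (l : k) ^ 4) = 0)
    (hβ : β * (1 - (l : k) ^ 2) = 0) :
    IsTwistingDatum (sigma α) (counit (R := k) (A := U k ⊗[k] U k)) (tauBeta l β) := by
  refine ⟨tauBeta_one l β, fun x => ?_, fun f x y => ?_, fun f t x => ?_⟩
  -- On `1 ⊗ x` the value depends neither on `λ` nor on `β`, so it can be read off at `λ = 1`, `β =
  -- 0`, where the functional is the counit.
  · refine LinearMap.congr_fun (f := tauBeta l β ∘ₗ TensorProduct.mk k (H k) (U k) 1) (U_ext fun n q => ?_) x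
    have e := LinearMap.congr_fun (IsRec.ext isRec_counit (isRec_tauBeta (m := 1) 1 (β := (0 : k)) (by simp)))
      (1 ⊗ₜ monU k (n, q))
    rw [TensorProduct.counit_tmul, Bialgebra.counit_one, smul_eq_mul, mul_one] at e
    rw [e, LinearMap.comp_apply, TensorProduct.mk_apply, ← monH_zero, tauBeta_mon, tauBeta_mon]
    rcases n with _ | n <;> simp
  · rw [twisting_right_sum h2, ← tauBeta_mul_right hβ, conv_counit_left]; rfl
  · rw [twisting_left_sum_conv h2]
    have e1 : pH k ∘ₗ swapA h2 α β l hα hβ = conv (tauBeta l β) (tri k) := by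
      rw [swapA_eq, comp_conv, pH_omega h2, pairA_eq]
    have e2 := pairA_mul_left h2 hα hβ f t x
    rw [← LinearMap.comp_assoc, e1, swapA_eq, pairA_eq] at e2
    rw [← e2, ← comp_conv, ← comp_conv]
    rfl

end TwistingData

/-! ### The conditions on a twisting datum, evaluated at `g` and `a` -/

section Uniqueness
variable {k : Type u} [Field k]

theorem comul_comp_mk_right_a : comul ∘ₗ (TensorProduct.mk k (H k) (U k)).flip (gen (URel k) .a) =
    TensorProduct.map ((TensorProduct.mk k (H k) (U k)).flip (gen (URel k) .a))
      ((TensorProduct.mk k (H k) (U k)).flip 1) ∘ₗ comul +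
    TensorProduct.map ((TensorProduct.mk k (H k) (U k)).flip (gen (URel k) .g ^ 2))
      ((TensorProduct.mk k (H k) (U k)).flip (gen (URel k) .a)) ∘ₗ comul (R := k) := by
  ext x
  simp only [LinearMap.comp_apply, LinearMap.flip_apply, TensorProduct.mk_apply,
    TensorProduct.comul_tmul, comul_U_a, LinearMap.add_apply, TensorProduct.tmul_add, map_add]
  induction comul (R := k) x using TensorProduct.induction_on with
  | zero => simp
  | add a b ha hb => simp only [TensorProduct.add_tmul, map_add] at ha hb ⊢; rw [add_add_add_comm, ha, hb, add_add_add_comm]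
  | tmul a b => simp

section
variable {M : Type*} [AddCommGroup M] [Module k M]

theorem conv_tmul_one (φ : H k ⊗[k] U k →ₗ[k] k) (χ : H k ⊗[k] U k →ₗ[k] M) (f : H k) :
    conv φ χ (f ⊗ₜ 1) = conv (φ ∘ₗ (TensorProduct.mk k (H k) (U k)).flip 1)
      (χ ∘ₗ (TensorProduct.mk k (H k) (U k)).flip 1) f :=
  LinearMap.congr_fun (conv_comp (comul_comp_mk_right (C := H k) (D := U k) (Bialgebra.comul_one (R := k))) φ χ) f

theorem conv_tmul_g (φ : H k ⊗[k] U k →ₗ[k] k) (χ : H k ⊗[k] U k →ₗ[k] M) (f : H k) :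
    conv φ χ (f ⊗ₜ gen (URel k) .g) = conv (φ ∘ₗ (TensorProduct.mk k (H k) (U k)).flip (gen (URel k) .g))
      (χ ∘ₗ (TensorProduct.mk k (H k) (U k)).flip (gen (URel k) .g)) f :=
  LinearMap.congr_fun (conv_comp (comul_comp_mk_right (C := H k) (D := U k) (comul_U_g (k := k))) φ χ) f

theorem conv_tmul_a (φ : H k ⊗[k] U k →ₗ[k] k) (χ : H k ⊗[k] U k →ₗ[k] M) (f : H k) :
    conv φ χ (f ⊗ₜ gen (URel k) .a) = conv (φ ∘ₗ (TensorProduct.mk k (H k) (U k)).flip (gen (URel k) .a))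
      (χ ∘ₗ (TensorProduct.mk k (H k) (U k)).flip 1) f +
      conv (φ ∘ₗ (TensorProduct.mk k (H k) (U k)).flip (gen (URel k) .g ^ 2))
      (χ ∘ₗ (TensorProduct.mk k (H k) (U k)).flip (gen (URel k) .a)) f :=
  LinearMap.congr_fun (conv_comp_add (comul_comp_mk_right_a (k := k)) φ χ) f

theorem conv_H_b (φ : H k →ₗ[k] k) (χ : H k →ₗ[k] M) :
    conv φ χ (gen (LRel k 0) .b) = φ (gen (LRel k 0) .b) • χ 1 + φ (gen (LRel k 0) .h ^ 2) • χ (gen (LRel k 0) .b) := by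
  simp [conv_apply]

theorem conv_H_c (φ : H k →ₗ[k] k) (χ : H k →ₗ[k] M) :
    conv φ χ (gen (LRel k 0) .c) = φ (gen (LRel k 0) .c) • χ 1 + φ (gen (LRel k 0) .h ^ 2) • χ (gen (LRel k 0) .c) := by
  simp [conv_apply]

theorem conv_H_h (φ : H k →ₗ[k] k) (χ : H k →ₗ[k] M) :
    conv φ χ (gen (LRel k 0) .h) = φ (gen (LRel k 0) .h) • χ (gen (LRel k 0) .h) := by
  simp [conv_apply]

theorem conv_H_hInv (φ : H k →ₗ[k] k) (χ : H k →ₗ[k] M) :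
    conv φ χ (gen (LRel k 0) .hInv) = φ (gen (LRel k 0) .hInv) • χ (gen (LRel k 0) .hInv) := by
  simp [conv_apply]
end

theorem omega_one (h2 : (2 : k) ≠ 0) (f : H k) : omega (tri k) (tle k) (f ⊗ₜ 1) = f ⊗ₜ 1 := by
  rw [← swapE_zero h2, swapE, swapN_one fun _ => rfl]

theorem omega_g (h2 : (2 : k) ≠ 0) (f : H k) : omega (tri k) (tle k) (f ⊗ₜ gen (URel k) .g) =
    gAut k f ⊗ₜ gen (URel k) .g := by
  have := swapN_mul_g (D := isPBW_E h2 0 0 1) (I := equivE (0 : k) 0 1 h2 (zero_mul _) (zero_mul _)) (fun _ => rfl)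
    (admissible_E (zero_mul _) (zero_mul _)) f 1
  rw [one_mul, swapN_one fun _ => rfl, LinearMap.lTensor_tmul, LinearMap.mulRight_apply, one_mul,
    gTw_one] at this
  rw [← swapE_zero h2, swapE, this]

theorem omega_a (h2 : (2 : k) ≠ 0) (f : H k) : omega (tri k) (tle k) (f ⊗ₜ gen (URel k) .a) =
    aTw 1 f ⊗ₜ gen (URel k) .a := by
  have := swapN_mul_a (D := isPBW_E h2 0 0 1) (I := equivE (0 : k) 0 1 h2 (zero_mul _) (zero_mul _)) (fun _ => rfl)
    (admissible_E (zero_mul _) (zero_mul _)) f 1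
  rw [one_mul, swapN_one fun _ => rfl, swapN_one fun _ => rfl, LinearMap.lTensor_tmul,
    LinearMap.mulRight_apply, one_mul, zero_smul, zero_add] at this
  rw [← swapE_zero h2, swapE, this]

theorem sigma_one_tmul (α : k) (t : H k) : sigma α (1 ⊗ₜ t) = counit (R := k) t :=
  LinearMap.congr_fun (sigma_one α) t

theorem sigma_b_tmul (α : k) (t : H k) : sigma α (gen (LRel k 0) .b ⊗ₜ t) =
    α / 2 * counit (R := k) (dC k t) := by
  have := LinearMap.congr_fun (sigma_b α) (1 ⊗ₜ t)
  simpa [sigma_one_tmul] using this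

theorem sigma_c_tmul (α : k) (t : H k) : sigma α (gen (LRel k 0) .c ⊗ₜ t) =
    -(α / 2 * counit (R := k) (dB k t)) := by
  have := LinearMap.congr_fun (sigma_c α) (1 ⊗ₜ t)
  simpa [sigma_one_tmul] using this

theorem sigma_h_tmul (α : k) (t : H k) : sigma α (gen (LRel k 0) .h ⊗ₜ t) = counit (R := k) t := by
  have := LinearMap.congr_fun (sigma_h α) (1 ⊗ₜ t)
  simpa [sigma_one_tmul] using this

theorem sigma_hInv_tmul (α : k) (t : H k) : sigma α (gen (LRel k 0) .hInv ⊗ₜ t) = counit (R := k) t := by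
  have := LinearMap.congr_fun (sigma_hInv α) (1 ⊗ₜ t)
  simpa [sigma_one_tmul] using this

theorem cleftMul_b_tmul (α : k) (t : H k) : cleftMul (sigma α) (gen (LRel k 0) .b ⊗ₜ t) =
    gen (LRel k 0) .b * t + (α / 2) • dC k t := by
  have := LinearMap.congr_fun (cleftMul_b α) (1 ⊗ₜ t)
  simpa [cleftMul_one] using this

theorem cleftMul_c_tmul (α : k) (t : H k) : cleftMul (sigma α) (gen (LRel k 0) .c ⊗ₜ t) =
    gen (LRel k 0) .c * t - (α / 2) • dB k t := by
  have := LinearMap.congr_fun (cleftMul_c α) (1 ⊗ₜ t)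
  simpa [cleftMul_one] using this

theorem cleftMul_h_tmul (α : k) (t : H k) : cleftMul (sigma α) (gen (LRel k 0) .h ⊗ₜ t) =
    gen (LRel k 0) .h * t := by
  have := LinearMap.congr_fun (cleftMul_h α) (1 ⊗ₜ t)
  simpa [cleftMul_one] using this

theorem cleftMul_hInv_tmul (α : k) (t : H k) : cleftMul (sigma α) (gen (LRel k 0) .hInv ⊗ₜ t) =
    gen (LRel k 0) .hInv * t := by
  have := LinearMap.congr_fun (cleftMul_hInv α) (1 ⊗ₜ t)
  simpa [cleftMul_one] using this

/-- The functional `f ↦ ψ(f, x)`. -/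
def slice (ψ : H k ⊗[k] U k →ₗ[k] k) (x : U k) : H k →ₗ[k] k :=
  ψ ∘ₗ (TensorProduct.mk k (H k) (U k)).flip x

theorem slice_apply (ψ : H k ⊗[k] U k →ₗ[k] k) (x : U k) (f : H k) : slice ψ x f = ψ (f ⊗ₜ x) := rfl

theorem counit_conv_id {φ : H k →ₗ[k] k} (T : H k →ₗ[k] H k) (hT : counit ∘ₗ T = counit (R := k)) (t : H k) :
    counit (R := k) (conv φ T t) = φ t := by
  rw [← LinearMap.comp_apply, comp_conv, hT, conv_counit_right]

theorem conv_counit_d {d : H k →ₗ[k] H k} (φ : H k →ₗ[k] k)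
    (hd : (LinearMap.mulLeft k (gen (LRel k 0) .h ^ 2) ∘ₗ d).rTensor (H k) ∘ₗ comul =
      d.lTensor (H k) ∘ₗ comul (R := k)) (t : H k) :
    conv φ (counit ∘ₗ d) t = φ (gen (LRel k 0) .h ^ 2 * d t) := by
  rw [← conv_balance hd, conv_counit_right]; rfl

section
variable {α : k} {ψ : H k ⊗[k] U k →ₗ[k] k}

theorem IsTwistingDatum.right (h2 : (2 : k) ≠ 0)
    (T : IsTwistingDatum (sigma α) (counit (R := k) (A := U k ⊗[k] U k)) ψ) (f : H k) (x y : U k) :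
    ψ (f ⊗ₜ (x * y)) = conv ψ (slice ψ x ∘ₗ tri k) (f ⊗ₜ y) := by
  have := T.map_mul_right f x y
  rw [twisting_right_sum h2, conv_counit_left] at this
  exact this

/-- For the group-like `g` the condition becomes a convolution on `H` alone. In the companion for
`a` the second summand of `Δ(a)` drops out, since `a` acts by zero on `H`. -/
theorem IsTwistingDatum.right_g (h2 : (2 : k) ≠ 0)
    (T : IsTwistingDatum (sigma α) (counit (R := k) (A := U k ⊗[k] U k)) ψ) (f : H k) (x : U k) :
    ψ (f ⊗ₜ (x * gen (URel k) .g)) =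
      conv (slice ψ (gen (URel k) .g)) (slice ψ x ∘ₗ (gAut k).toLinearMap) f := by
  have e2 : (slice ψ x ∘ₗ tri k) ∘ₗ (TensorProduct.mk k (H k) (U k)).flip (gen (URel k) .g) =
      slice ψ x ∘ₗ (gAut k).toLinearMap :=
    LinearMap.ext fun f => congrArg (slice ψ x) (leftAction_g f)
  rw [T.right h2, conv_tmul_g, e2]
  rfl

theorem IsTwistingDatum.right_a (h2 : (2 : k) ≠ 0)
    (T : IsTwistingDatum (sigma α) (counit (R := k) (A := U k ⊗[k] U k)) ψ) (f : H k) (x : U k) :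
    ψ (f ⊗ₜ (x * gen (URel k) .a)) = conv (slice ψ (gen (URel k) .a)) (slice ψ x) f := by
  have e1 : (slice ψ x ∘ₗ tri k) ∘ₗ (TensorProduct.mk k (H k) (U k)).flip 1 = slice ψ x := by
    ext f; simp [tri_tmul]
  have e2 : (slice ψ x ∘ₗ tri k) ∘ₗ (TensorProduct.mk k (H k) (U k)).flip (gen (URel k) .a) = 0 := by
    ext f; simp [tri_tmul, leftAction_a]
  have z : ∀ φ : H k →ₗ[k] k, conv φ (0 : H k →ₗ[k] k) = 0 := by
    intro φ; ext; simp [conv_apply]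
  rw [T.right h2, conv_tmul_a, e1, e2, z, LinearMap.zero_apply, add_zero]
  rfl

theorem IsTwistingDatum.left (h2 : (2 : k) ≠ 0)
    (T : IsTwistingDatum (sigma α) (counit (R := k) (A := U k ⊗[k] U k)) ψ) (f t : H k) (x : U k) :
    ψ (cleftMul (sigma α) (f ⊗ₜ t) ⊗ₜ x) =
      sigma α ((conv ψ (tri k) ∘ₗ TensorProduct.mk k (H k) (U k) t).lTensor (H k)
        (conv ψ (omega (tri k) (tle k)) (f ⊗ₜ x))) := by
  have := T.map_mul_left f t x
  rw [twisting_left_sum_conv h2, ← LinearMap.comp_assoc, ← comp_conv] at this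
  exact this

theorem IsTwistingDatum.slice_one
    (T : IsTwistingDatum (sigma α) (counit (R := k) (A := U k ⊗[k] U k)) ψ) :
    ψ ∘ₗ (TensorProduct.mk k (H k) (U k)).flip 1 = counit := LinearMap.ext T.map_one_right

/-- As `g` is group-like, `θ_ψ(g ⊗ f)` has the form `Γ(f) ⊗ g`, so the condition involves no slice
of `ψ` other than the one at `g`. -/
theorem IsTwistingDatum.left_g (h2 : (2 : k) ≠ 0)
    (T : IsTwistingDatum (sigma α) (counit (R := k) (A := U k ⊗[k] U k)) ψ) (f t : H k) :
    ψ (cleftMul (sigma α) (f ⊗ₜ t) ⊗ₜ gen (URel k) .g) =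
      sigma α (conv (slice ψ (gen (URel k) .g)) (gAut k).toLinearMap f ⊗ₜ
        conv (slice ψ (gen (URel k) .g)) (gAut k).toLinearMap t) := by
  have e1 : omega (tri k) (tle k) ∘ₗ (TensorProduct.mk k (H k) (U k)).flip (gen (URel k) .g) =
      (TensorProduct.mk k (H k) (U k)).flip (gen (URel k) .g) ∘ₗ (gAut k).toLinearMap :=
    LinearMap.ext (omega_g h2)
  have e2 : tri k ∘ₗ (TensorProduct.mk k (H k) (U k)).flip (gen (URel k) .g) = (gAut k).toLinearMap :=
    LinearMap.ext leftAction_g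
  rw [T.left h2, conv_tmul_g, e1, ← comp_conv, LinearMap.comp_apply, LinearMap.flip_apply,
    TensorProduct.mk_apply, LinearMap.lTensor_tmul, LinearMap.comp_apply, TensorProduct.mk_apply,
    conv_tmul_g, e2]
  rfl

/-- Here `θ_ψ(a ⊗ f)` has a component in `H ⊗ 1` and one in `H ⊗ a`. The slice of `ψ` at `a`
therefore obeys a Leibniz rule, twisted by the slice at `g²`. -/
theorem IsTwistingDatum.left_a (h2 : (2 : k) ≠ 0)
    (T : IsTwistingDatum (sigma α) (counit (R := k) (A := U k ⊗[k] U k)) ψ) (f t : H k) :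
    ψ (cleftMul (sigma α) (f ⊗ₜ t) ⊗ₜ gen (URel k) .a) =
      sigma α (conv (slice ψ (gen (URel k) .a)) LinearMap.id f ⊗ₜ t) +
      sigma α (conv (slice ψ (gen (URel k) .g ^ 2)) (aTw 1).toLinearMap f ⊗ₜ
        conv (slice ψ (gen (URel k) .a)) LinearMap.id t) := by
  have e0 : omega (tri k) (tle k) ∘ₗ (TensorProduct.mk k (H k) (U k)).flip 1 =
      (TensorProduct.mk k (H k) (U k)).flip 1 ∘ₗ LinearMap.id :=
    LinearMap.ext (omega_one h2)
  have e1 : omega (tri k) (tle k) ∘ₗ (TensorProduct.mk k (H k) (U k)).flip (gen (URel k) .a) =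
      (TensorProduct.mk k (H k) (U k)).flip (gen (URel k) .a) ∘ₗ (aTw 1).toLinearMap :=
    LinearMap.ext (omega_a h2)
  have e2 : tri k ∘ₗ (TensorProduct.mk k (H k) (U k)).flip (gen (URel k) .a) = 0 :=
    LinearMap.ext leftAction_a
  have e3 : tri k ∘ₗ (TensorProduct.mk k (H k) (U k)).flip 1 = LinearMap.id := by
    ext f; simp [tri_tmul]
  have z : ∀ φ : H k →ₗ[k] k, conv φ (0 : H k →ₗ[k] H k) = 0 := by
    intro φ; ext; simp [conv_apply]
  rw [T.left h2, conv_tmul_a, e0, e1, ← comp_conv, ← comp_conv, LinearMap.comp_apply, LinearMap.comp_apply,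
    LinearMap.flip_apply, LinearMap.flip_apply, TensorProduct.mk_apply, TensorProduct.mk_apply, map_add,
    map_add, LinearMap.lTensor_tmul, LinearMap.lTensor_tmul, LinearMap.comp_apply, LinearMap.comp_apply,
    TensorProduct.mk_apply, TensorProduct.mk_apply, conv_tmul_one, conv_tmul_a, e2, e3, z,
    LinearMap.zero_apply, add_zero, T.slice_one, conv_counit_left]
  rfl

end
end Uniqueness

/-! ### Classification of twisting data -/

section Classification
variable {k : Type u} [Field k] {α : k} {ψ : H k ⊗[k] U k →ₗ[k] k}

theorem gAut_b : gAut k (gen (LRel k 0) .b) = -gen (LRel k 0) .c := presLift_gen _ _ _ _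
theorem gAut_c : gAut k (gen (LRel k 0) .c) = -gen (LRel k 0) .b := presLift_gen _ _ _ _
theorem gAut_h : gAut k (gen (LRel k 0) .h) = gen (LRel k 0) .h := presLift_gen _ _ _ _
theorem gAut_hInv : gAut k (gen (LRel k 0) .hInv) = gen (LRel k 0) .hInv := presLift_gen _ _ _ _

theorem dB_gAut (f : H k) : dB k (gAut k f) = -gAut k (dC k f) := by
  rw [← gTw_one, dB_gTw]; simp

theorem dC_gAut (f : H k) : dC k (gAut k f) = -gAut k (dB k f) := by
  rw [← gTw_one, dC_gTw]; simp

theorem counit_gAut (f : H k) : counit (R := k) (gAut k f) = counit (R := k) f := by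
  rw [← gTw_one, counit_gTw]

theorem IsTwistingDatum.g_h (h2 : (2 : k) ≠ 0)
    (T : IsTwistingDatum (sigma α) (counit (R := k) (A := U k ⊗[k] U k)) ψ) (t : H k) :
    ψ ((gen (LRel k 0) .h * t) ⊗ₜ gen (URel k) .g) =
      ψ (gen (LRel k 0) .h ⊗ₜ gen (URel k) .g) * ψ (t ⊗ₜ gen (URel k) .g) := by
  have := T.left_g h2 (gen (LRel k 0) .h) t
  rwa [cleftMul_h_tmul, conv_H_h, ← TensorProduct.smul_tmul', map_smul, AlgHom.toLinearMap_apply, gAut_h,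
    sigma_h_tmul, counit_conv_id _ (LinearMap.ext counit_gAut)] at this

theorem IsTwistingDatum.g_hInv (h2 : (2 : k) ≠ 0)
    (T : IsTwistingDatum (sigma α) (counit (R := k) (A := U k ⊗[k] U k)) ψ) (t : H k) :
    ψ ((gen (LRel k 0) .hInv * t) ⊗ₜ gen (URel k) .g) =
      ψ (gen (LRel k 0) .hInv ⊗ₜ gen (URel k) .g) * ψ (t ⊗ₜ gen (URel k) .g) := by
  have := T.left_g h2 (gen (LRel k 0) .hInv) t
  rwa [cleftMul_hInv_tmul, conv_H_hInv, ← TensorProduct.smul_tmul', map_smul, AlgHom.toLinearMap_apply,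
    gAut_hInv, sigma_hInv_tmul, counit_conv_id _ (LinearMap.ext counit_gAut)] at this

theorem counit_d_conv_gAut {d d' : H k →ₗ[k] H k} (φ : H k →ₗ[k] k)
    (hd' : (LinearMap.mulLeft k (gen (LRel k 0) .h ^ 2) ∘ₗ d').rTensor (H k) ∘ₗ comul =
      d'.lTensor (H k) ∘ₗ comul (R := k)) (h : ∀ f, d (gAut k f) = -gAut k (d' f)) (t : H k) :
    counit (R := k) (d (conv φ (gAut k).toLinearMap t)) = -φ (gen (LRel k 0) .h ^ 2 * d' t) := by
  have e : (counit ∘ₗ d) ∘ₗ (gAut k).toLinearMap = -(counit (R := k) ∘ₗ d') := by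
    refine LinearMap.ext fun f => ?_
    rw [LinearMap.comp_apply, LinearMap.comp_apply, AlgHom.toLinearMap_apply, h, map_neg, counit_gAut]
    rfl
  rw [← LinearMap.comp_apply counit, ← LinearMap.comp_apply, comp_conv, e, ← conv_counit_d φ hd']
  have z : conv φ (-(counit (R := k) ∘ₗ d')) = -conv φ (counit (R := k) ∘ₗ d') := by
    have e : ∀ F : H k →ₗ[k] k, -F = (-1 : k) • F := fun F => by ext; simp
    rw [e, conv_smul_right, ← e]
  rw [z]; rfl

/-- Put `λ = ψ(h, g)`. The term `α/2` is the derivative term of the deformed product of `b` and `t`.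
The term `(α/2)λ⁴` comes from `σ_α` at `g ▷ b = -c`, with one `λ²` from `ψ(h², g)` and another from
`h²∂_c t` when the derivation crosses the coproduct. -/
theorem IsTwistingDatum.g_b (h2 : (2 : k) ≠ 0)
    (T : IsTwistingDatum (sigma α) (counit (R := k) (A := U k ⊗[k] U k)) ψ) (t : H k) :
    ψ ((gen (LRel k 0) .b * t) ⊗ₜ gen (URel k) .g) =
      ψ (gen (LRel k 0) .b ⊗ₜ gen (URel k) .g) * ψ (t ⊗ₜ gen (URel k) .g) -
      α / 2 * (1 + ψ (gen (LRel k 0) .h ⊗ₜ gen (URel k) .g) ^ 4) * ψ (dC k t ⊗ₜ gen (URel k) .g) := by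
  have := T.left_g h2 (gen (LRel k 0) .b) t
  rw [cleftMul_b_tmul, conv_H_b, TensorProduct.add_tmul, TensorProduct.add_tmul, map_add, map_add,
    ← TensorProduct.smul_tmul', ← TensorProduct.smul_tmul', ← TensorProduct.smul_tmul', map_smul, map_smul,
    map_smul, AlgHom.toLinearMap_apply, AlgHom.toLinearMap_apply, map_one, gAut_b,
    TensorProduct.neg_tmul, map_neg, sigma_one_tmul, sigma_c_tmul,
    counit_d_conv_gAut _ balance_dC dB_gAut, counit_conv_id _ (LinearMap.ext counit_gAut)] at this
  simp only [slice_apply, pow_two, mul_assoc, T.g_h h2, smul_eq_mul] at this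
  linear_combination this

theorem IsTwistingDatum.g_c (h2 : (2 : k) ≠ 0)
    (T : IsTwistingDatum (sigma α) (counit (R := k) (A := U k ⊗[k] U k)) ψ) (t : H k) :
    ψ ((gen (LRel k 0) .c * t) ⊗ₜ gen (URel k) .g) =
      ψ (gen (LRel k 0) .c ⊗ₜ gen (URel k) .g) * ψ (t ⊗ₜ gen (URel k) .g) +
      α / 2 * (1 + ψ (gen (LRel k 0) .h ⊗ₜ gen (URel k) .g) ^ 4) * ψ (dB k t ⊗ₜ gen (URel k) .g) := by
  have := T.left_g h2 (gen (LRel k 0) .c) t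
  rw [cleftMul_c_tmul, conv_H_c, TensorProduct.add_tmul, TensorProduct.sub_tmul, map_add, map_sub,
    ← TensorProduct.smul_tmul', ← TensorProduct.smul_tmul', ← TensorProduct.smul_tmul', map_smul, map_smul,
    map_smul, AlgHom.toLinearMap_apply, AlgHom.toLinearMap_apply, map_one, gAut_c,
    TensorProduct.neg_tmul, map_neg, sigma_one_tmul, sigma_b_tmul,
    counit_d_conv_gAut _ balance_dB dC_gAut, counit_conv_id _ (LinearMap.ext counit_gAut)] at this
  simp only [slice_apply, pow_two, mul_assoc, T.g_h h2, smul_eq_mul] at this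
  linear_combination this

/-- The values of a twisting datum on `H ⊗ g`. -/
theorem IsTwistingDatum.exists_g (h2 : (2 : k) ≠ 0)
    (T : IsTwistingDatum (sigma α) (counit (R := k) (A := U k ⊗[k] U k)) ψ) :
    ∃ l : kˣ, α * (1 + (l : k) ^ 4) = 0 ∧ slice ψ (gen (URel k) .g) = counit ∘ₗ (gTw l l).toLinearMap := by
  have one : ψ (1 ⊗ₜ gen (URel k) .g) = 1 := by rw [T.map_one_left, counit_U_g]
  have hu : ψ (gen (LRel k 0) .h ⊗ₜ gen (URel k) .g) * ψ (gen (LRel k 0) .hInv ⊗ₜ gen (URel k) .g) = 1 := by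
    rw [← T.g_h h2, L_h_hInv, one]
  obtain ⟨l, hl⟩ : ∃ l : kˣ, (l : k) = ψ (gen (LRel k 0) .h ⊗ₜ gen (URel k) .g) :=
    ⟨⟨_, _, hu, (mul_comm _ _).trans hu⟩, rfl⟩
  have hli : ((l⁻¹ : kˣ) : k) = ψ (gen (LRel k 0) .hInv ⊗ₜ gen (URel k) .g) := by
    rw [← hl] at hu
    rw [Units.val_inv_eq_inv_val, inv_eq_of_mul_eq_one_right hu]
  have dCh : dC k (gen (LRel k 0) .h) = 0 := by have := dC_h (k := k) 1; simpa [dC_one] using this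
  have dBh : dB k (gen (LRel k 0) .h) = 0 := by have := dB_h (k := k) 1; simpa [dB_one] using this
  have dCc : dC k (gen (LRel k 0) .c) = 1 := by have := dC_c (k := k) 1; simpa [dC_one] using this
  have dBb : dB k (gen (LRel k 0) .b) = 1 := by have := dB_b (k := k) 1; simpa [dB_one] using this
  -- Evaluating `hb = -bh` in both ways gives `2λψ(b, g) = 0`.
  have hb : ψ (gen (LRel k 0) .b ⊗ₜ gen (URel k) .g) = 0 := by
    have e := T.g_h h2 (gen (LRel k 0) .b)
    rw [L_h_b, TensorProduct.neg_tmul, map_neg, T.g_b h2, dCh, ← hl] at e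
    simp only [TensorProduct.zero_tmul, map_zero, mul_zero, sub_zero] at e
    refine (mul_eq_zero.1 (?_ : (2 * (l : k)) * ψ (gen (LRel k 0) .b ⊗ₜ gen (URel k) .g) = 0)).resolve_left
      (mul_ne_zero h2 l.ne_zero)
    linear_combination -e
  have hc : ψ (gen (LRel k 0) .c ⊗ₜ gen (URel k) .g) = 0 := by
    have e := T.g_h h2 (gen (LRel k 0) .c)
    rw [L_h_c, TensorProduct.neg_tmul, map_neg, T.g_c h2, dBh, ← hl] at e
    simp only [TensorProduct.zero_tmul, map_zero, mul_zero, add_zero] at e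
    refine (mul_eq_zero.1 (?_ : (2 * (l : k)) * ψ (gen (LRel k 0) .c ⊗ₜ gen (URel k) .g) = 0)).resolve_left
      (mul_ne_zero h2 l.ne_zero)
    linear_combination -e
  -- The two evaluations of `bc = cb` at `g` differ only in the sign of `(α/2)(1 + λ⁴)`, so this
  -- quantity vanishes.
  have hα : α / 2 * (1 + (l : k) ^ 4) = 0 := by
    have e := T.g_b h2 (gen (LRel k 0) .c)
    rw [H_b_c, T.g_c h2, dCc, dBb, hb, hc, one, ← hl] at e
    refine (mul_eq_zero.1 (?_ : 2 * (α / 2 * (1 + (l : k) ^ 4)) = 0)).resolve_left h2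
    linear_combination e
  refine ⟨l, by rw [← alpha_half h2 α, mul_assoc, hα, mul_zero], ?_⟩
  refine linearMap_ext_left ?_ fun x t ht => ?_
  · simpa [slice_apply] using one
  · rw [slice_apply] at ht
    rw [slice_apply]
    cases x
    · rw [T.g_b h2, hb, ← hl, hα]; simp
    · rw [T.g_c h2, hc, ← hl, hα]; simp
    · rw [T.g_h h2, ← hl, ht]; simp
    · rw [T.g_hInv h2, ← hli, ht]; simp

theorem IsTwistingDatum.a_h (h2 : (2 : k) ≠ 0)
    (T : IsTwistingDatum (sigma α) (counit (R := k) (A := U k ⊗[k] U k)) ψ) (t : H k) :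
    ψ ((gen (LRel k 0) .h * t) ⊗ₜ gen (URel k) .a) =
      ψ (gen (LRel k 0) .h ⊗ₜ gen (URel k) .a) * counit (R := k) t -
      ψ (gen (LRel k 0) .h ⊗ₜ (gen (URel k) .g ^ 2)) * ψ (t ⊗ₜ gen (URel k) .a) := by
  have := T.left_a h2 (gen (LRel k 0) .h) t
  rw [cleftMul_h_tmul, conv_H_h, conv_H_h, ← TensorProduct.smul_tmul', ← TensorProduct.smul_tmul',
    map_smul, map_smul, LinearMap.id_apply, AlgHom.toLinearMap_apply, aTw_h, Units.val_one, one_pow,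
    one_smul, TensorProduct.neg_tmul, map_neg, sigma_h_tmul, sigma_h_tmul,
    counit_conv_id _ (LinearMap.comp_id _)] at this
  simp only [slice_apply, smul_eq_mul] at this
  rw [this]; ring

theorem counit_d_conv_id {d : H k →ₗ[k] H k} (φ : H k →ₗ[k] k)
    (hd : (LinearMap.mulLeft k (gen (LRel k 0) .h ^ 2) ∘ₗ d).rTensor (H k) ∘ₗ comul =
      d.lTensor (H k) ∘ₗ comul (R := k)) (t : H k) :
    counit (R := k) (d (conv φ LinearMap.id t)) = φ (gen (LRel k 0) .h ^ 2 * d t) := by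
  rw [← LinearMap.comp_apply counit, ← LinearMap.comp_apply, comp_conv, LinearMap.comp_id, ← conv_counit_d φ hd]

theorem IsTwistingDatum.a_b (h2 : (2 : k) ≠ 0)
    (T : IsTwistingDatum (sigma α) (counit (R := k) (A := U k ⊗[k] U k)) ψ) (t : H k) :
    ψ ((gen (LRel k 0) .b * t) ⊗ₜ gen (URel k) .a) =
      ψ (gen (LRel k 0) .b ⊗ₜ gen (URel k) .a) * counit (R := k) t +
      ψ ((gen (LRel k 0) .h ^ 2) ⊗ₜ gen (URel k) .a) * (α / 2 * counit (R := k) (dC k t)) +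
      ψ (gen (LRel k 0) .b ⊗ₜ (gen (URel k) .g ^ 2)) * ψ (t ⊗ₜ gen (URel k) .a) +
      ψ ((gen (LRel k 0) .h ^ 2) ⊗ₜ (gen (URel k) .g ^ 2)) * (α / 2) *
        ψ ((gen (LRel k 0) .h ^ 2 * dC k t) ⊗ₜ gen (URel k) .a) -
      α / 2 * ψ (dC k t ⊗ₜ gen (URel k) .a) := by
  have := T.left_a h2 (gen (LRel k 0) .b) t
  rw [cleftMul_b_tmul, conv_H_b, conv_H_b] at this
  simp only [TensorProduct.add_tmul, map_add, ← TensorProduct.smul_tmul', map_smul, LinearMap.id_apply,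
    AlgHom.toLinearMap_apply, map_one, aTw_b, Units.val_one, one_pow, one_smul,
    sigma_one_tmul, sigma_b_tmul, counit_conv_id _ (LinearMap.comp_id _), counit_d_conv_id _ balance_dC,
    slice_apply, smul_eq_mul] at this
  linear_combination this

theorem IsTwistingDatum.a_c (h2 : (2 : k) ≠ 0)
    (T : IsTwistingDatum (sigma α) (counit (R := k) (A := U k ⊗[k] U k)) ψ) (t : H k) :
    ψ ((gen (LRel k 0) .c * t) ⊗ₜ gen (URel k) .a) =
      ψ (gen (LRel k 0) .c ⊗ₜ gen (URel k) .a) * counit (R := k) t -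
      ψ ((gen (LRel k 0) .h ^ 2) ⊗ₜ gen (URel k) .a) * (α / 2 * counit (R := k) (dB k t)) +
      ψ (gen (LRel k 0) .c ⊗ₜ (gen (URel k) .g ^ 2)) * ψ (t ⊗ₜ gen (URel k) .a) -
      ψ ((gen (LRel k 0) .h ^ 2) ⊗ₜ (gen (URel k) .g ^ 2)) * (α / 2) *
        ψ ((gen (LRel k 0) .h ^ 2 * dB k t) ⊗ₜ gen (URel k) .a) +
      α / 2 * ψ (dB k t ⊗ₜ gen (URel k) .a) := by
  have := T.left_a h2 (gen (LRel k 0) .c) t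
  rw [cleftMul_c_tmul, conv_H_c, conv_H_c] at this
  simp only [TensorProduct.add_tmul, TensorProduct.sub_tmul, map_add, map_sub, ← TensorProduct.smul_tmul',
    map_smul, LinearMap.id_apply,
    AlgHom.toLinearMap_apply, map_one, aTw_c, Units.val_one, one_pow, one_smul,
    sigma_one_tmul, sigma_c_tmul, counit_conv_id _ (LinearMap.comp_id _), counit_d_conv_id _ balance_dB,
    slice_apply, smul_eq_mul] at this
  linear_combination this

/-- A twisting datum for `H_α` is one of the functionals `τ_λ^β`. -/
theorem IsTwistingDatum.exists_eq (h2 : (2 : k) ≠ 0)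
    (T : IsTwistingDatum (sigma α) (counit (R := k) (A := U k ⊗[k] U k)) ψ) :
    ∃ (l : kˣ) (β : k), α * (1 + (l : k) ^ 4) = 0 ∧ β * (1 - (l : k) ^ 2) = 0 ∧ ψ = tauBeta l β := by
  obtain ⟨l, hα, hg⟩ := T.exists_g h2
  have hα' : α / 2 * (1 + (l : k) ^ 4) = 0 := by rw [div_mul_eq_mul_div, hα, zero_div]
  have g1 : ∀ f, ψ (f ⊗ₜ gen (URel k) .g) = counit (R := k) (gTw l l f) := LinearMap.congr_fun hg
  -- Since `ψ(·, g)` is `ε ∘ gTw`, the convolution with `gAut` is `gTw` itself; this is what gives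
  -- `ψ` the recursion rule for `g`.
  have Γ : conv (slice ψ (gen (URel k) .g)) (gAut k).toLinearMap = (gTw l l).toLinearMap := by
    have := conv_comp (comul_gTw l) counit (LinearMap.id (R := k) (M := H k))
    rwa [conv_counit_left, LinearMap.id_comp, LinearMap.id_comp, ← hg, eq_comm] at this
  have R_g : ∀ f y, ψ (f ⊗ₜ (y * gen (URel k) .g)) = ψ (gTw l l f ⊗ₜ y) := by
    intro f y
    rw [T.right_g h2, ← comp_conv, Γ]; rfl
  have g2 : ∀ f, ψ (f ⊗ₜ (gen (URel k) .g ^ 2)) = counit (R := k) (gTw l l (gTw l l f)) := by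
    intro f; rw [pow_two, R_g, g1]
  have a_one : ψ (1 ⊗ₜ gen (URel k) .a) = 0 := by rw [T.map_one_left, counit_U_a]
  have swap : ∀ f, ψ (f ⊗ₜ (gen (URel k) .g * gen (URel k) .a)) = -ψ (gTw l l f ⊗ₜ gen (URel k) .a) := by
    intro f; rw [U_g_a, TensorProduct.tmul_neg, map_neg, R_g]
  -- Evaluating `ga = -ag` on `h` in both ways gives `λψ(h, a) = -λψ(h, a)`.
  have dh : ψ (gen (LRel k 0) .h ⊗ₜ gen (URel k) .a) = 0 := by
    have e := swap (gen (LRel k 0) .h)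
    rw [T.right_a h2, conv_H_h, slice_apply, slice_apply, g1, gTw_h, ← TensorProduct.smul_tmul'] at e
    simp only [map_smul, counit_L_h, smul_eq_mul] at e
    refine (mul_eq_zero.1 (?_ : (2 * (l : k)) * ψ (gen (LRel k 0) .h ⊗ₜ gen (URel k) .a) = 0)).resolve_left
      (mul_ne_zero h2 l.ne_zero)
    linear_combination e
  have a_h : ∀ t, ψ ((gen (LRel k 0) .h * t) ⊗ₜ gen (URel k) .a) = -((l : k) ^ 2 * ψ (t ⊗ₜ gen (URel k) .a)) := by
    intro t
    rw [T.a_h h2, dh, g2]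
    simp only [gTw_h, map_smul, counit_L_h, smul_eq_mul]
    ring
  have dCh : dC k (gen (LRel k 0) .h) = 0 := by have := dC_h (k := k) 1; simpa [dC_one] using this
  -- The derivative terms have coefficient `(α/2)(λ⁸ - 1)`, with `λ⁴` from `ψ(h², g²)` and `λ⁴` from
  -- moving `h²` out; this is a multiple of `(α/2)(1 + λ⁴) = 0`.
  have a_b : ∀ t, ψ ((gen (LRel k 0) .b * t) ⊗ₜ gen (URel k) .a) =
      ψ (gen (LRel k 0) .b ⊗ₜ gen (URel k) .a) * counit (R := k) t := by
    intro t
    rw [T.a_b h2, g2, g2, ← mul_one (gen (LRel k 0) .h ^ 2)]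
    simp only [pow_two, mul_assoc, a_h, dh, a_one, map_mul, map_neg, map_smul, gTw_h, gTw_b, gTw_c,
      Bialgebra.counit_mul, counit_L_b, counit_L_h, smul_eq_mul, mul_one, Bialgebra.counit_one, map_one]
    linear_combination (((l : k) ^ 4 - 1) * ψ (dC k t ⊗ₜ gen (URel k) .a)) * hα'
  have a_c : ∀ t, ψ ((gen (LRel k 0) .c * t) ⊗ₜ gen (URel k) .a) =
      ψ (gen (LRel k 0) .c ⊗ₜ gen (URel k) .a) * counit (R := k) t := by
    intro t
    rw [T.a_c h2, g2, g2, ← mul_one (gen (LRel k 0) .h ^ 2)]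
    simp only [pow_two, mul_assoc, a_h, dh, a_one, map_mul, map_neg, map_smul, gTw_h, gTw_b, gTw_c,
      Bialgebra.counit_mul, counit_L_c, counit_L_h, smul_eq_mul, mul_one, Bialgebra.counit_one, map_one]
    linear_combination (-((l : k) ^ 4 - 1) * ψ (dB k t ⊗ₜ gen (URel k) .a)) * hα'
  obtain ⟨β, hβ⟩ : ∃ β, ψ (gen (LRel k 0) .b ⊗ₜ gen (URel k) .a) = β := ⟨_, rfl⟩
  -- The two evaluations of `hb = -bh` at `a` are `-λ²β` and `-β`.
  have e1 : (l : k) ^ 2 * β = β := by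
    have e := a_h (gen (LRel k 0) .b)
    rw [L_h_b, TensorProduct.neg_tmul, map_neg, a_b, hβ, counit_L_h] at e
    linear_combination e
  -- Conjugation by `g` exchanges `b` and `c`: evaluating `ga = -ag` on `c` gives `ψ(c, a) = λ²ψ(b,
  -- a) = λ²β`.
  have e2 : ψ (gen (LRel k 0) .c ⊗ₜ gen (URel k) .a) = β := by
    have e := swap (gen (LRel k 0) .c)
    rw [T.right_a h2, conv_H_c, slice_apply, slice_apply, slice_apply, slice_apply, g1, g1, gTw_c,
      ← mul_one (gen (LRel k 0) .h ^ 2), pow_two, mul_assoc, a_h, a_h, a_one, TensorProduct.neg_tmul,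
      ← TensorProduct.smul_tmul'] at e
    simp only [map_neg, map_smul, map_one, Bialgebra.counit_one, smul_eq_mul, hβ, mul_zero, neg_zero, mul_one,
      zero_mul, add_zero, neg_neg] at e
    linear_combination e + e1
  have hβ' : β * (1 - (l : k) ^ 2) = 0 := by linear_combination -e1
  refine ⟨l, β, hα, hβ', IsRec.ext ⟨T.map_one_right, R_g, fun f y => ?_⟩ (isRec_tauBeta l hβ')⟩
  have hδ : slice ψ (gen (URel k) .a) = β • (counit ∘ₗ dD k) := by
    refine linearMap_ext_left ?_ fun x t ht => ?_
    · simpa [slice_apply, dD_one] using a_one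
    · rw [slice_apply] at ht
      simp only [LinearMap.smul_apply, LinearMap.comp_apply, smul_eq_mul] at ht
      simp only [slice_apply, LinearMap.smul_apply, LinearMap.comp_apply, smul_eq_mul]
      cases x
      · rw [a_b, hβ, dD_b]; simp
      · rw [a_c, e2, dD_c]; simp
      · rw [a_h, ht, dD_h]; simp; linear_combination (counit (R := k) (dD k t)) * e1
      · have e := a_h (gen (LRel k 0) .hInv * t)
        rw [← mul_assoc, L_h_hInv, one_mul, ht] at e
        rw [dD_hInv]
        simp
        refine mul_left_cancel₀ (pow_ne_zero 2 l.ne_zero) ?_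
        linear_combination e + (counit (R := k) (dD k t)) * e1
  -- Because `Δ D = (D ⊗ 1) Δ` for `D = ∂_b + ∂_c`, convolution with `ε ∘ D` on the left is
  -- composition with `D`, which is the rule for `a` in the recursion.
  have c0 : comul ∘ₗ dD k = TensorProduct.map (dD k) LinearMap.id ∘ₗ comul (R := k) := by
    rw [dD, LinearMap.comp_add, comul_dB, comul_dC, TensorProduct.map_add_left, LinearMap.add_comp]
  have := LinearMap.congr_fun (conv_comp c0 counit (slice ψ y)) f
  rw [conv_counit_left, LinearMap.comp_id] at this
  rw [T.right_a h2, hδ, conv_smul_left, LinearMap.smul_apply, ← this]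
  rfl

end Classification

/-! ### Convolution of algebra-valued maps -/

section ConvolutionAlgebra
variable {k : Type u} [Field k] {C D R : Type*} [AddCommGroup C] [Module k C] [Coalgebra k C]
  [AddCommGroup D] [Module k D] [Coalgebra k D] [Ring R] [Algebra k R]

/-- The convolution product of two linear maps from a coalgebra to an algebra. -/
def convAlg (φ ψ : C →ₗ[k] R) : C →ₗ[k] R :=
  LinearMap.mul' k R ∘ₗ TensorProduct.map φ ψ ∘ₗ comul

theorem convAlg_apply (φ ψ : C →ₗ[k] R) (x : C) :
    convAlg φ ψ x = LinearMap.mul' k R (TensorProduct.map φ ψ (comul x)) := rfl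

theorem convAlg_comp {T T₁ T₂ : C →ₗ[k] C}
    (hT : comul ∘ₗ T = TensorProduct.map T₁ T₂ ∘ₗ comul) (φ ψ : C →ₗ[k] R) (x : C) :
    convAlg φ ψ (T x) = convAlg (φ ∘ₗ T₁) (ψ ∘ₗ T₂) x := by
  have h := LinearMap.congr_fun hT x
  simp only [LinearMap.comp_apply] at h
  rw [convAlg_apply, h, convAlg_apply, TensorProduct.map_comp]
  rfl

theorem convAlg_comp_add {T T₁ T₂ T₃ T₄ : C →ₗ[k] C}
    (hT : comul ∘ₗ T = TensorProduct.map T₁ T₂ ∘ₗ comul + TensorProduct.map T₃ T₄ ∘ₗ comul)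
    (φ ψ : C →ₗ[k] R) (x : C) :
    convAlg φ ψ (T x) = convAlg (φ ∘ₗ T₁) (ψ ∘ₗ T₂) x + convAlg (φ ∘ₗ T₃) (ψ ∘ₗ T₄) x := by
  have h := LinearMap.congr_fun hT x
  simp only [LinearMap.comp_apply, LinearMap.add_apply] at h
  rw [convAlg_apply, h, convAlg_apply, convAlg_apply, TensorProduct.map_comp, TensorProduct.map_comp,
    map_add, map_add]
  rfl

theorem convAlg_balance {T₁ T₂ : C →ₗ[k] C}
    (hT : T₁.rTensor C ∘ₗ comul = T₂.lTensor C ∘ₗ comul) (φ ψ : C →ₗ[k] R) :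
    convAlg (φ ∘ₗ T₁) ψ = convAlg φ (ψ ∘ₗ T₂) := by
  have h := congrArg (fun L => LinearMap.mul' k R ∘ₗ TensorProduct.map φ ψ ∘ₗ L) hT
  simpa only [convAlg, LinearMap.rTensor, LinearMap.lTensor, ← LinearMap.comp_assoc,
    ← TensorProduct.map_comp, LinearMap.comp_id, LinearMap.id_comp] using h

theorem convAlg_sub_left (φ φ' ψ : C →ₗ[k] R) (x : C) :
    convAlg (φ - φ') ψ x = convAlg φ ψ x - convAlg φ' ψ x := by
  simp only [convAlg_apply]
  rw [← map_sub, ← LinearMap.sub_apply]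
  congr 2
  exact TensorProduct.ext' fun a b => by simp [TensorProduct.sub_tmul]

theorem convAlg_sub_right (φ ψ ψ' : C →ₗ[k] R) (x : C) :
    convAlg φ (ψ - ψ') x = convAlg φ ψ x - convAlg φ ψ' x := by
  simp only [convAlg_apply]
  rw [← map_sub, ← LinearMap.sub_apply]
  congr 2
  exact TensorProduct.ext' fun a b => by simp [TensorProduct.tmul_sub]

theorem convAlg_mulLeft (r : R) (φ ψ : C →ₗ[k] R) (x : C) :
    convAlg (LinearMap.mulLeft k r ∘ₗ φ) ψ x = r * convAlg φ ψ x := by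
  simp only [convAlg_apply]
  induction comul (R := k) x using TensorProduct.induction_on with
  | zero => simp
  | add a b ha hb => simp only [map_add, mul_add, ha, hb]
  | tmul a b => simp [mul_assoc]

theorem convAlg_mulRight (r : R) (φ ψ : C →ₗ[k] R) (x : C) :
    convAlg φ (LinearMap.mulRight k r ∘ₗ ψ) x = convAlg φ ψ x * r := by
  simp only [convAlg_apply]
  induction comul (R := k) x using TensorProduct.induction_on with
  | zero => simp
  | add a b ha hb => simp only [map_add, add_mul, ha, hb]
  | tmul a b => simp [mul_assoc]

theorem convAlg_middle (r : R) (φ ψ : C →ₗ[k] R) (x : C) :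
    convAlg (LinearMap.mulRight k r ∘ₗ φ) ψ x = convAlg φ (LinearMap.mulLeft k r ∘ₗ ψ) x := by
  simp only [convAlg_apply]
  induction comul (R := k) x using TensorProduct.induction_on with
  | zero => simp
  | add a b ha hb => simp only [map_add, ha, hb]
  | tmul a b => simp [mul_assoc]

theorem convAlg_mulRight_neg (r : R) (φ ψ : C →ₗ[k] R) (x : C) :
    convAlg (LinearMap.mulRight k (-r) ∘ₗ φ) ψ x = -convAlg (LinearMap.mulRight k r ∘ₗ φ) ψ x := by
  simp only [convAlg_apply]
  induction comul (R := k) x using TensorProduct.induction_on with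
  | zero => simp
  | add a b ha hb => simp only [map_add, neg_add, ha, hb]
  | tmul a b => simp

end ConvolutionAlgebra

/-! ### The convolution inverse of symmetrization -/

section WeylInverse
variable {k : Type u} [Field k] {R : Type*} [Ring R] [Algebra k R] {s t : k} {b c : R} {h : Rˣ}

/-- The inverse of a unit, as a unit of the opposite algebra. -/
def opInv (h : Rˣ) : Rᵐᵒᵖˣ :=
  ⟨MulOpposite.op ((h⁻¹ : Rˣ) : R), MulOpposite.op h, by simp [← MulOpposite.op_mul], by simp [← MulOpposite.op_mul]⟩

/-- The candidate images are those of an antipode. In the opposite algebra the commutator becomes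
`h⁻⁴(cb - bc) = 2(t - s h⁻⁴)`, so the parameters `s` and `t` trade places; for `s ≠ t` the inverse
of `sym` is thus a symmetrization for a different Weyl relation. -/
theorem IsWeyl.op (W : IsWeyl s t b c h) :
    IsWeyl t s (MulOpposite.op (-(((h⁻¹ : Rˣ) : R) ^ 2 * b))) (MulOpposite.op (-(((h⁻¹ : Rˣ) : R) ^ 2 * c)))
      (opInv h) where
  h_b := by
    simp only [opInv, ← MulOpposite.op_mul, ← MulOpposite.op_neg]
    congr 1
    simp only [pow_two, mul_assoc, mul_neg, neg_mul, neg_neg, W.hInv_b, assoc_rule W.hInv_b]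
  h_c := by
    simp only [opInv, ← MulOpposite.op_mul, ← MulOpposite.op_neg]
    congr 1
    simp only [pow_two, mul_assoc, mul_neg, neg_mul, neg_neg, W.hInv_c, assoc_rule W.hInv_c]
  b_c := by
    have e (x y : R) (hy : ((h⁻¹ : Rˣ) : R) * y = -(y * ((h⁻¹ : Rˣ) : R))) :
        -(((h⁻¹ : Rˣ) : R) ^ 2 * y) * -(((h⁻¹ : Rˣ) : R) ^ 2 * x) = ((h⁻¹ : Rˣ) : R) ^ 4 * (y * x) := by
      have : y * ((h⁻¹ : Rˣ) : R) ^ 2 = ((h⁻¹ : Rˣ) : R) ^ 2 * y := by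
        rw [pow_two, mul_assoc ((h⁻¹ : Rˣ) : R), hy, mul_neg, ← mul_assoc ((h⁻¹ : Rˣ) : R), hy, neg_mul, neg_neg, mul_assoc]
      rw [neg_mul_neg, mul_assoc, ← mul_assoc y, this, show (4 : ℕ) = 2 + 2 from rfl, pow_add]
      simp only [mul_assoc]
    have e4 : ((h⁻¹ : Rˣ) : R) ^ 4 * (h : R) ^ 4 = 1 := by
      rw [← Units.val_pow_eq_pow_val, ← Units.val_pow_eq_pow_val, ← Units.val_mul]; simp
    apply MulOpposite.unop_injective
    simp only [opInv, MulOpposite.unop_mul, MulOpposite.unop_add, MulOpposite.unop_op,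
      MulOpposite.unop_smul, MulOpposite.unop_sub, MulOpposite.unop_one, MulOpposite.unop_pow]
    rw [e _ _ W.hInv_c, e _ _ W.hInv_b, W.b_c]
    simp only [mul_add, mul_smul_comm, mul_sub, e4, mul_one]
    rw [add_assoc, ← smul_add]
    simp

variable (s t b c h) in
/-- The convolution inverse of `sym`. -/
def symInv : H k →ₗ[k] R :=
  (MulOpposite.opLinearEquiv k).symm.toLinearMap ∘ₗ
    sym t s (MulOpposite.op (-(((h⁻¹ : Rˣ) : R) ^ 2 * b)))
      (MulOpposite.op (-(((h⁻¹ : Rˣ) : R) ^ 2 * c))) (opInv h)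

theorem symInv_apply (f : H k) : symInv s t b c h f =
    MulOpposite.unop (sym t s (MulOpposite.op (-(((h⁻¹ : Rˣ) : R) ^ 2 * b)))
      (MulOpposite.op (-(((h⁻¹ : Rˣ) : R) ^ 2 * c))) (opInv h) f) := rfl

theorem symInv_one : symInv s t b c h (1 : H k) = 1 := by
  rw [symInv_apply, sym_one]; rfl

theorem symInv_b : symInv s t b c h ∘ₗ LinearMap.mulLeft k (gen (LRel k 0) .b) =
    LinearMap.mulRight k (-(((h⁻¹ : Rˣ) : R) ^ 2 * b)) ∘ₗ symInv s t b c h -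
      LinearMap.mulRight k (t • 1 - s • ((h⁻¹ : Rˣ) : R) ^ 4) ∘ₗ symInv s t b c h ∘ₗ dC k := by
  ext f
  simp only [LinearMap.comp_apply, LinearMap.mulLeft_apply, LinearMap.sub_apply,
    LinearMap.mulRight_apply, symInv_apply, sym_b]
  simp [opInv]

theorem IsWeyl.symInv_c (W : IsWeyl s t b c h) :
    symInv s t b c h ∘ₗ LinearMap.mulLeft k (gen (LRel k 0) .c) =
    LinearMap.mulRight k (-(((h⁻¹ : Rˣ) : R) ^ 2 * c)) ∘ₗ symInv s t b c h -
      LinearMap.mulRight k (-(t • 1 - s • ((h⁻¹ : Rˣ) : R) ^ 4)) ∘ₗ symInv s t b c h ∘ₗ dB k := by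
  ext f
  simp only [LinearMap.comp_apply, LinearMap.mulLeft_apply, LinearMap.sub_apply,
    LinearMap.mulRight_apply, symInv_apply, W.op.sym_c, mul_neg (MulOpposite.unop _), sub_neg_eq_add]
  simp [opInv]

theorem IsWeyl.symInv_h (W : IsWeyl s t b c h) :
    symInv s t b c h ∘ₗ LinearMap.mulLeft k (gen (LRel k 0) .h) =
      LinearMap.mulRight k ((h⁻¹ : Rˣ) : R) ∘ₗ symInv s t b c h := by
  ext f
  simp only [LinearMap.comp_apply, LinearMap.mulLeft_apply, LinearMap.mulRight_apply, symInv_apply,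
    W.op.sym_h]
  simp [opInv]

theorem IsWeyl.symInv_hInv (W : IsWeyl s t b c h) :
    symInv s t b c h ∘ₗ LinearMap.mulLeft k (gen (LRel k 0) .hInv) =
      LinearMap.mulRight k (h : R) ∘ₗ symInv s t b c h := by
  ext f
  simp only [LinearMap.comp_apply, LinearMap.mulLeft_apply, LinearMap.mulRight_apply, symInv_apply,
    W.op.sym_hInv]
  simp [opInv]

theorem IsWeyl.symInv_hsq (W : IsWeyl s t b c h) :
    symInv s t b c h ∘ₗ LinearMap.mulLeft k (gen (LRel k 0) .h ^ 2) =
      LinearMap.mulRight k (((h⁻¹ : Rˣ) : R) ^ 2) ∘ₗ symInv s t b c h := by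
  ext f
  have e := fun f => LinearMap.congr_fun W.symInv_h f
  simp only [LinearMap.comp_apply, LinearMap.mulLeft_apply, LinearMap.mulRight_apply] at e ⊢
  rw [pow_two, mul_assoc, e, e, pow_two, mul_assoc]

theorem IsWeyl.sym_hsq (W : IsWeyl s t b c h) :
    sym s t b c h ∘ₗ LinearMap.mulLeft k (gen (LRel k 0) .h ^ 2) =
      LinearMap.mulLeft k ((h : R) ^ 2) ∘ₗ sym s t b c h := by
  ext f
  simp only [LinearMap.comp_apply, LinearMap.mulLeft_apply, pow_two, mul_assoc, W.sym_h]

theorem IsWeyl.sym_comp_h (W : IsWeyl s t b c h) :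
    sym s t b c h ∘ₗ LinearMap.mulLeft k (gen (LRel k 0) .h) =
      LinearMap.mulLeft k (h : R) ∘ₗ sym s t b c h := by
  ext f
  simp only [LinearMap.comp_apply, LinearMap.mulLeft_apply, W.sym_h]

theorem IsWeyl.sym_comp_hInv (W : IsWeyl s t b c h) :
    sym s t b c h ∘ₗ LinearMap.mulLeft k (gen (LRel k 0) .hInv) =
      LinearMap.mulLeft k ((h⁻¹ : Rˣ) : R) ∘ₗ sym s t b c h := by
  ext f
  simp only [LinearMap.comp_apply, LinearMap.mulLeft_apply, W.sym_hInv]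

theorem sym_comp_b :
    sym s t b c h ∘ₗ LinearMap.mulLeft k (gen (LRel k 0) .b) = LinearMap.mulLeft k b ∘ₗ sym s t b c h -
      LinearMap.mulLeft k (s • 1 - t • (h : R) ^ 4) ∘ₗ sym s t b c h ∘ₗ dC k := by
  ext f
  simp [sym_b]

theorem IsWeyl.sym_comp_c (W : IsWeyl s t b c h) :
    sym s t b c h ∘ₗ LinearMap.mulLeft k (gen (LRel k 0) .c) = LinearMap.mulLeft k c ∘ₗ sym s t b c h -
      LinearMap.mulLeft k (-(s • 1 - t • (h : R) ^ 4)) ∘ₗ sym s t b c h ∘ₗ dB k := by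
  ext f
  simp only [LinearMap.comp_apply, LinearMap.mulLeft_apply, LinearMap.sub_apply, W.sym_c, neg_mul,
    sub_neg_eq_add]

/-- The inductive step of `convAlg_sym_symInv` for a skew-primitive generator. -/
theorem IsWeyl.convAlg_sym_step (W : IsWeyl s t b c h) {y : R} {u : H k} {d : H k →ₗ[k] H k} {e : k}
    (hu : comul ∘ₗ LinearMap.mulLeft k u = TensorProduct.map (LinearMap.mulLeft k u) LinearMap.id ∘ₗ comul +
      TensorProduct.map (LinearMap.mulLeft k (gen (LRel k 0) .h ^ 2)) (LinearMap.mulLeft k u) ∘ₗ comul)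
    (hd : comul ∘ₗ d = TensorProduct.map d LinearMap.id ∘ₗ comul)
    (hd' : (LinearMap.mulLeft k (gen (LRel k 0) .h ^ 2) ∘ₗ d).rTensor (H k) ∘ₗ comul =
      d.lTensor (H k) ∘ₗ comul)
    (h1 : sym s t b c h ∘ₗ LinearMap.mulLeft k u = LinearMap.mulLeft k y ∘ₗ sym s t b c h -
      LinearMap.mulLeft k (e • (s • 1 - t • (h : R) ^ 4)) ∘ₗ sym s t b c h ∘ₗ d)
    (h2 : symInv s t b c h ∘ₗ LinearMap.mulLeft k u =
      LinearMap.mulRight k (-(((h⁻¹ : Rˣ) : R) ^ 2 * y)) ∘ₗ symInv s t b c h -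
      LinearMap.mulRight k (e • (t • 1 - s • ((h⁻¹ : Rˣ) : R) ^ 4)) ∘ₗ symInv s t b c h ∘ₗ d)
    (f : H k) (x x' : k)
    (hf : convAlg (sym s t b c h) (symInv s t b c h) f = algebraMap k R x)
    (hf' : convAlg (sym s t b c h) (symInv s t b c h) (d f) = algebraMap k R x') :
    convAlg (sym s t b c h) (symInv s t b c h) (u * f) = 0 := by
  have E := convAlg_comp_add hu (sym s t b c h) (symInv s t b c h) f
  rw [LinearMap.mulLeft_apply] at E
  rw [convAlg_comp hd, LinearMap.comp_id] at hf'
  rw [E, LinearMap.comp_id, h1, h2, W.sym_hsq, convAlg_sub_left, convAlg_sub_right,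
    convAlg_mulLeft, convAlg_mulLeft, convAlg_mulLeft, convAlg_mulLeft, convAlg_mulRight,
    convAlg_mulRight, hf, hf', ← convAlg_balance hd', ← LinearMap.comp_assoc, W.sym_hsq,
    LinearMap.comp_assoc, convAlg_mulLeft, hf']
  have e2 : (h : R) ^ 2 * ((h⁻¹ : Rˣ) : R) ^ 2 = 1 := by
    rw [← Units.val_pow_eq_pow_val, ← Units.val_pow_eq_pow_val, ← Units.val_mul]; simp
  have e4 : (h : R) ^ 4 * ((h⁻¹ : Rˣ) : R) ^ 4 = 1 := by
    rw [← Units.val_pow_eq_pow_val, ← Units.val_pow_eq_pow_val, ← Units.val_mul]; simp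
  have e3 : (h : R) ^ 2 * (h : R) ^ 2 = (h : R) ^ 4 := by rw [← pow_add]
  have e5 : (h : R) ^ 2 * (((h⁻¹ : Rˣ) : R) ^ 2 * y) = y := by rw [← mul_assoc, e2, one_mul]
  -- The terms in `y` cancel because the middle value is a scalar. The derivative terms cancel
  -- because `h⁴(t - s h⁻⁴) = -(s - t h⁴)`, one `h²` coming from the coproduct and one from moving
  -- `d` to the left leg.
  simp only [Algebra.algebraMap_eq_smul_one, mul_smul_comm, smul_mul_assoc, mul_one, one_mul, mul_neg,
    mul_sub, e4, e5, smul_sub, ← mul_assoc, e3]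
  module

theorem IsWeyl.convAlg_sym_symInv (W : IsWeyl s t b c h) (f : H k) :
    convAlg (sym s t b c h) (symInv s t b c h) f = algebraMap k R (counit f) := by
  refine LinearMap.congr_fun (g := Algebra.linearMap k R ∘ₗ counit) (linearMap_ext_H ?_ ?_ ?_ ?_ ?_) f
  · simp [convAlg_apply, Algebra.TensorProduct.one_def, sym_one, symInv_one]
  · intro f hf
    have E := convAlg_comp (comul_mulLeft_grouplike comul_L_h) (sym s t b c h) (symInv s t b c h) f
    rw [LinearMap.mulLeft_apply, W.symInv_h, convAlg_mulRight, W.sym_comp_h, convAlg_mulLeft, hf] at E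
    simp [E, ← Algebra.commutes, mul_assoc]
  · intro f hf
    have E := convAlg_comp (comul_mulLeft_grouplike comul_L_hInv) (sym s t b c h) (symInv s t b c h) f
    rw [LinearMap.mulLeft_apply, W.symInv_hInv, convAlg_mulRight, W.sym_comp_hInv, convAlg_mulLeft,
      hf] at E
    simp [E, ← Algebra.commutes, mul_assoc]
  · intro f hf hd
    rw [W.convAlg_sym_step comul_mulLeft_b comul_dC balance_dC (e := 1) (y := b)
      (by rw [one_smul]; exact sym_comp_b) (by rw [one_smul]; exact symInv_b) f _ _ hf hd]
    simp
  · intro f hf hd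
    rw [W.convAlg_sym_step comul_mulLeft_c comul_dB balance_dB (e := -1) (y := c)
      (by rw [neg_one_smul]; exact W.sym_comp_c) (by rw [neg_one_smul]; exact W.symInv_c) f _ _ hf hd]
    simp

/-- In this order the corrections stand between the two factors, where they cancel at once; unlike
in `IsWeyl.convAlg_sym_step`, no value at `f` or `d f` has to be known. -/
theorem IsWeyl.convAlg_symInv_step (W : IsWeyl s t b c h) {y : R} {u : H k} {d : H k →ₗ[k] H k} {e : k}
    (hu : comul ∘ₗ LinearMap.mulLeft k u = TensorProduct.map (LinearMap.mulLeft k u) LinearMap.id ∘ₗ comul +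
      TensorProduct.map (LinearMap.mulLeft k (gen (LRel k 0) .h ^ 2)) (LinearMap.mulLeft k u) ∘ₗ comul)
    (hd' : (LinearMap.mulLeft k (gen (LRel k 0) .h ^ 2) ∘ₗ d).rTensor (H k) ∘ₗ comul =
      d.lTensor (H k) ∘ₗ comul)
    (h1 : sym s t b c h ∘ₗ LinearMap.mulLeft k u = LinearMap.mulLeft k y ∘ₗ sym s t b c h -
      LinearMap.mulLeft k (e • (s • 1 - t • (h : R) ^ 4)) ∘ₗ sym s t b c h ∘ₗ d)
    (h2 : symInv s t b c h ∘ₗ LinearMap.mulLeft k u =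
      LinearMap.mulRight k (-(((h⁻¹ : Rˣ) : R) ^ 2 * y)) ∘ₗ symInv s t b c h -
      LinearMap.mulRight k (e • (t • 1 - s • ((h⁻¹ : Rˣ) : R) ^ 4)) ∘ₗ symInv s t b c h ∘ₗ d)
    (f : H k) : convAlg (symInv s t b c h) (sym s t b c h) (u * f) = 0 := by
  have E := convAlg_comp_add hu (symInv s t b c h) (sym s t b c h) f
  rw [LinearMap.mulLeft_apply] at E
  have e4 : ((h⁻¹ : Rˣ) : R) ^ 4 * (h : R) ^ 4 = 1 := by
    rw [← Units.val_pow_eq_pow_val, ← Units.val_pow_eq_pow_val, ← Units.val_mul]; simp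
  have e3 : ((h⁻¹ : Rˣ) : R) ^ 2 * ((h⁻¹ : Rˣ) : R) ^ 2 = ((h⁻¹ : Rˣ) : R) ^ 4 := by rw [← pow_add]
  have c3 (r : R) : convAlg (symInv s t b c h) (LinearMap.mulLeft k r ∘ₗ sym s t b c h ∘ₗ d) f =
      convAlg (LinearMap.mulRight k (((h⁻¹ : Rˣ) : R) ^ 2 * r) ∘ₗ symInv s t b c h ∘ₗ d) (sym s t b c h) f := by
    rw [← convAlg_middle, ← convAlg_balance hd', ← LinearMap.comp_assoc,
      LinearMap.comp_assoc _ _ (LinearMap.mulRight k r), W.symInv_hsq, LinearMap.comp_assoc,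
      LinearMap.comp_assoc, ← LinearMap.comp_assoc _ _ (LinearMap.mulRight k r), ← LinearMap.mulRight_mul]
  have c4 : ((h⁻¹ : Rˣ) : R) ^ 2 * (((h⁻¹ : Rˣ) : R) ^ 2 * e • (s • 1 - t • (h : R) ^ 4)) =
      -(e • (t • 1 - s • ((h⁻¹ : Rˣ) : R) ^ 4)) := by
    rw [← mul_assoc, e3, mul_smul_comm, mul_sub, mul_smul_comm, mul_smul_comm, e4, mul_one, ← smul_neg, neg_sub]
  rw [E, LinearMap.comp_id, h1, h2, W.symInv_hsq, convAlg_sub_left, convAlg_sub_right, convAlg_mulRight_neg,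
    convAlg_middle (_ ^ 2), convAlg_middle (_ ^ 2), ← LinearMap.comp_assoc _ (LinearMap.mulLeft k _),
    ← LinearMap.comp_assoc _ (LinearMap.mulLeft k _), ← LinearMap.mulLeft_mul, ← LinearMap.mulLeft_mul,
    ← convAlg_middle, c3, c4, convAlg_mulRight_neg]
  abel

theorem IsWeyl.convAlg_symInv_sym (W : IsWeyl s t b c h) (f : H k) :
    convAlg (symInv s t b c h) (sym s t b c h) f = algebraMap k R (counit f) := by
  refine LinearMap.congr_fun (g := Algebra.linearMap k R ∘ₗ counit) (linearMap_ext_H ?_ ?_ ?_ ?_ ?_) f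
  · simp [convAlg_apply, Algebra.TensorProduct.one_def, sym_one, symInv_one]
  · intro f hf
    have E := convAlg_comp (comul_mulLeft_grouplike comul_L_h) (symInv s t b c h) (sym s t b c h) f
    rw [LinearMap.mulLeft_apply, W.symInv_h, convAlg_middle, W.sym_comp_h, ← LinearMap.comp_assoc,
      ← LinearMap.mulLeft_mul, Units.inv_mul, LinearMap.mulLeft_one, LinearMap.id_comp, hf] at E
    simp [E]
  · intro f hf
    have E := convAlg_comp (comul_mulLeft_grouplike comul_L_hInv) (symInv s t b c h) (sym s t b c h) f
    rw [LinearMap.mulLeft_apply, W.symInv_hInv, convAlg_middle, W.sym_comp_hInv, ← LinearMap.comp_assoc,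
      ← LinearMap.mulLeft_mul, Units.mul_inv, LinearMap.mulLeft_one, LinearMap.id_comp, hf] at E
    simp [E]
  · intro f hf hd
    rw [W.convAlg_symInv_step comul_mulLeft_b balance_dC (e := 1) (y := b)
      (by rw [one_smul]; exact sym_comp_b) (by rw [one_smul]; exact symInv_b) f]
    simp
  · intro f hf hd
    rw [W.convAlg_symInv_step comul_mulLeft_c balance_dB (e := -1) (y := c)
      (by rw [neg_one_smul]; exact W.sym_comp_c) (by rw [neg_one_smul]; exact W.symInv_c) f]
    simp

end WeylInverse

/-! ### Convolution inverses and translation maps -/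

section Translation
variable {k : Type u} [Field k] {C D R : Type*} [AddCommGroup C] [Module k C] [Coalgebra k C]
  [AddCommGroup D] [Module k D] [Coalgebra k D] [Ring R] [Algebra k R]

/-- Convolution inverses `φ'` of `φ : C → R` and `χ'` of `χ : D → R` give the convolution inverse
`χ'φ'` of `φχ : C ⊗ D → R`. -/
theorem convAlg_tensor {φ φ' : C →ₗ[k] R} {χ χ' : D →ₗ[k] R}
    (hφ : ∀ x, convAlg φ φ' x = algebraMap k R (counit x))
    (hχ : ∀ x, convAlg χ χ' x = algebraMap k R (counit x)) (v : C ⊗[k] D) :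
    convAlg (LinearMap.mul' k R ∘ₗ TensorProduct.map φ χ)
      (LinearMap.mul' k R ∘ₗ TensorProduct.map χ' φ' ∘ₗ (TensorProduct.comm k C D).toLinearMap) v =
      algebraMap k R (counit v) := by
  induction v using TensorProduct.induction_on with
  | zero => simp
  | add a b ha hb => simp only [map_add, ha, hb]
  | tmul x y =>
    have key (X : C ⊗[k] C) (Y : D ⊗[k] D) (t : k)
        (hY : LinearMap.mul' k R (TensorProduct.map χ χ' Y) = algebraMap k R t) :
        LinearMap.mul' k R (TensorProduct.map (LinearMap.mul' k R ∘ₗ TensorProduct.map φ χ)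
          (LinearMap.mul' k R ∘ₗ TensorProduct.map χ' φ' ∘ₗ (TensorProduct.comm k C D).toLinearMap)
          (TensorProduct.AlgebraTensorModule.tensorTensorTensorComm k k k k C C D D (X ⊗ₜ Y))) =
        t • LinearMap.mul' k R (TensorProduct.map φ φ' X) := by
      induction X using TensorProduct.induction_on with
      | zero => simp
      | add a b ha hb => simp only [map_add, TensorProduct.add_tmul, smul_add, ha, hb]
      | tmul p q =>
        have : ∀ Y : D ⊗[k] D,
            LinearMap.mul' k R (TensorProduct.map (LinearMap.mul' k R ∘ₗ TensorProduct.map φ χ)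
              (LinearMap.mul' k R ∘ₗ TensorProduct.map χ' φ' ∘ₗ (TensorProduct.comm k C D).toLinearMap)
              (TensorProduct.AlgebraTensorModule.tensorTensorTensorComm k k k k C C D D ((p ⊗ₜ q) ⊗ₜ Y))) =
            φ p * LinearMap.mul' k R (TensorProduct.map χ χ' Y) * φ' q := by
          intro Y
          induction Y using TensorProduct.induction_on with
          | zero => simp
          | add a b ha hb => simp only [map_add, TensorProduct.tmul_add, mul_add, add_mul, ha, hb]
          | tmul a b => simp [mul_assoc]
        rw [this, hY, ← Algebra.commutes, mul_assoc, ← Algebra.smul_def]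
        simp
    rw [convAlg_apply, TensorProduct.comul_tmul, key _ _ _ (hχ y), ← convAlg_apply, hφ,
      TensorProduct.counit_tmul, smul_eq_mul, map_mul, Algebra.smul_def]

theorem convAlg_tensor' {φ φ' : C →ₗ[k] R} {χ χ' : D →ₗ[k] R}
    (hφ : ∀ x, convAlg φ' φ x = algebraMap k R (counit x))
    (hχ : ∀ x, convAlg χ' χ x = algebraMap k R (counit x)) (v : C ⊗[k] D) :
    convAlg (LinearMap.mul' k R ∘ₗ TensorProduct.map χ' φ' ∘ₗ (TensorProduct.comm k C D).toLinearMap)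
      (LinearMap.mul' k R ∘ₗ TensorProduct.map φ χ) v = algebraMap k R (counit v) := by
  induction v using TensorProduct.induction_on with
  | zero => simp
  | add a b ha hb => simp only [map_add, ha, hb]
  | tmul x y =>
    have key (Y : D ⊗[k] D) (X : C ⊗[k] C) (t : k)
        (hX : LinearMap.mul' k R (TensorProduct.map φ' φ X) = algebraMap k R t) :
        LinearMap.mul' k R (TensorProduct.map
          (LinearMap.mul' k R ∘ₗ TensorProduct.map χ' φ' ∘ₗ (TensorProduct.comm k C D).toLinearMap)
          (LinearMap.mul' k R ∘ₗ TensorProduct.map φ χ)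
          (TensorProduct.AlgebraTensorModule.tensorTensorTensorComm k k k k C C D D (X ⊗ₜ Y))) =
        t • LinearMap.mul' k R (TensorProduct.map χ' χ Y) := by
      induction Y using TensorProduct.induction_on with
      | zero => simp
      | add a b ha hb => simp only [map_add, TensorProduct.tmul_add, smul_add, ha, hb]
      | tmul p q =>
        have : ∀ X : C ⊗[k] C,
            LinearMap.mul' k R (TensorProduct.map
              (LinearMap.mul' k R ∘ₗ TensorProduct.map χ' φ' ∘ₗ (TensorProduct.comm k C D).toLinearMap)
              (LinearMap.mul' k R ∘ₗ TensorProduct.map φ χ)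
              (TensorProduct.AlgebraTensorModule.tensorTensorTensorComm k k k k C C D D (X ⊗ₜ (p ⊗ₜ q)))) =
            χ' p * LinearMap.mul' k R (TensorProduct.map φ' φ X) * χ q := by
          intro X
          induction X using TensorProduct.induction_on with
          | zero => simp
          | add a b ha hb => simp only [map_add, TensorProduct.add_tmul, mul_add, add_mul, ha, hb]
          | tmul a b => simp [mul_assoc]
        rw [this, hX, ← Algebra.commutes, mul_assoc, ← Algebra.smul_def]
        simp
    rw [convAlg_apply, TensorProduct.comul_tmul, key _ _ _ (hφ x), ← convAlg_apply, hχ,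
      TensorProduct.counit_tmul, smul_eq_mul, map_mul, Algebra.smul_def, ← map_mul, ← map_mul,
      mul_comm]

theorem convAlg_antipode {B : Type*} [Ring B] [HopfAlgebra k B] (i : B →ₐ[k] R) (x : B) :
    convAlg i.toLinearMap (i.toLinearMap ∘ₗ HopfAlgebra.antipode k) x = algebraMap k R (counit x) := by
  have h := congrArg i (HopfAlgebra.mul_antipode_lTensor_comul_apply (R := k) x)
  rw [AlgHom.commutes] at h
  rw [← h, convAlg_apply]
  induction comul (R := k) x using TensorProduct.induction_on with
  | zero => simp
  | add a b ha hb => simp only [map_add, ha, hb]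
  | tmul a b => simp

theorem convAlg_antipode' {B : Type*} [Ring B] [HopfAlgebra k B] (i : B →ₐ[k] R) (x : B) :
    convAlg (i.toLinearMap ∘ₗ HopfAlgebra.antipode k) i.toLinearMap x = algebraMap k R (counit x) := by
  have h := congrArg i (HopfAlgebra.mul_antipode_rTensor_comul_apply (R := k) x)
  rw [AlgHom.commutes] at h
  rw [← h, convAlg_apply]
  induction comul (R := k) x using TensorProduct.induction_on with
  | zero => simp
  | add a b ha hb => simp only [map_add, ha, hb]
  | tmul a b => simp

/-- The map `r ⊗ x ↦ r φ(x₁) ⊗ x₂`. -/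
def transRight (φ : C →ₗ[k] R) : R ⊗[k] C →ₗ[k] R ⊗[k] C :=
  (LinearMap.mul' k R).rTensor C ∘ₗ (TensorProduct.assoc k R R C).symm.toLinearMap ∘ₗ
    (φ.rTensor C ∘ₗ comul).lTensor R

/-- The map `x ⊗ r ↦ x₁ ⊗ φ(x₂) r`. -/
def transLeft (φ : C →ₗ[k] R) : C ⊗[k] R →ₗ[k] C ⊗[k] R :=
  (LinearMap.mul' k R).lTensor C ∘ₗ (TensorProduct.assoc k C R R).toLinearMap ∘ₗ
    (φ.lTensor C ∘ₗ comul).rTensor R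

theorem transRight_tmul (φ : C →ₗ[k] R) (r : R) (x : C) :
    transRight φ (r ⊗ₜ x) = (LinearMap.mulLeft k r ∘ₗ φ).rTensor C (comul x) := by
  simp only [transRight, LinearMap.comp_apply, LinearMap.lTensor_tmul]
  induction comul (R := k) x using TensorProduct.induction_on with
  | zero => simp
  | add a b ha hb => simp only [map_add, TensorProduct.tmul_add, ha, hb]
  | tmul a b => simp

theorem transLeft_tmul (φ : C →ₗ[k] R) (r : R) (x : C) :
    transLeft φ (x ⊗ₜ r) = (LinearMap.mulRight k r ∘ₗ φ).lTensor C (comul x) := by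
  simp only [transLeft, LinearMap.comp_apply, LinearMap.rTensor_tmul]
  induction comul (R := k) x using TensorProduct.induction_on with
  | zero => simp
  | add a b ha hb => simp only [map_add, TensorProduct.add_tmul, ha, hb]
  | tmul a b => simp

/-- By coassociativity the composite sends `r ⊗ x` to `r φ(x₁)ψ(x₂) ⊗ x₃`, and the convolution in
the middle collapses to the counit. In `transLeft_comp` the composite is `x₁ ⊗ φ(x₂)ψ(x₃) r`, so the
order of the factors is reversed. -/
theorem transRight_comp {φ ψ : C →ₗ[k] R} (h : ∀ x, convAlg φ ψ x = algebraMap k R (counit x))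
    (v : R ⊗[k] C) : transRight ψ (transRight φ v) = v := by
  induction v using TensorProduct.induction_on with
  | zero => simp
  | add a b ha hb => simp only [map_add, ha, hb]
  | tmul r x =>
    have e1 : transRight ψ (transRight φ (r ⊗ₜ x)) =
        (LinearMap.mulLeft k r ∘ₗ convAlg φ ψ).rTensor C (comul x) := by
      have hc := congrArg ((LinearMap.mulLeft k r ∘ₗ LinearMap.mul' k R ∘ₗ TensorProduct.map φ ψ).rTensor C ∘ₗ
        (TensorProduct.assoc k C C C).symm.toLinearMap) (Coalgebra.coassoc_apply (R := k) x)
      simp only [LinearMap.comp_apply, LinearEquiv.coe_coe, LinearEquiv.symm_apply_apply] at hc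
      rw [show LinearMap.mulLeft k r ∘ₗ convAlg φ ψ = (LinearMap.mulLeft k r ∘ₗ LinearMap.mul' k R ∘ₗ
        TensorProduct.map φ ψ) ∘ₗ comul from rfl, LinearMap.rTensor_comp, LinearMap.comp_apply, hc, transRight_tmul]
      induction comul (R := k) x using TensorProduct.induction_on with
      | zero => simp
      | add a b ha hb => simp only [map_add, ha, hb]
      | tmul a b =>
        simp only [LinearMap.rTensor_tmul, LinearMap.lTensor_tmul, transRight_tmul]
        induction comul (R := k) b using TensorProduct.induction_on with
        | zero => simp
        | add a b ha hb => simp only [map_add, TensorProduct.tmul_add, ha, hb]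
        | tmul a b => simp [mul_assoc]
    have e2 : LinearMap.mulLeft k r ∘ₗ convAlg φ ψ = LinearMap.toSpanSingleton k R r ∘ₗ counit := by
      ext y
      simp [h, Algebra.algebraMap_eq_smul_one]
    rw [e1, e2, LinearMap.rTensor_comp, LinearMap.comp_apply, Coalgebra.rTensor_counit_comul]
    simp

theorem transLeft_comp {φ ψ : C →ₗ[k] R} (h : ∀ x, convAlg φ ψ x = algebraMap k R (counit x))
    (v : C ⊗[k] R) : transLeft φ (transLeft ψ v) = v := by
  induction v using TensorProduct.induction_on with
  | zero => simp
  | add a b ha hb => simp only [map_add, ha, hb]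
  | tmul x r =>
    have e1 : transLeft φ (transLeft ψ (x ⊗ₜ r)) =
        (LinearMap.mulRight k r ∘ₗ convAlg φ ψ).lTensor C (comul x) := by
      have hc := congrArg ((LinearMap.mulRight k r ∘ₗ LinearMap.mul' k R ∘ₗ TensorProduct.map φ ψ).lTensor C)
        (Coalgebra.coassoc_apply (R := k) x)
      rw [show LinearMap.mulRight k r ∘ₗ convAlg φ ψ = (LinearMap.mulRight k r ∘ₗ LinearMap.mul' k R ∘ₗ
        TensorProduct.map φ ψ) ∘ₗ comul from rfl, LinearMap.lTensor_comp, LinearMap.comp_apply, ← hc, transLeft_tmul]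
      induction comul (R := k) x using TensorProduct.induction_on with
      | zero => simp
      | add a b ha hb => simp only [map_add, ha, hb]
      | tmul a b =>
        simp only [LinearMap.rTensor_tmul, LinearMap.lTensor_tmul, transLeft_tmul]
        induction comul (R := k) a using TensorProduct.induction_on with
        | zero => simp
        | add a b ha hb => simp only [map_add, TensorProduct.add_tmul, ha, hb]
        | tmul a b => simp [mul_assoc]
    have e2 : LinearMap.mulRight k r ∘ₗ convAlg φ ψ = LinearMap.toSpanSingleton k R r ∘ₗ counit := by
      ext y
      simp [h, Algebra.algebraMap_eq_smul_one]
    rw [e1, e2, LinearMap.lTensor_comp, LinearMap.comp_apply, Coalgebra.lTensor_counit_comul]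
    simp

end Translation

/-! ### The bi-Galois property -/

section BiGalois
variable {k : Type u} [Field k] {α β : k} {l : kˣ}

/-- The isomorphism is the product of `sym` on `H` and an algebra map on `U`. The first is inverted
by `symInv`, the second by composition with the antipode of `U`, and the inverses are multiplied in
the opposite order. -/
theorem convAlg_equivA_inverse (h2 : (2 : k) ≠ 0) (hα : α * (1 + (l : k) ^ 4) = 0)
    (hβ : β * (1 - (l : k) ^ 2) = 0) :
    ∃ φ' : H k ⊗[k] U k →ₗ[k] Adef k α β l,
      (∀ v, convAlg (equivA α β l h2 hα hβ).toLinearMap φ' v = algebraMap k _ (counit v)) ∧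
      ∀ v, convAlg φ' (equivA α β l h2 hα hβ).toLinearMap v = algebraMap k _ (counit v) :=
  have D := isPBW_A h2 α β l
  ⟨_, convAlg_tensor D.toIsWeyl.convAlg_sym_symInv (convAlg_antipode (uIncl D.g_a)),
    convAlg_tensor' D.toIsWeyl.convAlg_symInv_sym (convAlg_antipode' (uIncl D.g_a))⟩

/-- Cleftness: with `y = e(v)` for the ordered basis map `e`, the Galois map sends `r ⊗ y` to `r
e(v₁) ⊗ v₂` up to the identification `H ⊗ U ≅ E`. This is the translation map of `e`, inverted by
that of the convolution inverse of `e`. -/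
theorem right_galois_bijective (h2 : (2 : k) ≠ 0) (hα : α * (1 + (l : k) ^ 4) = 0)
    (hβ : β * (1 - (l : k) ^ 2) = 0) : Function.Bijective (TensorProduct.lift
      ((LinearMap.mul k (Adef k α β l ⊗[k] E k)).compl₁₂
        (Algebra.TensorProduct.includeLeft : Adef k α β l →ₐ[k] Adef k α β l ⊗[k] E k).toLinearMap
        (rightCoaction α β l).toLinearMap)) := by
  obtain ⟨φ', h1, h1'⟩ := convAlg_equivA_inverse h2 hα hβ
  let e := equivA α β l h2 hα hβ
  let e0 := equivE (0 : k) 0 1 h2 (zero_mul _) (zero_mul _)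
  let T : Adef k α β l ⊗[k] (H k ⊗[k] U k) ≃ₗ[k] Adef k α β l ⊗[k] (H k ⊗[k] U k) :=
    LinearEquiv.ofLinearMap (transRight e.toLinearMap) (transRight φ')
      (LinearMap.ext fun v => transRight_comp h1' v) (LinearMap.ext fun v => transRight_comp h1 v)
  have key : TensorProduct.lift
      ((LinearMap.mul k (Adef k α β l ⊗[k] E k)).compl₁₂
        (Algebra.TensorProduct.includeLeft : Adef k α β l →ₐ[k] Adef k α β l ⊗[k] E k).toLinearMap
        (rightCoaction α β l).toLinearMap) =
      ((e.symm.lTensor (Adef k α β l) ≪≫ₗ T ≪≫ₗ e0.lTensor (Adef k α β l)) : _ ≃ₗ[k] _).toLinearMap := by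
    refine TensorProduct.ext' fun r y => ?_
    obtain ⟨v, rfl⟩ := e.surjective y
    have e1 : transRight e.toLinearMap (r ⊗ₜ v) = _ := transRight_tmul _ r v
    simp only [TensorProduct.lift.tmul, LinearMap.compl₁₂_apply, LinearMap.mul_apply',
      AlgHom.toLinearMap_apply, LinearEquiv.coe_coe, LinearEquiv.trans_apply, LinearEquiv.lTensor_tmul,
      LinearEquiv.symm_apply_apply, T, LinearEquiv.coe_ofLinearMap, e1]
    rw [show rightCoaction α β l (e v) = _ from rightCoaction_equivA h2 hα hβ v, ← equivE_zero h2]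
    induction comul (R := k) v using TensorProduct.induction_on with
    | zero => simp
    | add a b ha hb => simp only [map_add, mul_add, ha, hb]
    | tmul a b => simp [e, e0]
  rw [key]
  exact LinearEquiv.bijective _

theorem left_galois_bijective (h2 : (2 : k) ≠ 0) (hα : α * (1 + (l : k) ^ 4) = 0)
    (hβ : β * (1 - (l : k) ^ 2) = 0) : Function.Bijective (TensorProduct.lift
      ((LinearMap.mul k (Edef k α β l ⊗[k] Adef k α β l)).compl₁₂ (leftCoaction α β l).toLinearMap
        (Algebra.TensorProduct.includeRight :
          Adef k α β l →ₐ[k] Edef k α β l ⊗[k] Adef k α β l).toLinearMap)) := by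
  obtain ⟨φ', h1, h1'⟩ := convAlg_equivA_inverse h2 hα hβ
  let e := equivA α β l h2 hα hβ
  let e0 := equivE α β l h2 hα hβ
  let T : (H k ⊗[k] U k) ⊗[k] Adef k α β l ≃ₗ[k] (H k ⊗[k] U k) ⊗[k] Adef k α β l :=
    LinearEquiv.ofLinearMap (transLeft e.toLinearMap) (transLeft φ')
      (LinearMap.ext fun v => transLeft_comp h1 v) (LinearMap.ext fun v => transLeft_comp h1' v)
  have key : TensorProduct.lift
      ((LinearMap.mul k (Edef k α β l ⊗[k] Adef k α β l)).compl₁₂ (leftCoaction α β l).toLinearMap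
        (Algebra.TensorProduct.includeRight :
          Adef k α β l →ₐ[k] Edef k α β l ⊗[k] Adef k α β l).toLinearMap) =
      ((e.symm.rTensor (Adef k α β l) ≪≫ₗ T ≪≫ₗ e0.rTensor (Adef k α β l)) : _ ≃ₗ[k] _).toLinearMap := by
    refine TensorProduct.ext' fun y r => ?_
    obtain ⟨v, rfl⟩ := e.surjective y
    have e1 : transLeft e.toLinearMap (v ⊗ₜ r) = _ := transLeft_tmul _ r v
    simp only [TensorProduct.lift.tmul, LinearMap.compl₁₂_apply, LinearMap.mul_apply',
      AlgHom.toLinearMap_apply, LinearEquiv.coe_coe, LinearEquiv.trans_apply, LinearEquiv.rTensor_tmul,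
      LinearEquiv.symm_apply_apply, T, LinearEquiv.coe_ofLinearMap, e1]
    rw [show leftCoaction α β l (e v) = _ from leftCoaction_equivA h2 hα hβ v]
    induction comul (R := k) v using TensorProduct.induction_on with
    | zero => simp
    | add a b ha hb => simp only [map_add, add_mul, ha, hb]
    | tmul a b => simp [e, e0]
  rw [key]
  exact LinearEquiv.bijective _

theorem isBiGalois (h2 : (2 : k) ≠ 0) (hα : α * (1 + (l : k) ^ 4) = 0)
    (hβ : β * (1 - (l : k) ^ 2) = 0) : IsBiGalois k (leftCoaction α β l) (rightCoaction α β l) := by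
  have rE (v) := rightCoaction_equivA h2 hα hβ v
  have lE (v) := leftCoaction_equivA h2 hα hβ v
  have e1 : equivA α β l h2 hα hβ (1 ⊗ₜ 1) = 1 := by
    change pbwMap (isPBW_A h2 α β l) _ = _
    rw [pbwMap_tmul, sym_one, map_one, mul_one]
  refine ⟨?_, ?_, ?_, ?_, ?_, ?_, ?_, ?_, right_galois_bijective h2 hα hβ,
    left_galois_bijective h2 hα hβ⟩
  -- The counit of `H ⊗ U` takes the value `1` at the element corresponding to `1`, so `1 ≠ 0`.
  · refine ⟨⟨1, 0, fun h => ?_⟩⟩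
    have e2 := congrArg (fun y => counit (R := k) ((equivA α β l h2 hα hβ).symm y)) (e1.trans h)
    simp at e2
  -- Each bicomodule axiom is an equality of algebra maps, so it is enough to compare generators.
  · have : ((Algebra.TensorProduct.assoc k k k (Adef k α β l) (E k) (E k)).toAlgHom.comp
        ((Algebra.TensorProduct.map (rightCoaction α β l) (AlgHom.id k (E k))).comp
          (rightCoaction α β l))) =
        (Algebra.TensorProduct.map (AlgHom.id k (Adef k α β l)) (Bialgebra.comulAlgHom k (E k))).comp
          (rightCoaction α β l) := by
      apply pres_ext
      rintro (_ | _ | _ | _ | _ | _ | _) <;>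
      simp [rightCoaction, coactionOnGen, TensorProduct.tmul_add, TensorProduct.add_tmul, pow_two,
        Algebra.TensorProduct.one_def, add_assoc]
    exact fun a => DFunLike.congr_fun this a
  · have : ((Algebra.TensorProduct.rid k k (Adef k α β l)).toAlgHom.comp
        ((Algebra.TensorProduct.map (AlgHom.id k (Adef k α β l)) (Bialgebra.counitAlgHom k (E k))).comp
          (rightCoaction α β l))) = AlgHom.id k _ := by
      apply pres_ext
      rintro (_ | _ | _ | _ | _ | _ | _) <;> simp [rightCoaction, coactionOnGen]
    exact fun a => DFunLike.congr_fun this a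
  · have : ((Algebra.TensorProduct.assoc k k k (Edef k α β l) (Edef k α β l) (Adef k α β l)).toAlgHom.comp
        ((Algebra.TensorProduct.map (Bialgebra.comulAlgHom k (Edef k α β l))
          (AlgHom.id k (Adef k α β l))).comp (leftCoaction α β l))) =
        (Algebra.TensorProduct.map (AlgHom.id k (Edef k α β l)) (leftCoaction α β l)).comp
          (leftCoaction α β l) := by
      apply pres_ext
      rintro (_ | _ | _ | _ | _ | _ | _) <;>
      simp [leftCoaction, coactionOnGen, TensorProduct.tmul_add, TensorProduct.add_tmul, pow_two,
        Algebra.TensorProduct.one_def, add_assoc]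
    exact fun a => DFunLike.congr_fun this a
  · have : ((Algebra.TensorProduct.lid k (Adef k α β l)).toAlgHom.comp
        ((Algebra.TensorProduct.map (Bialgebra.counitAlgHom k (Edef k α β l))
          (AlgHom.id k (Adef k α β l))).comp (leftCoaction α β l))) = AlgHom.id k _ := by
      apply pres_ext
      rintro (_ | _ | _ | _ | _ | _ | _) <;> simp [leftCoaction, coactionOnGen]
    exact fun a => DFunLike.congr_fun this a
  · have : ((Algebra.TensorProduct.assoc k k k (Edef k α β l) (Adef k α β l) (E k)).toAlgHom.comp
        ((Algebra.TensorProduct.map (leftCoaction α β l) (AlgHom.id k (E k))).comp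
          (rightCoaction α β l))) =
        (Algebra.TensorProduct.map (AlgHom.id k (Edef k α β l)) (rightCoaction α β l)).comp
          (leftCoaction α β l) := by
      apply pres_ext
      rintro (_ | _ | _ | _ | _ | _ | _) <;>
      simp [leftCoaction, rightCoaction, coactionOnGen, TensorProduct.tmul_add, TensorProduct.add_tmul,
        pow_two, Algebra.TensorProduct.one_def, add_assoc]
    exact fun a => DFunLike.congr_fun this a
  · intro y hy
    obtain ⟨v, rfl⟩ := (equivA α β l h2 hα hβ).surjective y
    have e2 : equivE (0 : k) 0 1 h2 (zero_mul _) (zero_mul _) (1 ⊗ₜ 1) = 1 := by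
      change pbwMap (isPBW_E h2 0 0 1) _ = _
      rw [pbwMap_tmul, sym_one, map_one, mul_one]
    rw [rE, ← equivE_zero h2, ← e2] at hy
    refine ⟨counit v, ?_⟩
    -- Transported to `H ⊗ U`, coinvariance reads `Δ(v) = v ⊗ 1`; the counit on the first leg then
    -- gives `v = ε(v) 1`. The left coinvariants are treated with the counit on the second leg.
    have hc := LinearMap.congr_fun (conv_counit_left (equivA α β l h2 hα hβ).toLinearMap) v
    rw [LinearEquiv.coe_coe, conv_apply] at hc
    have hh : ∀ T, TensorProduct.map (counit (R := k)) (equivA α β l h2 hα hβ).toLinearMap T =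
        TensorProduct.map (counit (R := k) ∘ₗ (equivA α β l h2 hα hβ).symm.toLinearMap)
          ((equivA α β l h2 hα hβ).toLinearMap ∘ₗ
            (equivE (0 : k) 0 1 h2 (zero_mul _) (zero_mul _)).symm.toLinearMap)
          (TensorProduct.map (equivA α β l h2 hα hβ).toLinearMap
            (equivE (0 : k) 0 1 h2 (zero_mul _) (zero_mul _)).toLinearMap T) :=
      fun T => LinearMap.congr_fun (TensorProduct.ext' fun p q => by simp :
        _ = TensorProduct.map _ _ ∘ₗ TensorProduct.map _ _) T
    rw [← hc, hh, hy]
    simp [e1, Algebra.algebraMap_eq_smul_one]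
  · intro y hy
    obtain ⟨v, rfl⟩ := (equivA α β l h2 hα hβ).surjective y
    have e2 : equivE α β l h2 hα hβ (1 ⊗ₜ 1) = 1 := by
      change pbwMap (isPBW_E h2 α β l) _ = _
      rw [pbwMap_tmul, sym_one, map_one, mul_one]
    rw [lE, ← e2] at hy
    refine ⟨counit v, ?_⟩
    have hc := LinearMap.congr_fun (convRight_counit (equivA α β l h2 hα hβ).toLinearMap) v
    rw [LinearEquiv.coe_coe, convRight_apply] at hc
    have hh : ∀ T, TensorProduct.map (equivA α β l h2 hα hβ).toLinearMap (counit (R := k)) T =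
        TensorProduct.map
          ((equivA α β l h2 hα hβ).toLinearMap ∘ₗ (equivE α β l h2 hα hβ).symm.toLinearMap)
          (counit (R := k) ∘ₗ (equivA α β l h2 hα hβ).symm.toLinearMap)
          (TensorProduct.map (equivE α β l h2 hα hβ).toLinearMap
            (equivA α β l h2 hα hβ).toLinearMap T) :=
      fun T => LinearMap.congr_fun (TensorProduct.ext' fun p q => by simp :
        _ = TensorProduct.map _ _ ∘ₗ TensorProduct.map _ _) T
    rw [← hc, hh, hy]
    simp [e1, Algebra.algebraMap_eq_smul_one]

end BiGalois

/-! ### Values of the twisting map `θ` on generators -/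

section Theta
variable {k : Type u} [Field k]

theorem theta_tauLam_g (h2 : (2 : k) ≠ 0) (l : kˣ) (f : H k) :
    theta (tauLam l) (gen (URel k) .g ⊗ₜ f) = gTw l l f ⊗ₜ gen (URel k) .g := by
  have e1 : omega (tri k) (tle k) ∘ₗ (TensorProduct.mk k (H k) (U k)).flip (gen (URel k) .g) =
      (TensorProduct.mk k (H k) (U k)).flip (gen (URel k) .g) ∘ₗ (gAut k).toLinearMap :=
    LinearMap.ext (omega_g h2)
  have e2 : tauLam l ∘ₗ (TensorProduct.mk k (H k) (U k)).flip (gen (URel k) .g) =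
      counit ∘ₗ (gTw l l).toLinearMap := by
    refine LinearMap.ext fun f => ?_
    have := tauBeta_mul_g (m := l) l (β := 0) (by simp) f 1
    rwa [one_mul, tauBeta_zero, ← tauBeta_zero, tauBeta_one, tauBeta_zero] at this
  have := conv_comp (comul_gTw l) counit (LinearMap.id (R := k) (M := H k))
  rw [conv_counit_left, LinearMap.id_comp, LinearMap.id_comp] at this
  rw [theta, LinearMap.comp_apply, LinearEquiv.coe_coe, TensorProduct.comm_tmul, conv_tmul_g, e1, e2,
    ← comp_conv, ← this]
  rfl

/-- The functional `τ_λ` vanishes on `H ⊗ a`, so only the summand `g² ⊗ a` of `Δ(a)` contributes;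
its functional is `τ_λ(·, g²)`, that is, `ε` after two twists by `g`. -/
theorem theta_tauLam_a (h2 : (2 : k) ≠ 0) (l : kˣ) (f : H k) :
    theta (tauLam l) (gen (URel k) .a ⊗ₜ f) =
      conv (counit ∘ₗ (gTw l l).toLinearMap ∘ₗ (gTw l l).toLinearMap) (aTw 1).toLinearMap f ⊗ₜ
        gen (URel k) .a := by
  have e1 : omega (tri k) (tle k) ∘ₗ (TensorProduct.mk k (H k) (U k)).flip (gen (URel k) .a) =
      (TensorProduct.mk k (H k) (U k)).flip (gen (URel k) .a) ∘ₗ (aTw 1).toLinearMap :=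
    LinearMap.ext (omega_a h2)
  have e2 : tauLam l ∘ₗ (TensorProduct.mk k (H k) (U k)).flip (gen (URel k) .a) = 0 := by
    refine LinearMap.ext fun f => ?_
    have := tauBeta_mul_a l 0 f 1
    rwa [one_mul, tauBeta_zero, zero_mul] at this
  have e3 : tauLam l ∘ₗ (TensorProduct.mk k (H k) (U k)).flip (gen (URel k) .g ^ 2) =
      counit ∘ₗ (gTw l l).toLinearMap ∘ₗ (gTw l l).toLinearMap := by
    refine LinearMap.ext fun f => ?_
    have e := tauBeta_mul_g (m := l) l (β := 0) (by simp) f (gen (URel k) .g)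
    have e' := tauBeta_mul_g (m := l) l (β := 0) (by simp) (gTw l l f) 1
    rw [one_mul, tauBeta_one] at e'
    rw [e', ← pow_two, tauBeta_zero] at e
    exact e
  have z : ∀ {N : Type u} [AddCommGroup N] [Module k N] (χ : H k →ₗ[k] N), conv (0 : H k →ₗ[k] k) χ = 0 := by
    intro N _ _ φ; ext; simp [conv_apply]
  rw [theta, LinearMap.comp_apply, LinearEquiv.coe_coe, TensorProduct.comm_tmul, conv_tmul_a, e1, e2, e3, z,
    LinearMap.zero_apply, zero_add, ← comp_conv]
  rfl

end Theta

end BicrossedExample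

end

/-! ### The theorem -/

open BicrossedExample

theorem corollary5p10 {k : Type*} [Field k] (h2 : (2 : k) ≠ 0) :
    -- `E` is the bicrossed product `H ⋈ U`.
    (Function.Bijective (factor (k := k)) ∧
      (∀ z : H k ⊗[k] U k, comul (R := k) (factor z) =
        TensorProduct.map factor factor (comul (R := k) z)) ∧
      (∀ z : H k ⊗[k] U k, counit (R := k) (factor z) = counit (R := k) z) ∧
      factor ((1 : H k) ⊗ₜ[k] (1 : U k)) = 1 ∧
      ∀ u v : H k ⊗[k] U k, factor u * factor v =
        factor (bicrossedMul (LinearMap.mul' k (H k)) (tri k) (tle k) (u ⊗ₜ[k] v))) ∧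
    -- The skew pairings, and the Hopf algebras and Galois objects that they define.
    (∀ τ : H k ⊗[k] U k →ₗ[k] k, IsSkewPairing τ ↔
      (∃ l : kˣ, τ = tauLam l) ∨
        ∃ (ξ : kˣ) (β : k), (ξ = 1 ∨ ξ = -1) ∧ τ = tauBeta ξ β) ∧
    (∀ l : kˣ,
      Realizes (LinearMap.mul' k (H k)) (LinearMap.mul' k (H k)) (tauLam l) 0 0 l) ∧
    (∀ (ξ : kˣ) (β : k), (ξ = 1 ∨ ξ = -1) →
      Realizes (LinearMap.mul' k (H k)) (LinearMap.mul' k (H k)) (tauBeta ξ β) 0 β ξ) ∧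
    -- The deformations `H_α` and `L_α` of `H` that are determined by `σ_α`.
    (∀ α : k, IsConvInverse (sigma α) (sigma (-α)) ∧
      (∃ j : HCleft k α ≃ₗ[k] H k, j 1 = 1 ∧
        (∀ x, j (gen (HRel k α) x) = gen (LRel k 0) x) ∧
        ∀ x y, j (x * y) = cleftMul (sigma α) (j x ⊗ₜ j y)) ∧
      ∃ e : L k α ≃ₗc[k] H k, e 1 = 1 ∧
        (∀ x, e (gen (LRel k α) x) = gen (LRel k 0) x) ∧
        ∀ x y, e (x * y) = cocycleMul (sigma α) (sigma (-α)) (e x ⊗ₜ e y)) ∧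
    -- The twisting data for `H_α` with `α ≠ 0`.
    (∀ α : k, α ≠ 0 →
      (∀ ψ : H k ⊗[k] U k →ₗ[k] k,
        IsTwistingDatum (sigma α) (counit (R := k) (A := U k ⊗[k] U k)) ψ ↔
          ∃ ζ : kˣ, (ζ : k) ^ 4 = -1 ∧ ψ = tauLam ζ) ∧
      ∀ ζ : kˣ, (ζ : k) ^ 4 = -1 →
        Realizes (cocycleMul (sigma α) (sigma (-α))) (cleftMul (sigma α)) (tauLam ζ) α 0 ζ) ∧
    (∀ ζ : kˣ, (ζ : k) ^ 4 = -1 →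
      theta (tauLam ζ) (gen (URel k) .g ⊗ₜ gen (LRel k 0) .h) =
        (ζ : k) • (gen (LRel k 0) .h ⊗ₜ gen (URel k) .g) ∧
      theta (tauLam ζ) (gen (URel k) .g ⊗ₜ gen (LRel k 0) .b) =
        -((ζ : k) ^ 2 • (gen (LRel k 0) .c ⊗ₜ gen (URel k) .g)) ∧
      theta (tauLam ζ) (gen (URel k) .g ⊗ₜ gen (LRel k 0) .c) =
        -((ζ : k) ^ 2 • (gen (LRel k 0) .b ⊗ₜ gen (URel k) .g)) ∧
      theta (tauLam ζ) (gen (URel k) .a ⊗ₜ gen (LRel k 0) .h) =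
        -((ζ : k) ^ 2 • (gen (LRel k 0) .h ⊗ₜ gen (URel k) .a)) ∧
      theta (tauLam ζ) (gen (URel k) .a ⊗ₜ gen (LRel k 0) .b) =
        (ζ : k) ^ 4 • (gen (LRel k 0) .b ⊗ₜ gen (URel k) .a) ∧
      theta (tauLam ζ) (gen (URel k) .a ⊗ₜ gen (LRel k 0) .c) =
        (ζ : k) ^ 4 • (gen (LRel k 0) .c ⊗ₜ gen (URel k) .a)) ∧
    -- The twisting data for `H_0 = H`.
    ((∀ ψ : H k ⊗[k] U k →ₗ[k] k,
        IsTwistingDatum (sigma 0) (counit (R := k) (A := U k ⊗[k] U k)) ψ ↔ IsSkewPairing ψ) ∧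
      (∀ ψ : H k ⊗[k] U k →ₗ[k] k,
        IsTwistingDatum (sigma 0) (counit (R := k) (A := U k ⊗[k] U k)) ψ ↔
          ∃ (l : kˣ) (β : k), β * (1 - (l : k) ^ 2) = 0 ∧ ψ = tauBeta l β) ∧
      ∀ (l : kˣ) (β : k), β * (1 - (l : k) ^ 2) = 0 →
        Realizes (cocycleMul (sigma 0) (sigma 0)) (cleftMul (sigma 0)) (tauBeta l β) 0 β l) ∧
    -- `A^λ_{α,β}` is an `E^λ_{α,β}`-`E`-bi-Galois object.
    (∀ (α β : k) (l : kˣ), α * (1 + (l : k) ^ 4) = 0 → β * (1 - (l : k) ^ 2) = 0 →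
      IsBiGalois k (leftCoaction α β l) (rightCoaction α β l)) := by
  have l0 : ∀ (ξ : kˣ) (β : k), (ξ = 1 ∨ ξ = -1) → β * (1 - (ξ : k) ^ 2) = 0 := by
    rintro ξ β (rfl | rfl) <;> simp
  have hTD : ∀ (α : k) (ψ : H k ⊗[k] U k →ₗ[k] k),
      IsTwistingDatum (sigma α) (counit (R := k) (A := U k ⊗[k] U k)) ψ ↔
        ∃ (l : kˣ) (β : k), α * (1 + (l : k) ^ 4) = 0 ∧ β * (1 - (l : k) ^ 2) = 0 ∧ ψ = tauBeta l β := by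
    refine fun α ψ => ⟨fun T => T.exists_eq h2, ?_⟩
    rintro ⟨l, β, hα, hβ, rfl⟩
    exact isTwistingDatum_tauBeta h2 hα hβ
  have hTD0 : ∀ ψ : H k ⊗[k] U k →ₗ[k] k,
      IsTwistingDatum (sigma 0) (counit (R := k) (A := U k ⊗[k] U k)) ψ ↔
        ∃ (l : kˣ) (β : k), β * (1 - (l : k) ^ 2) = 0 ∧ ψ = tauBeta l β := by
    intro ψ; rw [hTD]; simp
  have hSP : ∀ ψ : H k ⊗[k] U k →ₗ[k] k,
      IsTwistingDatum (sigma 0) (counit (R := k) (A := U k ⊗[k] U k)) ψ ↔ IsSkewPairing ψ := by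
    intro ψ
    rw [isSkewPairing_iff h2]
    refine ⟨fun T => ⟨?_, T⟩, fun h => h.2⟩
    -- Convolution invertibility is automatic: by the classification `ψ` is some `τ_λ^β`, and that
    -- has an explicit inverse.
    obtain ⟨l, β, hβ, rfl⟩ := (hTD0 ψ).1 T
    exact ⟨_, isConvInverse_tauBeta l hβ⟩
  have hR0 : ∀ (l : kˣ) (β : k), β * (1 - (l : k) ^ 2) = 0 →
      Realizes (cocycleMul (sigma 0) (sigma 0)) (cleftMul (sigma 0)) (tauBeta l β) 0 β l := by
    intro l β hβ
    simpa using realizes_tauBeta h2 (zero_mul (1 + (l : k) ^ 4)) hβ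
  have hR : ∀ (l : kˣ) (β : k), β * (1 - (l : k) ^ 2) = 0 →
      Realizes (LinearMap.mul' k (H k)) (LinearMap.mul' k (H k)) (tauBeta l β) 0 β l := by
    intro l β hβ
    have := hR0 l β hβ
    rwa [cocycleMul_zero, cleftMul_zero] at this
  refine ⟨E_bicrossed h2, fun τ => ?_, fun l => ?_, fun ξ β hξ => hR ξ β (l0 ξ β hξ),
    fun α => ⟨isConvInverse_sigma α, exists_cleft_equiv h2 α, exists_cocycle_equiv h2 α⟩,
    fun α hα => ⟨fun ψ => ?_, fun ζ hζ => ?_⟩, fun ζ hζ => ?_, ⟨hSP, hTD0, hR0⟩,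
    fun α β l hα hβ => isBiGalois h2 hα hβ⟩
  · rw [← hSP, hTD0]
    constructor
    · rintro ⟨l, β, hβ, rfl⟩
      -- Either `β = 0`, which gives `τ_λ`, or `λ² = 1`, which gives `λ = ±1` with `β` arbitrary.
      rcases mul_eq_zero.1 hβ with rfl | h
      · exact Or.inl ⟨l, tauBeta_zero l⟩
      · refine Or.inr ⟨l, β, ?_, rfl⟩
        have : ((l : k) - 1) * (l + 1) = 0 := by linear_combination -h
        rcases mul_eq_zero.1 this with h | h
        · exact Or.inl (Units.ext (sub_eq_zero.1 h))
        · exact Or.inr (Units.ext (eq_neg_of_add_eq_zero_left h))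
    · rintro (⟨l, rfl⟩ | ⟨ξ, β, hξ, rfl⟩)
      · exact ⟨l, 0, zero_mul _, (tauBeta_zero l).symm⟩
      · exact ⟨ξ, β, l0 ξ β hξ, rfl⟩
  · rw [← tauBeta_zero]
    exact hR l 0 (zero_mul _)
  · rw [hTD]
    constructor
    · rintro ⟨l, β, h4, hβ, rfl⟩
      have h4' : (l : k) ^ 4 = -1 := by
        linear_combination (mul_eq_zero.1 h4).resolve_left hα
      -- Multiplying `β(1 - λ²) = 0` by `1 + λ²` gives `β(1 - λ⁴) = 2β = 0`.
      have hβ0 : β = 0 := by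
        refine (mul_eq_zero.1 (?_ : β * 2 = 0)).resolve_right h2
        linear_combination (1 + (l : k) ^ 2) * hβ + β * h4'
      exact ⟨l, h4', by rw [hβ0, tauBeta_zero]⟩
    · rintro ⟨l, h4, rfl⟩
      exact ⟨l, 0, by rw [h4]; ring, zero_mul _, (tauBeta_zero l).symm⟩
  · rw [← tauBeta_zero]
    exact realizes_tauBeta h2 (by rw [hζ]; ring) (zero_mul _)
  · refine ⟨?_, ?_, ?_, ?_, ?_, ?_⟩
    · rw [theta_tauLam_g h2, gTw_h, TensorProduct.smul_tmul']
    · rw [theta_tauLam_g h2, gTw_b, TensorProduct.neg_tmul, TensorProduct.smul_tmul']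
    · rw [theta_tauLam_g h2, gTw_c, TensorProduct.neg_tmul, TensorProduct.smul_tmul']
    · rw [theta_tauLam_a h2, conv_H_h]
      simp [TensorProduct.neg_tmul, ← TensorProduct.smul_tmul', smul_smul, pow_two]
    · rw [theta_tauLam_a h2, conv_H_b]
      simp [TensorProduct.neg_tmul, ← TensorProduct.smul_tmul', smul_smul, ← pow_mul, mul_pow, ← pow_add]
    · rw [theta_tauLam_a h2, conv_H_c]
      simp [TensorProduct.neg_tmul, ← TensorProduct.smul_tmul', smul_smul, ← pow_mul, mul_pow, ← pow_add]
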